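/- Let $R$ be a commutative ring and $A$ a Frobenius $R$-algebra, that is, an $R$-algebra that is finitely generated and projective as an $R$-module and satisfies $\operatorname{add}\omega=\operatorname{add}A$ for the $A$-module $\omega=\operatorname{Hom}_R(A,R)$. Here $\operatorname{add}M$ denotes the direct summands of finite direct sums of copies of $M$. **Notation.** Let $\operatorname{Mod}(A,R)$ (respectively $\operatorname{mod}(A,R)$) be the category of $A$-modules that are projective (respectively finitely generated projective) over $R$, with the exact structure given by the short exact sequences of $A$-modules. Let $\operatorname{Mod}^{\mathrm{lf}}(A,R)\subseteq\operatorname{Mod}(A,R)$ be the smallest full subcategory that contains $\operatorname{mod}(A,R)$, is closed under all coproducts, and has the two-out-of-three property for short exact sequences in $\operatorname{Mod}(A,R)$. The categories $\operatorname{mod}(A,R)$ and $\operatorname{Mod}^{\mathrm{lf}}(A,R)$ are Frobenius categories whose projective-injective objects are the objects that are projective as $A$-modules. Write $\operatorname{stmod}(A,R)$ and $\operatorname{StMod}^{\mathrm{lf}}(A,R)$ for their stable categories, with their natural triangulated structure. Let $\mathbf K(\operatorname{Proj}A)$ be the homotopy category of complexes of projective $A$-modules, and let $\mathbf K^{+,b}(\operatorname{proj}A)$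 be the full subcategory of complexes $X$ of finitely generated projective $A$-modules such that $X^n=0$ for $n\ll0$ and, for $n\gg 0$, $H^n(X)=0$ and $\operatorname{Ker}d^n_X$ is projective over $R$. Let $\mathbf K^{\mathrm{lf}}(\operatorname{Proj}A,R)$ be the localising subcategory of $\mathbf K(\operatorname{Proj}A)$ generated by $\mathbf K^{+,b}(\operatorname{proj}A)$, and let $\mathbf q\colon\mathbf K^{\mathrm{lf}}(\operatorname{Proj}A,R)\to\mathbf D(\operatorname{Mod}A)$ be the canonical functor. Let $\mathbf D^b(\operatorname{mod}(A,R))$ be the quotient of the bounded homotopy category $\mathbf K^b(\operatorname{mod}(A,R))$ by the acyclic complexes, and let $\mathbf D^{\mathrm{perf}}(A)$ be the category of perfect complexes (those quasi-isomorphic to bounded complexes of finitely generated projective $A$-modules), considered as a full subcategory of $\mathbf D(\operatorname{Mod}A)$ and of $\mathbf D^b(\operatorname{mod}(A,R))$. **Claim.** The functor $\mathbf q$ is the right-hand functor of a recollement $$\operatorname{StMod}^{\mathrm{lf}}(A,R)\;\longrightarrow\;\mathbf K^{\mathrm{lf}}(\operatorname{Proj}A,R)\;\overset{\mathbf q}{\longrightarrow}\;\mathbf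 D(\operatorname{Mod}A).$$ That is, there is a fully faithful exact functor $i_*\colon \operatorname{StMod}^{\mathrm{lf}}(A,R)\to\mathbf K^{\mathrm{lf}}(\operatorname{Proj}A,R)$ whose essential image is the kernel of $\mathbf q$, both $i_*$ and $\mathbf q$ have exact left and right adjoints, and the adjoints of $\mathbf q$ are fully faithful. Write $\mathbf t$ for the left adjoint of $i_*$ and $\mathbf p$ for the left adjoint of $\mathbf q$. The recollement can be chosen such that, naturally in the complex $X$, $\mathbf t(X)\cong\operatorname{Coker}(d_X^{-1})$ for every acyclic $X$ in $\mathbf K^{\mathrm{lf}}(\operatorname{Proj}A,R)$ (as objects of the category of $A$-modules modulo projectives). The pair $(\mathbf p,\mathbf t)$ induces, when restricted to compact objects, a triangle equivalence $$G\colon\mathbf D^b(\operatorname{mod}(A,R))/\mathbf D^{\mathrm{perf}}(A)\;\overset{\sim}{\longrightarrow}\;\operatorname{stmod}(A,R).$$ Precisely: the compact objects of $\mathbf D(\operatorname{Mod}A)$ are the perfect complexes, and $\mathbf p$ preserves compactness. There is a fully faithful exact functor $\kappa\colon\mathbf D^b(\operatorname{mod}(A,R))\to\mathbf K^{\mathrm{lf}}(\operatorname{Proj}A,R)$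 whose essential image consists of the compact objects and such that $\mathbf q\circ\kappa$ is isomorphic to the canonical functor $\mathbf D^b(\operatorname{mod}(A,R))\to\mathbf D(\operatorname{Mod}A)$. On $\mathbf D^{\mathrm{perf}}(A)$ the functor $\kappa$ is isomorphic to $\mathbf p$. Finally, there is an exact equivalence $G$ as above such that $\mathbf t\circ\kappa$ is isomorphic to the composite $\mathbf D^b(\operatorname{mod}(A,R))\to\mathbf D^b(\operatorname{mod}(A,R))/\mathbf D^{\mathrm{perf}}(A)\xrightarrow{\,G\,}\operatorname{stmod}(A,R)\subseteq\operatorname{StMod}^{\mathrm{lf}}(A,R)$. -/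

import Mathlib

universe w v u u₁ u₂ u₃ v₁ v₂ v₃

open CategoryTheory Limits Pretriangulated ZeroObject

noncomputable section

namespace FrobRec

/-! ### Exact functors and recollements -/

/-- A category with a suspension functor and a class of exact triangles
`X ⟶ Y ⟶ Z ⟶ susp X`. It is only used to have a common language for the triangulated structures
of Mathlib and the explicitly defined triangulated structure of a stable category. -/
class TriangleStructure (C : Type u₁) [Category.{v₁} C] where
  /-- the suspension functor -/
  susp : C ⥤ C
  /-- the exact triangles -/
  exactTriangle : ∀ {X Y Z : C}, (X ⟶ Y) → (Y ⟶ Z) → (Z ⟶ susp.obj X) → Prop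

instance TriangleStructure.ofPretriangulated (C : Type u₁) [Category.{v₁} C] [Preadditive C]
    [HasZeroObject C] [HasShift C ℤ] [∀ n : ℤ, (shiftFunctor C n).Additive] [Pretriangulated C] :
    TriangleStructure C where
  susp := shiftFunctor C (1 : ℤ)
  exactTriangle f g h := Triangle.mk f g h ∈ distTriang C

/-- A functor is exact if it commutes with the suspensions up to a natural isomorphism
such that exact triangles are sent to exact triangles. -/
def IsExactFunctor {C : Type u₁} [Category.{v₁} C] [TriangleStructure C]
    {D : Type u₂} [Category.{v₂} D] [TriangleStructure D] (F : C ⥤ D) : Prop :=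
  ∃ η : TriangleStructure.susp (C := C) ⋙ F ≅ F ⋙ TriangleStructure.susp (C := D),
    ∀ {X Y Z : C} (f : X ⟶ Y) (g : Y ⟶ Z) (h : Z ⟶ TriangleStructure.susp.obj X),
      TriangleStructure.exactTriangle f g h →
        TriangleStructure.exactTriangle (F.map f) (F.map g) (F.map h ≫ η.hom.app X)

/-- A recollement
```
      ←– iUpperStar –       ←– jLowerShriek –
  U   –– iLowerStar –→  T   –––––– j –––––––→   D
      ←– iUpperShriek –     ←– jLowerStar –
```
with prescribed right-hand functor `j`: all six functors are exact, each functor is left adjoint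
to the one drawn below it, the functors `iLowerStar`, `jLowerShriek`, `jLowerStar` are fully
faithful, and the essential image of `iLowerStar` is the kernel of `j`. -/
structure Recollement (U : Type u₁) [Category.{v₁} U] [TriangleStructure U]
    {T : Type u₂} [Category.{v₂} T] [TriangleStructure T]
    {D : Type u₃} [Category.{v₃} D] [TriangleStructure D] (j : T ⥤ D) where
  iLowerStar : U ⥤ T
  iUpperStar : T ⥤ U
  iUpperShriek : T ⥤ U
  jLowerShriek : D ⥤ T
  jLowerStar : D ⥤ T
  exact_j : IsExactFunctor j
  exact_iLowerStar : IsExactFunctor iLowerStar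
  exact_iUpperStar : IsExactFunctor iUpperStar
  exact_iUpperShriek : IsExactFunctor iUpperShriek
  exact_jLowerShriek : IsExactFunctor jLowerShriek
  exact_jLowerStar : IsExactFunctor jLowerStar
  adj_iUpperStar : iUpperStar ⊣ iLowerStar
  adj_iUpperShriek : iLowerStar ⊣ iUpperShriek
  adj_jLowerShriek : jLowerShriek ⊣ j
  adj_jLowerStar : j ⊣ jLowerStar
  ff_iLowerStar : iLowerStar.FullyFaithful
  ff_jLowerShriek : jLowerShriek.FullyFaithful
  ff_jLowerStar : jLowerStar.FullyFaithful
  essImage_iff : ∀ X : T, iLowerStar.essImage X ↔ IsZero (j.obj X)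

/-! ### Compact objects and localising subcategories -/

/-- An object `X` is compact if every morphism from `X` to a coproduct (indexed by a set in the
universe `u`) factors through a finite subcoproduct. -/
def IsCompactObject {T : Type u₁} [Category.{v₁} T] [Preadditive T] (X : T) : Prop :=
  ∀ (J : Type u) (Y : J → T) (c : Cofan Y), IsColimit c → ∀ f : X ⟶ c.pt,
    ∃ (s : Finset J) (g : ∀ j, X ⟶ Y j), f = ∑ j ∈ s, g j ≫ c.inj j

section Localising

variable {T : Type u₁} [Category.{v₁} T] [Preadditive T] [HasZeroObject T] [HasShift T ℤ]
  [∀ n : ℤ, (shiftFunctor T n).Additive] [Pretriangulated T]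

/-- The localising subcategory of a triangulated category generated by a class `S` of objects:
the smallest strictly full triangulated subcategory that contains `S` and is closed under
coproducts (indexed by sets in the universe `u`). -/
inductive Localising (S : ObjectProperty T) : ObjectProperty T
  | of (X : T) : S X → Localising S X
  | zero (X : T) : IsZero X → Localising S X
  | shift (X : T) (n : ℤ) : Localising S X → Localising S (X⟦n⟧)
  | ext₂ (D : Triangle T) : D ∈ distTriang T → Localising S D.obj₁ → Localising S D.obj₃ →
      Localising S D.obj₂
  | coprod (J : Type u) (Y : J → T) (c : Cofan Y) : IsColimit c → (∀ j, Localising S (Y j)) →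
      Localising S c.pt

instance (S : ObjectProperty T) : (Localising.{u} S).IsClosedUnderIsomorphisms where
  of_iso {X Y} e hX := by
    refine Localising.ext₂ (Triangle.mk e.hom (0 : Y ⟶ 0) 0) ?_ hX (.zero _ (isZero_zero T))
    exact isomorphic_distinguished _ (contractible_distinguished X) _
      (Triangle.isoMk _ _ (Iso.refl _) e.symm (Iso.refl _)
        (e.hom_inv_id.trans (Category.id_comp (𝟙 X)).symm)
        (zero_comp.trans comp_zero.symm) (zero_comp.trans comp_zero.symm))

instance (S : ObjectProperty T) : (Localising.{u} S).IsTriangulated where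
  exists_zero := ⟨0, isZero_zero T, .zero _ (isZero_zero T)⟩
  isStableUnderShiftBy n := ⟨fun X hX => .shift X n hX⟩
  toIsTriangulatedClosed₂ := .mk' fun D hD h₁ h₃ => .ext₂ D hD h₁ h₃

end Localising

/-! ### The stable category of a Frobenius category -/

section Stable

variable {C : Type u₁} [Category.{v₁} C] [Abelian C]

/-- Let `E` be a full subcategory of an abelian category, with the exact structure given by the
short exact sequences with terms in `E`. The conditions say that the objects of `E` that are
projective in the ambient category are injective in `E`,
and that each object of `E` is a quotient of such an object with kernel in `E`
and embeds into such an object with cokernel in `E`. Thus `E` has enough projective and enough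
injective objects, and both are precisely the objects of `E` that are projective in the
ambient category. -/
class IsFrobeniusSubcategory (E : ObjectProperty C) : Prop where
  exists_cover (X : C) : E X → ∃ (N Q : C) (i : N ⟶ Q) (p : Q ⟶ X) (w : i ≫ p = 0),
    (ShortComplex.mk i p w).ShortExact ∧ E Q ∧ Projective Q ∧ E N
  exists_embedding (X : C) : E X → ∃ (Q N : C) (i : X ⟶ Q) (p : Q ⟶ N) (w : i ≫ p = 0),
    (ShortComplex.mk i p w).ShortExact ∧ E Q ∧ Projective Q ∧ E N
  extend (S : ShortComplex C) : S.ShortExact → E S.X₁ → E S.X₂ → E S.X₃ →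
    ∀ P : C, E P → Projective P → ∀ f : S.X₁ ⟶ P, ∃ g : S.X₂ ⟶ P, S.f ≫ g = f

variable (E : ObjectProperty C)

/-- Two morphisms in `E` are identified in the stable category if their difference factors
through a projective object in `E`. -/
def stableRel : HomRel E.FullSubcategory := fun X Y f g =>
  ∃ (P : C) (_ : E P) (_ : Projective P) (a : X.obj ⟶ P) (b : P ⟶ Y.obj), f.hom - g.hom = a ≫ b

/-- The stable category: the objects are those of `E`, the morphisms are the
morphisms in `E` modulo those factoring through a projective object in `E`. -/
abbrev StableCat := CategoryTheory.Quotient (stableRel E)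

/-- The canonical functor to the stable category. -/
abbrev toStable : E.FullSubcategory ⥤ StableCat E := CategoryTheory.Quotient.functor (stableRel E)

/-- The functor between stable categories that is induced by an inclusion. -/
def stableInclusion {E E' : ObjectProperty C} (h : E ≤ E') : StableCat E ⥤ StableCat E' :=
  CategoryTheory.Quotient.lift _ (ObjectProperty.ιOfLE h ⋙ toStable E') (by
    rintro X Y f g ⟨P, hP, hP', a, b, hab⟩
    exact CategoryTheory.Quotient.sound _ ⟨P, h _ hP, hP', a, b, hab⟩)

section Susp

variable [hE : IsFrobeniusSubcategory E]

/-- The chosen projective (and injective) object of `E` into which `X` embeds. -/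
def suspQ (X : E.FullSubcategory) : C := (hE.exists_embedding X.obj X.property).choose

/-- The chosen cokernel `ΣX` in an exact sequence `0 ⟶ X ⟶ Q ⟶ ΣX ⟶ 0`. -/
def suspN (X : E.FullSubcategory) : C :=
  (hE.exists_embedding X.obj X.property).choose_spec.choose

/-- The monomorphism in the exact sequence `0 ⟶ X ⟶ Q ⟶ ΣX ⟶ 0`. -/
def suspI (X : E.FullSubcategory) : X.obj ⟶ suspQ E X :=
  (hE.exists_embedding X.obj X.property).choose_spec.choose_spec.choose

/-- The epimorphism in the exact sequence `0 ⟶ X ⟶ Q ⟶ ΣX ⟶ 0`. -/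
def suspP (X : E.FullSubcategory) : suspQ E X ⟶ suspN E X :=
  (hE.exists_embedding X.obj X.property).choose_spec.choose_spec.choose_spec.choose

lemma suspI_suspP (X : E.FullSubcategory) : suspI E X ≫ suspP E X = 0 :=
  (hE.exists_embedding X.obj X.property).choose_spec.choose_spec.choose_spec.choose_spec.choose

/-- The chosen exact sequence `0 ⟶ X ⟶ Q ⟶ ΣX ⟶ 0` with `Q` projective. -/
abbrev suspSeq (X : E.FullSubcategory) : ShortComplex C :=
  ShortComplex.mk (suspI E X) (suspP E X) (suspI_suspP E X)

lemma suspSeq_spec (X : E.FullSubcategory) :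
    (suspSeq E X).ShortExact ∧ E (suspQ E X) ∧ Projective (suspQ E X) ∧ E (suspN E X) :=
  (hE.exists_embedding X.obj
    X.property).choose_spec.choose_spec.choose_spec.choose_spec.choose_spec

/-- The suspension `ΣX` as an object of `E`. -/
abbrev suspObj (X : E.FullSubcategory) : E.FullSubcategory := ⟨suspN E X, (suspSeq_spec E X).2.2.2⟩

variable {E}

lemma exists_suspMap {X Y : E.FullSubcategory} (f : X ⟶ Y) :
    ∃ (b : suspQ E X ⟶ suspQ E Y) (c : suspObj E X ⟶ suspObj E Y),
      suspI E X ≫ b = f.hom ≫ suspI E Y ∧ suspP E X ≫ c.hom = b ≫ suspP E Y := by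
  obtain ⟨hX, hX₁, hX₂, hX₃⟩ := suspSeq_spec E X
  obtain ⟨hY, hY₁, hY₂, hY₃⟩ := suspSeq_spec E Y
  obtain ⟨b, hb⟩ := hE.extend _ hX X.property hX₁ hX₃ _ hY₁ hY₂ (f.hom ≫ suspI E Y)
  have := hX.epi_g
  refine ⟨b, ObjectProperty.homMk (hX.exact.desc (b ≫ suspP E Y) ?_), hb, hX.exact.g_desc _ _⟩
  dsimp at hb ⊢
  rw [reassoc_of% hb, suspI_suspP, comp_zero]

/-- A morphism `ΣX ⟶ ΣY` that is induced by `f`; it is well defined in the stable category. -/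
def suspMap {X Y : E.FullSubcategory} (f : X ⟶ Y) : suspObj E X ⟶ suspObj E Y :=
  (exists_suspMap f).choose_spec.choose

lemma suspMap_spec {X Y : E.FullSubcategory} (f : X ⟶ Y) : ∃ b : suspQ E X ⟶ suspQ E Y,
    suspI E X ≫ b = f.hom ≫ suspI E Y ∧ suspP E X ≫ (suspMap f).hom = b ≫ suspP E Y :=
  ⟨_, (exists_suspMap f).choose_spec.choose_spec⟩

lemma susp_wellDefined {X Y : E.FullSubcategory} {f f' : X ⟶ Y} (h : stableRel E f f')
    {b b' : suspQ E X ⟶ suspQ E Y} {c c' : suspObj E X ⟶ suspObj E Y}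
    (hb : suspI E X ≫ b = f.hom ≫ suspI E Y) (hc : suspP E X ≫ c.hom = b ≫ suspP E Y)
    (hb' : suspI E X ≫ b' = f'.hom ≫ suspI E Y) (hc' : suspP E X ≫ c'.hom = b' ≫ suspP E Y) :
    (toStable E).map c = (toStable E).map c' := by
  obtain ⟨hX, hX₁, hX₂, hX₃⟩ := suspSeq_spec E X
  obtain ⟨hY, hY₁, hY₂, hY₃⟩ := suspSeq_spec E Y
  obtain ⟨P, hP, hP', u, v, huv⟩ := h
  obtain ⟨u', hu'⟩ := hE.extend _ hX X.property hX₁ hX₃ _ hP hP' u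
  dsimp at hu'
  have := hX.epi_g
  let k : suspQ E X ⟶ suspQ E Y := b - b' - u' ≫ v ≫ suspI E Y
  have hk : suspI E X ≫ k = 0 := by
    simp only [k, Preadditive.comp_sub, hb, hb', reassoc_of% hu']
    rw [← Category.assoc u, ← huv, Preadditive.sub_comp, sub_self]
  refine CategoryTheory.Quotient.sound _ ⟨_, hY₁, hY₂, hX.exact.desc k hk, suspP E Y, ?_⟩
  rw [← cancel_epi (suspP E X)]
  have h₁ : suspP E X ≫ hX.exact.desc k hk = k := hX.exact.g_desc _ _
  rw [reassoc_of% h₁, Preadditive.comp_sub, hc, hc']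
  simp [k, Preadditive.sub_comp, suspI_suspP]

lemma stableRel_refl {X Y : E.FullSubcategory} (f : X ⟶ Y) : stableRel E f f :=
  ⟨_, (suspSeq_spec E X).2.1, (suspSeq_spec E X).2.2.1, 0, 0, by simp⟩

variable (E)

/-- The suspension functor of the stable category: `ΣX` is given by an exact sequence
`0 ⟶ X ⟶ Q ⟶ ΣX ⟶ 0` in `E` with `Q` projective. -/
def stableSusp : StableCat E ⥤ StableCat E :=
  CategoryTheory.Quotient.lift _
    { obj := fun X => (toStable E).obj (suspObj E X)
      map := fun f => (toStable E).map (suspMap f)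
      map_id := fun X => by
        obtain ⟨b, hb, hc⟩ := suspMap_spec (𝟙 X)
        rw [← (toStable E).map_id]
        exact susp_wellDefined (stableRel_refl (𝟙 X)) hb hc (b' := 𝟙 _) (by simp) (by simp)
      map_comp := fun {X Y Z} f g => by
        obtain ⟨b, hb, hc⟩ := suspMap_spec f
        obtain ⟨b', hb', hc'⟩ := suspMap_spec g
        obtain ⟨b'', hb'', hc''⟩ := suspMap_spec (f ≫ g)
        rw [← (toStable E).map_comp]
        refine susp_wellDefined (stableRel_refl (f ≫ g)) hb'' hc'' (b' := b ≫ b') ?_ ?_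
        · simp [reassoc_of% hb, hb']
        · simp [reassoc_of% hc, hc'] }
    (by
      intro X Y f g h
      obtain ⟨b, hb, hc⟩ := suspMap_spec f
      obtain ⟨b', hb', hc'⟩ := suspMap_spec g
      exact susp_wellDefined h hb hc hb' hc')

/-- The triangulated structure of the stable category. The exact triangles are those isomorphic to
`X ⟶ Y ⟶ Z ⟶ ΣX`, where `0 ⟶ X ⟶ Y ⟶ Z ⟶ 0` is an exact sequence in `E` and `Z ⟶ ΣX` is
part of a commutative diagram
```
  0 ⟶ X ⟶ Y ⟶ Z  ⟶ 0
      ‖    ↓b   ↓c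
  0 ⟶ X ⟶ Q ⟶ ΣX ⟶ 0.
```
-/
instance stableTriangleStructure : TriangleStructure (StableCat E) where
  susp := stableSusp E
  exactTriangle {U V W} f g h :=
    ∃ (X Y Z : E.FullSubcategory) (f' : X ⟶ Y) (g' : Y ⟶ Z) (w : f'.hom ≫ g'.hom = 0)
      (b : Y.obj ⟶ suspQ E X) (c : Z ⟶ suspObj E X)
      (α : U ≅ (toStable E).obj X) (β : V ≅ (toStable E).obj Y) (γ : W ≅ (toStable E).obj Z),
      (ShortComplex.mk f'.hom g'.hom w).ShortExact ∧
      f'.hom ≫ b = suspI E X ∧ g'.hom ≫ c.hom = b ≫ suspP E X ∧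
      f ≫ β.hom = α.hom ≫ (toStable E).map f' ∧
      g ≫ γ.hom = β.hom ≫ (toStable E).map g' ∧
      h ≫ (stableSusp E).map α.hom = γ.hom ≫ (toStable E).map c

end Susp

end Stable

/-! ### Coinduced modules -/

section Coinduced

variable (R : Type u) (A : Type u) [CommRing R] [Ring A] [Algebra R A]

/-- For an `R`-module `U` the `A`-module `Hom_R(A, U)` with the action `(a • f) x = f (x * a)`. -/
def Coind (U : Type v) [AddCommGroup U] [Module R U] : Type (max u v) := A →ₗ[R] U

namespace Coind

variable (U : Type v) [AddCommGroup U] [Module R U]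

instance : AddCommGroup (Coind R A U) := inferInstanceAs (AddCommGroup (A →ₗ[R] U))
instance : Module R (Coind R A U) := inferInstanceAs (Module R (A →ₗ[R] U))
instance : FunLike (Coind R A U) A U := inferInstanceAs (FunLike (A →ₗ[R] U) A U)

/-- The `R`-linear map that corresponds to an element of the coinduced module. -/
def toLin : Coind R A U ≃ₗ[R] (A →ₗ[R] U) := LinearEquiv.refl R _

variable {R A U}

instance : SMul A (Coind R A U) :=
  ⟨fun a f => ((toLin R A U).symm ((toLin R A U f).comp (LinearMap.mulRight R a)))⟩

@[ext] lemma ext {f g : Coind R A U} (h : ∀ x, f x = g x) : f = g := LinearMap.ext h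
@[simp] lemma smul_apply (a : A) (f : Coind R A U) (x : A) : (a • f) x = f (x * a) := rfl
@[simp] lemma rsmul_apply (r : R) (f : Coind R A U) (x : A) : (r • f) x = r • f x := rfl
@[simp] lemma add_apply (f g : Coind R A U) (x : A) : (f + g) x = f x + g x := rfl
@[simp] lemma zero_apply (x : A) : (0 : Coind R A U) x = 0 := rfl
@[simp] lemma map_add' (f : Coind R A U) (x y : A) : f (x + y) = f x + f y :=
  LinearMap.map_add (toLin R A U f) x y
@[simp] lemma map_zero' (f : Coind R A U) : f 0 = 0 := LinearMap.map_zero (toLin R A U f)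
@[simp] lemma map_smul' (f : Coind R A U) (r : R) (x : A) : f (r • x) = r • f x :=
  LinearMap.map_smul (toLin R A U f) r x

instance : Module A (Coind R A U) where
  one_smul f := by ext; simp
  mul_smul a b f := by ext; simp [mul_assoc]
  smul_zero a := by ext; simp
  smul_add a f g := by ext; simp
  add_smul a b f := by ext; simp [mul_add]
  zero_smul f := by ext; simp

instance : IsScalarTower R A (Coind R A U) :=
  ⟨fun r a f => by ext; simp⟩

/-- Functoriality of the coinduced module. -/
def map {V : Type w} [AddCommGroup V] [Module R V] (g : U →ₗ[R] V) :
    Coind R A U →ₗ[A] Coind R A V where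
  toFun f := (toLin R A V).symm (g.comp (toLin R A U f))
  map_add' _ _ := LinearMap.comp_add _ _ _
  map_smul' _ _ := rfl

@[simp] lemma map_apply {V : Type w} [AddCommGroup V] [Module R V] (g : U →ₗ[R] V)
    (f : Coind R A U) (x : A) : map g f x = g (f x) := rfl

/-- The adjunction between restriction and coinduction. -/
def adj {M : Type w} [AddCommGroup M] [Module A M] [Module R M] [IsScalarTower R A M]
    (g : M →ₗ[R] U) : M →ₗ[A] Coind R A U where
  toFun m := (toLin R A U).symm (g.comp ((LinearMap.toSpanSingleton A M m).restrictScalars R))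
  map_add' m m' := by
    refine LinearMap.ext fun a => ?_
    exact (congrArg g (smul_add a m m')).trans (LinearMap.map_add g _ _)
  map_smul' a m := by
    refine LinearMap.ext fun x => ?_
    exact congrArg g (mul_smul x a m).symm

@[simp] lemma adj_apply {M : Type w} [AddCommGroup M] [Module A M] [Module R M]
    [IsScalarTower R A M] (g : M →ₗ[R] U) (m : M) (a : A) : adj (A := A) g m a = g (a • m) := rfl

/-- Coinduction commutes with direct sums when `A` is finite over `R`. -/
lemma exists_finsuppEquiv [Module.Finite R A] (I : Type w) :
    Nonempty ((I →₀ Coind R A U) ≃ₗ[A] Coind R A (I →₀ U)) := by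
  classical
  let φ : (I →₀ Coind R A U) →ₗ[A] Coind R A (I →₀ U) :=
    Finsupp.lsum ℕ fun i => map (Finsupp.lsingle i)
  have hφ : ∀ (f : I →₀ Coind R A U) (x : A) (i : I), φ f x i = f i x := by
    intro f x i
    induction f using Finsupp.induction_linear with
    | zero => simp
    | add f g hf hg => simp [hf, hg]
    | single j g =>
      simp only [φ, Finsupp.lsum_single, map_apply, Finsupp.lsingle_apply]
      by_cases h : j = i
      · subst h; simp
      · simp [h]
  refine ⟨LinearEquiv.ofBijective φ ⟨?_, ?_⟩⟩
  · intro f g h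
    ext i x
    rw [← hφ f, ← hφ g, h]
  · intro h
    obtain ⟨s, hs⟩ := Module.Finite.fg_top (R := R) (M := A)
    let S : Finset I := s.biUnion fun a => (h a).support
    have hS : ∀ a : A, ∀ i ∉ S, h a i = 0 := by
      intro a i hi
      have ha : a ∈ Submodule.span R (s : Set A) := hs ▸ Submodule.mem_top
      induction ha using Submodule.span_induction with
      | mem x hx =>
        by_contra hne
        exact hi (Finset.mem_biUnion.2 ⟨x, hx, by simpa using hne⟩)
      | zero => simp
      | add x y _ _ hx hy => simp [hx, hy]
      | smul r x _ hx => simp [hx]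
    refine ⟨Finsupp.onFinset S (fun i => (toLin R A U).symm
      ((Finsupp.lapply i).comp (toLin R A (I →₀ U) h))) ?_, ?_⟩
    · intro i hi
      by_contra hne
      exact hi (ext fun a => hS a i hne)
    · ext x i
      rw [hφ]
      rfl

lemma exists_piEquiv (n : ℕ) :
    Nonempty ((Fin n → Coind R A U) ≃ₗ[A] Coind R A (Fin n → U)) :=
  ⟨{ toFun := fun f => (toLin R A _).symm (LinearMap.pi fun i => toLin R A U (f i))
     invFun := fun g i => (toLin R A U).symm ((LinearMap.proj i).comp (toLin R A _ g))
     map_add' := fun _ _ => rfl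
     map_smul' := fun _ _ => rfl
     left_inv := fun _ => rfl
     right_inv := fun _ => rfl }⟩

end Coind

end Coinduced

/-! ### Frobenius algebras -/

section Frobenius

/-- `add M`: the direct summands of finite direct sums of copies of `M`. -/
def addClosure {A : Type u} [Ring A] (M : ModuleCat.{u} A) : ObjectProperty (ModuleCat.{u} A) :=
  fun N => ∃ n : ℕ, Nonempty (Retract N (ModuleCat.of A (Fin n → M)))

variable (R : Type u) (A : Type u) [CommRing R] [Ring A] [Algebra R A]

/-- The dualising module `ω = Hom_R(A, R)` as an `A`-module. -/
abbrev dualisingModule : ModuleCat.{u} A := ModuleCat.of A (Coind R A R)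

/-- A Frobenius `R`-algebra is an `R`-algebra `A` that is finitely generated
and projective as an `R`-module and satisfies `add ω = add A`. -/
class IsFrobeniusAlgebra : Prop extends Module.Finite R A, Module.Projective R A where
  addClosure_eq : addClosure (dualisingModule R A) = addClosure (ModuleCat.of A A)

/-- `Mod(A, R)`: the `A`-modules that are projective as `R`-modules. -/
def ModProj : ObjectProperty (ModuleCat.{u} A) := fun M =>
  Module.Projective R ((ModuleCat.restrictScalars (algebraMap R A)).obj M)

/-- `mod(A, R)`: the `A`-modules that are finitely generated and projective as `R`-modules. -/
def ModFinProj : ObjectProperty (ModuleCat.{u} A) := fun M =>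
  ModProj R A M ∧ Module.Finite R ((ModuleCat.restrictScalars (algebraMap R A)).obj M)

/-- `Mod^lf(A, R)`: the localising subcategory of `Mod(A, R)` generated by `mod(A, R)`, that is, the
smallest full subcategory of `Mod(A, R)` that contains `mod(A, R)`, is closed under coproducts,
and has the two-out-of-three property for exact sequences in `Mod(A, R)`. -/
inductive ModLF : ObjectProperty (ModuleCat.{u} A)
  | of (M : ModuleCat.{u} A) : ModFinProj R A M → ModLF M
  | coprod (J : Type u) (M : J → ModuleCat.{u} A) (c : Cofan M) : IsColimit c →
      (∀ j, ModLF (M j)) → ModLF c.pt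
  | two_of_three₁ (S : ShortComplex (ModuleCat.{u} A)) : S.ShortExact →
      ModProj R A S.X₁ → ModLF S.X₂ → ModLF S.X₃ → ModLF S.X₁
  | two_of_three₂ (S : ShortComplex (ModuleCat.{u} A)) : S.ShortExact →
      ModLF S.X₁ → ModProj R A S.X₂ → ModLF S.X₃ → ModLF S.X₂
  | two_of_three₃ (S : ShortComplex (ModuleCat.{u} A)) : S.ShortExact →
      ModLF S.X₁ → ModLF S.X₂ → ModProj R A S.X₃ → ModLF S.X₃

variable {R A}

section Unbundled

variable {M : Type u} [AddCommGroup M] [Module A M] [Module R M] [IsScalarTower R A M]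

lemma smul_restrict (M : ModuleCat.{u} A) (r : R)
    (m : (ModuleCat.restrictScalars (algebraMap R A)).obj M) :
    r • m = (show (ModuleCat.restrictScalars (algebraMap R A)).obj M from
      (algebraMap R A r • (show M from m))) := rfl

/-- The identity, as a linear map from `M` to the restriction of the bundled module. -/
def restrictEquiv : M ≃ₗ[R] (ModuleCat.restrictScalars (algebraMap R A)).obj (ModuleCat.of A M) where
  toFun m := m
  invFun m := m
  map_add' _ _ := rfl
  map_smul' r m := (algebraMap_smul A r m).symm
  left_inv _ := rfl
  right_inv _ := rfl

lemma modProj_of_iff : ModProj R A (ModuleCat.of A M) ↔ Module.Projective R M :=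
  ⟨fun (_ : Module.Projective R _) => Module.Projective.of_equiv' (restrictEquiv (A := A)).symm,
    fun _ => Module.Projective.of_equiv' restrictEquiv⟩

lemma modFinProj_of_iff :
    ModFinProj R A (ModuleCat.of A M) ↔ Module.Projective R M ∧ Module.Finite R M := by
  rw [ModFinProj, modProj_of_iff]
  exact and_congr_right fun _ => (Module.Finite.equiv_iff restrictEquiv).symm

end Unbundled

section Unbundled

variable [IsFrobeniusAlgebra R A]

lemma exists_retract_coind (P : Type u) [AddCommGroup P] [Module A P] [Module.Projective A P] :
    ∃ (W : Type u) (_ : AddCommGroup W) (_ : Module R W) (s : P →ₗ[A] Coind R A W)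
      (r : Coind R A W →ₗ[A] P), r ∘ₗ s = LinearMap.id := by
  have hA : addClosure (dualisingModule R A) (ModuleCat.of A A) := by
    rw [IsFrobeniusAlgebra.addClosure_eq (R := R)]
    refine ⟨1, ⟨⟨ModuleCat.ofHom (LinearMap.pi fun _ => LinearMap.id),
      ModuleCat.ofHom (LinearMap.proj 0), ?_⟩⟩⟩
    ext
    simp
  obtain ⟨n, ⟨ρ⟩⟩ := hA
  obtain ⟨e₁⟩ := Coind.exists_piEquiv (R := R) (A := A) (U := R) n
  obtain ⟨e₂⟩ := Coind.exists_finsuppEquiv (R := R) (A := A) (U := Fin n → R) P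
  obtain ⟨s, hs⟩ := (Module.projective_def' (R := A) (P := P)).1 inferInstance
  let a : A →ₗ[A] Coind R A (Fin n → R) := e₁.toLinearMap ∘ₗ ρ.i.hom
  let b : Coind R A (Fin n → R) →ₗ[A] A := ρ.r.hom ∘ₗ e₁.symm.toLinearMap
  have hab : b ∘ₗ a = LinearMap.id := by
    ext
    have h : ρ.r.hom (ρ.i.hom (1 : A)) = 1 :=
      LinearMap.congr_fun (congrArg (fun f => f.hom) ρ.retract) (1 : A)
    simpa [a, b] using h
  refine ⟨P →₀ (Fin n → R), inferInstance, inferInstance,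
    e₂.toLinearMap ∘ₗ Finsupp.mapRange.linearMap a ∘ₗ s,
    Finsupp.linearCombination A id ∘ₗ Finsupp.mapRange.linearMap b ∘ₗ e₂.symm.toLinearMap, ?_⟩
  ext x
  have h₁ : Finsupp.mapRange.linearMap b (Finsupp.mapRange.linearMap a (s x)) = s x := by
    rw [← LinearMap.comp_apply, ← Finsupp.mapRange.linearMap_comp, hab,
      Finsupp.mapRange.linearMap_id, LinearMap.id_apply]
  have h₂ : Finsupp.linearCombination A id (s x) = x := LinearMap.congr_fun hs x
  simp only [LinearMap.comp_apply, LinearEquiv.coe_coe, LinearEquiv.symm_apply_apply, h₁, h₂,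
    LinearMap.id_apply]

lemma projective_finsupp (S : Type u) [Ring S] (P : Type u) [AddCommGroup P] [Module S P]
    [Module.Projective S P] (I : Type u) : Module.Projective S (I →₀ P) := by
  classical
  exact Module.Projective.of_equiv' (finsuppLequivDFinsupp (ι := I) (M := P) S).symm

lemma projective_coind (U : Type u) [AddCommGroup U] [Module R U] [Module.Projective R U] :
    Module.Projective A (Coind R A U) := by
  have hω : Module.Projective A (Coind R A R) := by
    have : addClosure (ModuleCat.of A A) (dualisingModule R A) := by
      rw [← IsFrobeniusAlgebra.addClosure_eq (R := R)]
      refine ⟨1, ⟨⟨ModuleCat.ofHom (LinearMap.pi fun _ => LinearMap.id),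
        ModuleCat.ofHom (LinearMap.proj 0), ?_⟩⟩⟩
      ext
      simp
    obtain ⟨n, ⟨ρ⟩⟩ := this
    exact Module.Projective.of_split (M := Fin n → A) ρ.i.hom ρ.r.hom
      (congrArg (fun f => f.hom) ρ.retract)
  obtain ⟨s, hs⟩ := (Module.projective_def' (R := R) (P := U)).1 inferInstance
  obtain ⟨e⟩ := Coind.exists_finsuppEquiv (R := R) (A := A) (U := R) U
  have := projective_finsupp A (Coind R A R) U
  have : Module.Projective A (Coind R A (U →₀ R)) := Module.Projective.of_equiv' e
  refine Module.Projective.of_split (Coind.map s) (Coind.map (Finsupp.linearCombination R id)) ?_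
  ext f x
  exact LinearMap.congr_fun hs (f x)

lemma finite_coind (U : Type u) [AddCommGroup U] [Module R U] [Module.Finite R U] :
    Module.Finite R (Coind R A U) := by
  obtain ⟨n, f, hf⟩ := Module.Finite.exists_fin' R A
  obtain ⟨g, hg⟩ := Module.projective_lifting_property f LinearMap.id hf
  have : Module.Finite R ((Fin n → R) →ₗ[R] U) := Module.Finite.linearMap R R (Fin n → R) U
  refine Module.Finite.of_surjective
    (((Coind.toLin R A U).symm.toLinearMap) ∘ₗ LinearMap.lcomp R U g) ?_
  intro h
  refine ⟨(Coind.toLin R A U h) ∘ₗ f, ?_⟩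
  ext x
  exact congrArg h (LinearMap.congr_fun hg x)

variable {M : Type u} [AddCommGroup M] [Module A M] [Module R M] [IsScalarTower R A M]

lemma exists_split_embedding [Module.Projective R M] {I : Type u}
    (q : (I →₀ A) →ₗ[A] Coind R A M) (hq : Function.Surjective q) :
    ∃ (i : M →ₗ[A] (I →₀ A)) (ρ : (I →₀ A) →ₗ[R] M), ρ ∘ₗ i.restrictScalars R = LinearMap.id := by
  have := projective_coind (R := R) (A := A) M
  obtain ⟨s, hs⟩ := Module.projective_lifting_property q LinearMap.id hq
  refine ⟨s ∘ₗ Coind.adj LinearMap.id,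
    ((LinearMap.applyₗ (1 : A)) ∘ₗ (Coind.toLin R A M).toLinearMap) ∘ₗ q.restrictScalars R, ?_⟩
  ext m
  have h := LinearMap.congr_fun hs (Coind.adj (LinearMap.id (R := R) (M := M)) m)
  have h' : (q (s (Coind.adj (LinearMap.id (R := R) (M := M)) m))) (1 : A) = m := by
    simp at h
    rw [h]; simp
  exact h'

lemma exists_extension {X Y P : Type u} [AddCommGroup X] [Module A X] [Module R X]
    [IsScalarTower R A X] [AddCommGroup Y] [Module A Y] [Module R Y] [IsScalarTower R A Y]
    [AddCommGroup P] [Module A P] [Module.Projective A P]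
    (i : X →ₗ[A] Y) (ρ : Y →ₗ[R] X) (h : ρ ∘ₗ i.restrictScalars R = LinearMap.id)
    (f : X →ₗ[A] P) : ∃ g : Y →ₗ[A] P, g ∘ₗ i = f := by
  obtain ⟨W, _, _, s, r, hrs⟩ := exists_retract_coind (R := R) (A := A) P
  let φ : X →ₗ[R] W := (LinearMap.applyₗ (1 : A)) ∘ₗ (Coind.toLin R A W).toLinearMap ∘ₗ
    (s ∘ₗ f).restrictScalars R
  refine ⟨r ∘ₗ Coind.adj (φ ∘ₗ ρ), ?_⟩
  ext x
  have h₁ : Coind.adj (φ ∘ₗ ρ) (i x) = s (f x) := by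
    ext a
    have h₂ : ρ (a • i x) = a • x := by
      rw [← map_smul]
      exact LinearMap.congr_fun h (a • x)
    have h₃ : φ (a • x) = (s (f (a • x))) 1 := rfl
    rw [Coind.adj_apply, LinearMap.comp_apply, h₂, h₃]
    simp
  have := LinearMap.congr_fun hrs (f x)
  simpa [h₁] using this

end Unbundled

section Instances

/-- The `R`-module structure on an `A`-module. -/
abbrev restrictModule (M : ModuleCat.{u} A) : Module R M := Module.compHom M (algebraMap R A)

lemma restrict_isScalarTower (M : ModuleCat.{u} A) :
    letI := restrictModule (R := R) M
    IsScalarTower R A M :=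
  letI := restrictModule (R := R) M
  ⟨fun r a m => by
    rw [Algebra.smul_def, mul_smul]
    rfl⟩

lemma projective_finsupp_self [Module.Projective R A] (I : Type u) :
    ModProj R A (ModuleCat.of A (I →₀ A)) :=
  modProj_of_iff.2 (projective_finsupp R A I)

/-- The multiplication with scalars as a linear map for the restricted module. -/
def restrictHom {M N : ModuleCat.{u} A} (f : M ⟶ N) :
    (ModuleCat.restrictScalars (algebraMap R A)).obj M →ₗ[R]
      (ModuleCat.restrictScalars (algebraMap R A)).obj N :=
  ((ModuleCat.restrictScalars (algebraMap R A)).map f).hom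

lemma exists_linear_splitting (S : ShortComplex (ModuleCat.{u} A)) (hS : S.ShortExact)
    (h₃ : ModProj R A S.X₃) :
    (∃ l, restrictHom (R := R) S.g ∘ₗ l = LinearMap.id) ∧
      ∃ l, l ∘ₗ restrictHom (R := R) S.f = LinearMap.id := by
  have : Module.Projective R ((ModuleCat.restrictScalars (algebraMap R A)).obj S.X₃) := h₃
  have hinj : Function.Injective (restrictHom (R := R) S.f) := hS.moduleCat_injective_f
  have hsurj : Function.Surjective (restrictHom (R := R) S.g) := hS.moduleCat_surjective_g
  have hex : Function.Exact (restrictHom (R := R) S.f) (restrictHom (R := R) S.g) :=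
    (ShortComplex.ShortExact.moduleCat_exact_iff_function_exact S).1 hS.exact
  have h : ∃ l, restrictHom (R := R) S.g ∘ₗ l = LinearMap.id :=
    Module.projective_lifting_property _ LinearMap.id hsurj
  have h' := (hex.split_tfae'.out 0 1).1 (And.intro hinj h)
  exact ⟨h, h'.2⟩

lemma exists_section {X Y Z : Type u} [AddCommGroup X] [AddCommGroup Y] [AddCommGroup Z]
    [Module R X] [Module R Y] [Module R Z] (f : X →ₗ[R] Y) (g : Y →ₗ[R] Z)
    (h : Function.Exact f g) (hg : Function.Surjective g) (ρ : Y →ₗ[R] X)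
    (hρ : ρ ∘ₗ f = LinearMap.id) : ∃ l, g ∘ₗ l = LinearMap.id := by
  have hk : LinearMap.ker g ≤ LinearMap.ker (LinearMap.id - f ∘ₗ ρ) := by
    intro y hy
    obtain ⟨x, rfl⟩ := (h y).1 hy
    have hx : ρ (f x) = x := LinearMap.congr_fun hρ x
    simp [hx]
  refine ⟨((LinearMap.ker g).liftQ (LinearMap.id - f ∘ₗ ρ) hk) ∘ₗ
    (g.quotKerEquivOfSurjective hg).symm.toLinearMap, ?_⟩
  ext z
  obtain ⟨y, rfl⟩ := hg z
  have hz : (g.quotKerEquivOfSurjective hg).symm (g y) = Submodule.Quotient.mk y := by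
    rw [LinearEquiv.symm_apply_eq]
    rfl
  have hf : g (f (ρ y)) = 0 := (h _).2 ⟨_, rfl⟩
  simp [hz, hf]

lemma modProj_of_shortExact (S : ShortComplex (ModuleCat.{u} A)) (hS : S.ShortExact)
    (h₂ : ModProj R A S.X₂) (h₃ : ModProj R A S.X₃) : ModProj R A S.X₁ := by
  obtain ⟨l, hl⟩ := (exists_linear_splitting S hS h₃).2
  have : Module.Projective R ((ModuleCat.restrictScalars (algebraMap R A)).obj S.X₂) := h₂
  exact Module.Projective.of_split _ _ hl

lemma projective_cokernel {X Y Z : Type u} [AddCommGroup X] [AddCommGroup Y] [AddCommGroup Z]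
    [Module A X] [Module A Y] [Module A Z] [Module R X] [Module R Y] [Module R Z]
    [IsScalarTower R A X] [IsScalarTower R A Y] [IsScalarTower R A Z] [Module.Projective R Y]
    (f : X →ₗ[A] Y) (g : Y →ₗ[A] Z) (h : Function.Exact f g) (hg : Function.Surjective g)
    (ρ : Y →ₗ[R] X) (hρ : ρ ∘ₗ f.restrictScalars R = LinearMap.id) : Module.Projective R Z := by
  obtain ⟨l, hl⟩ := exists_section (f.restrictScalars R) (g.restrictScalars R) h hg ρ hρ
  exact Module.Projective.of_split l _ hl

lemma exists_embedding_aux [IsFrobeniusAlgebra R A] (M : Type u) [AddCommGroup M] [Module A M]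
    [Module R M] [IsScalarTower R A M] [Module.Projective R M] {I : Type u}
    (q : (I →₀ A) →ₗ[A] Coind R A M) (hq : Function.Surjective q) :
    ∃ (N : ModuleCat.{u} A) (i : ModuleCat.of A M ⟶ ModuleCat.of A (I →₀ A))
      (p : ModuleCat.of A (I →₀ A) ⟶ N) (w : i ≫ p = 0),
      (ShortComplex.mk i p w).ShortExact ∧ ModProj R A N := by
  obtain ⟨i, ρ, hρ⟩ := exists_split_embedding (M := M) q hq
  have hinj : Function.Injective i := by
    intro x y hxy
    have := congrArg ρ hxy
    rwa [show ρ (i x) = x from LinearMap.congr_fun hρ x,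
      show ρ (i y) = y from LinearMap.congr_fun hρ y] at this
  have := projective_finsupp R A I
  have hS : Function.Exact i (LinearMap.range i).mkQ :=
    LinearMap.exact_iff.2 (Submodule.ker_mkQ _)
  have hN := projective_cokernel i (LinearMap.range i).mkQ hS (Submodule.mkQ_surjective _) ρ hρ
  exact ⟨ModuleCat.of A ((I →₀ A) ⧸ LinearMap.range i), ModuleCat.ofHom i,
    ModuleCat.ofHom (LinearMap.range i).mkQ, ModuleCat.hom_ext (LinearMap.range_mkQ_comp i),
    ModuleCat.shortComplex_shortExact _ hS hinj (Submodule.mkQ_surjective _),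
    modProj_of_iff.2 hN⟩

lemma isFrobeniusSubcategory_of [IsFrobeniusAlgebra R A] (E : ObjectProperty (ModuleCat.{u} A))
    (hE : E ≤ ModProj R A)
    (hM : ∀ M, E M → ∃ I : Type u, E (ModuleCat.of A (I →₀ A)) ∧
      ∃ q : (I →₀ A) →ₗ[A] M, Function.Surjective q)
    (hC : ∀ M, E M → ∃ I : Type u, E (ModuleCat.of A (I →₀ A)) ∧
      letI := restrictModule (R := R) M
      ∃ q : (I →₀ A) →ₗ[A] Coind R A M, Function.Surjective q)
    (h₁ : ∀ S : ShortComplex (ModuleCat.{u} A), S.ShortExact → ModProj R A S.X₁ → E S.X₂ →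
      E S.X₃ → E S.X₁)
    (h₃ : ∀ S : ShortComplex (ModuleCat.{u} A), S.ShortExact → E S.X₁ → E S.X₂ →
      ModProj R A S.X₃ → E S.X₃) : IsFrobeniusSubcategory E where
  exists_cover M hM' := by
    obtain ⟨I, hI, q, hq⟩ := hM M hM'
    have hS := LinearMap.shortExact_shortComplexKer hq
    refine ⟨_, _, _, _, _, hS, hI, ?_, ?_⟩
    · exact (IsProjective.iff_projective (I →₀ A)).1 inferInstance
    · exact h₁ _ hS (modProj_of_shortExact _ hS (hE _ hI) (hE _ hM')) hI hM'
  exists_embedding M hM' := by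
    obtain ⟨I, hI, q, hq⟩ := hC M hM'
    let := restrictModule (R := R) M
    have := restrict_isScalarTower (R := R) M
    have : Module.Projective R M := hE _ hM'
    obtain ⟨N, i, p, w, hS, hN⟩ := exists_embedding_aux (R := R) M q hq
    exact ⟨_, N, i, p, w, hS, hI, (IsProjective.iff_projective (I →₀ A)).1 inferInstance,
      h₃ _ hS hM' hI hN⟩
  extend S hS hS₁ hS₂ hS₃ P _ hP' f := by
    let := restrictModule (R := R) S.X₁
    have := restrict_isScalarTower (R := R) S.X₁
    let := restrictModule (R := R) S.X₂
    have := restrict_isScalarTower (R := R) S.X₂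
    have : Module.Projective A P := (IsProjective.iff_projective P).2 hP'
    obtain ⟨ρ, hρ⟩ : ∃ ρ : S.X₂ →ₗ[R] S.X₁, ρ ∘ₗ S.f.hom.restrictScalars R = LinearMap.id :=
      (exists_linear_splitting (R := R) S hS (hE _ hS₃)).2
    obtain ⟨g, hg⟩ := exists_extension (R := R) S.f.hom ρ hρ f.hom
    exact ⟨ModuleCat.ofHom g, ModuleCat.hom_ext hg⟩

lemma exists_surjection (M : Type u) [AddCommGroup M] [Module A M] :
    ∃ q : (M →₀ A) →ₗ[A] M, Function.Surjective q :=
  ⟨Finsupp.linearCombination A id, fun m => ⟨Finsupp.single m 1, by simp⟩⟩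

lemma exists_finite_surjection (M : Type u) [AddCommGroup M] [Module A M] [Module.Finite A M] :
    ∃ (I : Type u) (_ : Finite I) (q : (I →₀ A) →ₗ[A] M), Function.Surjective q := by
  obtain ⟨s, hs⟩ := Module.Finite.fg_top (R := A) (M := M)
  refine ⟨s, inferInstance, Finsupp.linearCombination A ((↑) : s → M), ?_⟩
  rw [← LinearMap.range_eq_top, Finsupp.range_linearCombination, Subtype.range_coe_subtype]
  exact hs

lemma modFinProj_finsupp [Module.Finite R A] [Module.Projective R A] (I : Type u) [Finite I] :
    ModFinProj R A (ModuleCat.of A (I →₀ A)) :=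
  modFinProj_of_iff.2 ⟨projective_finsupp R A I, inferInstance⟩

lemma modLF_le_modProj : ModLF R A ≤ ModProj R A := by
  intro M hM
  induction hM with
  | of M hM => exact hM.1
  | coprod J M c hc _ ih =>
    let F := ModuleCat.restrictScalars.{u} (algebraMap R A)
    have hc' : IsColimit (Cofan.mk _ fun j => F.map (c.inj j)) :=
      isColimitCofanMkObjOfIsColimit F M c.inj
        (IsColimit.ofIsoColimit hc (Cofan.ext (Iso.refl _) (by simp)))
    have (j : J) : Projective (F.obj (M j)) :=
      (IsProjective.iff_projective (F.obj (M j))).1 (ih j)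
    have h : Projective (F.obj c.pt) := ⟨fun f e _ => by
      refine ⟨Cofan.IsColimit.desc hc' fun j => Projective.factorThru (F.map (c.inj j) ≫ f) e, ?_⟩
      refine Cofan.IsColimit.hom_ext hc' _ _ fun j => ?_
      rw [Cofan.IsColimit.fac_assoc, Projective.factorThru_comp]
      rfl⟩
    exact (IsProjective.iff_projective (F.obj c.pt)).2 h
  | two_of_three₁ S _ h _ _ _ _ => exact h
  | two_of_three₂ S _ _ h _ _ _ => exact h
  | two_of_three₃ S _ _ _ h _ _ => exact h

lemma modFinProj_le_modLF : ModFinProj R A ≤ ModLF R A := fun M hM => .of M hM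

lemma modLF_finsupp [Module.Finite R A] [Module.Projective R A] (I : Type u) :
    ModLF R A (ModuleCat.of A (I →₀ A)) := by
  let c : Cofan fun _ : I => ModuleCat.of A A :=
    Cofan.mk (ModuleCat.of A (I →₀ A)) fun i => ModuleCat.ofHom (Finsupp.lsingle i)
  have hc : IsColimit c := Cofan.IsColimit.mk c
    (fun s => ModuleCat.ofHom (Finsupp.lsum ℕ fun i => (s.inj i).hom))
    (fun s i => by
      ext
      simp [c])
    (fun s m h => by
      refine ModuleCat.hom_ext (Finsupp.lhom_ext' fun i => ?_)
      have := congrArg (fun f => f.hom) (h i)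
      ext
      simpa [c] using LinearMap.congr_fun this (1 : A))
  exact ModLF.coprod I _ c hc fun _ => .of _ (modFinProj_of_iff.2 ⟨inferInstance, inferInstance⟩)

variable (R A)

instance [IsFrobeniusAlgebra R A] : IsFrobeniusSubcategory (ModProj R A) :=
  isFrobeniusSubcategory_of (R := R) _ le_rfl
    (fun M _ => ⟨M, projective_finsupp_self _, exists_surjection M⟩)
    (fun _ _ => ⟨_, projective_finsupp_self _, exists_surjection _⟩)
    (fun _ _ h _ _ => h) (fun _ _ _ _ h => h)

instance [IsFrobeniusAlgebra R A] : IsFrobeniusSubcategory (ModLF R A) :=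
  isFrobeniusSubcategory_of (R := R) _ modLF_le_modProj
    (fun M _ => ⟨M, modLF_finsupp _, exists_surjection M⟩)
    (fun _ _ => ⟨_, modLF_finsupp _, exists_surjection _⟩)
    (fun S hS h₁ h₂ h₃ => .two_of_three₁ S hS h₁ h₂ h₃)
    (fun S hS h₁ h₂ h₃ => .two_of_three₃ S hS h₁ h₂ h₃)

instance [IsFrobeniusAlgebra R A] : IsFrobeniusSubcategory (ModFinProj R A) := by
  refine isFrobeniusSubcategory_of (R := R) _ (fun _ h => h.1) ?_ ?_ ?_ ?_
  · rintro M ⟨-, h⟩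
    let := restrictModule (R := R) M
    have := restrict_isScalarTower (R := R) M
    have : Module.Finite R M := h
    have : Module.Finite A M := Module.Finite.of_restrictScalars_finite R A M
    obtain ⟨I, _, h⟩ := exists_finite_surjection (A := A) M
    exact ⟨I, modFinProj_finsupp I, h⟩
  · rintro M ⟨-, h⟩
    let := restrictModule (R := R) M
    have : Module.Finite R M := h
    have := finite_coind (R := R) (A := A) M
    have := Module.Finite.of_restrictScalars_finite R A (Coind R A M)
    obtain ⟨I, _, h⟩ := exists_finite_surjection (A := A) (Coind R A M)
    exact ⟨I, modFinProj_finsupp I, h⟩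
  · rintro S hS h₁ ⟨-, h₂⟩ h₃
    obtain ⟨l, hl⟩ := (exists_linear_splitting S hS h₃.1).2
    have := h₂
    exact ⟨h₁, Module.Finite.of_surjective l fun x => ⟨_, LinearMap.congr_fun hl x⟩⟩
  · rintro S hS - ⟨-, h₂⟩ h₃
    have := h₂
    exact ⟨h₃, Module.Finite.of_surjective (restrictHom (R := R) S.g) hS.moduleCat_surjective_g⟩

end Instances

end Frobenius
/-! ### Homotopy categories and derived categories -/

section Homotopy

variable {C : Type u₁} [Category.{v₁} C] [Abelian C]

/-- A property of cochain complexes, considered as a property of the objects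
in the homotopy category. -/
def homotopyProp (Φ : ObjectProperty (CochainComplex C ℤ)) :
    ObjectProperty (HomotopyCategory C (ComplexShape.up ℤ)) := fun X => Φ X.as

lemma homotopyProp_isTriangulated (Φ : ObjectProperty (CochainComplex C ℤ))
    (h₀ : Φ 0) (hs : ∀ K, Φ K → ∀ n : ℤ, Φ (K⟦n⟧))
    (hc : ∀ K L (f : K ⟶ L), Φ K → Φ L → Φ (CochainComplex.mappingCone f)) :
    (homotopyProp Φ).IsTriangulated :=
  have h₁ : (homotopyProp Φ).IsStableUnderShift ℤ :=
    { isStableUnderShiftBy n :=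
        { le_shift K hK := by
            obtain ⟨K : CochainComplex _ _, rfl⟩ := K.quotient_obj_surjective
            rw [ObjectProperty.prop_shift_iff, HomotopyCategory.shift_quotient_obj]
            exact hs K hK n } }
  have h₂ : (homotopyProp Φ).ContainsZero :=
    { exists_zero := ⟨(HomotopyCategory.quotient _ _).obj 0,
        Functor.map_isZero _ (isZero_zero _), h₀⟩ }
  have h₃ : (homotopyProp Φ).IsTriangulatedClosed₃ :=
    { ext₃' T hT h h' := by
        obtain ⟨f : T.obj₁.as ⟶ T.obj₂.as, hf⟩ :=
          (HomotopyCategory.quotient _ _).map_surjective T.mor₁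
        refine ⟨_, hc _ _ f h h', ⟨Triangle.π₃.mapIso (isoTriangleOfIso₁₂ T _ hT
          (HomotopyCategory.mappingCone_triangleh_distinguished f)
            (Iso.refl _) (Iso.refl _) ?_)⟩⟩
        refine (Category.comp_id _).trans (Eq.trans ?_ (Category.id_comp _).symm)
        exact hf.symm }
  { toIsTriangulatedClosed₂ := .of_isTriangulatedClosed₃ }

/-- The complexes with terms in `E`. -/
def termwise (E : ObjectProperty C) : ObjectProperty (CochainComplex C ℤ) :=
  fun K => ∀ n, E (K.X n)

/-- The bounded complexes with terms in `E`. -/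
def boundedTermwise (E : ObjectProperty C) : ObjectProperty (CochainComplex C ℤ) :=
  fun K => (∀ n, E (K.X n)) ∧ (∃ a, K.IsStrictlyGE a) ∧ ∃ b, K.IsStrictlyLE b

/-- `K(E)`: the homotopy category of complexes with terms in `E`, as a full subcategory of the
homotopy category of the ambient abelian category. -/
abbrev KTerm (E : ObjectProperty C) : ObjectProperty (HomotopyCategory C (ComplexShape.up ℤ)) :=
  homotopyProp (termwise E)

/-- `K^b(E)`: the homotopy category of bounded complexes with terms in `E`. -/
abbrev KBounded (E : ObjectProperty C) : ObjectProperty (HomotopyCategory C (ComplexShape.up ℤ)) :=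
  homotopyProp (boundedTermwise E)

lemma boundedTermwise_shift (E : ObjectProperty C) {K : CochainComplex C ℤ}
    (hK : boundedTermwise E K) (n : ℤ) :
    boundedTermwise E (K⟦n⟧) := by
  obtain ⟨hK, ⟨a, _⟩, ⟨b, _⟩⟩ := hK
  exact ⟨fun i => hK (i + n), ⟨a - n, K.isStrictlyGE_shift a n (a - n) (by lia)⟩,
    ⟨b - n, K.isStrictlyLE_shift b n (b - n) (by lia)⟩⟩

/-- The closure properties of an additive subcategory. -/
class IsAdditiveSubcategory (E : ObjectProperty C) : Prop where
  of_isZero (X : C) : IsZero X → E X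
  of_iso {X Y : C} : (X ≅ Y) → E X → E Y
  biprod (X Y : C) : E X → E Y → E (X ⊞ Y)

variable (E : ObjectProperty C) [hE : IsAdditiveSubcategory E]

lemma termwise_zero : termwise E 0 := fun n =>
  hE.of_isZero _ (Functor.map_isZero (HomologicalComplex.eval C (ComplexShape.up ℤ) n)
    (isZero_zero _))

lemma termwise_cone {K L : CochainComplex C ℤ} (f : K ⟶ L) (hK : termwise E K)
    (hL : termwise E L) : termwise E (CochainComplex.mappingCone f) := fun n =>
  hE.of_iso (HomologicalComplex.homotopyCofiber.XIsoBiprod f n (n + 1) rfl).symm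
    (hE.biprod _ _ (hK _) (hL _))

instance : (KTerm E).IsTriangulated :=
  homotopyProp_isTriangulated _ (termwise_zero E) (fun _ hK n i => hK (i + n))
    (fun _ _ f hK hL => termwise_cone E f hK hL)

lemma boundedTermwise_cone {K L : CochainComplex C ℤ} (f : K ⟶ L) (hK : boundedTermwise E K)
    (hL : boundedTermwise E L) : boundedTermwise E (CochainComplex.mappingCone f) := by
  obtain ⟨hK, ⟨a, _⟩, ⟨b, _⟩⟩ := hK
  obtain ⟨hL, ⟨a', _⟩, ⟨b', _⟩⟩ := hL
  refine ⟨termwise_cone E f hK hL, ⟨min a a' - 1, ?_⟩, ⟨max b b' + 1, ?_⟩⟩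
  · rw [CochainComplex.isStrictlyGE_iff]
    intro i hi
    rw [CochainComplex.mappingCone.isZero_X_iff]
    exact ⟨K.isZero_of_isStrictlyGE a _ (by omega), L.isZero_of_isStrictlyGE a' _ (by omega)⟩
  · rw [CochainComplex.isStrictlyLE_iff]
    intro i hi
    rw [CochainComplex.mappingCone.isZero_X_iff]
    exact ⟨K.isZero_of_isStrictlyLE b _ (by omega), L.isZero_of_isStrictlyLE b' _ (by omega)⟩

lemma boundedTermwise_zero : boundedTermwise E 0 :=
  ⟨termwise_zero E, ⟨0, inferInstance⟩, ⟨0, inferInstance⟩⟩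

instance : (KBounded E).IsTriangulated :=
  homotopyProp_isTriangulated _ (boundedTermwise_zero E)
    (fun _ hK n => boundedTermwise_shift E hK n)
    (fun _ _ f hK hL => boundedTermwise_cone E f hK hL)

/-- The complexes in `K^b(E)` that are acyclic. -/
abbrev acyclicBounded : ObjectProperty (KBounded E).FullSubcategory :=
  (HomotopyCategory.subcategoryAcyclic C).inverseImage (KBounded E).ι

/-- `D^b(E)`: the bounded derived category, that is, the Verdier quotient of `K^b(E)` with respect
to the acyclic complexes. (It is used when `E` contains all kernels of epimorphisms between objects
of `E`, so that the cycles of a bounded acyclic complex in `E` belong to `E`.) -/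
abbrev DBounded := (acyclicBounded E).trW.Localization

instance : TriangleStructure (DBounded E) := TriangleStructure.ofPretriangulated _

variable [HasDerivedCategory.{w} C]

lemma acyclicBounded_inverts :
    (acyclicBounded E).trW.IsInvertedBy ((KBounded E).ι ⋙ DerivedCategory.Qh) :=
  ObjectProperty.inverseImage_trW_isInverted _ _ _

/-- The canonical functor from `D^b(E)` to the derived category of the ambient abelian
category. -/
def DBounded.toDerived : DBounded E ⥤ DerivedCategory C :=
  Localization.lift ((KBounded E).ι ⋙ DerivedCategory.Qh) (acyclicBounded_inverts E)
    (acyclicBounded E).trW.Q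

instance : Localization.Lifting (acyclicBounded E).trW.Q (acyclicBounded E).trW
    ((KBounded E).ι ⋙ DerivedCategory.Qh) (DBounded.toDerived.{w} E) :=
  inferInstanceAs (Localization.Lifting _ _ _ (Localization.lift _ (acyclicBounded_inverts E) _))

instance : (DBounded.toDerived.{w} E).CommShift ℤ :=
  Functor.commShiftOfLocalization (acyclicBounded E).trW.Q (acyclicBounded E).trW ℤ
    ((KBounded E).ι ⋙ DerivedCategory.Qh) _

instance : NatTrans.CommShift (Localization.Lifting.iso (acyclicBounded E).trW.Q
    (acyclicBounded E).trW ((KBounded E).ι ⋙ DerivedCategory.Qh)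
      (DBounded.toDerived.{w} E)).hom ℤ :=
  NatTrans.commShift_iso_hom_of_localization ..

instance : (DBounded.toDerived.{w} E).IsTriangulated :=
  have : (acyclicBounded E).trW.Q.mapArrow.EssSurj :=
    Localization.essSurj_mapArrow _ (acyclicBounded E).trW
  Functor.isTriangulated_of_precomp_iso (Localization.Lifting.iso (acyclicBounded E).trW.Q
    (acyclicBounded E).trW ((KBounded E).ι ⋙ DerivedCategory.Qh) _)

end Homotopy

section Perfect

variable (A : Type u) [Ring A]

/-- The projective modules. -/
def IsProj : ObjectProperty (ModuleCat.{u} A) := fun M => Module.Projective A M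

/-- The finitely generated projective modules. -/
def IsFGProj : ObjectProperty (ModuleCat.{u} A) := fun M =>
  Module.Projective A M ∧ Module.Finite A M

instance : IsAdditiveSubcategory (IsProj A) where
  of_isZero X h := by
    have := ModuleCat.subsingleton_of_isZero h
    have := Module.Free.of_subsingleton A X
    exact Module.Projective.of_free (R := A) (P := X)
  of_iso e (h : Module.Projective A _) := Module.Projective.of_equiv' e.toLinearEquiv
  biprod X Y (hX : Module.Projective A X) (hY : Module.Projective A Y) :=
    Module.Projective.of_equiv' (ModuleCat.biprodIsoProd X Y).symm.toLinearEquiv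

instance : IsAdditiveSubcategory (IsFGProj A) where
  of_isZero X h := ⟨IsAdditiveSubcategory.of_isZero (E := IsProj A) X h,
    have := ModuleCat.subsingleton_of_isZero h
    inferInstance⟩
  of_iso e := fun ⟨h, _⟩ => ⟨IsAdditiveSubcategory.of_iso (E := IsProj A) e h,
    Module.Finite.equiv e.toLinearEquiv⟩
  biprod X Y := fun ⟨hX, _⟩ ⟨hY, _⟩ =>
    ⟨IsAdditiveSubcategory.biprod (E := IsProj A) X Y hX hY,
      Module.Finite.equiv (ModuleCat.biprodIsoProd X Y).symm.toLinearEquiv⟩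

lemma isKProjective_of_perfect (K : CochainComplex (ModuleCat.{u} A) ℤ)
    (hK : boundedTermwise (IsFGProj A) K) : K.IsKProjective := by
  obtain ⟨hK, -, ⟨b, _⟩⟩ := hK
  have (n : ℤ) : Projective (K.X n) := (IsProjective.iff_projective _).1 (hK n).1
  exact CochainComplex.isKProjective_of_projective K b

variable [HasDerivedCategory.{w} (ModuleCat.{u} A)]

/-- A perfect complex: a complex that is quasi-isomorphic to a bounded complex of finitely generated
projective modules. -/
def IsPerfect : ObjectProperty (DerivedCategory (ModuleCat.{u} A)) := fun X =>
  ∃ K : CochainComplex (ModuleCat.{u} A) ℤ, boundedTermwise (IsFGProj A) K ∧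
    Nonempty (X ≅ DerivedCategory.Q.obj K)

instance : (IsPerfect.{w} A).IsClosedUnderIsomorphisms where
  of_iso e := fun ⟨K, hK, ⟨e'⟩⟩ => ⟨K, hK, ⟨e.symm ≪≫ e'⟩⟩

lemma exists_map_of_perfect (K L : CochainComplex (ModuleCat.{u} A) ℤ)
    (hK : boundedTermwise (IsFGProj A) K)
    (f : DerivedCategory.Q.obj K ⟶ DerivedCategory.Q.obj L) :
    ∃ g : K ⟶ L, DerivedCategory.Q.map g = f := by
  have := isKProjective_of_perfect A K hK
  obtain ⟨g, hg⟩ := (CochainComplex.IsKProjective.Qh_map_bijective K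
    ((HomotopyCategory.quotient _ _).obj L)).2
      ((DerivedCategory.quotientCompQhIso _).hom.app K ≫ f ≫
        (DerivedCategory.quotientCompQhIso _).inv.app L)
  obtain ⟨g, rfl⟩ := (HomotopyCategory.quotient _ _).map_surjective g
  refine ⟨g, ?_⟩
  rw [← cancel_epi ((DerivedCategory.quotientCompQhIso _).hom.app K),
    ← DerivedCategory.quotientCompQhIso_hom_naturality, hg]
  simp

instance : (IsPerfect.{w} A).IsStableUnderShift ℤ where
  isStableUnderShiftBy n :=
    { le_shift _ := fun ⟨K, hK, ⟨e⟩⟩ => ⟨K⟦n⟧, boundedTermwise_shift _ hK n,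
        ⟨(shiftFunctor _ n).mapIso e ≪≫ (DerivedCategory.Q.commShiftIso n).symm.app K⟩⟩ }

instance : (IsPerfect.{w} A).IsTriangulatedClosed₃ :=
  .mk' fun T hT ⟨K, hK, ⟨e⟩⟩ ⟨L, hL, ⟨e'⟩⟩ => by
    obtain ⟨f, hf⟩ := exists_map_of_perfect A K L hK (e.inv ≫ T.mor₁ ≫ e'.hom)
    refine ⟨CochainComplex.mappingCone f, boundedTermwise_cone _ f hK hL, ?_⟩
    refine ⟨Triangle.π₃.mapIso (isoTriangleOfIso₁₂ T _ hT
      (DerivedCategory.mappingCone_triangle_distinguished f) e e' ?_)⟩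
    have : e.hom ≫ DerivedCategory.Q.map f = T.mor₁ ≫ e'.hom := by rw [hf]; simp
    exact this.symm

instance : (IsPerfect.{w} A).IsTriangulated where
  exists_zero := ⟨DerivedCategory.Q.obj 0, Functor.map_isZero _ (isZero_zero _), 0,
    boundedTermwise_zero _, ⟨Iso.refl _⟩⟩
  toIsTriangulatedClosed₂ := .of_isTriangulatedClosed₃

end Perfect

section Main

variable (R : Type u) (A : Type u) [CommRing R] [Ring A] [Algebra R A]

lemma modFinProj_of_iso {X Y : ModuleCat.{u} A} (e : X ≅ Y) (h : ModFinProj R A X) :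
    ModFinProj R A Y := by
  have e' := ((ModuleCat.restrictScalars (algebraMap R A)).mapIso e).toLinearEquiv
  have : Module.Projective R ((ModuleCat.restrictScalars (algebraMap R A)).obj X) := h.1
  have : Module.Finite R ((ModuleCat.restrictScalars (algebraMap R A)).obj X) := h.2
  exact ⟨Module.Projective.of_equiv' e', Module.Finite.equiv e'⟩

instance : IsAdditiveSubcategory (ModFinProj R A) where
  of_isZero X h := by
    have := ModuleCat.subsingleton_of_isZero h
    have h : Subsingleton ((ModuleCat.restrictScalars (algebraMap R A)).obj X) := this
    have := Module.Free.of_subsingleton R ((ModuleCat.restrictScalars (algebraMap R A)).obj X)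
    exact ⟨Module.Projective.of_free (R := R)
      (P := (ModuleCat.restrictScalars (algebraMap R A)).obj X), inferInstance⟩
  of_iso := modFinProj_of_iso R A
  biprod X Y := fun ⟨hX, hX'⟩ ⟨hY, hY'⟩ => by
    let := restrictModule (R := R) X
    have := restrict_isScalarTower (R := R) X
    let := restrictModule (R := R) Y
    have := restrict_isScalarTower (R := R) Y
    have : Module.Projective R X := hX
    have : Module.Projective R Y := hY
    have : Module.Finite R X := hX'
    have : Module.Finite R Y := hY'
    refine modFinProj_of_iso R A (ModuleCat.biprodIsoProd X Y).symm (modFinProj_of_iff.2 ?_)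
    exact ⟨inferInstance, inferInstance⟩

/-- `K(Proj A)`: the homotopy category of complexes of projective `A`-modules. -/
abbrev KProj := (KTerm (IsProj A)).FullSubcategory

/-- `K^{+,b}(proj A)`: the complexes of finitely generated projective `A`-modules that are
bounded below and such that in all sufficiently high degrees the complex is exact with cycles in
`Mod(A, R)` (that is, exact with respect to the exact structure of `Mod(A, R)`). -/
def KPlusB : ObjectProperty (KProj A) := fun X =>
  (∀ n, IsFGProj A (X.obj.as.X n)) ∧ (∃ a, CochainComplex.IsStrictlyGE X.obj.as a) ∧
    ∃ b : ℤ, ∀ n ≥ b, X.obj.as.ExactAt n ∧ ModProj R A (X.obj.as.cycles n)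

/-- `K^lf(Proj A, R)`: the localising subcategory of `K(Proj A)` generated by
`K^{+,b}(proj A)`. -/
abbrev isKLF : ObjectProperty (KProj A) := Localising.{u} (KPlusB R A)

/-- `K^lf(Proj A, R)` as a category. -/
abbrev KLF := (isKLF R A).FullSubcategory

/-- `StMod^lf(A, R)`: the stable category of `Mod^lf(A, R)`. -/
abbrev StModLF := StableCat (ModLF R A)

/-- `stmod(A, R)`: the stable category of `mod(A, R)`. -/
abbrev Stmod := StableCat (ModFinProj R A)

/-- `D^b(mod(A, R))`. -/
abbrev Dbmod := DBounded (ModFinProj R A)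

/-- The acyclic complexes of projective `A`-modules that belong to `K^lf(Proj A, R)`,
as a property of cochain complexes. -/
def acyclicKLF : ObjectProperty (CochainComplex (ModuleCat.{u} A) ℤ) := fun K =>
  K.Acyclic ∧ ∃ h : termwise (IsProj A) K,
    isKLF R A ⟨(HomotopyCategory.quotient _ _).obj K, h⟩

/-- The canonical functor from the acyclic complexes of projectives in `K^lf(Proj A, R)`
to `K^lf(Proj A, R)`. -/
def acyclicToKLF : (acyclicKLF R A).FullSubcategory ⥤ KLF R A :=
  ObjectProperty.lift _
    (ObjectProperty.lift _ ((acyclicKLF R A).ι ⋙ HomotopyCategory.quotient _ _)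
      fun K => K.property.2.choose)
    fun K => K.property.2.choose_spec

/-- The functor that sends a complex `X` to `Coker (X^{-1} ⟶ X^0)`, considered as an object of the
category of all `A`-modules modulo projectives. -/
def cokernelFunctor :
    (acyclicKLF R A).FullSubcategory ⥤ StableCat (⊤ : ObjectProperty (ModuleCat.{u} A)) :=
  ObjectProperty.lift _ ((acyclicKLF R A).ι ⋙
    HomologicalComplex.opcyclesFunctor _ (ComplexShape.up ℤ) 0) (fun _ => trivial) ⋙ toStable _

variable [HasDerivedCategory.{w} (ModuleCat.{u} A)]

/-- The canonical functor `K^lf(Proj A, R) ⥤ D(Mod A)`. -/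
def canonicalFunctor : KLF R A ⥤ DerivedCategory (ModuleCat.{u} A) :=
  (isKLF R A).ι ⋙ (KTerm (IsProj A)).ι ⋙ DerivedCategory.Qh

/-- The canonical functor `D^b(mod(A, R)) ⥤ D(Mod A)`. -/
abbrev Dbmod.toDerived : Dbmod R A ⥤ DerivedCategory (ModuleCat.{u} A) :=
  DBounded.toDerived (ModFinProj R A)

/-- The perfect complexes `D^perf(A)` as a subcategory of `D^b(mod(A, R))`. -/
abbrev perfDbmod : ObjectProperty (Dbmod R A) :=
  (IsPerfect A).inverseImage (Dbmod.toDerived.{w} R A)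

/-- The Verdier quotient `D^b(mod(A, R)) / D^perf(A)`. -/
abbrev DbmodModPerf := (perfDbmod.{w} R A).trW.Localization

set_option synthInstance.maxSize 1000 in
instance : TriangleStructure (DbmodModPerf.{w} R A) := TriangleStructure.ofPretriangulated _

end Main

end FrobRec

end

/-!
The theorem compares two descriptions of the complexes in `K^lf(Proj A, R)`: up to acyclic
complexes they are objects of the derived category, and the acyclic ones are complete resolutions
of modules in `Mod^lf(A, R)`.

*Complete resolutions.* Over a Frobenius algebra, the projective `A`-modules are the
projective-injective objects of the exact categories `mod(A, R)` and `Mod^lf(A, R)`, so each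
module `M` in one of them is the cokernel of a differential of a totally acyclic complex, one that
stays exact under morphisms into projective modules (`exists_isTotallyAcyclic`). Chain maps between
such complexes are determined up to homotopy by the induced morphism of cokernels modulo
projectives (`exists_chain_map`, `nonempty_homotopy_of_stablyEq`). This gives a fully faithful
exact functor from the stable category to complexes up to homotopy. It takes values in
`K^lf(Proj A, R)`: it is exact and preserves coproducts, and the complete resolution of a finitely
generated module is the acyclic part of its brutal truncation, which belongs to `K^{+,b}(proj A)`
(`IsTotallyAcyclic.exists_klf`, `klfImage_resolutionFunctor`). Conversely, the acyclic parts of the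
generators are totally acyclic complexes, so all acyclic objects are obtained
(`resolutions_acyclicPart`), and `acyclicEquivalence` identifies the kernel of `q` with
`StMod^lf(A, R)`.

*The recollement.* Complexes in `K^{+,b}(proj A)` are compact: a morphism into a coproduct only
matters in finitely many degrees, since maps from syzygies that are projective over `R` into
projective modules extend. By a construction with homotopy colimits (`exists_couniversal`), each
object has a universal approximation by the localising subcategory that is generated by a set of
compact objects. For `K^b(proj A)` this provides projective resolutions, hence the left adjoint `p`
of `q`; for `K^{+,b}(proj A)` it provides the right adjoint of `q`. The adjoints of the inclusion of
the kernel are the cone and the fibre of the resulting (co)units.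

*The functor `κ`.* Complexes in `K^{+,b}(proj A)` receive no nonzero morphisms from acyclic objects
(`klfPlusB_le_rightOrthogonal`), so `q` is fully faithful on them
(`bijective_canonicalFunctor_map`). Every bounded complex in `mod(A, R)` is quasi-isomorphic to
such a complex (`exists_isPlusB`), and truncating these resolutions shows that `D^b(mod(A, R))` is
a full subcategory of the derived category (`exists_fraction`). Lifting it along `q` defines
`dbmodToKLF`. A compact object `X` of `K^lf(Proj A, R)` is a direct summand of a complex in
`K^{+,b}(proj A)`, because morphisms from a compact object factor through the subcategory
generated in finitely many steps (`exists_factor_of_isCompactObject`). Then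
`X ⊞ X⟦N⟧` is itself such a complex for some `N ≪ 0` (`exists_biprod_shift_mem`), and
cutting it between the cohomology of the two summands exhibits `X`
as the image of a bounded complex in `mod(A, R)` (`exists_boundedTermwise_of_isCompactObject`). The
same argument with `proj A` in place of `mod(A, R)` shows that compact objects of the derived
category are perfect.

*The equivalence `G`.* The acyclic part of `κ X` vanishes if and only if `X` is perfect, so it
defines an exact functor on the Verdier quotient that reflects zero objects and hence is faithful
once it is full. It is full as a morphism from a compact object into an object built from
`K^b(proj A)` factors through a perfect complex (`exists_dbmodToAcyclic_fraction`). Its image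
consists of the complete resolutions of modules in `mod(A, R)`, which are the acyclic parts of
their brutal truncations.
-/

noncomputable section

set_option linter.unusedSectionVars false

namespace FrobRec

/-! ### Exact triangles -/

/-- The part of the axioms of a triangulated category that is needed in order to transfer exactness
along fully faithful functors: morphisms can be completed to exact triangles, and exact triangles
are closed under isomorphisms. -/
class HasCones (C : Type u₁) [Category.{v₁} C] [TriangleStructure C] : Prop where
  exists_cone {X Y : C} (f : X ⟶ Y) : ∃ (Z : C) (g : Y ⟶ Z) (h : Z ⟶ TriangleStructure.susp.obj X),
    TriangleStructure.exactTriangle f g h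
  of_iso {X Y Z X' Y' Z' : C} {f : X ⟶ Y} {g : Y ⟶ Z} {h : Z ⟶ TriangleStructure.susp.obj X}
    {f' : X' ⟶ Y'} {g' : Y' ⟶ Z'} {h' : Z' ⟶ TriangleStructure.susp.obj X'}
    (α : X ≅ X') (β : Y ≅ Y') (γ : Z ≅ Z') : f ≫ β.hom = α.hom ≫ f' → g ≫ γ.hom = β.hom ≫ g' →
    h ≫ TriangleStructure.susp.map α.hom = γ.hom ≫ h' →
    TriangleStructure.exactTriangle f g h → TriangleStructure.exactTriangle f' g' h'

instance (C : Type u₁) [Category.{v₁} C] [Preadditive C]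
    [HasZeroObject C] [HasShift C ℤ] [∀ n : ℤ, (shiftFunctor C n).Additive] [Pretriangulated C] :
    HasCones C where
  exists_cone f := distinguished_cocone_triangle f
  of_iso α β γ h₁ h₂ h₃ H :=
    isomorphic_distinguished _ H _ (Triangle.isoMk _ _ α β γ h₁ h₂ h₃).symm

/-! ### Distinguished triangles, unbundled -/

section Unbundled

variable {C : Type u₁} [Category.{v₁} C] [Preadditive C]
    [HasZeroObject C] [HasShift C ℤ] [∀ n : ℤ, (shiftFunctor C n).Additive] [Pretriangulated C]
    {D : Type u₂} [Category.{v₂} D] [Preadditive D]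
    [HasZeroObject D] [HasShift D ℤ] [∀ n : ℤ, (shiftFunctor D n).Additive] [Pretriangulated D]
    {X Y Z : C} {f : X ⟶ Y} {g : Y ⟶ Z} {h : Z ⟶ X⟦(1 : ℤ)⟧}

lemma exists_iso_of_distTriang (H : Triangle.mk f g h ∈ distTriang C) {Z' : C} {g' : Y ⟶ Z'}
    {h' : Z' ⟶ X⟦(1 : ℤ)⟧} (H' : Triangle.mk f g' h' ∈ distTriang C) :
    ∃ e : Z ≅ Z', g ≫ e.hom = g' ∧ e.hom ≫ h' = h := by
  let i := isoTriangleOfIso₁₂ _ _ H H' (Iso.refl _) (Iso.refl _)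
    ((Category.comp_id _).trans (Category.id_comp _).symm)
  have c₂ : g ≫ i.hom.hom₃ = 𝟙 Y ≫ g' := i.hom.comm₂
  have c₃ : h ≫ (shiftFunctor C (1 : ℤ)).map (𝟙 X) = i.hom.hom₃ ≫ h' := i.hom.comm₃
  refine ⟨Triangle.π₃.mapIso i, c₂.trans (Category.id_comp _), c₃.symm.trans ?_⟩
  rw [CategoryTheory.Functor.map_id, Category.comp_id]

lemma map_distTriang (F : C ⥤ D) [F.CommShift ℤ] [F.IsTriangulated]
    (H : Triangle.mk f g h ∈ distTriang C) :
    Triangle.mk (F.map f) (F.map g) (F.map h ≫ (F.commShiftIso (1 : ℤ)).hom.app X) ∈ distTriang D :=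
  F.map_distinguished _ H

lemma exists_lift₂ (H : Triangle.mk f g h ∈ distTriang C) {W : C} (a : W ⟶ Y) (ha : a ≫ g = 0) :
    ∃ b : W ⟶ X, a = b ≫ f := Triangle.coyoneda_exact₂ _ H a ha

lemma exists_lift₃ (H : Triangle.mk f g h ∈ distTriang C) {W : C} (a : W ⟶ Z) (ha : a ≫ h = 0) :
    ∃ b : W ⟶ Y, a = b ≫ g := Triangle.coyoneda_exact₃ _ H a ha

lemma exists_lift₁ (H : Triangle.mk f g h ∈ distTriang C) {W : C} (a : W ⟶ X⟦(1 : ℤ)⟧)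
    (ha : a ≫ f⟦(1 : ℤ)⟧' = 0) : ∃ b : W ⟶ Z, a = b ≫ h := Triangle.coyoneda_exact₁ _ H a ha

lemma exists_desc₂ (H : Triangle.mk f g h ∈ distTriang C) {W : C} (a : Y ⟶ W) (ha : f ≫ a = 0) :
    ∃ b : Z ⟶ W, a = g ≫ b := Triangle.yoneda_exact₂ _ H a ha

lemma exists_desc₃ (H : Triangle.mk f g h ∈ distTriang C) {W : C} (a : Z ⟶ W) (ha : g ≫ a = 0) :
    ∃ b : X⟦(1 : ℤ)⟧ ⟶ W, a = h ≫ b := Triangle.yoneda_exact₃ _ H a ha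

lemma distTriang_comp₁₂ (H : Triangle.mk f g h ∈ distTriang C) : f ≫ g = 0 :=
  comp_distTriang_mor_zero₁₂ _ H

lemma distTriang_comp₂₃ (H : Triangle.mk f g h ∈ distTriang C) : g ≫ h = 0 :=
  comp_distTriang_mor_zero₂₃ _ H

lemma distTriang_comp₃₁ (H : Triangle.mk f g h ∈ distTriang C) : h ≫ f⟦(1 : ℤ)⟧' = 0 :=
  comp_distTriang_mor_zero₃₁ _ H

lemma isIso₁_iff_isZero (H : Triangle.mk f g h ∈ distTriang C) : IsIso f ↔ IsZero Z :=
  (Triangle.isZero₃_iff_isIso₁ _ H).symm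

lemma exists_fill₂ (H : Triangle.mk f g h ∈ distTriang C) {X' Y' Z' : C} {f' : X' ⟶ Y'}
    {g' : Y' ⟶ Z'} {h' : Z' ⟶ X'⟦(1 : ℤ)⟧} (H' : Triangle.mk f' g' h' ∈ distTriang C)
    (a : X ⟶ X') (c : Z ⟶ Z') (hac : h ≫ a⟦(1 : ℤ)⟧' = c ≫ h') :
    ∃ b : Y ⟶ Y', f ≫ b = a ≫ f' ∧ g ≫ c = b ≫ g' :=
  complete_distinguished_triangle_morphism₂ _ _ H H' a c hac

lemma distTriang_of_iso₃ (H : Triangle.mk f g h ∈ distTriang C) {Z' : C} (e : Z ≅ Z') :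
    Triangle.mk f (g ≫ e.hom) (e.inv ≫ h) ∈ distTriang C := by
  refine HasCones.of_iso (Iso.refl _) (Iso.refl _) e ?_ ?_ ?_ H
  · simp
  · simp
  · rw [Iso.hom_inv_id_assoc]
    exact (congrArg _ ((shiftFunctor C (1 : ℤ)).map_id X)).trans (Category.comp_id _)

lemma distTriang_of_iso₃' (H : Triangle.mk f g h ∈ distTriang C) {Z' : C} {g' : Y ⟶ Z'}
    {h' : Z' ⟶ X⟦(1 : ℤ)⟧} (e : Z ≅ Z') (hg : g ≫ e.hom = g') (hh : e.hom ≫ h' = h) :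
    Triangle.mk f g' h' ∈ distTriang C := by
  obtain rfl : h' = e.inv ≫ h := by rw [← hh, Iso.inv_hom_id_assoc]
  rw [← hg]
  exact distTriang_of_iso₃ H e

lemma exists_inv_rot (H : Triangle.mk f g h ∈ distTriang C) :
    ∃ (k : Z⟦(-1 : ℤ)⟧ ⟶ X) (l : Y ⟶ (Z⟦(-1 : ℤ)⟧)⟦(1 : ℤ)⟧), Triangle.mk k f l ∈ distTriang C :=
  ⟨_, _, inv_rot_of_distTriang _ H⟩

lemma exists_biprod_iso {X Y Z : C} {f : X ⟶ Y} {g : Y ⟶ Z}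
    (H : Triangle.mk f g (0 : Z ⟶ X⟦(1 : ℤ)⟧) ∈ distTriang C) :
    ∃ e : Y ≅ X ⊞ Z, f ≫ e.hom = biprod.inl ∧ g = e.hom ≫ biprod.snd :=
  exists_iso_binaryBiproduct_of_distTriang _ H rfl

/-- The adjunction between the shift functors by `n` and `-n`. -/
def shiftAdjunction (C : Type u₁) [Category.{v₁} C] [HasShift C ℤ] (n : ℤ) :
    shiftFunctor C n ⊣ shiftFunctor C (-n) :=
  (shiftEquiv C n).toAdjunction

/-- The adjunction between the shift functors by `-n` and `n`. -/
def shiftAdjunction' (C : Type u₁) [Category.{v₁} C] [HasShift C ℤ] (n : ℤ) :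
    shiftFunctor C (-n) ⊣ shiftFunctor C n :=
  (shiftEquiv C n).symm.toAdjunction

/-- A morphism into a suspension, as the suspension of a morphism. -/
lemma exists_eq_shift_map {X Y : C} (f : X ⟶ Y⟦(1 : ℤ)⟧) :
    ∃ (e : X ≅ (X⟦(-1 : ℤ)⟧)⟦(1 : ℤ)⟧) (f' : X⟦(-1 : ℤ)⟧ ⟶ Y), f = e.hom ≫ f'⟦(1 : ℤ)⟧' := by
  let e : X ≅ (X⟦(-1 : ℤ)⟧)⟦(1 : ℤ)⟧ := (shiftEquiv C (1 : ℤ)).symm.unitIso.app X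
  exact ⟨e, (shiftFunctor C (1 : ℤ)).preimage (e.inv ≫ f), by simp⟩

end Unbundled

/-! ### Exact functors -/

section ExactFunctor

variable {B : Type u₃} [Category.{v₃} B] [TriangleStructure B]
  {C : Type u₁} [Category.{v₁} C] [TriangleStructure C]
  {D : Type u₂} [Category.{v₂} D] [TriangleStructure D]

lemma IsExactFunctor.comp {F : B ⥤ C} {G : C ⥤ D} (hF : IsExactFunctor F)
    (hG : IsExactFunctor G) : IsExactFunctor (F ⋙ G) := by
  obtain ⟨η, hη⟩ := hF
  obtain ⟨θ, hθ⟩ := hG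
  refine ⟨(Functor.associator _ _ _).symm ≪≫ Functor.isoWhiskerRight η G ≪≫
    Functor.associator _ _ _ ≪≫ Functor.isoWhiskerLeft F θ ≪≫ (Functor.associator _ _ _).symm, ?_⟩
  intro X Y Z f g h H
  have := hθ _ _ _ (hη f g h H)
  simpa using this

lemma IsExactFunctor.of_iso [HasCones D] {F G : C ⥤ D} (e : F ≅ G) (hF : IsExactFunctor F) :
    IsExactFunctor G := by
  obtain ⟨η, hη⟩ := hF
  refine ⟨Functor.isoWhiskerLeft _ e.symm ≪≫ η ≪≫ Functor.isoWhiskerRight e _, ?_⟩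
  intro X Y Z f g h H
  refine HasCones.of_iso (e.app X) (e.app Y) (e.app Z) ?_ ?_ ?_ (hη f g h H)
  · simp
  · simp
  · simp

lemma isExactFunctor_of_isTriangulated {C : Type u₁} [Category.{v₁} C] [Preadditive C]
    [HasZeroObject C] [HasShift C ℤ] [∀ n : ℤ, (shiftFunctor C n).Additive] [Pretriangulated C]
    {D : Type u₂} [Category.{v₂} D] [Preadditive D]
    [HasZeroObject D] [HasShift D ℤ] [∀ n : ℤ, (shiftFunctor D n).Additive] [Pretriangulated D]
    (F : C ⥤ D) [F.CommShift ℤ] [F.IsTriangulated] : IsExactFunctor F :=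
  ⟨F.commShiftIso (1 : ℤ), fun _ _ _ H => F.map_distinguished _ H⟩

/-- Exactness can be tested after composition with a fully faithful exact functor. -/
lemma IsExactFunctor.of_comp [HasCones C]
    {D : Type u₂} [Category.{v₂} D] [Preadditive D]
    [HasZeroObject D] [HasShift D ℤ] [∀ n : ℤ, (shiftFunctor D n).Additive] [Pretriangulated D]
    {G : B ⥤ C} {F : C ⥤ D} [F.Full] [F.Faithful] (hF : IsExactFunctor F)
    (hGF : IsExactFunctor (G ⋙ F)) : IsExactFunctor G := by
  obtain ⟨θ, hθ⟩ := hF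
  obtain ⟨η, hη⟩ := hGF
  let e : TriangleStructure.susp ⋙ G ≅ G ⋙ TriangleStructure.susp :=
    NatIso.ofComponents (fun X => F.preimageIso (η.app X ≪≫ (θ.app (G.obj X)).symm)) (by
      intro X Y f
      apply F.map_injective
      have h₁ := η.hom.naturality f
      have h₂ := θ.inv.naturality (G.map f)
      dsimp at h₁ h₂
      simp [reassoc_of% h₁, h₂])
  have he (X : B) : F.map (e.hom.app X) = η.hom.app X ≫ θ.inv.app (G.obj X) := by simp [e]
  refine ⟨e, ?_⟩
  intro X Y Z f g h H
  -- both `F(g', h')` and `FG(g, h)` complete `FG f` to a triangle, and the resulting isomorphism of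
  -- the cones comes from an isomorphism in `C`
  obtain ⟨Z', g', h', H'⟩ := HasCones.exists_cone (G.map f)
  have H₁ : Triangle.mk (F.map (G.map f)) (F.map g') (F.map h' ≫ θ.hom.app _) ∈ distTriang D :=
    hθ _ _ _ H'
  have H₂ : Triangle.mk (F.map (G.map f)) (F.map (G.map g)) (F.map (G.map h) ≫ η.hom.app X) ∈
    distTriang D := hη _ _ _ H
  obtain ⟨i, c₂, c₃⟩ := exists_iso_of_distTriang H₁ H₂
  let γ : Z' ≅ G.obj Z := F.preimageIso i
  have hγ : F.map γ.hom = i.hom := F.map_preimage _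
  refine HasCones.of_iso (Iso.refl _) (Iso.refl _) γ (by simp) ?_ ?_ H'
  · apply F.map_injective
    rw [Functor.map_comp, hγ, c₂, Iso.refl_hom, Category.id_comp]
  · apply F.map_injective
    have := reassoc_of% c₃
    rw [Functor.map_comp, Functor.map_comp, hγ, Functor.map_comp, he, this]
    simp

end ExactFunctor

/-! ### Functors and universal arrows -/

section Adjoint

variable {C : Type u₁} [Category.{v₁} C] {D : Type u₂} [Category.{v₂} D]

lemma isLeftAdjoint_of_bijective (F : C ⥤ D) (h : ∀ Y : D, ∃ (X : C) (ε : F.obj X ⟶ Y),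
    ∀ W : C, Function.Bijective fun k : W ⟶ X => F.map k ≫ ε) : F.IsLeftAdjoint := by
  choose X ε h using h
  exact ⟨_, ⟨Adjunction.adjunctionOfEquivRight (G_obj := X)
    (fun W Y => (Equiv.ofBijective _ (h Y W)).symm) (by
      intro W' W Y f g
      rw [Equiv.symm_apply_eq]
      obtain ⟨g, rfl⟩ := (h Y W).2 g
      have : (Equiv.ofBijective _ (h Y W)).symm (F.map g ≫ ε Y) = g :=
        (Equiv.ofBijective _ (h Y W)).symm_apply_apply g
      rw [this]
      simp)⟩⟩

lemma isRightAdjoint_of_bijective (F : C ⥤ D) (h : ∀ Y : D, ∃ (X : C) (η : Y ⟶ F.obj X),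
    ∀ W : C, Function.Bijective fun k : X ⟶ W => η ≫ F.map k) : F.IsRightAdjoint := by
  choose X η h using h
  exact ⟨_, ⟨Adjunction.adjunctionOfEquivLeft (F_obj := X)
    (fun Y W => Equiv.ofBijective _ (h Y W)) (by
      intro Y W W' f g
      simp)⟩⟩

end Adjoint

section Triangulated

variable {C : Type u₁} [Category.{v₁} C] [Preadditive C]
    [HasZeroObject C] [HasShift C ℤ] [∀ n : ℤ, (shiftFunctor C n).Additive] [Pretriangulated C]
    {D : Type u₂} [Category.{v₂} D] [Preadditive D]
    [HasZeroObject D] [HasShift D ℤ] [∀ n : ℤ, (shiftFunctor D n).Additive] [Pretriangulated D]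

lemma reflectsIsomorphisms_of_isZero (F : C ⥤ D) [F.CommShift ℤ] [F.IsTriangulated]
    (h : ∀ X, IsZero (F.obj X) → IsZero X) : F.ReflectsIsomorphisms where
  reflects {X Y} f hf := by
    obtain ⟨Z, g, k, H⟩ := distinguished_cocone_triangle f
    exact (isIso₁_iff_isZero H).2 (h _ ((isIso₁_iff_isZero (map_distTriang F H)).1 hf))

/-- A full exact functor is faithful if it reflects zero objects. -/
lemma faithful_of_isZero (F : C ⥤ D) [F.CommShift ℤ] [F.IsTriangulated] [F.Full]
    (h : ∀ X, IsZero (F.obj X) → IsZero X) : F.Faithful := by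
  have := reflectsIsomorphisms_of_isZero F h
  have key : ∀ {X Y : C} (f : X ⟶ Y), F.map f = 0 → f = 0 := by
    intro X Y f hf
    obtain ⟨Z, g, k, H⟩ := distinguished_cocone_triangle f
    -- `F f = 0` splits the connecting morphism `F k`; by fullness and reflection of isomorphisms,
    -- `k` itself is a split epimorphism, and hence `f⟦1⟧ = 0`
    obtain ⟨s, hs⟩ := exists_lift₁ (map_distTriang F H) ((F.commShiftIso (1 : ℤ)).hom.app X)
      (by rw [hf, Functor.map_zero, comp_zero])
    have hs' : F.map (F.preimage s ≫ k) = 𝟙 _ := by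
      rw [← cancel_mono ((F.commShiftIso (1 : ℤ)).hom.app X), Functor.map_comp, F.map_preimage,
        Category.assoc, ← hs]
      exact (Category.id_comp _).symm
    have : IsIso (F.map (F.preimage s ≫ k)) := by rw [hs']; infer_instance
    have := isIso_of_reflects_iso (F.preimage s ≫ k) F
    have h₀ : k ≫ (shiftFunctor C (1 : ℤ)).map f = 0 := comp_distTriang_mor_zero₃₁ _ H
    have h₁ : (F.preimage s ≫ k) ≫ (shiftFunctor C (1 : ℤ)).map f = 0 := by
      rw [Category.assoc, h₀, comp_zero]
    rw [Preadditive.IsIso.comp_left_eq_zero] at h₁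
    exact (shiftFunctor C (1 : ℤ)).map_injective (by rw [h₁, Functor.map_zero])
  refine ⟨fun {X Y f g} hfg => ?_⟩
  have := F.additive_of_preserves_binary_products
  exact sub_eq_zero.1 (key _ (by rw [F.map_sub, hfg, sub_self]))

end Triangulated

/-! ### Compact objects -/

section Compact

variable {T : Type u₁} [Category.{v₁} T] [Preadditive T]

/-- The morphisms to a coproduct that factor through a finite subcoproduct. -/
def finiteMaps {J : Type u} {Y : J → T} (c : Cofan Y) (X : T) : AddSubgroup (X ⟶ c.pt) where
  carrier := {f | ∃ (s : Finset J) (g : ∀ j, X ⟶ Y j), f = ∑ j ∈ s, g j ≫ c.inj j}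
  zero_mem' := ⟨∅, 0, by simp⟩
  add_mem' := by
    classical
    rintro _ _ ⟨s, g, rfl⟩ ⟨t, h, rfl⟩
    refine ⟨s ∪ t, fun j => (if j ∈ s then g j else 0) + if j ∈ t then h j else 0, ?_⟩
    simp only [Preadditive.add_comp, Finset.sum_add_distrib]
    congr 1
    · rw [← Finset.sum_subset (Finset.subset_union_left (s₂ := t))]
      · exact Finset.sum_congr rfl fun j hj => by rw [if_pos hj]
      · intro j _ hj
        rw [if_neg hj, zero_comp]
    · rw [← Finset.sum_subset (Finset.subset_union_right (s₁ := s))]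
      · exact Finset.sum_congr rfl fun j hj => by rw [if_pos hj]
      · intro j _ hj
        rw [if_neg hj, zero_comp]
  neg_mem' := by
    rintro _ ⟨s, g, rfl⟩
    exact ⟨s, fun j => - g j, by simp⟩

lemma finiteMaps_le {J : Type u} {Y : J → T} {c : Cofan Y} {X : T} (H : AddSubgroup (X ⟶ c.pt))
    (h : ∀ j (g : X ⟶ Y j), g ≫ c.inj j ∈ H) : finiteMaps c X ≤ H := by
  rintro _ ⟨s, g, rfl⟩
  exact sum_mem fun j _ => h j (g j)

lemma comp_mem_finiteMaps {J : Type u} {Y : J → T} {c : Cofan Y} {X X' : T} (a : X' ⟶ X)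
    {f : X ⟶ c.pt} (hf : f ∈ finiteMaps c X) : a ≫ f ∈ finiteMaps c X' := by
  obtain ⟨s, g, rfl⟩ := hf
  exact ⟨s, fun j => a ≫ g j, by simp [Preadditive.comp_sum]⟩

/-- The projections of a coproduct. -/
lemma exists_projections {J : Type u} {Y : J → T} {c : Cofan Y} (hc : IsColimit c) :
    ∃ π : ∀ j, c.pt ⟶ Y j, (∀ j, c.inj j ≫ π j = 𝟙 _) ∧ ∀ i j, i ≠ j → c.inj i ≫ π j = 0 := by
  classical
  refine ⟨fun j => Cofan.IsColimit.desc hc fun i => if h : i = j then eqToHom (by rw [h]) else 0,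
    ?_, ?_⟩
  · intro j
    rw [Cofan.IsColimit.fac]
    simp
  · intro i j h
    rw [Cofan.IsColimit.fac]
    simp [h]

lemma eq_zero_of_mem_finiteMaps {J : Type u} {Y : J → T} {c : Cofan Y} {X : T} {f : X ⟶ c.pt}
    (hf : f ∈ finiteMaps c X) {π : ∀ j, c.pt ⟶ Y j} (h₁ : ∀ j, c.inj j ≫ π j = 𝟙 _)
    (h₂ : ∀ i j, i ≠ j → c.inj i ≫ π j = 0) (h : ∀ j, f ≫ π j = 0) : f = 0 := by
  obtain ⟨s, g, rfl⟩ := hf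
  refine Finset.sum_eq_zero fun j hj => ?_
  have := h j
  rw [Preadditive.sum_comp, Finset.sum_eq_single j] at this
  · rw [Category.assoc, h₁, Category.comp_id] at this
    rw [this, zero_comp]
  · intro i _ hij
    rw [Category.assoc, h₂ i j hij, comp_zero]
  · exact fun h => (h hj).elim

lemma IsCompactObject.of_retract {X X' : T} (h : IsCompactObject.{u} X) (i : X' ⟶ X) (r : X ⟶ X')
    (hir : i ≫ r = 𝟙 _) : IsCompactObject.{u} X' := by
  intro J Y c hc f
  have := comp_mem_finiteMaps i (h J Y c hc (r ≫ f))
  rwa [reassoc_of% hir] at this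

lemma IsCompactObject.of_iso {X X' : T} (h : IsCompactObject.{u} X) (e : X ≅ X') :
    IsCompactObject.{u} X' := h.of_retract e.inv e.hom e.inv_hom_id

/-- A left adjoint preserves compactness if its right adjoint preserves coproducts. -/
lemma IsCompactObject.map_of_adjunction {T' : Type u₂} [Category.{v₂} T'] [Preadditive T']
    {F : T ⥤ T'} {G : T' ⥤ T} (adj : F ⊣ G) [F.Additive]
    [∀ J : Type u, PreservesColimitsOfShape (Discrete J) G] {X : T} (h : IsCompactObject.{u} X) :
    IsCompactObject.{u} (F.obj X) := by
  intro J Y c hc f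
  have hc' : IsColimit (Cofan.mk _ fun j => G.map (c.inj j)) :=
    isColimitCofanMkObjOfIsColimit G Y c.inj
      (IsColimit.ofIsoColimit hc (Cofan.ext (Iso.refl _) (by simp)))
  obtain ⟨s, g, hg⟩ := h J _ _ hc' (adj.homEquiv _ _ f)
  refine ⟨s, fun j => (adj.homEquiv _ _).symm (g j), ?_⟩
  rw [← (adj.homEquiv _ _).symm_apply_apply f, hg, Adjunction.homEquiv_counit, Functor.map_sum,
    Preadditive.sum_comp]
  refine Finset.sum_congr rfl fun j _ => ?_
  rw [← adj.homEquiv_naturality_right_symm, Adjunction.homEquiv_counit]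
  rfl

section

variable [HasZeroObject T] [HasShift T ℤ]
  [∀ n : ℤ, (shiftFunctor T n).Additive] [Pretriangulated T]

lemma IsCompactObject.shift {X : T} (h : IsCompactObject.{u} X) (n : ℤ) :
    IsCompactObject.{u} (X⟦n⟧) :=
  h.map_of_adjunction (shiftAdjunction T n)

/-- The cone of a morphism between compact objects is compact. -/
lemma IsCompactObject.cone {X Y Z : T} {f : X ⟶ Y} {g : Y ⟶ Z} {h : Z ⟶ X⟦(1 : ℤ)⟧}
    (H : Triangle.mk f g h ∈ distTriang T) (hX : IsCompactObject.{u} X)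
    (hY : IsCompactObject.{u} Y) : IsCompactObject.{u} Z := by
  intro J W c hc φ
  change φ ∈ finiteMaps c Z
  obtain ⟨π, h₁, h₂⟩ := exists_projections hc
  obtain ⟨s, a, ha⟩ := hY J W c hc (g ≫ φ)
  have ha' : ∀ j ∈ s, a j = g ≫ φ ≫ π j := by
    intro j hj
    rw [← Category.assoc, ha, Preadditive.sum_comp, Finset.sum_eq_single j]
    · rw [Category.assoc, h₁, Category.comp_id]
    · intro i _ hij
      rw [Category.assoc, h₂ i j hij, comp_zero]
    · exact fun h => (h hj).elim
  -- after subtraction of finitely many components, `φ` vanishes on `Y` and factors through `X⟦1⟧`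
  obtain ⟨b, hb⟩ := exists_desc₃ H (φ - ∑ j ∈ s, (φ ≫ π j) ≫ c.inj j) (by
    rw [Preadditive.comp_sub, ha, Preadditive.comp_sum, sub_eq_zero]
    exact Finset.sum_congr rfl fun j hj => by rw [ha' j hj]; simp)
  rw [sub_eq_iff_eq_add] at hb
  rw [hb]
  refine add_mem ?_ ⟨s, _, rfl⟩
  exact comp_mem_finiteMaps h (hX.shift 1 J W c hc b)

/-- Every morphism from a compact object to an object of the localising subcategory generated by a
triangulated subcategory of compact objects factors through an object of this subcategory. -/
lemma exists_factor_of_isCompactObject (S : ObjectProperty T) [S.IsTriangulated]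
    (hS : ∀ X, S X → IsCompactObject.{u} X) {Y : T} (hY : Localising.{u} S Y) :
    ∀ {X : T}, IsCompactObject.{u} X → ∀ f : X ⟶ Y,
      ∃ (C : T) (_ : S C) (a : X ⟶ C) (b : C ⟶ Y), f = a ≫ b := by
  -- isomorphic copies of objects of `S` are allowed in the induction
  suffices H : ∀ {X : T}, IsCompactObject.{u} X → ∀ f : X ⟶ Y,
      ∃ (C : T) (_ : S.isoClosure C) (a : X ⟶ C) (b : C ⟶ Y), f = a ≫ b by
    intro X hX f
    obtain ⟨C, ⟨C', hC', ⟨e⟩⟩, a, b, rfl⟩ := H hX f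
    exact ⟨C', hC', a ≫ e.hom, e.inv ≫ b, by simp⟩
  have hS' : ∀ X, S.isoClosure X → IsCompactObject.{u} X := by
    rintro X ⟨X', hX', ⟨e⟩⟩
    exact (hS _ hX').of_iso e.symm
  have biprod_mem : ∀ X Y, S.isoClosure X → S.isoClosure Y → S.isoClosure (X ⊞ Y) :=
    fun X Y hX hY => S.isoClosure.ext_of_isTriangulatedClosed₂ _
      (binaryBiproductTriangle_distinguished X Y) hX hY
  induction hY with
  | of Y hY => exact fun _ f => ⟨Y, S.le_isoClosure _ hY, f, 𝟙 _, by simp⟩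
  | zero Y hY => exact fun _ f => ⟨0, S.isoClosure.prop_zero, 0, 0, hY.eq_of_tgt _ _⟩
  | shift Y n _ ih =>
    intro X hX f
    obtain ⟨C, hC, a, b, hab⟩ := ih (hX.shift (-n))
      (((shiftAdjunction' T n).homEquiv X Y).symm f)
    refine ⟨C⟦n⟧, S.isoClosure.le_shift n _ hC,
      (shiftAdjunction' T n).homEquiv _ _ a, b⟦n⟧', ?_⟩
    rw [Equiv.symm_apply_eq] at hab
    rw [hab]
    exact Adjunction.homEquiv_naturality_right _ _ _
  | ext₂ D hD _ _ ih₁ ih₃ =>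
    intro X hX f
    obtain ⟨Y', Y, Y'', i, p, δ⟩ := D
    dsimp at ih₁ ih₃ f
    -- `f ≫ p` factors through some `C''`. The obstruction against lifting `b''` along `p` vanishes
    -- on `X`, so it is a morphism from the compact object `W⟦-1⟧` to `Y'`, which factors through
    -- some `C'`. The extension `C` of `C''` by `C'` maps to `Y`, and `a''` lifts to `C`; the
    -- difference between `f` and the resulting morphism comes from a morphism `X ⟶ Y'`.
    obtain ⟨C'', hC'', a'', b'', h''⟩ := ih₃ hX (f ≫ p)
    obtain ⟨W, v, w, HW⟩ := distinguished_cocone_triangle a''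
    obtain ⟨t, ht⟩ := exists_desc₂ HW (b'' ≫ δ) (by
      rw [← Category.assoc, ← h'', Category.assoc, distTriang_comp₂₃ hD, comp_zero])
    have hW : IsCompactObject.{u} W := IsCompactObject.cone HW hX (hS' _ hC'')
    obtain ⟨e, t', rfl⟩ := exists_eq_shift_map t
    obtain ⟨C', hC', s, r, rfl⟩ := ih₁ (hW.shift (-1)) t'
    obtain ⟨C, i', p', HC⟩ := distinguished_cocone_triangle₂ (v ≫ e.hom ≫ s⟦(1 : ℤ)⟧')
    have hC : S.isoClosure C := S.isoClosure.ext_of_isTriangulatedClosed₂ _ HC hC' hC''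
    obtain ⟨m, hm₁, hm₂⟩ := exists_fill₂ HC hD r b'' (by
      rw [ht]
      simp)
    obtain ⟨ã, hã⟩ := exists_lift₃ HC a'' (by
      rw [← Category.assoc, distTriang_comp₁₂ HW, zero_comp])
    obtain ⟨g, hg⟩ := exists_lift₂ hD (f - ã ≫ m) (by
      rw [Preadditive.sub_comp, h'', Category.assoc, ← hm₂, hã, Category.assoc, sub_self])
    obtain ⟨C₂, hC₂, a₂, b₂, rfl⟩ := ih₁ hX g
    refine ⟨C ⊞ C₂, biprod_mem _ _ hC hC₂, biprod.lift ã a₂, biprod.desc m (b₂ ≫ i), ?_⟩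
    rw [biprod.lift_desc, ← Category.assoc, ← hg]
    simp
  | coprod J Y c hc _ ih =>
    intro X hX f
    let H : AddSubgroup (X ⟶ c.pt) :=
      { carrier := {f | ∃ (C : T) (_ : S.isoClosure C) (a : X ⟶ C) (b : C ⟶ c.pt), f = a ≫ b}
        zero_mem' := ⟨0, S.isoClosure.prop_zero, 0, 0, by simp⟩
        add_mem' := by
          rintro _ _ ⟨C, hC, a, b, rfl⟩ ⟨C', hC', a', b', rfl⟩
          exact ⟨C ⊞ C', biprod_mem _ _ hC hC', biprod.lift a a', biprod.desc b b', by simp⟩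
        neg_mem' := by
          rintro _ ⟨C, hC, a, b, rfl⟩
          exact ⟨C, hC, -a, b, by simp⟩ }
    refine finiteMaps_le (c := c) H ?_ (hX J Y c hc f)
    intro j g
    obtain ⟨C, hC, a, b, rfl⟩ := ih j hX g
    exact ⟨C, hC, a, b ≫ c.inj j, by simp⟩

end

end Compact

/-! ### Direct summands of objects of a triangulated subcategory -/

section Retract

variable {C : Type u₁} [Category.{v₁} C] [Preadditive C]
    [HasZeroObject C] [HasShift C ℤ] [∀ n : ℤ, (shiftFunctor C n).Additive] [Pretriangulated C]
    [IsTriangulated C]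

lemma exists_cone_splitEpi_splitMono {U S V S' W : C} {a : U ⟶ S} {b : S ⟶ V} {c : V ⟶ S'}
    {d : S' ⟶ W} (H₁ : Triangle.mk a b (0 : V ⟶ U⟦(1 : ℤ)⟧) ∈ distTriang C)
    (H₂ : Triangle.mk c d (0 : W ⟶ V⟦(1 : ℤ)⟧) ∈ distTriang C) :
    ∃ (g : S' ⟶ (U⟦(1 : ℤ)⟧) ⊞ W) (h : (U⟦(1 : ℤ)⟧) ⊞ W ⟶ S⟦(1 : ℤ)⟧),
      Triangle.mk (b ≫ c) g h ∈ distTriang C := by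
  have H₁' : Triangle.mk b (0 : V ⟶ U⟦(1 : ℤ)⟧) (-a⟦(1 : ℤ)⟧') ∈ distTriang C :=
    rot_of_distTriang _ H₁
  obtain ⟨Z, v, w, H⟩ := distinguished_cocone_triangle (b ≫ c)
  have o := Triangulated.someOctahedron rfl H₁' H₂ H
  have hm : Triangle.mk o.m₁ o.m₃ ((0 : W ⟶ V⟦(1 : ℤ)⟧) ≫ (0 : V ⟶ U⟦(1 : ℤ)⟧)⟦(1 : ℤ)⟧') ∈
    distTriang C := o.mem
  rw [zero_comp] at hm
  obtain ⟨e, -, -⟩ := exists_biprod_iso hm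
  exact ⟨_, _, distTriang_of_iso₃ H e⟩

variable (S : ObjectProperty C) [S.IsTriangulated] [S.IsClosedUnderIsomorphisms]

lemma biprod_shift_mem {U V W : C} (h : S (U ⊞ V)) (h' : S (V ⊞ W)) : S (U ⊞ (W⟦(-1 : ℤ)⟧)) := by
  obtain ⟨g, k, H⟩ := exists_cone_splitEpi_splitMono (binaryBiproductTriangle_distinguished U V)
    (binaryBiproductTriangle_distinguished V W)
  have h₁ : S ((U⟦(1 : ℤ)⟧) ⊞ W) := S.ext_of_isTriangulatedClosed₃ _ H h h'
  have := preservesBinaryBiproducts_of_preservesBiproducts (shiftFunctor C (-1 : ℤ))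
  refine S.prop_of_iso ((shiftFunctor C (-1 : ℤ)).mapBiprod (U⟦(1 : ℤ)⟧) W ≪≫
    biprod.mapIso ?_ (Iso.refl _)) (S.le_shift (-1) _ h₁)
  exact (shiftFunctorCompIsoId C (1 : ℤ) (-1) (by simp)).app U

lemma biprod_self_shift_mem {X K : C} (hK : S K) (i : X ⟶ K) (r : K ⟶ X) (hir : i ≫ r = 𝟙 X) :
    S (X ⊞ (X⟦(-1 : ℤ)⟧)) := by
  obtain ⟨V, d, δ, H⟩ := distinguished_cocone_triangle i
  have hδ : δ = 0 := by
    have h := distTriang_comp₃₁ H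
    rw [← Category.comp_id δ, ← CategoryTheory.Functor.map_id, ← hir, Functor.map_comp,
      ← Category.assoc, h, zero_comp]
  subst hδ
  obtain ⟨e, -, -⟩ := exists_biprod_iso H
  have h₁ : S (X ⊞ V) := S.prop_of_iso e hK
  exact biprod_shift_mem S h₁ (S.prop_of_iso (biprod.braiding X V) h₁)

/-- A direct summand `X` of an object of a triangulated subcategory becomes an object of this
subcategory after adding a shift of `X`, and this shift can be far away. -/
lemma exists_biprod_shift_mem {X K : C} (hK : S K) (i : X ⟶ K) (r : K ⟶ X) (hir : i ≫ r = 𝟙 X)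
    (k : ℕ) : ∃ N : ℤ, N ≤ -k ∧ S (X ⊞ (X⟦N⟧)) := by
  have h₁ := biprod_self_shift_mem S hK i r hir
  induction k with
  | zero => exact ⟨-1, by simp, h₁⟩
  | succ k ih =>
    obtain ⟨N, hN, h⟩ := ih
    refine ⟨N + (-1) + (-1), by push_cast; omega, ?_⟩
    have h₂ := biprod_self_shift_mem S (S.le_shift N _ hK) (i⟦N⟧') (r⟦N⟧')
      (by rw [← Functor.map_comp, hir, CategoryTheory.Functor.map_id])
    refine S.prop_of_iso (biprod.mapIso (Iso.refl _) ?_) (biprod_shift_mem S h h₂)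
    exact ((shiftFunctorAdd C (N + (-1)) (-1)).app X ≪≫
      (shiftFunctor C (-1 : ℤ)).mapIso ((shiftFunctorAdd C N (-1)).app X)).symm

end Retract

/-! ### Approximation by objects of a localising subcategory -/

section Brown

variable {T : Type u₁} [Category.{u} T] [Preadditive T]
    [HasZeroObject T] [HasShift T ℤ] [∀ n : ℤ, (shiftFunctor T n).Additive] [Pretriangulated T]
    {D : Type u₂} [Category.{v₂} D] [Preadditive D]
    [HasZeroObject D] [HasShift D ℤ] [∀ n : ℤ, (shiftFunctor D n).Additive] [Pretriangulated D]
    (F : T ⥤ D) [F.CommShift ℤ] [F.IsTriangulated]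

/-- The morphism `ε` is couniversal with respect to morphisms from `W`. -/
def IsCouniversalFor {X : T} {Y : D} (ε : F.obj X ⟶ Y) : ObjectProperty T :=
  fun W => Function.Bijective fun k : W ⟶ X => F.map k ≫ ε

variable {F} in
lemma IsCouniversalFor.of_iso {X : T} {Y : D} {ε : F.obj X ⟶ Y} {W W' : T} (e : W ≅ W')
    (h : IsCouniversalFor F ε W) : IsCouniversalFor F ε W' := by
  have : (fun k : W' ⟶ X => F.map k ≫ ε) = (fun k => F.map e.inv ≫ k) ∘
      (fun k : W ⟶ X => F.map k ≫ ε) ∘ fun k => e.hom ≫ k := by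
    funext k
    simp only [Function.comp_apply]
    rw [← Functor.map_comp_assoc, Iso.inv_hom_id_assoc]
  unfold IsCouniversalFor
  rw [this]
  exact (F.mapIso e.symm).homFromEquiv.symm.bijective.comp (h.comp e.homFromEquiv.symm.bijective)

/-- The objects `W` for which `ε` is couniversal are closed under extensions, by the five lemma. -/
lemma IsCouniversalFor.ext {X : T} {Y : D} {ε : F.obj X ⟶ Y} {W₁ W₂ W₃ : T} {f : W₁ ⟶ W₂}
    {g : W₂ ⟶ W₃} {δ : W₃ ⟶ W₁⟦(1 : ℤ)⟧} (H : Triangle.mk f g δ ∈ distTriang T)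
    (h₁ : IsCouniversalFor F ε W₁) (h₃ : IsCouniversalFor F ε W₃)
    (h₁' : IsCouniversalFor F ε (W₁⟦(1 : ℤ)⟧)) (h₃' : IsCouniversalFor F ε (W₃⟦(-1 : ℤ)⟧)) :
    IsCouniversalFor F ε W₂ := by
  have := F.additive_of_preserves_binary_products
  have H' : Triangle.mk (F.map f) (F.map g) (F.map δ ≫ (F.commShiftIso (1 : ℤ)).hom.app W₁) ∈
    distTriang D := map_distTriang F H
  constructor
  · intro a b hab
    rw [← sub_eq_zero]
    have hc : F.map (a - b) ≫ ε = 0 := by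
      dsimp at hab
      rw [Functor.map_sub, Preadditive.sub_comp, hab, sub_self]
    generalize a - b = c at hc ⊢
    have hfc : f ≫ c = 0 := h₁.1 (by simp [hc])
    obtain ⟨d, rfl⟩ := exists_desc₂ H c hfc
    rw [Functor.map_comp, Category.assoc] at hc
    obtain ⟨e, he⟩ := exists_desc₃ H' (F.map d ≫ ε) hc
    obtain ⟨e', he'⟩ := h₁'.2 ((F.commShiftIso (1 : ℤ)).hom.app W₁ ≫ e)
    dsimp at he'
    have : d = δ ≫ e' := h₃.1 (by
      dsimp
      rw [he, Functor.map_comp, Category.assoc, Category.assoc, he'])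
    rw [this, ← Category.assoc, distTriang_comp₂₃ H, zero_comp]
  · intro y
    obtain ⟨a, ha⟩ := h₁.2 (F.map f ≫ y)
    dsimp at ha
    obtain ⟨k, l, H₀⟩ := exists_inv_rot H
    have hk : F.map k ≫ F.map f = 0 := distTriang_comp₁₂ (map_distTriang F H₀)
    obtain ⟨b, rfl⟩ := exists_desc₂ H₀ a (h₃'.1 (by
      dsimp
      rw [Functor.map_comp, Category.assoc, ha, reassoc_of% hk, zero_comp, Functor.map_zero,
        zero_comp]))
    obtain ⟨c, hc⟩ := exists_desc₂ H' (y - F.map b ≫ ε) (by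
      rw [Preadditive.comp_sub, ← ha, Functor.map_comp, Category.assoc, sub_self])
    obtain ⟨d, hd⟩ := h₃.2 c
    refine ⟨b + g ≫ d, ?_⟩
    dsimp at hd ⊢
    rw [Functor.map_add, Preadditive.add_comp, Functor.map_comp, Category.assoc, hd, ← hc]
    simp

lemma IsCouniversalFor.coprod [∀ J : Type u, PreservesColimitsOfShape (Discrete J) F]
    {X : T} {Y : D} {ε : F.obj X ⟶ Y} {J : Type u} {W : J → T} {c : Cofan W} (hc : IsColimit c)
    (h : ∀ j, IsCouniversalFor F ε (W j)) : IsCouniversalFor F ε c.pt := by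
  have hc' : IsColimit (Cofan.mk _ fun j => F.map (c.inj j)) :=
    isColimitCofanMkObjOfIsColimit F W c.inj
      (IsColimit.ofIsoColimit hc (Cofan.ext (Iso.refl _) (by simp)))
  constructor
  · intro a b hab
    refine Cofan.IsColimit.hom_ext hc _ _ fun j => (h j).1 ?_
    dsimp at hab ⊢
    simp [hab]
  · intro y
    choose k hk using fun j => (h j).2 (F.map (c.inj j) ≫ y)
    refine ⟨Cofan.IsColimit.desc hc k, Cofan.IsColimit.hom_ext hc' _ _ fun j => ?_⟩
    refine Eq.trans ?_ (hk j)
    change F.map (c.inj j) ≫ F.map _ ≫ ε = F.map _ ≫ ε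
    rw [← Functor.map_comp_assoc, Cofan.IsColimit.fac]

/-- A morphism that is couniversal with respect to the objects of `S` is couniversal with
respect to all objects of the localising subcategory generated by `S`. -/
lemma isCouniversalFor_of_localising [∀ J : Type u, PreservesColimitsOfShape (Discrete J) F]
    (S : ObjectProperty T) [S.IsStableUnderShift ℤ]
    {X : T} {Y : D} {ε : F.obj X ⟶ Y} (h : ∀ W, S W → IsCouniversalFor F ε W) {W : T}
    (hW : Localising.{u} S W) : IsCouniversalFor F ε W := by
  suffices ∀ n : ℤ, IsCouniversalFor F ε (W⟦n⟧) from
    (this 0).of_iso ((shiftFunctorZero T ℤ).app W)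
  induction hW with
  | of W hW => exact fun n => h _ (S.le_shift n _ hW)
  | zero W hW =>
    intro n
    have h₁ : IsZero (W⟦n⟧) := Functor.map_isZero _ hW
    have h₂ : IsZero (F.obj (W⟦n⟧)) := Functor.map_isZero _ h₁
    exact ⟨fun _ _ _ => h₁.eq_of_src _ _, fun _ => ⟨0, h₂.eq_of_src _ _⟩⟩
  | shift W m _ ih =>
    exact fun n => (ih (m + n)).of_iso ((shiftFunctorAdd T m n).app W)
  | ext₂ D hD _ _ ih₁ ih₃ =>
    intro n
    exact IsCouniversalFor.ext F (Triangle.shift_distinguished _ hD n) (ih₁ n) (ih₃ n)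
      ((ih₁ (n + 1)).of_iso ((shiftFunctorAdd T n 1).app _))
      ((ih₃ (n + (-1))).of_iso ((shiftFunctorAdd T n (-1)).app _))
  | coprod J W c hc _ ih =>
    intro n
    exact IsCouniversalFor.coprod F (isColimitCofanMkObjOfIsColimit (shiftFunctor T n) W c.inj
      (IsColimit.ofIsoColimit hc (Cofan.ext (Iso.refl _) (by simp)))) fun j => ih j n

end Brown

section Telescope

variable {T : Type u₁} [Category.{v₁} T] [Preadditive T]
    [HasZeroObject T] [HasShift T ℤ] [∀ n : ℤ, (shiftFunctor T n).Additive] [Pretriangulated T]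
    {X : ℕ → T} (f : ∀ n, X n ⟶ X (n + 1)) {c : Cofan fun n : ULift.{u} ℕ => X n.down}
    (hc : IsColimit c)

/-- The endomorphism "identity minus shift" of the coproduct of the terms of a sequence. Its cone
is the homotopy colimit of the sequence. -/
def oneSubShift : c.pt ⟶ c.pt :=
  𝟙 _ - Cofan.IsColimit.desc hc fun n => f n.down ≫ c.inj ⟨n.down + 1⟩

lemma inj_oneSubShift (n : ℕ) :
    c.inj ⟨n⟩ ≫ oneSubShift f hc = c.inj ⟨n⟩ - f n ≫ c.inj ⟨n + 1⟩ := by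
  rw [oneSubShift, Preadditive.comp_sub, Category.comp_id, Cofan.IsColimit.fac]

/-- "Identity minus shift" is a monomorphism as seen by compact objects: the components of `g`
vanish by induction. -/
lemma eq_zero_of_comp_oneSubShift {W : T} (hW : IsCompactObject.{u} W) (g : W ⟶ c.pt)
    (hg : g ≫ oneSubShift f hc = 0) : g = 0 := by
  obtain ⟨π, h₁, h₂⟩ := exists_projections hc
  refine eq_zero_of_mem_finiteMaps (hW _ _ c hc g) h₁ h₂ ?_
  have h₀ : oneSubShift f hc ≫ π ⟨0⟩ = π ⟨0⟩ := by
    refine Cofan.IsColimit.hom_ext hc _ _ fun n => ?_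
    rw [← Category.assoc, inj_oneSubShift, Preadditive.sub_comp, Category.assoc, h₂ ⟨_ + 1⟩ ⟨0⟩,
      comp_zero, sub_zero]
    simp
  have hs : ∀ n, oneSubShift f hc ≫ π ⟨n + 1⟩ = π ⟨n + 1⟩ - π ⟨n⟩ ≫ f n := by
    intro n
    refine Cofan.IsColimit.hom_ext hc _ _ fun ⟨m⟩ => ?_
    rw [← Category.assoc, inj_oneSubShift, Preadditive.sub_comp, Category.assoc,
      Preadditive.comp_sub, ← Category.assoc (c.inj _) (π ⟨n⟩)]
    congr 1
    by_cases h : m = n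
    · subst h
      rw [h₁, h₁, Category.comp_id, Category.id_comp]
    · rw [h₂ ⟨m + 1⟩ ⟨n + 1⟩ (by simpa using h), h₂ ⟨m⟩ ⟨n⟩ (by simpa using h), comp_zero,
        zero_comp]
  rintro ⟨n⟩
  induction n with
  | zero => rw [← h₀, ← Category.assoc, hg, zero_comp]
  | succ n ih =>
    have := hs n
    rw [eq_sub_iff_add_eq] at this
    rw [← this, Preadditive.comp_add, ← Category.assoc, hg, ← Category.assoc, ih]
    simp

/-- A morphism from a compact object to a homotopy colimit of a sequence factors through
a term of the sequence. -/
lemma exists_factor_telescope {W Z : T} (hW : IsCompactObject.{u} W) {p : c.pt ⟶ Z}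
    {δ : Z ⟶ c.pt⟦(1 : ℤ)⟧} (H : Triangle.mk (oneSubShift f hc) p δ ∈ distTriang T) (k : W ⟶ Z) :
    ∃ (n : ℕ) (a : W ⟶ X n), k = a ≫ c.inj ⟨n⟩ ≫ p := by
  have hf : ∀ n, f n ≫ c.inj ⟨n + 1⟩ ≫ p = c.inj ⟨n⟩ ≫ p := by
    intro n
    have := congrArg (fun g => c.inj ⟨n⟩ ≫ g) (distTriang_comp₁₂ H)
    dsimp at this
    rw [← Category.assoc, inj_oneSubShift, Preadditive.sub_comp, comp_zero, sub_eq_zero,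
      Category.assoc] at this
    exact this.symm
  -- `k` lifts to the coproduct, since `k ≫ δ` is killed by "identity minus shift"
  have hk : k ≫ δ = 0 := by
    obtain ⟨e, g, hg⟩ := exists_eq_shift_map (k ≫ δ)
    have h₀ : g = 0 := by
      refine eq_zero_of_comp_oneSubShift f hc (hW.shift (-1)) g ?_
      apply (shiftFunctor T (1 : ℤ)).map_injective
      rw [← cancel_epi e.hom, Functor.map_comp, ← Category.assoc, ← hg, Category.assoc,
        distTriang_comp₃₁ H]
      simp
    rw [hg, h₀]
    simp
  obtain ⟨k', rfl⟩ := exists_lift₃ H k hk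
  -- the morphisms that factor through a term form a subgroup since the terms form a sequence
  have mono : ∀ (n m : ℕ) (_ : n ≤ m) (a : W ⟶ X n), ∃ b : W ⟶ X m,
      a ≫ c.inj ⟨n⟩ ≫ p = b ≫ c.inj ⟨m⟩ ≫ p := by
    intro n m hnm a
    induction m, hnm using Nat.le_induction with
    | base => exact ⟨a, rfl⟩
    | succ m _ ih =>
      obtain ⟨b, hb⟩ := ih
      exact ⟨b ≫ f _, by rw [hb, Category.assoc, hf m]⟩
  let G : AddSubgroup (W ⟶ c.pt) :=
    { carrier := {g | ∃ (n : ℕ) (a : W ⟶ X n), g ≫ p = a ≫ c.inj ⟨n⟩ ≫ p}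
      zero_mem' := ⟨0, 0, by simp⟩
      add_mem' := by
        rintro g g' ⟨n, a, h⟩ ⟨n', a', h'⟩
        obtain ⟨b, hb⟩ := mono n (n + n') (by omega) a
        obtain ⟨b', hb'⟩ := mono n' (n + n') (by omega) a'
        exact ⟨_, b + b', by
          rw [Preadditive.add_comp, Preadditive.add_comp, h, h', hb, hb']⟩
      neg_mem' := by
        rintro g ⟨n, a, h⟩
        exact ⟨n, -a, by simp [h]⟩ }
  exact finiteMaps_le (c := c) G (fun j g => ⟨j.down, g, by rw [Category.assoc]⟩)
    (hW _ _ c hc k')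

end Telescope

section Brown

variable {T : Type u₁} [Category.{u} T] [Preadditive T]
    [HasZeroObject T] [HasShift T ℤ] [∀ n : ℤ, (shiftFunctor T n).Additive] [Pretriangulated T]
    {D : Type u₂} [Category.{v₂} D] [Preadditive D]
    [HasZeroObject D] [HasShift D ℤ] [∀ n : ℤ, (shiftFunctor D n).Additive] [Pretriangulated D]
    (F : T ⥤ D) [F.CommShift ℤ] [F.IsTriangulated]

/-- The inductive step: kill all morphisms from the objects `G i` that become zero after
composition with `ε`. -/
lemma exists_kill [HasCoproducts.{u} T]
    [∀ J : Type u, PreservesColimitsOfShape (Discrete J) F] (S : ObjectProperty T)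
    {ι : Type u} (G : ι → T) (hG : ∀ i, S (G i))
    {Y : D} {X : T} (hX : Localising.{u} S X) (ε : F.obj X ⟶ Y) :
    ∃ (X' : T) (_ : Localising.{u} S X') (ε' : F.obj X' ⟶ Y) (f : X ⟶ X'), F.map f ≫ ε' = ε ∧
      ∀ i (k : G i ⟶ X), F.map k ≫ ε = 0 → k ≫ f = 0 := by
  let J := Σ i, { k : G i ⟶ X // F.map k ≫ ε = 0 }
  let s : (∐ fun j : J => G j.1) ⟶ X := Sigma.desc fun j => j.2.1
  have hs : F.map s ≫ ε = 0 := by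
    have hc' : IsColimit (Cofan.mk (F.obj (∐ fun j : J => G j.1))
        fun j => F.map (Sigma.ι (fun j : J => G j.1) j)) :=
      isColimitOfHasCoproductOfPreservesColimit F _
    refine Cofan.IsColimit.hom_ext hc' _ _ fun j => ?_
    change F.map _ ≫ F.map _ ≫ ε = F.map _ ≫ 0
    rw [← Functor.map_comp_assoc, comp_zero, ← j.2.2]
    simp [s]
  obtain ⟨X', f, δ, H⟩ := distinguished_cocone_triangle s
  obtain ⟨ε', hε'⟩ := exists_desc₂ (map_distTriang F H) ε hs
  refine ⟨X', (Localising S).ext_of_isTriangulatedClosed₃ _ H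
    (.coprod J _ _ (coproductIsCoproduct _) fun j => .of _ (hG j.1)) hX, ε', f, hε'.symm, ?_⟩
  intro i k hk
  have : k = Sigma.ι (fun j : J => G j.1) ⟨i, k, hk⟩ ≫ s := by simp [s]
  rw [this, Category.assoc, distTriang_comp₁₂ H, comp_zero]

/-- Let `S` be an essentially small class of compact objects that is stable under shifts. Then
every object has a couniversal morphism from the localising subcategory generated by `S`.
It is obtained as a homotopy colimit: start with a coproduct of objects of `S` that is sufficiently
large for surjectivity, and enforce injectivity step by step. -/
theorem exists_couniversal [HasCoproducts.{u} T]
    [∀ J : Type u, PreservesColimitsOfShape (Discrete J) F] (S : ObjectProperty T)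
    [S.IsStableUnderShift ℤ] {ι : Type u} (G : ι → T) (hG : ∀ i, S (G i))
    (hS : ∀ X, S X → ∃ i, Nonempty (G i ≅ X)) (hc : ∀ X, S X → IsCompactObject.{u} X)
    (Y : D) [∀ i, Small.{u} (F.obj (G i) ⟶ Y)] :
    ∃ (X : T) (_ : Localising.{u} S X) (ε : F.obj X ⟶ Y),
      ∀ W, Localising.{u} S W → IsCouniversalFor F ε W := by
  have := F.additive_of_preserves_binary_products
  let Stage := Σ (X : { X : T // Localising.{u} S X }), (F.obj X.1 ⟶ Y)
  have hnext : ∀ s : Stage, ∃ (s' : Stage) (f : s.1.1 ⟶ s'.1.1), F.map f ≫ s'.2 = s.2 ∧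
      ∀ i (k : G i ⟶ s.1.1), F.map k ≫ s.2 = 0 → k ≫ f = 0 := by
    rintro ⟨⟨X, hX⟩, ε⟩
    obtain ⟨X', hX', ε', f, h⟩ := exists_kill F S G hG hX ε
    exact ⟨⟨⟨X', hX'⟩, ε'⟩, f, h⟩
  choose next f hf₁ hf₂ using hnext
  -- the first stage: one copy of `G i` for each morphism `F (G i) ⟶ Y`
  let J := Σ i, Shrink.{u} (F.obj (G i) ⟶ Y)
  have hc₀ : IsColimit (Cofan.mk (F.obj (∐ fun j : J => G j.1))
      fun j => F.map (Sigma.ι (fun j : J => G j.1) j)) :=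
    isColimitOfHasCoproductOfPreservesColimit F _
  let s₀ : Stage := ⟨⟨∐ fun j : J => G j.1,
    .coprod J _ _ (coproductIsCoproduct _) fun j => .of _ (hG j.1)⟩,
    Cofan.IsColimit.desc hc₀ fun j => (equivShrink _).symm j.2⟩
  let st : ℕ → Stage := fun n => Nat.rec s₀ (fun _ s => next s) n
  let X : ℕ → T := fun n => (st n).1.1
  let φ : ∀ n, X n ⟶ X (n + 1) := fun n => f (st n)
  let c : Cofan fun n : ULift.{u} ℕ => X n.down := Cofan.mk _ (Sigma.ι _)
  have hcc : IsColimit c := coproductIsCoproduct _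
  have hcF : IsColimit (Cofan.mk (F.obj c.pt) fun n => F.map (c.inj n)) :=
    isColimitOfHasCoproductOfPreservesColimit F _
  -- `Z` is the homotopy colimit of the stages
  obtain ⟨Z, p, δ, H⟩ := distinguished_cocone_triangle (oneSubShift φ hcc)
  let ε' : F.obj c.pt ⟶ Y := Cofan.IsColimit.desc hcF fun n => (st n.down).2
  have hε' : ∀ n, F.map (c.inj ⟨n⟩) ≫ ε' = (st n).2 := fun n => Cofan.IsColimit.fac hcF _ ⟨n⟩
  obtain ⟨ε, hε⟩ := exists_desc₂ (map_distTriang F H) ε' (by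
    refine Cofan.IsColimit.hom_ext hcF _ _ fun ⟨n⟩ => ?_
    change F.map _ ≫ F.map _ ≫ ε' = F.map _ ≫ 0
    rw [← Functor.map_comp_assoc, inj_oneSubShift, Functor.map_sub, Preadditive.sub_comp, hε',
      Functor.map_comp, Category.assoc, hε', comp_zero, sub_eq_zero]
    exact (hf₁ (st n)).symm)
  have hp : ∀ n, F.map (c.inj ⟨n⟩ ≫ p) ≫ ε = (st n).2 := fun n => by
    rw [Functor.map_comp, Category.assoc, ← hε, hε']
  have hcl : Localising.{u} S c.pt := .coprod _ _ c hcc fun n => (st n.down).1.2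
  refine ⟨Z, (Localising S).ext_of_isTriangulatedClosed₃ _ H hcl hcl, ε, fun W hW =>
    isCouniversalFor_of_localising F S (fun V hV => ?_) hW⟩
  obtain ⟨i, ⟨e⟩⟩ := hS V hV
  -- injectivity: a morphism from `G i` to `Z` that is killed by `ε` comes from a stage `X n`, and
  -- it becomes zero in the next stage; surjectivity holds already for the first stage
  refine IsCouniversalFor.of_iso e ⟨?_, ?_⟩
  · intro a b hab
    rw [← sub_eq_zero]
    have hk : F.map (a - b) ≫ ε = 0 := by
      dsimp at hab
      rw [Functor.map_sub, Preadditive.sub_comp, hab, sub_self]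
    obtain ⟨n, k, hk'⟩ := exists_factor_telescope φ hcc (hc _ (hG i)) H (a - b)
    rw [hk', Functor.map_comp, Category.assoc, hp] at hk
    have h₀ : k ≫ φ n = 0 := hf₂ (st n) i k hk
    have hf : c.inj ⟨n⟩ ≫ p = φ n ≫ c.inj ⟨n + 1⟩ ≫ p := by
      have := congrArg (fun g => c.inj ⟨n⟩ ≫ g) (distTriang_comp₁₂ H)
      dsimp at this
      rw [← Category.assoc, inj_oneSubShift, Preadditive.sub_comp, comp_zero, sub_eq_zero,
        Category.assoc] at this
      exact this
    rw [hk', hf, reassoc_of% h₀, zero_comp]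
  · intro y
    refine ⟨Sigma.ι (fun j : J => G j.1) ⟨i, equivShrink _ y⟩ ≫ c.inj ⟨0⟩ ≫ p, ?_⟩
    dsimp only
    rw [Functor.map_comp, Category.assoc, hp]
    exact (Cofan.IsColimit.fac hc₀ _ (⟨i, equivShrink _ y⟩ : J)).trans (Equiv.symm_apply_apply _ _)

end Brown

/-! ### Sequences indexed by the integers -/

section Recursion

/-- Recursive choice in the degrees above `b`, starting from `x₀ b`. The property `P` is the
invariant that makes the next choice possible. -/
lemma exists_sequence_up {α : ℤ → Sort w} (R : ∀ n m, α n → α m → Prop)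
    (P : ∀ n, α n → Prop) (b : ℤ) (x₀ : ∀ n, α n) (hb : P b (x₀ b))
    (h : ∀ n m, n + 1 = m → b ≤ n → ∀ x, P n x → ∃ y, R n m x y ∧ P m y) :
    ∃ x : ∀ n, α n, (∀ n ≤ b, x n = x₀ n) ∧ ∀ n m, n + 1 = m → b ≤ n → R n m (x n) (x m) := by
  classical
  let β : ℤ → Sort _ := fun n => { x : α n // b ≤ n → P n x }
  let succ : ∀ k, b ≤ k → β k → β (k + 1) := fun k hk x =>
    ⟨(h k (k + 1) rfl hk x.1 (x.2 hk)).choose,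
      fun _ => (h k (k + 1) rfl hk x.1 (x.2 hk)).choose_spec.2⟩
  let y : ∀ n, β n := fun n => Int.inductionOn' n b ⟨x₀ b, fun _ => hb⟩ succ
    fun k hk _ => ⟨x₀ (k - 1), fun h => by omega⟩
  refine ⟨fun n => (y n).1, fun n hn => ?_, ?_⟩
  · obtain rfl | hn := hn.eq_or_lt
    · have : y n = ⟨x₀ n, fun _ => hb⟩ := Int.inductionOn'_self
      exact congrArg Subtype.val this
    · obtain ⟨k, rfl⟩ : ∃ k, n = k - 1 := ⟨n + 1, by omega⟩
      have : y (k - 1) = ⟨x₀ (k - 1), fun h => by omega⟩ := Int.inductionOn'_sub_one (by omega)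
      exact congrArg Subtype.val this
  · rintro n m rfl hn
    have : y (n + 1) = succ n hn (y n) := Int.inductionOn'_add_one hn
    dsimp only
    rw [this]
    exact (h n (n + 1) rfl hn (y n).1 ((y n).2 hn)).choose_spec.1

/-- Recursive choice in the degrees below `b`, starting from `x₀ b`. -/
lemma exists_sequence_down {α : ℤ → Sort w} (R : ∀ n m, α n → α m → Prop)
    (P : ∀ n, α n → Prop) (b : ℤ) (x₀ : ∀ n, α n) (hb : P b (x₀ b))
    (h : ∀ n m, n + 1 = m → m ≤ b → ∀ y, P m y → ∃ x, R n m x y ∧ P n x) :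
    ∃ x : ∀ n, α n, (∀ n, b ≤ n → x n = x₀ n) ∧ ∀ n m, n + 1 = m → m ≤ b → R n m (x n) (x m) := by
  classical
  let β : ℤ → Sort _ := fun n => { x : α n // n ≤ b → P n x }
  let pred : ∀ k, k ≤ b → β k → β (k - 1) := fun k hk x =>
    ⟨(h (k - 1) k (by omega) hk x.1 (x.2 hk)).choose,
      fun _ => (h (k - 1) k (by omega) hk x.1 (x.2 hk)).choose_spec.2⟩
  let y : ∀ n, β n := fun n => Int.inductionOn' n b ⟨x₀ b, fun _ => hb⟩
    (fun k hk _ => ⟨x₀ (k + 1), fun h => by omega⟩) pred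
  refine ⟨fun n => (y n).1, fun n hn => ?_, ?_⟩
  · obtain rfl | hn := hn.eq_or_lt
    · have : y b = ⟨x₀ b, fun _ => hb⟩ := Int.inductionOn'_self
      exact congrArg Subtype.val this
    · obtain ⟨k, rfl⟩ : ∃ k, n = k + 1 := ⟨n - 1, by omega⟩
      have : y (k + 1) = ⟨x₀ (k + 1), fun h => by omega⟩ := Int.inductionOn'_add_one (by omega)
      exact congrArg Subtype.val this
  · rintro n m hnm hn
    obtain rfl : n = m - 1 := by omega
    have : y (m - 1) = pred m hn (y m) := Int.inductionOn'_sub_one hn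
    dsimp only
    rw [this]
    exact (h (m - 1) m (by omega) hn (y m).1 ((y m).2 hn)).choose_spec.1

end Recursion

/-! ### Constructing homotopies and chain maps degree by degree -/

section Complexes

variable {C : Type u₁} [Category.{v₁} C] [Preadditive C]

/-- A null-homotopic morphism from components without conditions on the degrees. -/
lemma nonempty_homotopy_zero {K L : CochainComplex C ℤ} {f : K ⟶ L}
    (s : ∀ n m : ℤ, K.X n ⟶ L.X m) (hs : ∀ i n j : ℤ, i + 1 = n → n + 1 = j →
      f.f n = K.d n j ≫ s j n + s n i ≫ L.d i n) : Nonempty (Homotopy f 0) := by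
  have : f = Homotopy.nullHomotopicMap s := by
    ext n
    rw [Homotopy.nullHomotopicMap_f (k₂ := n - 1) (k₁ := n) (k₀ := n + 1) (by simp) (by simp)]
    exact hs _ _ _ (by simp) rfl
  rw [this]
  refine ⟨(Homotopy.ofEq ?_).trans (Homotopy.nullHomotopy
    (fun n m => if (ComplexShape.up ℤ).Rel m n then s n m else 0) (by intro i j h; exact if_neg h))⟩
  ext n
  rw [Homotopy.nullHomotopicMap_f (k₂ := n - 1) (k₁ := n) (k₀ := n + 1) (by simp) (by simp),
    Homotopy.nullHomotopicMap_f (k₂ := n - 1) (k₁ := n) (k₀ := n + 1) (by simp) (by simp)]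
  simp

/-- Every morphism from `K.X n` to `Y` that is trivial on the boundaries extends along the
differential. -/
def ExtendsAt (K : CochainComplex C ℤ) (n : ℤ) (Y : C) : Prop :=
  ∀ i j, i + 1 = n → n + 1 = j → ∀ φ : K.X n ⟶ Y, K.d i n ≫ φ = 0 →
    ∃ ψ : K.X j ⟶ Y, K.d n j ≫ ψ = φ

/-- Every morphism from `X` to the cycles in `L.X n` lifts along the differential. -/
def LiftsAt (L : CochainComplex C ℤ) (n : ℤ) (X : C) : Prop :=
  ∀ i j, i + 1 = n → n + 1 = j → ∀ φ : X ⟶ L.X n, φ ≫ L.d n j = 0 →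
    ∃ ψ : X ⟶ L.X i, ψ ≫ L.d i n = φ

/-- A chain map that vanishes in the degrees up to `b` is null-homotopic if morphisms extend along
the differential in the degrees above `b`. -/
lemma homotopy_zero_of_extendsAt {K L : CochainComplex C ℤ} (f : K ⟶ L) (b : ℤ)
    (hf : ∀ n ≤ b, f.f n = 0) (h : ∀ n, b < n → ExtendsAt K n (L.X n)) :
    Nonempty (Homotopy f 0) := by
  obtain ⟨s, hs₁, hs₂⟩ := exists_sequence_up (α := fun n => ∀ m : ℤ, K.X n ⟶ L.X m)
    (fun n m s t => ∀ i, i + 1 = n → f.f n = K.d n m ≫ t n + s i ≫ L.d i n)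
    -- the invariant: the part of `f.f n` that remains is trivial on the boundaries
    (fun n s => ∀ i j, i + 1 = n → n + 1 = j → K.d i n ≫ (f.f n - s i ≫ L.d i n) = 0) (b + 1)
    (fun _ _ => 0) (by
      intro i j hi hj
      rw [zero_comp, sub_zero, ← f.comm, hf i (by omega), zero_comp]) (by
      intro n m hnm hn s hs
      obtain ⟨ψ, hψ⟩ := h n (by omega) (n - 1) m (by omega) hnm _
        (hs (n - 1) m (by omega) hnm)
      refine ⟨fun k => if hk : n = k then ψ ≫ eqToHom (by rw [hk]) else 0, ?_, ?_⟩
      · intro i hi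
        obtain rfl : i = n - 1 := by omega
        simp [hψ]
      · intro i j hi hj
        obtain rfl : i = n := by omega
        simp only [dite_true, eqToHom_refl, Category.comp_id]
        rw [Preadditive.comp_sub, ← Category.assoc, hψ, Preadditive.sub_comp, Category.assoc,
          L.d_comp_d, comp_zero, sub_zero, f.comm, sub_self])
  refine nonempty_homotopy_zero s fun i n j hi hj => ?_
  by_cases hn : b + 1 ≤ n
  · exact hs₂ n j hj hn i hi
  · rw [hf n (by omega), hs₁ n (by omega), hs₁ j (by omega)]
    simp

/-- A chain map that vanishes in the degrees from `b` on is null-homotopic if morphisms lift along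
the differential in the degrees below `b`. -/
lemma homotopy_zero_of_liftsAt {K L : CochainComplex C ℤ} (f : K ⟶ L) (b : ℤ)
    (hf : ∀ n, b ≤ n → f.f n = 0) (h : ∀ n < b, LiftsAt L n (K.X n)) :
    Nonempty (Homotopy f 0) := by
  obtain ⟨s, hs₁, hs₂⟩ := exists_sequence_down (α := fun n => ∀ m : ℤ, K.X m ⟶ L.X n)
    (fun n m s t => ∀ j, m + 1 = j → f.f m = K.d m j ≫ t j + s m ≫ L.d n m)
    (fun n s => ∀ i j, i + 1 = n → n + 1 = j → (f.f n - K.d n j ≫ s j) ≫ L.d n j = 0) (b - 1)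
    (fun _ _ => 0) (by
      intro i j hi hj
      rw [comp_zero, sub_zero, f.comm, hf j (by omega), comp_zero]) (by
      intro n m hnm hn t ht
      obtain ⟨ψ, hψ⟩ := h m (by omega) n (m + 1) hnm rfl _ (ht n (m + 1) hnm rfl)
      refine ⟨fun k => if hk : k = m then eqToHom (by rw [hk]) ≫ ψ else 0, ?_, ?_⟩
      · intro j hj
        obtain rfl : j = m + 1 := by omega
        simp [hψ]
      · intro i j hi hj
        obtain rfl : j = m := by omega
        simp only [dite_true, eqToHom_refl, Category.id_comp]
        rw [Preadditive.sub_comp, Category.assoc, hψ, Preadditive.comp_sub,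
          K.d_comp_d_assoc, zero_comp, sub_zero, f.comm, sub_self])
  refine nonempty_homotopy_zero (fun n m => s m n) fun i n j hi hj => ?_
  by_cases hn : n ≤ b - 1
  · exact hs₂ i n hi hn j hj
  · rw [hf n (by omega), hs₁ n (by omega), hs₁ i (by omega)]
    simp

/-- A commutative square between the degrees `b` and `b + 1` of two complexes extends
to a chain map. -/
lemma exists_chain_map {K L : CochainComplex C ℤ} (b c : ℤ) (hbc : b + 1 = c)
    (f : K.X b ⟶ L.X b) (g : K.X c ⟶ L.X c) (hfg : K.d b c ≫ g = f ≫ L.d b c)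
    (hK : ∀ n m, n + 1 = m → c ≤ n → ExtendsAt K n (L.X m))
    (hL : ∀ n m, n + 1 = m → m ≤ b → LiftsAt L m (K.X n)) :
    ∃ φ : K ⟶ L, φ.f b = f ∧ φ.f c = g := by
  -- extend upwards from degree `c`; the value in degree `b` is kept for the second construction
  obtain ⟨x, hx₁, hx₂⟩ := exists_sequence_up (α := fun n => K.X n ⟶ L.X n)
    (fun n m x y => x ≫ L.d n m = K.d n m ≫ y)
    (fun n x => ∀ i j, i + 1 = n → n + 1 = j → K.d i n ≫ x ≫ L.d n j = 0) c
    (fun n => if h : n = c then eqToHom (by rw [h]) ≫ g ≫ eqToHom (by rw [h]) else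
      if h : n = b then eqToHom (by rw [h]) ≫ f ≫ eqToHom (by rw [h]) else 0) (by
      intro i j hi hj
      obtain rfl : i = b := by omega
      simp [reassoc_of% hfg]) (by
      intro n m hnm hn x hx
      obtain ⟨ψ, hψ⟩ := hK n m hnm hn (n - 1) m (by omega) hnm (x ≫ L.d n m)
        (hx _ _ (by omega) hnm)
      refine ⟨ψ, hψ.symm, fun i j hi hj => ?_⟩
      obtain rfl : i = n := by omega
      rw [← Category.assoc, hψ, Category.assoc, L.d_comp_d, comp_zero])
  have hxb : x b = f := by
    rw [hx₁ b (by omega), dif_neg (by omega), dif_pos rfl]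
    simp
  have hxc : x c = g := by
    rw [hx₁ c le_rfl, dif_pos rfl]
    simp
  -- extend downwards from degree `b`
  obtain ⟨y, hy₁, hy₂⟩ := exists_sequence_down (α := fun n => K.X n ⟶ L.X n)
    (fun n m x y => x ≫ L.d n m = K.d n m ≫ y)
    (fun n x => ∀ i j, i + 1 = n → n + 1 = j → K.d i n ≫ x ≫ L.d n j = 0) b x (by
      intro i j hi hj
      obtain rfl : j = c := by omega
      rw [hxb, ← hfg, K.d_comp_d_assoc, zero_comp]) (by
      intro n m hnm hn y hy
      obtain ⟨ψ, hψ⟩ := hL n m hnm hn n (m + 1) hnm rfl (K.d n m ≫ y)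
        (by rw [Category.assoc, hy _ _ hnm rfl])
      refine ⟨ψ, hψ, fun i j hi hj => ?_⟩
      obtain rfl : j = m := by omega
      rw [hψ, K.d_comp_d_assoc, zero_comp])
  refine ⟨{ f := y, comm' := ?_ }, (hy₁ b le_rfl).trans hxb, (hy₁ c (by omega)).trans hxc⟩
  rintro n m (hnm : n + 1 = m)
  by_cases h : m ≤ b
  · exact hy₂ n m hnm h
  · rw [hy₁ n (by omega), hy₁ m (by omega)]
    by_cases h : c ≤ n
    · exact hx₂ n m hnm h
    · obtain rfl : n = b := by omega
      obtain rfl : m = c := by omega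
      rw [hxb, hxc, hfg]

/-- A chain map that is zero in degree `b` is null-homotopic if both parts of it, in the degrees
above and below `b`, are. -/
lemma homotopy_zero_of_extendsAt_of_liftsAt {K L : CochainComplex C ℤ} (f : K ⟶ L) (b : ℤ)
    (hf : f.f b = 0) (hK : ∀ n, b < n → ExtendsAt K n (L.X n))
    (hL : ∀ n < b, LiftsAt L n (K.X n)) : Nonempty (Homotopy f 0) := by
  let g : K ⟶ L :=
    { f := fun n => if b < n then f.f n else 0
      comm' := by
        rintro i j (hij : i + 1 = j)
        by_cases hi : b < i
        · rw [if_pos hi, if_pos (by omega), f.comm]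
        · rw [if_neg hi, zero_comp]
          by_cases hj : b < j
          · obtain rfl : i = b := by omega
            rw [if_pos hj, ← f.comm, hf, zero_comp]
          · rw [if_neg hj, comp_zero] }
  have hg (n : ℤ) : g.f n = if b < n then f.f n else 0 := rfl
  obtain ⟨h₁⟩ := homotopy_zero_of_extendsAt g b (fun n hn => by rw [hg, if_neg (by omega)]) hK
  obtain ⟨h₂⟩ := homotopy_zero_of_liftsAt (f - g) b (fun n hn => by
    rw [HomologicalComplex.sub_f_apply, hg]
    obtain rfl | hn := hn.eq_or_lt
    · simp [hf]
    · rw [if_pos hn, sub_self]) hL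
  exact ⟨(Homotopy.ofEq (by simp)).trans ((h₁.add h₂).trans (Homotopy.ofEq (by simp)))⟩

end Complexes

/-! ### Cokernels of differentials -/

section Opcycles

variable {C : Type u₁} [Category.{v₁} C] [Abelian C]

lemma shortExact_opcycles (K : CochainComplex C ℤ) {n m : ℤ} (hnm : n + 1 = m)
    (hK : K.ExactAt n) : (ShortComplex.mk (K.fromOpcycles n m) (K.pOpcycles m) (by
      rw [← cancel_epi (K.pOpcycles n), K.p_fromOpcycles_assoc, K.d_pOpcycles,
        comp_zero])).ShortExact := by
  have h₁ : Mono (K.fromOpcycles n m) := by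
    rw [Preadditive.mono_iff_cancel_zero]
    intro Z g hg
    have hk := K.homologyIsKernel n m (by simp [← hnm])
    obtain ⟨l, hl⟩ := KernelFork.IsLimit.lift' hk g hg
    rw [← hl, show l = 0 from hK.isZero_homology.eq_of_tgt l 0]
    exact zero_comp
  refine ShortComplex.ShortExact.mk' (ShortComplex.exact_of_g_is_cokernel _ ?_) h₁
    (by dsimp; infer_instance)
  refine CokernelCofork.IsColimit.ofπ' _ _ fun {Z} g hg => ?_
  dsimp at g hg ⊢
  have : K.d n m ≫ g = 0 := by rw [← K.p_fromOpcycles, Category.assoc, hg, comp_zero]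
  exact ⟨K.descOpcycles g n (by simp [← hnm]) this, by simp⟩

lemma liftsAt_of_exactAt (L : CochainComplex C ℤ) {n : ℤ} (hL : L.ExactAt n) (X : C)
    [Projective X] : LiftsAt L n X := by
  intro i j hi hj φ hφ
  rw [L.exactAt_iff' i n j (by simp [← hi]) (by simp [← hj])] at hL
  exact ⟨hL.liftFromProjective φ hφ, hL.liftFromProjective_comp φ hφ⟩

variable {E : ObjectProperty C} [hE : IsFrobeniusSubcategory E]

lemma extendsAt_of_exactAt (K : CochainComplex C ℤ) {n m : ℤ} (hnm : n + 1 = m)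
    (hK : K.ExactAt n) (h₁ : E (K.opcycles n)) (h₂ : E (K.X m)) (h₃ : E (K.opcycles m))
    {Y : C} (hY : E Y) [Projective Y] : ExtendsAt K n Y := by
  intro i j hi hj φ hφ
  obtain rfl : m = j := by omega
  obtain ⟨g, hg⟩ := hE.extend _ (shortExact_opcycles K hnm hK) h₁ h₂ h₃ Y hY inferInstance
    (K.descOpcycles φ i (by simp [← hi]) hφ)
  refine ⟨g, ?_⟩
  dsimp at hg
  rw [← K.p_fromOpcycles, Category.assoc, hg, K.p_descOpcycles]

end Opcycles

/-! ### Morphisms modulo projectives -/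

section StablyEq

variable {C : Type u₁} [Category.{v₁} C] [Abelian C]

/-- Two morphisms are stably equal if their difference factors through a projective object. -/
def StablyEq {X Y : C} (f g : X ⟶ Y) : Prop :=
  ∃ (P : C) (_ : Projective P) (a : X ⟶ P) (b : P ⟶ Y), f - g = a ≫ b

namespace StablyEq

variable {X Y Z : C}

lemma of_eq {f g : X ⟶ Y} (h : f = g) : StablyEq f g :=
  ⟨0, inferInstance, 0, 0, by simp [h]⟩

lemma symm {f g : X ⟶ Y} (h : StablyEq f g) : StablyEq g f := by
  obtain ⟨P, hP, a, b, h⟩ := h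
  exact ⟨P, hP, -a, b, by rw [Preadditive.neg_comp, ← h, neg_sub]⟩

lemma trans {f g k : X ⟶ Y} (h : StablyEq f g) (h' : StablyEq g k) : StablyEq f k := by
  obtain ⟨P, hP, a, b, h⟩ := h
  obtain ⟨P', hP', a', b', h'⟩ := h'
  exact ⟨P ⊞ P', inferInstance, biprod.lift a a', biprod.desc b b', by
    rw [biprod.lift_desc, ← h, ← h', sub_add_sub_cancel]⟩

lemma comp_left (k : X ⟶ Y) {f g : Y ⟶ Z} (h : StablyEq f g) : StablyEq (k ≫ f) (k ≫ g) := by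
  obtain ⟨P, hP, a, b, h⟩ := h
  exact ⟨P, hP, k ≫ a, b, by rw [← Preadditive.comp_sub, h, Category.assoc]⟩

lemma comp_right {f g : X ⟶ Y} (h : StablyEq f g) (k : Y ⟶ Z) : StablyEq (f ≫ k) (g ≫ k) := by
  obtain ⟨P, hP, a, b, h⟩ := h
  exact ⟨P, hP, a, b ≫ k, by rw [← Preadditive.sub_comp, h, Category.assoc]⟩

end StablyEq

variable (E : ObjectProperty C)

/-- The stable category is formed modulo a congruence as soon as each object of `E` is a quotient of
a projective object in `E`. In this case stable equality does not depend on `E`. -/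
lemma stableRel_iff (hE : ∀ X, E X → ∃ (Q : C) (p : Q ⟶ X), E Q ∧ Projective Q ∧ Epi p)
    {X Y : E.FullSubcategory} (f g : X ⟶ Y) : stableRel E f g ↔ StablyEq f.hom g.hom := by
  constructor
  · rintro ⟨P, -, hP, a, b, h⟩
    exact ⟨P, hP, a, b, h⟩
  · rintro ⟨P, hP, a, b, h⟩
    obtain ⟨Q, p, hQ, hQ', _⟩ := hE Y.obj Y.property
    exact ⟨Q, hQ, hQ', a ≫ Projective.factorThru b p, p, by simp [h]⟩

lemma toStable_map_eq_iff (hE : ∀ X, E X → ∃ (Q : C) (p : Q ⟶ X), E Q ∧ Projective Q ∧ Epi p)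
    {X Y : E.FullSubcategory} (f g : X ⟶ Y) :
    (toStable E).map f = (toStable E).map g ↔ StablyEq f.hom g.hom := by
  have hc : Congruence (stableRel E) :=
    { equivalence := fun {X Y} =>
        ⟨fun f => (stableRel_iff E hE f f).2 (.of_eq rfl),
          fun h => (stableRel_iff E hE _ _).2 ((stableRel_iff E hE _ _).1 h).symm,
          fun h h' => (stableRel_iff E hE _ _).2
            (((stableRel_iff E hE _ _).1 h).trans ((stableRel_iff E hE _ _).1 h'))⟩
      comp_left := fun f _ _ h => (stableRel_iff E hE _ _).2
        (((stableRel_iff E hE _ _).1 h).comp_left f.hom)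
      comp_right := fun g h => (stableRel_iff E hE _ _).2
        (((stableRel_iff E hE _ _).1 h).comp_right g.hom) }
  rw [CategoryTheory.Quotient.functor_map_eq_iff, stableRel_iff E hE]

lemma exists_cover_of_isFrobeniusSubcategory [hE : IsFrobeniusSubcategory E] (X : C) (hX : E X) :
    ∃ (Q : C) (p : Q ⟶ X), E Q ∧ Projective Q ∧ Epi p := by
  obtain ⟨N, Q, i, p, w, h, hQ, hQ', -⟩ := hE.exists_cover X hX
  exact ⟨Q, p, hQ, hQ', h.epi_g⟩

lemma exists_cover_top [EnoughProjectives C] (X : C) (_ : (⊤ : ObjectProperty C) X) :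
    ∃ (Q : C) (p : Q ⟶ X), (⊤ : ObjectProperty C) Q ∧ Projective Q ∧ Epi p :=
  ⟨Projective.over X, Projective.π X, trivial, inferInstance, inferInstance⟩

/-- Let `f` and `f'` be stably equal morphisms, extended to morphisms of short exact sequences
with projective middle term of the target. Then the induced morphisms of the cokernels
are stably equal. -/
lemma StablyEq.of_shortExact [hE : IsFrobeniusSubcategory E]
    {S T : ShortComplex C} (hS : S.ShortExact)
    (h₁ : E S.X₁) (h₂ : E S.X₂) (h₃ : E S.X₃) (hT : E T.X₁) [Projective T.X₂] {f f' : S.X₁ ⟶ T.X₁}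
    {b b' : S.X₂ ⟶ T.X₂} {c c' : S.X₃ ⟶ T.X₃} (h : StablyEq f f')
    (hb : S.f ≫ b = f ≫ T.f) (hc : S.g ≫ c = b ≫ T.g)
    (hb' : S.f ≫ b' = f' ≫ T.f) (hc' : S.g ≫ c' = b' ≫ T.g) : StablyEq c c' := by
  obtain ⟨P, hP, huv⟩ :=
    (stableRel_iff E (exists_cover_of_isFrobeniusSubcategory E)
      (X := ⟨S.X₁, h₁⟩) (Y := ⟨T.X₁, hT⟩) (ObjectProperty.homMk f) (ObjectProperty.homMk f')).2 h
  obtain ⟨hP', u, v, huv⟩ : ∃ (_ : Projective P) (u : S.X₁ ⟶ P) (v : P ⟶ T.X₁), f - f' = u ≫ v :=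
    huv
  -- `f - f'` factors through a projective object `P` that is injective relative to `E`, so the
  -- factorisation extends to `S.X₂`; what remains of `b - b'` factors through `S.X₃`
  obtain ⟨u', hu'⟩ := hE.extend S hS h₁ h₂ h₃ _ hP hP' u
  have := hS.epi_g
  let k : S.X₂ ⟶ T.X₂ := b - b' - u' ≫ v ≫ T.f
  have hk : S.f ≫ k = 0 := by
    simp only [k, Preadditive.comp_sub, hb, hb', reassoc_of% hu']
    rw [← Category.assoc u, ← huv, Preadditive.sub_comp, sub_self]
  refine ⟨T.X₂, inferInstance, hS.exact.desc k hk, T.g, ?_⟩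
  rw [← cancel_epi S.g]
  have h₁ : S.g ≫ hS.exact.desc k hk = k := hS.exact.g_desc _ _
  rw [reassoc_of% h₁, Preadditive.comp_sub, hc, hc']
  simp [k, Preadditive.sub_comp]

end StablyEq

/-! ### Splicing exact sequences -/

section Splice

variable {C : Type u₁} [Category.{v₁} C] [Abelian C] {N Q : ℤ → C} (i : ∀ n, N n ⟶ Q n)
  (p : ∀ n, Q n ⟶ N (n + 1)) (w : ∀ n, i n ≫ p n = 0)

/-- The complex that is obtained by splicing sequences `N n ⟶ Q n ⟶ N (n + 1)`. -/
def splice : CochainComplex C ℤ :=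
  CochainComplex.of Q (fun n => p n ≫ i (n + 1)) fun n => by
    rw [Category.assoc, ← Category.assoc (i (n + 1)), w, zero_comp, comp_zero]

lemma splice_d (n : ℤ) : (splice i p w).d n (n + 1) = p n ≫ i (n + 1) :=
  CochainComplex.of_d Q (fun n => p n ≫ i (n + 1)) n

variable (hi : ∀ n, Mono (i n)) (h : ∀ n, (ShortComplex.mk (i n) (p n) (w n)).Exact)

include hi h in
/-- A splice of exact sequences is exact: composition with an epimorphism in front and with a
monomorphism behind does not change exactness. -/
lemma exactAt_splice {n m : ℤ} (hnm : n + 1 = m) (hp : Epi (p n)) :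
    (splice i p w).ExactAt m := by
  subst hnm
  rw [(splice i p w).exactAt_iff' n (n + 1) (n + 1 + 1) (by simp) (by simp)]
  let S₁ := (splice i p w).sc' n (n + 1) (n + 1 + 1)
  let S₂ : ShortComplex C := ShortComplex.mk (i (n + 1)) (p (n + 1) ≫ i (n + 1 + 1))
    (by rw [← Category.assoc, w, zero_comp])
  let φ : S₁ ⟶ S₂ :=
    { τ₁ := p n
      τ₂ := 𝟙 (Q (n + 1))
      τ₃ := 𝟙 (Q (n + 1 + 1))
      comm₁₂ := (splice_d i p w n).symm.trans (Category.comp_id _).symm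
      comm₂₃ := by
        refine (Category.id_comp _).trans (Eq.trans ?_ (Category.comp_id _).symm)
        exact (splice_d i p w (n + 1)).symm }
  let ψ : ShortComplex.mk (i (n + 1)) (p (n + 1)) (w (n + 1)) ⟶ S₂ :=
    { τ₁ := 𝟙 _, τ₂ := 𝟙 _, τ₃ := i (n + 1 + 1) }
  have : Epi φ.τ₁ := hp
  have : IsIso φ.τ₂ := by dsimp [φ]; exact inferInstanceAs (IsIso (𝟙 (Q (n + 1))))
  have : Mono φ.τ₃ := by dsimp [φ]; exact inferInstanceAs (Mono (𝟙 (Q (n + 1 + 1))))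
  rw [show (splice i p w).sc' n (n + 1) (n + 1 + 1) = S₁ from rfl,
    ShortComplex.exact_iff_of_epi_of_isIso_of_mono φ]
  have : Epi ψ.τ₁ := by dsimp [ψ]; infer_instance
  have : IsIso ψ.τ₂ := by dsimp [ψ]; infer_instance
  have : Mono ψ.τ₃ := hi _
  rw [← ShortComplex.exact_iff_of_epi_of_isIso_of_mono ψ]
  exact h _

include h in
lemma nonempty_opcycles_splice_iso {n m : ℤ} (hnm : n + 1 = m) (hp : Epi (p n))
    (hp' : Epi (p m)) : Nonempty ((splice i p w).opcycles m ≅ N (m + 1)) := by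
  subst hnm
  have hk : IsColimit (CokernelCofork.ofπ (p (n + 1)) (w (n + 1))) := (h (n + 1)).gIsCokernel
  have hk' := isCokernelEpiComp hk (p n) (splice_d i p w n)
  exact ⟨((splice i p w).opcyclesIsCokernel n (n + 1) (by simp)).coconePointUniqueUpToIso hk'⟩

end Splice

/-! ### Totally acyclic complexes -/

section TotallyAcyclic

variable {C : Type u₁} [Category.{v₁} C] [Abelian C] (E : ObjectProperty C)

/-- The complete resolutions of the objects of `E`: the acyclic complexes of objects of `E` that are
projective, with cokernels of differentials in `E`. -/
structure IsTotallyAcyclic (K : CochainComplex C ℤ) : Prop where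
  projective (n : ℤ) : Projective (K.X n)
  mem (n : ℤ) : E (K.X n)
  acyclic : K.Acyclic
  opcycles (n : ℤ) : E (K.opcycles n)

variable {E} [hE : IsFrobeniusSubcategory E]

/-- Each object of `E` has a complete resolution. -/
lemma exists_isTotallyAcyclic (hE' : E.IsClosedUnderIsomorphisms) (M : C) (hM : E M) :
    ∃ K : CochainComplex C ℤ, IsTotallyAcyclic E K ∧ Nonempty (K.opcycles 0 ≅ M) := by
  -- `Y` is the next term after `X` if there is `0 ⟶ X ⟶ Q ⟶ Y ⟶ 0` with `Q` projective in `E`; such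
  -- sequences are chosen upwards (by embeddings) and downwards (by covers) from degree `1`, and
  -- they are spliced
  let α : ℤ → Type _ := fun _ => E.FullSubcategory
  let R : ∀ n m : ℤ, α n → α m → Prop := fun n m X Y =>
    ∃ (Q : C) (i : X.obj ⟶ Q) (p : Q ⟶ Y.obj) (w : i ≫ p = 0),
      (ShortComplex.mk i p w).ShortExact ∧ E Q ∧ Projective Q
  obtain ⟨x, hx₁, hx₂⟩ := exists_sequence_up (α := α) R (fun _ _ => True) 1
    (fun _ => ⟨M, hM⟩) trivial (by
      intro n m _ _ X _
      obtain ⟨Q, N, i, p, w, h, hQ, hQ', hN⟩ := hE.exists_embedding X.obj X.property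
      exact ⟨⟨N, hN⟩, ⟨Q, i, p, w, h, hQ, hQ'⟩, trivial⟩)
  obtain ⟨y, hy₁, hy₂⟩ := exists_sequence_down (α := α) R (fun _ _ => True) 1 x trivial (by
      intro n m _ _ X _
      obtain ⟨N, Q, i, p, w, h, hQ, hQ', hN⟩ := hE.exists_cover X.obj X.property
      exact ⟨⟨N, hN⟩, ⟨Q, i, p, w, h, hQ, hQ'⟩, trivial⟩)
  have hR : ∀ n, R n (n + 1) (y n) (y (n + 1)) := by
    intro n
    by_cases h : n + 1 ≤ 1
    · exact hy₂ n (n + 1) rfl h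
    · rw [hy₁ n (by omega), hy₁ (n + 1) (by omega)]
      exact hx₂ n (n + 1) rfl (by omega)
  choose Q i p w h hQ hQ' using hR
  have hi (n : ℤ) : Mono (i n) := (h n).mono_f
  have hp (n : ℤ) : Epi (p n) := (h n).epi_g
  have hex (n : ℤ) := (h n).exact
  refine ⟨splice i p w, ⟨hQ', hQ, fun n => ?_, fun n => ?_⟩, ?_⟩
  · exact exactAt_splice i p w hi hex (n := n - 1) (by omega) (hp _)
  · obtain ⟨e⟩ := nonempty_opcycles_splice_iso i p w hex (n := n - 1) (m := n) (by omega)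
      (hp _) (hp _)
    exact hE'.of_iso e.symm (y (n + 1)).property
  · obtain ⟨e⟩ := nonempty_opcycles_splice_iso i p w hex (n := -1) (m := 0) (by omega)
      (hp _) (hp _)
    have h₁ : y (0 + 1) = ⟨M, hM⟩ := (hy₁ 1 le_rfl).trans (hx₁ 1 le_rfl)
    exact ⟨e.trans (eqToIso (congrArg (fun X => X.obj) h₁))⟩

variable {K L : CochainComplex C ℤ}

lemma IsTotallyAcyclic.extendsAt (hK : IsTotallyAcyclic E K) (hL : IsTotallyAcyclic E L)
    (n m : ℤ) : ExtendsAt K n (L.X m) :=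
  have := hL.projective m
  extendsAt_of_exactAt K rfl (hK.acyclic n) (hK.opcycles _) (hK.mem _) (hK.opcycles _) (hL.mem m)

lemma IsTotallyAcyclic.liftsAt (hK : IsTotallyAcyclic E K) (hL : IsTotallyAcyclic E L)
    (n m : ℤ) : LiftsAt L n (K.X m) :=
  have := hK.projective m
  liftsAt_of_exactAt L (hL.acyclic n) _

lemma stablyEq_opcyclesMap (hL : ∀ n, Projective (L.X n)) {f g : K ⟶ L} (h : Homotopy f g)
    (n : ℤ) : StablyEq (HomologicalComplex.opcyclesMap f n)
      (HomologicalComplex.opcyclesMap g n) := by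
  refine ⟨L.X n, hL n, K.fromOpcycles n (n + 1) ≫ h.hom (n + 1) n, L.pOpcycles n, ?_⟩
  rw [← cancel_epi (K.pOpcycles n), Preadditive.comp_sub, HomologicalComplex.p_opcyclesMap,
    HomologicalComplex.p_opcyclesMap, ← Preadditive.sub_comp, h.comm n,
    dNext_eq h.hom (i := n) (i' := n + 1) (by simp),
    prevD_eq h.hom (j := n) (j' := n - 1) (by simp), add_sub_cancel_right,
    Preadditive.add_comp, Category.assoc, Category.assoc, L.d_pOpcycles, comp_zero, add_zero,
    Category.assoc, K.p_fromOpcycles_assoc]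

/-- Chain maps are homotopic if they are stably equal on the cokernels of the differentials in one
degree, provided that morphisms to the terms of `L` extend above that degree. -/
lemma nonempty_homotopy_of_stablyEq {f g : K ⟶ L} (n : ℤ)
    (hK : ∀ m ≥ n, ∀ i, ExtendsAt K m (L.X i)) (hL : ∀ m i, LiftsAt L m (K.X i))
    (h : StablyEq (HomologicalComplex.opcyclesMap f n) (HomologicalComplex.opcyclesMap g n)) :
    Nonempty (Homotopy f g) := by
  obtain ⟨P, hP, a, b, hab⟩ := h
  -- the factorisation through a projective object yields a homotopy in degree `n + 1`
  obtain ⟨b', hb'⟩ : ∃ b' : P ⟶ L.X n, b' ≫ L.pOpcycles n = b :=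
    ⟨Projective.factorThru b (L.pOpcycles n), Projective.factorThru_comp _ _⟩
  obtain ⟨t, ht⟩ := hK n le_rfl n (n - 1) (n + 1) (by omega) rfl
    (K.pOpcycles n ≫ a ≫ b') (by rw [K.d_pOpcycles_assoc, zero_comp])
  have h₁ : (f.f n - g.f n - K.d n (n + 1) ≫ t) ≫ L.pOpcycles n = 0 := by
    rw [ht, Preadditive.sub_comp, Preadditive.sub_comp, Category.assoc, Category.assoc, hb', ← hab,
      ← HomologicalComplex.p_opcyclesMap, ← HomologicalComplex.p_opcyclesMap,
      Preadditive.comp_sub, sub_self]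
  have h₂ : (f.f n - g.f n - K.d n (n + 1) ≫ t) ≫ L.d n (n + 1) = 0 := by
    rw [← L.p_fromOpcycles, reassoc_of% h₁, zero_comp]
  -- the rest of `f.f n - g.f n` consists of cycles, which lift to degree `n - 1`; subtracting the
  -- null-homotopic map with these two components leaves a map that vanishes in degree `n`
  obtain ⟨s, hs⟩ := hL n n (n - 1) (n + 1) (by omega) rfl _ h₂
  let σ : ∀ i j : ℤ, K.X i ⟶ L.X j := fun i j =>
    if h : i = n + 1 ∧ j = n then eqToHom (by rw [h.1]) ≫ t ≫ eqToHom (by rw [h.2])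
    else if h : i = n ∧ j = n - 1 then eqToHom (by rw [h.1]) ≫ s ≫ eqToHom (by rw [h.2]) else 0
  have hσ₁ : σ (n + 1) n = t := by simp [σ]
  have hσ₂ : σ n (n - 1) = s := by simp [σ]
  obtain ⟨k⟩ : Nonempty (Homotopy (Homotopy.nullHomotopicMap σ) 0) :=
    nonempty_homotopy_zero σ fun i m j hi hj =>
      Homotopy.nullHomotopicMap_f (by simp [hi]) (by simp [hj]) _
  have h₃ : (f - g - Homotopy.nullHomotopicMap σ).f n = 0 := by
    rw [HomologicalComplex.sub_f_apply, HomologicalComplex.sub_f_apply,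
      Homotopy.nullHomotopicMap_f (k₂ := n - 1) (k₁ := n) (k₀ := n + 1) (by simp) (by simp),
      hσ₁, hσ₂, hs]
    abel
  obtain ⟨l⟩ := homotopy_zero_of_extendsAt_of_liftsAt _ n h₃
    (fun m hm => hK m hm.le m) (fun m _ => hL m m)
  exact ⟨Homotopy.equivSubZero.symm ((Homotopy.ofEq (by abel)).trans
    ((l.add k).trans (Homotopy.ofEq (add_zero 0))))⟩

/-- Chain maps between totally acyclic complexes are homotopic if they are stably equal on the
cokernels of the differentials in one degree. -/
lemma IsTotallyAcyclic.homotopy (hK : IsTotallyAcyclic E K) (hL : IsTotallyAcyclic E L)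
    {f g : K ⟶ L} (n : ℤ) (h : StablyEq (HomologicalComplex.opcyclesMap f n)
      (HomologicalComplex.opcyclesMap g n)) : Nonempty (Homotopy f g) :=
  nonempty_homotopy_of_stablyEq n (fun m _ i => hK.extendsAt hL m i) (hK.liftsAt hL) h

lemma exists_opcyclesMap_eq_of_extendsAt (n : ℤ) [Projective (K.X n)]
    (hK : ∀ m ≥ n, ∀ i, ExtendsAt K m (L.X i)) (hL : ∀ m i, LiftsAt L m (K.X i))
    (α : K.opcycles n ⟶ L.opcycles n) :
    ∃ f : K ⟶ L, HomologicalComplex.opcyclesMap f n = α := by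
  let f₀ : K.X n ⟶ L.X n := Projective.factorThru (K.pOpcycles n ≫ α) (L.pOpcycles n)
  have hf₀ : f₀ ≫ L.pOpcycles n = K.pOpcycles n ≫ α := Projective.factorThru_comp _ _
  obtain ⟨f₁, hf₁⟩ := hK n le_rfl (n + 1) (n - 1) (n + 1) (by omega) rfl
    (f₀ ≫ L.d n (n + 1)) (by
      rw [← L.p_fromOpcycles, reassoc_of% hf₀, K.d_pOpcycles_assoc, zero_comp])
  obtain ⟨f, hf, -⟩ := exists_chain_map n (n + 1) rfl f₀ f₁ hf₁
    (fun i j _ hi => hK i (by omega) j) (fun i j _ _ => hL j i)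
  refine ⟨f, ?_⟩
  rw [← cancel_epi (K.pOpcycles n), HomologicalComplex.p_opcyclesMap, hf, hf₀]

/-- Each morphism between the cokernels of the differentials is induced by a chain map. -/
lemma IsTotallyAcyclic.exists_opcyclesMap_eq (hK : IsTotallyAcyclic E K)
    (hL : IsTotallyAcyclic E L) (n : ℤ) (α : K.opcycles n ⟶ L.opcycles n) :
    ∃ f : K ⟶ L, HomologicalComplex.opcyclesMap f n = α :=
  have := hK.projective n
  exists_opcyclesMap_eq_of_extendsAt n (fun m _ i => hK.extendsAt hL m i) (hK.liftsAt hL) α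

end TotallyAcyclic

/-! ### Cokernels of differentials for shifts and mapping cones -/

section ShiftCone

variable {C : Type u₁} [Category.{v₁} C] [Abelian C]

lemma exists_opcycles_iso {K L : CochainComplex C ℤ} {i j i' j' : ℤ} (hi : i + 1 = j)
    (hi' : i' + 1 = j') (x : K.X i ≅ L.X i') (y : K.X j ≅ L.X j')
    (h : K.d i j ≫ y.hom = x.hom ≫ L.d i' j' ∨ K.d i j ≫ y.hom = -(x.hom ≫ L.d i' j')) :
    ∃ e : K.opcycles j ≅ L.opcycles j', K.pOpcycles j ≫ e.hom = y.hom ≫ L.pOpcycles j' := by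
  have h' : L.d i' j' ≫ y.inv = x.inv ≫ K.d i j ∨ L.d i' j' ≫ y.inv = -(x.inv ≫ K.d i j) := by
    rcases h with h | h
    · refine Or.inl ?_
      rw [Iso.comp_inv_eq, Category.assoc, h, Iso.inv_hom_id_assoc]
    · refine Or.inr ?_
      rw [Iso.comp_inv_eq, Preadditive.neg_comp, Category.assoc, h, Preadditive.comp_neg, neg_neg,
        Iso.inv_hom_id_assoc]
  have h₁ : K.d i j ≫ y.hom ≫ L.pOpcycles j' = 0 := by
    rw [← Category.assoc]
    rcases h with h | h <;> simp [h]
  have h₂ : L.d i' j' ≫ y.inv ≫ K.pOpcycles j = 0 := by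
    rw [← Category.assoc]
    rcases h' with h | h <;> simp [h]
  exact ⟨⟨K.descOpcycles _ i (by simp [← hi]) h₁, L.descOpcycles _ i' (by simp [← hi']) h₂,
    by simp [← cancel_epi (K.pOpcycles j)], by simp [← cancel_epi (L.pOpcycles j')]⟩, by simp⟩

lemma exists_shift_opcycles_iso (K : CochainComplex C ℤ) {k n m : ℤ} (h : n + k = m) :
    ∃ e : (K⟦k⟧).opcycles n ≅ K.opcycles m,
      (K⟦k⟧).pOpcycles n ≫ e.hom = (K.shiftFunctorObjXIso k n m h.symm).hom ≫ K.pOpcycles m := by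
  subst h
  refine exists_opcycles_iso (K := K⟦k⟧) (i := n - 1) (i' := n - 1 + k) (by omega) (by omega)
    (K.shiftFunctorObjXIso k _ _ rfl) _ ?_
  have hd : (K⟦k⟧).d (n - 1) n ≫ (K.shiftFunctorObjXIso k n _ rfl).hom =
      k.negOnePow • ((K.shiftFunctorObjXIso k (n - 1) _ rfl).hom ≫ K.d (n - 1 + k) (n + k)) := by
    simp only [CochainComplex.shiftFunctor_obj_d', CochainComplex.shiftFunctorObjXIso,
      HomologicalComplex.XIsoOfEq_rfl, Iso.refl_hom]
    exact (Category.comp_id _).trans (congrArg _ (Category.id_comp _).symm)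
  refine Or.imp hd.trans hd.trans ?_
  rcases k.even_or_odd with h | h
  · exact Or.inl (by rw [Int.negOnePow_even _ h, one_smul])
  · exact Or.inr (by rw [Int.negOnePow_odd _ h, Units.neg_smul, one_smul])

/-- The cokernel of a differential of a shifted complex. -/
def shiftOpcyclesIso (K : CochainComplex C ℤ) (k n m : ℤ) (h : n + k = m) :
    (K⟦k⟧).opcycles n ≅ K.opcycles m := (exists_shift_opcycles_iso K h).choose

lemma p_shiftOpcyclesIso_hom (K : CochainComplex C ℤ) (k n m : ℤ) (h : n + k = m) :
    (K⟦k⟧).pOpcycles n ≫ (shiftOpcyclesIso K k n m h).hom =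
      (K.shiftFunctorObjXIso k n m h.symm).hom ≫ K.pOpcycles m :=
  (exists_shift_opcycles_iso K h).choose_spec

lemma shiftOpcyclesIso_naturality {K L : CochainComplex C ℤ} (φ : K ⟶ L) (k n m : ℤ)
    (h : n + k = m) : HomologicalComplex.opcyclesMap (φ⟦k⟧') n ≫ (shiftOpcyclesIso L k n m h).hom =
      (shiftOpcyclesIso K k n m h).hom ≫ HomologicalComplex.opcyclesMap φ m := by
  have h₁ : (φ⟦k⟧').f n ≫ (L.shiftFunctorObjXIso k n m h.symm).hom =
      (K.shiftFunctorObjXIso k n m h.symm).hom ≫ φ.f m := by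
    subst h
    exact (Category.comp_id _).trans (Category.id_comp _).symm
  rw [← cancel_epi ((K⟦k⟧).pOpcycles n), HomologicalComplex.p_opcyclesMap_assoc,
    p_shiftOpcyclesIso_hom, reassoc_of% (p_shiftOpcyclesIso_hom K),
    HomologicalComplex.p_opcyclesMap,
    reassoc_of% h₁]

lemma opcyclesMap_fromOpcycles {K L : CochainComplex C ℤ} (φ : K ⟶ L) (n m : ℤ) :
    HomologicalComplex.opcyclesMap φ n ≫ L.fromOpcycles n m = K.fromOpcycles n m ≫ φ.f m := by
  rw [← cancel_epi (K.pOpcycles n)]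
  simp

open CochainComplex.mappingCone CochainComplex.HomComplex

variable {K L : CochainComplex C ℤ} (φ : K ⟶ L) {n m : ℤ} (hnm : n + 1 = m)

lemma d_inl_pOpcycles : K.d n m ≫ (inl φ).v m n (by omega) ≫
      (CochainComplex.mappingCone φ).pOpcycles n =
    φ.f n ≫ (inr φ).f n ≫ (CochainComplex.mappingCone φ).pOpcycles n := by
  have h := inl_v_d_assoc φ n (n - 1) m (by omega) (by omega)
    ((CochainComplex.mappingCone φ).pOpcycles n)
  rw [HomologicalComplex.d_pOpcycles, comp_zero, Preadditive.sub_comp, Category.assoc,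
    Category.assoc, eq_comm, sub_eq_zero] at h
  exact h.symm

lemma exists_desc_opcycles {W : C} (a : K.X m ⟶ W) (b : L.opcycles n ⟶ W)
    (h : K.d n m ≫ a = φ.f n ≫ L.pOpcycles n ≫ b) :
    ∃ t : (CochainComplex.mappingCone φ).opcycles n ⟶ W,
      (inl φ).v m n (by omega) ≫ (CochainComplex.mappingCone φ).pOpcycles n ≫ t = a ∧
      HomologicalComplex.opcyclesMap (inr φ) n ≫ t = b := by
  refine ⟨HomologicalComplex.descOpcycles _
    ((fst φ).1.v n m hnm ≫ a + (snd φ).v n n (add_zero n) ≫ L.pOpcycles n ≫ b) (n - 1)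
      (by simp) ?_, ?_, ?_⟩
  · rw [Preadditive.comp_add, d_fst_v_assoc φ (n - 1) n m (by omega) hnm,
      ← Category.assoc ((CochainComplex.mappingCone φ).d _ _) ((snd φ).v _ _ _),
      d_snd_v φ (n - 1) n (by omega), Preadditive.add_comp, Category.assoc, Category.assoc,
      L.d_pOpcycles_assoc, zero_comp, comp_zero, add_zero, Preadditive.neg_comp, Category.assoc, h,
      neg_add_cancel]
  · rw [HomologicalComplex.p_descOpcycles, Preadditive.comp_add, inl_v_fst_v_assoc,
      inl_v_snd_v_assoc, zero_comp, add_zero]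
  · rw [← cancel_epi (L.pOpcycles n), HomologicalComplex.p_opcyclesMap_assoc,
      HomologicalComplex.p_descOpcycles, Preadditive.comp_add, inr_f_fst_v_assoc,
      inr_f_snd_v_assoc, zero_comp, zero_add]

include hnm in
lemma opcycles_mappingCone_hom_ext {W : C}
    {s t : (CochainComplex.mappingCone φ).opcycles n ⟶ W}
    (h₁ : (inl φ).v m n (by omega) ≫ (CochainComplex.mappingCone φ).pOpcycles n ≫ s =
      (inl φ).v m n (by omega) ≫ (CochainComplex.mappingCone φ).pOpcycles n ≫ t)
    (h₂ : HomologicalComplex.opcyclesMap (inr φ) n ≫ s =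
      HomologicalComplex.opcyclesMap (inr φ) n ≫ t) : s = t := by
  rw [← cancel_epi ((CochainComplex.mappingCone φ).pOpcycles n)]
  refine ext_from φ m n hnm h₁ ?_
  rw [← HomologicalComplex.p_opcyclesMap_assoc, h₂, HomologicalComplex.p_opcyclesMap_assoc]

include hnm in
lemma mono_opcyclesMap_inr (hL : L.ExactAt n) :
    Mono (HomologicalComplex.opcyclesMap (inr φ) n) := by
  have := (shortExact_opcycles L hnm hL).mono_f
  rw [Preadditive.mono_iff_cancel_zero]
  intro Z g hg
  have h : (g ≫ L.fromOpcycles n m) ≫ (inr φ).f m = 0 := by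
    rw [Category.assoc, ← opcyclesMap_fromOpcycles, reassoc_of% hg, zero_comp]
  rw [← cancel_mono (L.fromOpcycles n m), zero_comp, ← Category.comp_id (g ≫ _),
    ← inr_f_snd_v φ m, ← Category.assoc (g ≫ _), h, zero_comp]

/-- The cokernels of a mapping cone are extensions of cokernels of the two complexes. -/
lemma shortExact_opcycles_mappingCone (hL : L.ExactAt n) :
    ∃ (p : (CochainComplex.mappingCone φ).opcycles n ⟶ K.opcycles m)
      (w : HomologicalComplex.opcyclesMap (inr φ) n ≫ p = 0),
      (inl φ).v m n (by omega) ≫ (CochainComplex.mappingCone φ).pOpcycles n ≫ p =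
        K.pOpcycles m ∧ (ShortComplex.mk _ p w).ShortExact := by
  obtain ⟨p, hp, hp'⟩ := exists_desc_opcycles φ hnm (K.pOpcycles m) (0 : L.opcycles n ⟶ _)
    (by simp)
  have := mono_opcyclesMap_inr φ hnm hL
  have hepi : Epi p := by
    have : Epi ((inl φ).v m n (by omega) ≫ (CochainComplex.mappingCone φ).pOpcycles n ≫ p) := by
      rw [hp]; infer_instance
    rw [← Category.assoc] at this
    exact epi_of_epi ((inl φ).v m n _ ≫ (CochainComplex.mappingCone φ).pOpcycles n) p
  refine ⟨p, hp', hp, ShortComplex.ShortExact.mk' (ShortComplex.exact_of_g_is_cokernel _ ?_)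
    this hepi⟩
  refine CokernelCofork.IsColimit.ofπ' _ _ fun {Z} t ht => ?_
  dsimp at t ht ⊢
  have h : K.d n m ≫ (inl φ).v m n (by omega) ≫ (CochainComplex.mappingCone φ).pOpcycles n ≫ t =
      0 := by
    have h₁ := d_inl_pOpcycles φ hnm
    rw [← HomologicalComplex.p_opcyclesMap] at h₁
    have h₂ := congrArg (fun k => k ≫ t) h₁
    simp only [Category.assoc] at h₂
    rw [h₂, ht, comp_zero, comp_zero]
  refine ⟨K.descOpcycles _ n (by simp [← hnm]) h, ?_⟩
  refine opcycles_mappingCone_hom_ext φ hnm ?_ ?_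
  · rw [reassoc_of% hp, HomologicalComplex.p_descOpcycles]
  · rw [ht, ← Category.assoc, hp', zero_comp]

/-- If a morphism of complexes induces a short exact sequence of cokernels, then the last term of
this sequence is the quotient of the cokernel of the mapping cone by a term of the complex. -/
lemma shortExact_inl_mappingCone (hK : K.ExactAt n) (hK' : K.ExactAt m) (hL : L.ExactAt n)
    {Z : C} {g : L.opcycles n ⟶ Z} (w : HomologicalComplex.opcyclesMap φ n ≫ g = 0)
    (h : (ShortComplex.mk _ _ w).ShortExact) :
    ∃ (κ : (CochainComplex.mappingCone φ).opcycles n ⟶ Z)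
      (w : ((inl φ).v m n (by omega) ≫ (CochainComplex.mappingCone φ).pOpcycles n) ≫ κ = 0),
      HomologicalComplex.opcyclesMap (inr φ) n ≫ κ = g ∧ (ShortComplex.mk _ _ w).ShortExact := by
  have hφ : φ.f n ≫ L.pOpcycles n ≫ g = 0 := by
    rw [← HomologicalComplex.p_opcyclesMap_assoc, w, comp_zero]
  obtain ⟨κ, h₁, h₂⟩ := exists_desc_opcycles φ hnm (0 : K.X m ⟶ Z) g (by rw [hφ, comp_zero])
  have hg : Epi g := h.epi_g
  have hf : Mono (HomologicalComplex.opcyclesMap φ n) := h.mono_f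
  have hr := mono_opcyclesMap_inr φ hnm hL
  have hepi : Epi κ := by
    rw [← h₂] at hg
    exact epi_of_epi (HomologicalComplex.opcyclesMap (inr φ) n) κ
  -- if `t` becomes zero in the cokernel of the cone, then `t` is a cycle, hence a boundary `t'`,
  -- and `t'` becomes zero under the composite of two monomorphisms
  have hmono : Mono ((inl φ).v m n (by omega) ≫
      (CochainComplex.mappingCone φ).pOpcycles n) := by
    rw [Preadditive.mono_iff_cancel_zero]
    intro Z t ht
    have h₃ : t ≫ (φ.f m ≫ (inr φ).f m - K.d m (m + 1) ≫ (inl φ).v (m + 1) m (by omega)) = 0 := by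
      rw [← inl_v_d φ m n (m + 1) (by omega) (by omega),
        ← (CochainComplex.mappingCone φ).p_fromOpcycles]
      simpa using congrArg (fun k => k ≫ (CochainComplex.mappingCone φ).fromOpcycles n m) ht
    have h₄ : t ≫ K.d m (m + 1) = 0 := by
      have := congrArg (fun k => k ≫ (fst φ).1.v m (m + 1) rfl) h₃
      simpa [Preadditive.sub_comp] using this
    have hc := (shortExact_opcycles K hnm hK)
    have hd := (shortExact_opcycles K (n := m) rfl hK').mono_f
    have h₅ : t ≫ K.pOpcycles m = 0 := by
      rw [← K.p_fromOpcycles] at h₄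
      dsimp at hd
      rw [← cancel_mono (K.fromOpcycles m (m + 1)), Category.assoc, h₄, zero_comp]
    obtain ⟨t', ht'⟩ : ∃ t' : Z ⟶ K.opcycles n, t' ≫ K.fromOpcycles n m = t :=
      have := hc.mono_f
      ⟨hc.exact.lift t h₅, hc.exact.lift_f _ _⟩
    have h₆ : K.fromOpcycles n m ≫ (inl φ).v m n (by omega) ≫
        (CochainComplex.mappingCone φ).pOpcycles n =
        HomologicalComplex.opcyclesMap φ n ≫ HomologicalComplex.opcyclesMap (inr φ) n := by
      rw [← cancel_epi (K.pOpcycles n), HomologicalComplex.p_opcyclesMap_assoc,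
        HomologicalComplex.p_opcyclesMap, K.p_fromOpcycles_assoc, d_inl_pOpcycles φ hnm]
    rw [← ht', Category.assoc, h₆, ← Category.assoc] at ht
    rw [← ht', zero_of_comp_mono _ (zero_of_comp_mono _ ht), zero_comp]
  refine ⟨κ, by rw [Category.assoc, h₁], h₂,
    ShortComplex.ShortExact.mk' (ShortComplex.exact_of_g_is_cokernel _ ?_) hmono hepi⟩
  refine CokernelCofork.IsColimit.ofπ' _ _ fun {Z} t ht => ?_
  dsimp at t ht ⊢
  rw [Category.assoc] at ht
  have h₃ : HomologicalComplex.opcyclesMap φ n ≫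
      HomologicalComplex.opcyclesMap (inr φ) n ≫ t = 0 := by
    rw [← cancel_epi (K.pOpcycles n), HomologicalComplex.p_opcyclesMap_assoc,
      HomologicalComplex.p_opcyclesMap_assoc, comp_zero]
    have := congrArg (fun k => k ≫ t) (d_inl_pOpcycles φ hnm)
    simpa [ht] using this.symm
  refine ⟨h.exact.desc _ h₃, opcycles_mappingCone_hom_ext φ hnm ?_ ?_⟩
  · rw [reassoc_of% h₁, zero_comp, ht]
  · rw [reassoc_of% h₂]
    exact h.exact.g_desc _ _

end ShiftCone

section

variable {C : Type u₁} [Category.{v₁} C] [Abelian C] {E : ObjectProperty C}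
  [hE : IsAdditiveSubcategory E]

lemma IsTotallyAcyclic.shift {K : CochainComplex C ℤ} (hK : IsTotallyAcyclic E K) (k : ℤ) :
    IsTotallyAcyclic E (K⟦k⟧) where
  projective n := hK.projective (n + k)
  mem n := hK.mem (n + k)
  acyclic := by
    have h := hK.acyclic
    rw [← HomotopyCategory.quotient_obj_mem_subcategoryAcyclic_iff_acyclic] at h ⊢
    exact ObjectProperty.prop_of_iso _ (((HomotopyCategory.quotient C _).commShiftIso k).symm.app K)
      ((HomotopyCategory.subcategoryAcyclic C).le_shift k _ h)
  opcycles n := hE.of_iso (shiftOpcyclesIso K k n _ rfl).symm (hK.opcycles _)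

lemma acyclic_mappingCone {K L : CochainComplex C ℤ} (φ : K ⟶ L) (hK : K.Acyclic)
    (hL : L.Acyclic) : (CochainComplex.mappingCone φ).Acyclic := by
  rw [← HomotopyCategory.quotient_obj_mem_subcategoryAcyclic_iff_acyclic] at hK hL ⊢
  exact ObjectProperty.ext_of_isTriangulatedClosed₃ (HomotopyCategory.subcategoryAcyclic C) _
    (HomotopyCategory.mappingCone_triangleh_distinguished φ) hK hL

lemma IsTotallyAcyclic.mappingCone [E.IsClosedUnderExtensions] {K L : CochainComplex C ℤ}
    (φ : K ⟶ L) (hK : IsTotallyAcyclic E K) (hL : IsTotallyAcyclic E L) :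
    IsTotallyAcyclic E (CochainComplex.mappingCone φ) where
  projective n :=
    have := hK.projective (n + 1)
    have := hL.projective n
    Projective.of_iso (HomologicalComplex.homotopyCofiber.XIsoBiprod φ n (n + 1) rfl).symm
      inferInstance
  mem n := hE.of_iso (HomologicalComplex.homotopyCofiber.XIsoBiprod φ n (n + 1) rfl).symm
      (hE.biprod _ _ (hK.mem _) (hL.mem _))
  acyclic := acyclic_mappingCone φ hK.acyclic hL.acyclic
  opcycles n := by
    obtain ⟨p, w, -, h⟩ := shortExact_opcycles_mappingCone φ (n := n) rfl (hL.acyclic n)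
    exact ObjectProperty.prop_X₂_of_shortExact E h (hL.opcycles n) (hK.opcycles _)

lemma isTotallyAcyclic_zero : IsTotallyAcyclic E (0 : CochainComplex C ℤ) := by
  have h : IsZero (0 : CochainComplex C ℤ) := isZero_zero _
  have hX (n : ℤ) : IsZero ((0 : CochainComplex C ℤ).X n) :=
    Functor.map_isZero (HomologicalComplex.eval C (ComplexShape.up ℤ) n) h
  exact ⟨fun n => (hX n).projective, fun n => hE.of_isZero _ (hX n), 
    HomologicalComplex.acyclic_of_isZero _ h, fun n => hE.of_isZero _ (Functor.map_isZero
      (HomologicalComplex.opcyclesFunctor C (ComplexShape.up ℤ) n) h)⟩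

/-- The totally acyclic complexes, as a triangulated subcategory of the homotopy category. -/
instance [E.IsClosedUnderExtensions] : (homotopyProp (IsTotallyAcyclic E)).IsTriangulated :=
  homotopyProp_isTriangulated _ isTotallyAcyclic_zero (fun _ hK n => hK.shift n)
    fun _ _ f hK hL => hK.mappingCone f hL

end

/-! ### Complete resolutions -/

section Resolution

variable {C : Type u₁} [Category.{v₁} C] [Abelian C]

section

variable {E : ObjectProperty C} [hF : IsFrobeniusSubcategory E] {K L : CochainComplex C ℤ}

lemma quotient_map_eq_iff (hK : IsTotallyAcyclic E K) (hL : IsTotallyAcyclic E L) {f g : K ⟶ L}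
    (n : ℤ) : (HomotopyCategory.quotient C (ComplexShape.up ℤ)).map f =
      (HomotopyCategory.quotient C (ComplexShape.up ℤ)).map g ↔
      StablyEq (HomologicalComplex.opcyclesMap f n) (HomologicalComplex.opcyclesMap g n) :=
  ⟨fun h => stablyEq_opcyclesMap hL.projective (HomotopyCategory.homotopyOfEq _ _ h) n,
    fun h => HomotopyCategory.eq_of_homotopy _ _ (hK.homotopy hL n h).some⟩

lemma quotient_map_eq_of_iso (hK : IsTotallyAcyclic E K) (hL : IsTotallyAcyclic E L) {f g : K ⟶ L}
    {n : ℤ} {W : C} (e : L.opcycles n ≅ W)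
    (h : StablyEq (HomologicalComplex.opcyclesMap f n ≫ e.hom)
      (HomologicalComplex.opcyclesMap g n ≫ e.hom)) :
    (HomotopyCategory.quotient C (ComplexShape.up ℤ)).map f =
      (HomotopyCategory.quotient C (ComplexShape.up ℤ)).map g := by
  rw [quotient_map_eq_iff hK hL n]
  simpa using h.comp_right e.inv

/-- Two morphisms are mutually inverse modulo projectives. -/
def StablyInverse {X Y : C} (α : X ⟶ Y) (β : Y ⟶ X) : Prop :=
  StablyEq (α ≫ β) (𝟙 X) ∧ StablyEq (β ≫ α) (𝟙 Y)

lemma StablyInverse.comp {X Y Z : C} {α : X ⟶ Y} {β : Y ⟶ X} {γ : Y ⟶ Z} {δ : Z ⟶ Y}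
    (h : StablyInverse α β) (h' : StablyInverse γ δ) : StablyInverse (α ≫ γ) (δ ≫ β) := by
  refine ⟨StablyEq.trans ?_ h.1, StablyEq.trans ?_ h'.2⟩
  · simpa using (h'.1.comp_left α).comp_right β
  · simpa using (h.2.comp_left δ).comp_right γ

lemma StablyInverse.of_iso {X Y : C} (e : X ≅ Y) : StablyInverse e.hom e.inv :=
  ⟨.of_eq e.hom_inv_id, .of_eq e.inv_hom_id⟩

lemma isIso_quotient_map (hK : IsTotallyAcyclic E K) (hL : IsTotallyAcyclic E L) (f : K ⟶ L) (n : ℤ)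
    (β : L.opcycles n ⟶ K.opcycles n)
    (h : StablyInverse (HomologicalComplex.opcyclesMap f n) β) :
    IsIso ((HomotopyCategory.quotient C (ComplexShape.up ℤ)).map f) := by
  obtain ⟨g, rfl⟩ := hL.exists_opcyclesMap_eq hK n β
  refine ⟨(HomotopyCategory.quotient C (ComplexShape.up ℤ)).map g, ?_, ?_⟩
  · rw [← CategoryTheory.Functor.map_comp, ← CategoryTheory.Functor.map_id,
      quotient_map_eq_iff hK hK n, HomologicalComplex.opcyclesMap_comp,
      HomologicalComplex.opcyclesMap_id]
    exact h.1
  · rw [← CategoryTheory.Functor.map_comp, ← CategoryTheory.Functor.map_id,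
      quotient_map_eq_iff hL hL n, HomologicalComplex.opcyclesMap_comp,
      HomologicalComplex.opcyclesMap_id]
    exact h.2

/-- Totally acyclic complexes with isomorphic cokernels of differentials are homotopy equivalent. -/
lemma nonempty_quotient_obj_iso (hK : IsTotallyAcyclic E K) (hL : IsTotallyAcyclic E L) {n : ℤ}
    (e : K.opcycles n ≅ L.opcycles n) :
    Nonempty ((HomotopyCategory.quotient C (ComplexShape.up ℤ)).obj K ≅
      (HomotopyCategory.quotient C (ComplexShape.up ℤ)).obj L) := by
  obtain ⟨f, hf⟩ := hK.exists_opcyclesMap_eq hL n e.hom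
  have := isIso_quotient_map hK hL f n e.inv (hf ▸ .of_iso e)
  exact ⟨asIso ((HomotopyCategory.quotient C (ComplexShape.up ℤ)).map f)⟩

/-- A short exact sequence in a Frobenius category with projective first term is split. -/
lemma exists_stablyInverse_of_shortExact {S : ShortComplex C} (hS : S.ShortExact) (h₁ : E S.X₁)
    (h₂ : E S.X₂) (h₃ : E S.X₃) [Projective S.X₁] : ∃ β, StablyInverse S.g β := by
  obtain ⟨r, hr⟩ := hF.extend S hS h₁ h₂ h₃ S.X₁ h₁ inferInstance (𝟙 _)
  let s := ShortComplex.Splitting.ofExactOfRetraction S hS.exact r hr hS.epi_g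
  refine ⟨s.s, StablyEq.symm ⟨S.X₁, inferInstance, s.r, S.f, ?_⟩, .of_eq s.s_g⟩
  rw [← s.id]
  abel

end

variable (E : ObjectProperty C) [hF : IsFrobeniusSubcategory E] [hE : IsAdditiveSubcategory E]

lemma isClosedUnderIsomorphisms_of_isAdditiveSubcategory : E.IsClosedUnderIsomorphisms :=
  ⟨fun e h => hE.of_iso e h⟩

/-- A chosen complete resolution of an object of `E`. -/
def completeResolution (X : E.FullSubcategory) : CochainComplex C ℤ :=
  (exists_isTotallyAcyclic (isClosedUnderIsomorphisms_of_isAdditiveSubcategory E) X.obj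
    X.property).choose

lemma isTotallyAcyclic_completeResolution (X : E.FullSubcategory) :
    IsTotallyAcyclic E (completeResolution E X) :=
  (exists_isTotallyAcyclic (isClosedUnderIsomorphisms_of_isAdditiveSubcategory E) X.obj
    X.property).choose_spec.1

/-- The object is recovered from its complete resolution as the cokernel of a differential. -/
def completeResolutionIso (X : E.FullSubcategory) :
    (completeResolution E X).opcycles 0 ≅ X.obj :=
  (exists_isTotallyAcyclic (isClosedUnderIsomorphisms_of_isAdditiveSubcategory E) X.obj
    X.property).choose_spec.2.some

variable {E}

lemma exists_resolutionMap {K L : CochainComplex C ℤ} (hK : IsTotallyAcyclic E K)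
    (hL : IsTotallyAcyclic E L) {n : ℤ} {X Y : C} (a : K.opcycles n ⟶ X) (e : L.opcycles n ≅ Y)
    (f : X ⟶ Y) : ∃ φ : K ⟶ L, HomologicalComplex.opcyclesMap φ n ≫ e.hom = a ≫ f := by
  obtain ⟨φ, hφ⟩ := hK.exists_opcyclesMap_eq hL n (a ≫ f ≫ e.inv)
  exact ⟨φ, by simp [hφ]⟩

/-- A chain map between the complete resolutions that is induced by a morphism. -/
def resolutionMap {X Y : E.FullSubcategory} (f : X ⟶ Y) :
    completeResolution E X ⟶ completeResolution E Y :=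
  (exists_resolutionMap (isTotallyAcyclic_completeResolution E X)
    (isTotallyAcyclic_completeResolution E Y) (completeResolutionIso E X).hom
    (completeResolutionIso E Y) f.hom).choose

lemma resolutionMap_spec {X Y : E.FullSubcategory} (f : X ⟶ Y) :
    HomologicalComplex.opcyclesMap (resolutionMap f) 0 ≫ (completeResolutionIso E Y).hom =
      (completeResolutionIso E X).hom ≫ f.hom :=
  (exists_resolutionMap (isTotallyAcyclic_completeResolution E X)
    (isTotallyAcyclic_completeResolution E Y) (completeResolutionIso E X).hom
    (completeResolutionIso E Y) f.hom).choose_spec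

lemma quotient_map_resolutionMap_eq {X Y : E.FullSubcategory} (f : X ⟶ Y)
    (φ : completeResolution E X ⟶ completeResolution E Y)
    (h : StablyEq (HomologicalComplex.opcyclesMap φ 0 ≫ (completeResolutionIso E Y).hom)
      ((completeResolutionIso E X).hom ≫ f.hom)) :
    (HomotopyCategory.quotient C (ComplexShape.up ℤ)).map (resolutionMap f) =
      (HomotopyCategory.quotient C (ComplexShape.up ℤ)).map φ := by
  refine quotient_map_eq_of_iso (isTotallyAcyclic_completeResolution E X)
    (isTotallyAcyclic_completeResolution E Y) (completeResolutionIso E Y) ?_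
  rw [resolutionMap_spec]
  exact h.symm

variable (E) in
/-- The functor that sends an object of the stable category to a complete resolution. -/
def resolutionFunctor : StableCat E ⥤ HomotopyCategory C (ComplexShape.up ℤ) :=
  CategoryTheory.Quotient.lift _
    { obj := fun X => (HomotopyCategory.quotient C (ComplexShape.up ℤ)).obj (completeResolution E X)
      map := fun f => (HomotopyCategory.quotient C (ComplexShape.up ℤ)).map (resolutionMap f)
      map_id := fun X => by
        rw [← CategoryTheory.Functor.map_id]
        exact quotient_map_resolutionMap_eq _ _ (.of_eq (by simp))
      map_comp := fun {X Y Z} f g => by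
        rw [← CategoryTheory.Functor.map_comp]
        refine quotient_map_resolutionMap_eq _ _ (.of_eq ?_)
        rw [HomologicalComplex.opcyclesMap_comp, Category.assoc, resolutionMap_spec,
          reassoc_of% (resolutionMap_spec f)]
        rfl }
    (by
      intro X Y f g h
      refine quotient_map_resolutionMap_eq _ _ ?_
      rw [resolutionMap_spec]
      exact (((stableRel_iff E (exists_cover_of_isFrobeniusSubcategory E) f g).1 h).comp_left
        _).symm)

instance : (resolutionFunctor E).Full where
  map_surjective {X Y} φ := by
    obtain ⟨X⟩ := X
    obtain ⟨Y⟩ := Y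
    obtain ⟨φ : completeResolution E X ⟶ completeResolution E Y, rfl⟩ :=
      (HomotopyCategory.quotient C (ComplexShape.up ℤ)).map_surjective φ
    refine ⟨(toStable E).map (ObjectProperty.homMk ((completeResolutionIso E X).inv ≫
      HomologicalComplex.opcyclesMap φ 0 ≫ (completeResolutionIso E Y).hom)), ?_⟩
    exact quotient_map_resolutionMap_eq _ _ (.of_eq (by simp))

instance : (resolutionFunctor E).Faithful where
  map_injective {X Y} f g h := by
    obtain ⟨f, rfl⟩ := (toStable E).map_surjective f
    obtain ⟨g, rfl⟩ := (toStable E).map_surjective g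
    rw [toStable_map_eq_iff _ (exists_cover_of_isFrobeniusSubcategory E)]
    have h' := ((quotient_map_eq_iff (isTotallyAcyclic_completeResolution E _)
      (isTotallyAcyclic_completeResolution E _) 0).1 h).comp_right (completeResolutionIso E _).hom
    erw [resolutionMap_spec, resolutionMap_spec] at h'
    simpa using h'.comp_left (completeResolutionIso E _).inv

lemma resolutionFunctor_obj_mem (X : StableCat E) :
    homotopyProp (IsTotallyAcyclic E) ((resolutionFunctor E).obj X) :=
  isTotallyAcyclic_completeResolution E X.as

lemma essImage_resolutionFunctor {K : CochainComplex C ℤ} (hK : IsTotallyAcyclic E K) :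
    (resolutionFunctor E).essImage ((HomotopyCategory.quotient C (ComplexShape.up ℤ)).obj K) :=
  ⟨(toStable E).obj ⟨K.opcycles 0, hK.opcycles 0⟩, nonempty_quotient_obj_iso
    (isTotallyAcyclic_completeResolution E _) hK
    (completeResolutionIso E ⟨K.opcycles 0, hK.opcycles 0⟩)⟩

end Resolution

/-! ### Exactness of complete resolutions -/

section ResolutionExact

variable {C : Type u₁} [Category.{v₁} C] [Abelian C] {E : ObjectProperty C}
  [hF : IsFrobeniusSubcategory E] [hE : IsAdditiveSubcategory E]

/-- The exact sequence `0 ⟶ X ⟶ S¹ ⟶ S¹/X ⟶ 0` for the complete resolution `S` of `X`. -/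
abbrev completeResolutionSeq (X : E.FullSubcategory) : ShortComplex C :=
  ShortComplex.mk ((completeResolution E X).fromOpcycles 0 1)
    ((completeResolution E X).pOpcycles 1) (by
      rw [← cancel_epi ((completeResolution E X).pOpcycles 0)]
      simp)

lemma shortExact_completeResolution (X : E.FullSubcategory) :
    (completeResolutionSeq X).ShortExact :=
  shortExact_opcycles (completeResolution E X) (n := 0) (m := 1) rfl
    ((isTotallyAcyclic_completeResolution E X).acyclic 0)

variable (E) in
lemma exists_suspComparison (X : E.FullSubcategory) :
    ∃ (b : (completeResolution E X).X 1 ⟶ suspQ E X)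
      (c : (completeResolution E X).opcycles 1 ⟶ suspN E X),
      (completeResolution E X).fromOpcycles 0 1 ≫ b =
        (completeResolutionIso E X).hom ≫ suspI E X ∧
      (completeResolution E X).pOpcycles 1 ≫ c = b ≫ suspP E X := by
  have h := isTotallyAcyclic_completeResolution E X
  obtain ⟨-, hX₁, hX₂, hX₃⟩ := suspSeq_spec E X
  have hS := shortExact_completeResolution X
  obtain ⟨b, hb⟩ := hF.extend _ hS (h.opcycles 0) (h.mem 1) (h.opcycles 1) _ hX₁ hX₂
    ((completeResolutionIso E X).hom ≫ suspI E X)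
  dsimp at hb
  have := hS.epi_g
  refine ⟨b, hS.exact.desc (b ≫ suspP E X) ?_, hb, hS.exact.g_desc _ _⟩
  dsimp
  rw [reassoc_of% hb, suspI_suspP, comp_zero]

/-- The comparison between the cokernels in `0 ⟶ X ⟶ S¹ ⟶ S¹/X ⟶ 0` for a complete resolution `S`
of `X` and in the chosen sequence `0 ⟶ X ⟶ Q ⟶ ΣX ⟶ 0`. -/
def suspComparison (X : E.FullSubcategory) :
    (completeResolution E X).opcycles 1 ⟶ suspN E X :=
  (exists_suspComparison E X).choose_spec.choose

lemma suspComparison_spec (X : E.FullSubcategory) :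
    ∃ b : (completeResolution E X).X 1 ⟶ suspQ E X,
      (completeResolution E X).fromOpcycles 0 1 ≫ b =
        (completeResolutionIso E X).hom ≫ suspI E X ∧
      (completeResolution E X).pOpcycles 1 ≫ suspComparison X = b ≫ suspP E X :=
  ⟨_, (exists_suspComparison E X).choose_spec.choose_spec⟩

/-- The comparison of cokernels is a stable equivalence since both middle terms are projective and
injective relative to `E`. -/
lemma exists_stablyInverse_suspComparison (X : E.FullSubcategory) :
    ∃ β, StablyInverse (suspComparison X) β := by
  have h := isTotallyAcyclic_completeResolution E X
  obtain ⟨hX, hX₁, hX₂, hX₃⟩ := suspSeq_spec E X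
  have hS := shortExact_completeResolution X
  have hp : Projective ((completeResolution E X).X 1) := h.projective 1
  obtain ⟨b, hb, hc⟩ := suspComparison_spec X
  obtain ⟨b', hb'⟩ := hF.extend _ hX X.property hX₁ hX₃ _ (h.mem 1) (h.projective 1)
    ((completeResolutionIso E X).inv ≫ (completeResolution E X).fromOpcycles 0 1)
  dsimp at hb'
  have := hX.epi_g
  obtain ⟨c', hc'⟩ : ∃ c', suspP E X ≫ c' = b' ≫ (completeResolution E X).pOpcycles 1 := by
    refine ⟨hX.exact.desc (b' ≫ (completeResolution E X).pOpcycles 1) ?_, hX.exact.g_desc _ _⟩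
    have := (completeResolutionSeq X).zero
    dsimp at this ⊢
    rw [reassoc_of% hb', this, comp_zero]
  refine ⟨c', StablyEq.of_shortExact (E := E) hS (h.opcycles 0) (h.mem 1) (h.opcycles 1)
    (h.opcycles 0) (.of_eq rfl) (f := 𝟙 _) (f' := 𝟙 _) (b := b ≫ b') (b' := 𝟙 _) ?_ ?_ ?_ ?_,
    StablyEq.of_shortExact (E := E) hX X.property hX₁ hX₃ X.property (.of_eq rfl)
    (f := 𝟙 _) (f' := 𝟙 _) (b := b' ≫ b) (b' := 𝟙 _) ?_ ?_ ?_ ?_⟩ <;> dsimp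
  · rw [reassoc_of% hb, hb']; simp
  · rw [reassoc_of% hc, hc', Category.assoc]
  · simp
  · simp
  · rw [reassoc_of% hb', hb]; simp
  · rw [reassoc_of% hc', hc, Category.assoc]
  · simp
  · simp

/-- The comparison between the shift of a complete resolution of `X` and
a complete resolution of `ΣX`. -/
def resolutionShiftMap (X : E.FullSubcategory) :
    (completeResolution E X)⟦(1 : ℤ)⟧ ⟶ completeResolution E (suspObj E X) :=
  (exists_resolutionMap ((isTotallyAcyclic_completeResolution E X).shift 1)
    (isTotallyAcyclic_completeResolution E (suspObj E X))
    (shiftOpcyclesIso (completeResolution E X) 1 0 1 rfl).hom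
    (completeResolutionIso E (suspObj E X)) (suspComparison X)).choose

lemma resolutionShiftMap_spec (X : E.FullSubcategory) :
    HomologicalComplex.opcyclesMap (resolutionShiftMap X) 0 ≫
      (completeResolutionIso E (suspObj E X)).hom =
      (shiftOpcyclesIso (completeResolution E X) 1 0 1 rfl).hom ≫ suspComparison X :=
  (exists_resolutionMap ((isTotallyAcyclic_completeResolution E X).shift 1)
    (isTotallyAcyclic_completeResolution E (suspObj E X))
    (shiftOpcyclesIso (completeResolution E X) 1 0 1 rfl).hom
    (completeResolutionIso E (suspObj E X)) (suspComparison X)).choose_spec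

instance (X : E.FullSubcategory) :
    IsIso ((HomotopyCategory.quotient C (ComplexShape.up ℤ)).map (resolutionShiftMap X)) := by
  obtain ⟨β, hβ⟩ := exists_stablyInverse_suspComparison X
  refine isIso_quotient_map ((isTotallyAcyclic_completeResolution E X).shift 1)
    (isTotallyAcyclic_completeResolution E (suspObj E X)) _ 0
    ((completeResolutionIso E (suspObj E X)).hom ≫ β ≫
      (shiftOpcyclesIso (completeResolution E X) 1 0 1 rfl).inv) ?_
  have h : HomologicalComplex.opcyclesMap (resolutionShiftMap X) 0 =
      (shiftOpcyclesIso (completeResolution E X) 1 0 1 rfl).hom ≫ suspComparison X ≫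
        (completeResolutionIso E (suspObj E X)).inv := by
    rw [← Category.assoc, Iso.eq_comp_inv, resolutionShiftMap_spec]
  rw [h]
  simpa using (StablyInverse.of_iso (shiftOpcyclesIso (completeResolution E X) 1 0 1 rfl)).comp
    (hβ.comp (StablyInverse.of_iso (completeResolutionIso E (suspObj E X)).symm))

/-- Naturality can be tested on the cokernels in degree `0`, where it says that the two ways to
extend a morphism to the suspensions agree stably. -/
lemma resolutionShiftMap_naturality {X Y : E.FullSubcategory} (f : X ⟶ Y) :
    (HomotopyCategory.quotient C (ComplexShape.up ℤ)).map (resolutionShiftMap X) ≫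
      (HomotopyCategory.quotient C (ComplexShape.up ℤ)).map (resolutionMap (suspMap f)) =
    (HomotopyCategory.quotient C (ComplexShape.up ℤ)).map ((resolutionMap f)⟦(1 : ℤ)⟧') ≫
      (HomotopyCategory.quotient C (ComplexShape.up ℤ)).map (resolutionShiftMap Y) := by
  rw [← CategoryTheory.Functor.map_comp, ← CategoryTheory.Functor.map_comp]
  refine quotient_map_eq_of_iso ((isTotallyAcyclic_completeResolution E X).shift 1)
    (isTotallyAcyclic_completeResolution E (suspObj E Y))
    (completeResolutionIso E (suspObj E Y)) ?_
  rw [HomologicalComplex.opcyclesMap_comp, HomologicalComplex.opcyclesMap_comp, Category.assoc,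
    Category.assoc, resolutionMap_spec, reassoc_of% (resolutionShiftMap_spec X),
    resolutionShiftMap_spec, reassoc_of% (shiftOpcyclesIso_naturality)]
  refine StablyEq.comp_left _ ?_
  have h := isTotallyAcyclic_completeResolution E X
  obtain ⟨hY, hY₁, hY₂, hY₃⟩ := suspSeq_spec E Y
  obtain ⟨b, hb, hc⟩ := suspComparison_spec X
  obtain ⟨b', hb', hc'⟩ := suspComparison_spec Y
  obtain ⟨d, hd, hd'⟩ := suspMap_spec f
  refine StablyEq.of_shortExact (E := E) (T := suspSeq E Y) (shortExact_completeResolution X)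
    (h.opcycles 0) (h.mem 1) (h.opcycles 1) Y.property
    (f := (completeResolutionIso E X).hom ≫ f.hom) (.of_eq rfl)
    (b := b ≫ d) (b' := (resolutionMap f).f 1 ≫ b') ?_ ?_ ?_ ?_ <;> dsimp
  · rw [reassoc_of% hb, hd, Category.assoc]
  · rw [reassoc_of% hc, hd', Category.assoc]
  · rw [← reassoc_of% (opcyclesMap_fromOpcycles), hb',
      reassoc_of% (resolutionMap_spec f), Category.assoc]
  · rw [HomologicalComplex.p_opcyclesMap_assoc, hc', Category.assoc]

variable (E) in
/-- The compatibility of complete resolutions with the suspension functors. -/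
def resolutionSuspIso : stableSusp E ⋙ resolutionFunctor E ≅
    resolutionFunctor E ⋙ shiftFunctor (HomotopyCategory C (ComplexShape.up ℤ)) (1 : ℤ) :=
  NatIso.ofComponents (fun X =>
    (asIso ((HomotopyCategory.quotient C (ComplexShape.up ℤ)).map
      (resolutionShiftMap X.as))).symm ≪≫
      ((HomotopyCategory.quotient C (ComplexShape.up ℤ)).commShiftIso (1 : ℤ)).app
        (completeResolution E X.as)) (by
    intro X Y f
    obtain ⟨f, rfl⟩ := (toStable E).map_surjective f
    change (HomotopyCategory.quotient C (ComplexShape.up ℤ)).map (resolutionMap (suspMap f)) ≫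
      inv ((HomotopyCategory.quotient C (ComplexShape.up ℤ)).map (resolutionShiftMap Y.as)) ≫
        ((HomotopyCategory.quotient C (ComplexShape.up ℤ)).commShiftIso (1 : ℤ)).hom.app _ =
      (inv ((HomotopyCategory.quotient C (ComplexShape.up ℤ)).map (resolutionShiftMap X.as)) ≫
        ((HomotopyCategory.quotient C (ComplexShape.up ℤ)).commShiftIso (1 : ℤ)).hom.app _) ≫
      ((HomotopyCategory.quotient C (ComplexShape.up ℤ)).map (resolutionMap f))⟦(1 : ℤ)⟧'
    rw [Category.assoc, IsIso.eq_inv_comp, ← Functor.commShiftIso_hom_naturality,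
      ← Category.assoc, resolutionShiftMap_naturality, Category.assoc, IsIso.hom_inv_id_assoc])

open CochainComplex.mappingCone CochainComplex.HomComplex

/-- The complete resolution of a standard exact triangle of the stable category is distinguished:
the complete resolution of `Z` is homotopy equivalent to the mapping cone of the complete
resolution of `f`, since both have stably isomorphic cokernels. -/
lemma resolutionFunctor_distinguished {X Y Z : E.FullSubcategory} (f : X ⟶ Y) (g : Y ⟶ Z)
    (w : f.hom ≫ g.hom = 0) (hS : (ShortComplex.mk f.hom g.hom w).ShortExact)
    (b : Y.obj ⟶ suspQ E X) (c : Z ⟶ suspObj E X) (hb : f.hom ≫ b = suspI E X)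
    (hc : g.hom ≫ c.hom = b ≫ suspP E X) [E.IsClosedUnderExtensions] :
    Triangle.mk ((resolutionFunctor E).map ((toStable E).map f))
      ((resolutionFunctor E).map ((toStable E).map g))
      ((resolutionFunctor E).map ((toStable E).map c) ≫
        (resolutionSuspIso E).hom.app ((toStable E).obj X)) ∈
      distTriang (HomotopyCategory C (ComplexShape.up ℤ)) := by
  let φ := resolutionMap f
  have hφ := resolutionMap_spec f
  have hX := isTotallyAcyclic_completeResolution E X
  have hY := isTotallyAcyclic_completeResolution E Y
  have hZ := isTotallyAcyclic_completeResolution E Z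
  have hX' := isTotallyAcyclic_completeResolution E (suspObj E X)
  have hC := hX.mappingCone φ hY
  have w' : HomologicalComplex.opcyclesMap φ 0 ≫ (completeResolutionIso E Y).hom ≫ g.hom = 0 := by
    rw [reassoc_of% hφ, w, comp_zero]
  let e : ShortComplex.mk _ _ w' ≅ ShortComplex.mk f.hom g.hom w :=
    ShortComplex.isoMk (completeResolutionIso E X) (completeResolutionIso E Y) (Iso.refl _)
      hφ.symm (by simp)
  have hS' : (ShortComplex.mk _ _ w').ShortExact := ShortComplex.shortExact_of_iso e.symm hS
  obtain ⟨κ, wκ, hκ, hSκ⟩ := shortExact_inl_mappingCone φ (n := 0) (m := 1) rfl (hX.acyclic 0)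
    (hX.acyclic 1) (hY.acyclic 0) w' hS'
  have h₁ : Projective ((completeResolution E X).X 1) := hX.projective 1
  obtain ⟨κ', hκ'⟩ := exists_stablyInverse_of_shortExact (E := E) hSκ (hX.mem 1) (hC.opcycles 0)
    Z.property
  obtain ⟨pr, wpr, hpr, -⟩ := shortExact_opcycles_mappingCone φ (n := 0) (m := 1) rfl
    (hY.acyclic 0)
  obtain ⟨χ, hχ⟩ := exists_resolutionMap hC hZ κ (completeResolutionIso E Z) (𝟙 _)
  rw [Category.comp_id] at hχ
  -- `χ` identifies the mapping cone with the complete resolution of `Z`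
  let Q := HomotopyCategory.quotient C (ComplexShape.up ℤ)
  have hχ' : IsIso (Q.map χ) := by
    refine isIso_quotient_map hC hZ χ 0 ((completeResolutionIso E Z).hom ≫ κ') ?_
    rw [(Iso.eq_comp_inv (completeResolutionIso E Z)).2 hχ]
    exact hκ'.comp (.of_iso (completeResolutionIso E Z).symm)
  have hinr : Q.map (inr φ) ≫ Q.map χ = Q.map (resolutionMap g) := by
    rw [← CategoryTheory.Functor.map_comp]
    refine quotient_map_eq_of_iso hY hZ (completeResolutionIso E Z) (.of_eq ?_)
    rw [HomologicalComplex.opcyclesMap_comp, Category.assoc, hχ, hκ, resolutionMap_spec]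
  obtain ⟨δ, hδ₀, hδ₁, hδ₂⟩ :
      ∃ δ : CochainComplex.mappingCone φ ⟶ (completeResolution E X)⟦(1 : ℤ)⟧,
      δ = (triangle φ).mor₃ ∧ (inl φ).v 1 0 (by omega) ≫ δ.f 0 =
        -((completeResolution E X).shiftFunctorObjXIso 1 0 1 rfl).inv ∧ inr φ ≫ δ = 0 :=
    ⟨(triangle φ).mor₃, rfl, inl_v_triangle_mor₃_f φ 1 0 (by omega), inr_triangleδ φ⟩
  have hδ : HomologicalComplex.opcyclesMap δ 0 ≫
      (shiftOpcyclesIso (completeResolution E X) 1 0 1 rfl).hom = -pr := by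
    refine opcycles_mappingCone_hom_ext φ (m := 1) rfl ?_ ?_
    · rw [HomologicalComplex.p_opcyclesMap_assoc, p_shiftOpcyclesIso_hom, Preadditive.comp_neg,
        Preadditive.comp_neg, hpr, reassoc_of% hδ₁, Preadditive.neg_comp, Iso.inv_hom_id_assoc]
    · rw [← HomologicalComplex.opcyclesMap_comp_assoc, hδ₂, Preadditive.comp_neg, wpr, neg_zero,
        HomologicalComplex.opcyclesMap_zero, zero_comp]
  -- compatibility with the connecting morphisms: on cokernels, the difference of the two composites
  -- factors through the projective object `suspQ E X`; the sign comes from the third morphism of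
  -- the triangle of the mapping cone
  have hmor : Q.map δ ≫ Q.map (resolutionShiftMap X) =
      Q.map χ ≫ Q.map (resolutionMap c) := by
    rw [← CategoryTheory.Functor.map_comp, ← CategoryTheory.Functor.map_comp]
    refine quotient_map_eq_of_iso hC hX' (completeResolutionIso E (suspObj E X)) ?_
    rw [HomologicalComplex.opcyclesMap_comp, HomologicalComplex.opcyclesMap_comp, Category.assoc,
      Category.assoc, resolutionShiftMap_spec, resolutionMap_spec, reassoc_of% hδ, reassoc_of% hχ]
    obtain ⟨b', hb', hc'⟩ := suspComparison_spec X
    obtain ⟨u, hu, hu'⟩ := exists_desc_opcycles φ (n := 0) (m := 1) rfl b'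
      ((completeResolutionIso E Y).hom ≫ b) (by
        rw [← HomologicalComplex.p_opcyclesMap_assoc, reassoc_of% hφ, hb, ← hb',
          HomologicalComplex.p_fromOpcycles_assoc])
    refine StablyEq.symm ⟨suspQ E X, (suspSeq_spec E X).2.2.1, u, suspP E X, ?_⟩
    rw [Preadditive.neg_comp, sub_neg_eq_add]
    refine opcycles_mappingCone_hom_ext φ (m := 1) rfl ?_ ?_
    · rw [Preadditive.comp_add, Preadditive.comp_add, reassoc_of% hpr, reassoc_of% hu, hc']
      have := congrArg (fun k => k ≫ c.hom) wκ
      simp only [Category.assoc, zero_comp] at this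
      rw [this, zero_add]
    · rw [Preadditive.comp_add, reassoc_of% hκ, reassoc_of% hu', ← Category.assoc _ pr, wpr,
        zero_comp, add_zero, hc]
  have H : Triangle.mk (Q.map φ) (Q.map (inr φ)) (Q.map δ ≫ (Q.commShiftIso (1 : ℤ)).hom.app
      (completeResolution E X)) ∈ distTriang (HomotopyCategory C (ComplexShape.up ℤ)) := by
    rw [hδ₀]
    exact HomotopyCategory.mappingCone_triangleh_distinguished φ
  refine distTriang_of_iso₃' H (@asIso _ _ _ _ (Q.map χ) hχ') hinr ?_
  change Q.map χ ≫ Q.map (resolutionMap c) ≫ inv (Q.map (resolutionShiftMap X)) ≫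
    (Q.commShiftIso (1 : ℤ)).hom.app _ = _
  rw [← reassoc_of% hmor, IsIso.hom_inv_id_assoc]

lemma comp_inv_eq_inv_comp {B : Type u₂} [Category.{v₂} B] {U V X Y : B} {f : U ⟶ V} {f' : X ⟶ Y}
    {α : U ≅ X} {β : V ≅ Y} (h : f ≫ β.hom = α.hom ≫ f') : f' ≫ β.inv = α.inv ≫ f := by
  rw [Iso.comp_inv_eq, Category.assoc, h, Iso.inv_hom_id_assoc]

lemma comp_map_inv_comp {B : Type u₂} [Category.{v₂} B] (F : B ⥤ B) {X X' X'' Z Z' W : B}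
    {h : Z ⟶ F.obj X} {h' : Z' ⟶ F.obj X'} {α : X ≅ X'} {γ : Z ≅ Z'} {a : X ⟶ X''}
    {k : Z ⟶ W} {c : W ⟶ F.obj X''} (h₁ : h ≫ F.map α.hom = γ.hom ≫ h')
    (h₂ : h ≫ F.map a = k ≫ c) : h' ≫ F.map (α.inv ≫ a) = (γ.inv ≫ k) ≫ c := by
  rw [Category.assoc, ← h₂, Iso.eq_inv_comp, ← Category.assoc, ← h₁, Category.assoc,
    ← CategoryTheory.Functor.map_comp, Iso.hom_inv_id_assoc]

variable (E) in
theorem isExactFunctor_resolutionFunctor [E.IsClosedUnderExtensions] :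
    IsExactFunctor (resolutionFunctor E) := by
  refine ⟨resolutionSuspIso E, ?_⟩
  rintro U V W f g h ⟨X, Y, Z, f', g', w, b, c, α, β, γ, hS, hb, hc, h₁, h₂, h₃⟩
  have H := resolutionFunctor_distinguished f' g' w hS b c hb hc
  refine HasCones.of_iso ((resolutionFunctor E).mapIso α.symm) ((resolutionFunctor E).mapIso β.symm)
    ((resolutionFunctor E).mapIso γ.symm) ?_ ?_ ?_ H
  · exact ((resolutionFunctor E).map_comp _ _).symm.trans ((congrArg _
      (comp_inv_eq_inv_comp h₁)).trans ((resolutionFunctor E).map_comp _ _))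
  · exact ((resolutionFunctor E).map_comp _ _).symm.trans ((congrArg _
      (comp_inv_eq_inv_comp h₂)).trans ((resolutionFunctor E).map_comp _ _))
  · have hη := (resolutionSuspIso E).hom.naturality α.inv
    have h₄ := comp_inv_eq_inv_comp (β := (stableSusp E).mapIso α) (α := γ) h₃
    refine (Category.assoc _ _ _).trans ?_
    refine (congrArg (fun k => (resolutionFunctor E).map ((toStable E).map c) ≫ k) hη.symm).trans ?_
    exact (Category.assoc _ _ _).symm.trans (((congrArg (fun k => k ≫
      (resolutionSuspIso E).hom.app U) (((resolutionFunctor E).map_comp _ _).symm.trans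
        ((congrArg _ h₄).trans ((resolutionFunctor E).map_comp _ _))))).trans
          (Category.assoc _ _ _))

/-! ### Cones in the stable category -/

/-- The pushout of an exact sequence `0 ⟶ X ⟶ Q ⟶ N ⟶ 0` along a morphism `X ⟶ Y`. -/
lemma exists_shortExact_of_embedding [E.IsClosedUnderExtensions] {X Q N Y : C} {i : X ⟶ Q}
    {p : Q ⟶ N} {w : i ≫ p = 0} (h : (ShortComplex.mk i p w).ShortExact) (hY : E Y) (hN : E N)
    (f : X ⟶ Y) : ∃ (Z : C) (π : Q ⊞ Y ⟶ Z) (w' : biprod.lift i f ≫ π = 0),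
      (ShortComplex.mk _ _ w').ShortExact ∧ E Z := by
  have hi : Mono i := h.mono_f
  have hp : Epi p := h.epi_g
  let l := biprod.lift i f
  have hl : Mono l := by
    have : l ≫ biprod.fst = i := biprod.lift_fst _ _
    rw [← this] at hi
    exact mono_of_mono l biprod.fst
  have hS : (ShortComplex.mk l (cokernel.π l) (cokernel.condition l)).ShortExact :=
    .mk' (ShortComplex.exact_of_g_is_cokernel _ (cokernelIsCokernel l)) hl inferInstance
  refine ⟨cokernel l, cokernel.π l, cokernel.condition l, hS, ?_⟩
  let c : cokernel l ⟶ N := cokernel.desc l (biprod.fst ≫ p) (by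
    rw [biprod.lift_fst_assoc, w])
  have hc : cokernel.π l ≫ c = biprod.fst ≫ p := cokernel.π_desc _ _ _
  have w' : (biprod.inr ≫ cokernel.π l) ≫ c = 0 := by simp [hc]
  have hc' : Epi c := by
    have : Epi (cokernel.π l ≫ c) := by rw [hc]; infer_instance
    exact epi_of_epi (cokernel.π l) c
  have hj : Mono (biprod.inr ≫ cokernel.π l) := by
    rw [Preadditive.mono_iff_cancel_zero]
    intro T t ht
    rw [← Category.assoc] at ht
    have h₁ : hS.exact.lift _ ht ≫ l = t ≫ biprod.inr := hS.exact.lift_f _ _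
    have h₂ : hS.exact.lift _ ht ≫ i = 0 := by
      have := congrArg (fun k => k ≫ biprod.fst) h₁
      simpa [l] using this
    have h₃ := zero_of_comp_mono i h₂
    have h₄ := congrArg (fun k => k ≫ biprod.snd) h₁
    simpa [h₃] using h₄.symm
  refine ObjectProperty.prop_X₂_of_shortExact E (S := ShortComplex.mk _ _ w')
    (.mk' (ShortComplex.exact_of_g_is_cokernel _ ?_) hj hc') hY hN
  refine CokernelCofork.IsColimit.ofπ' _ _ fun {T} t ht => ?_
  dsimp at t ht ⊢
  rw [Category.assoc] at ht
  have h₁ : i ≫ biprod.inl ≫ cokernel.π l ≫ t = 0 := by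
    have h₂ : l ≫ cokernel.π l ≫ t = 0 := by rw [cokernel.condition_assoc, zero_comp]
    have h₃ (t' : Q ⊞ Y ⟶ T) : l ≫ t' = i ≫ biprod.inl ≫ t' + f ≫ biprod.inr ≫ t' := by
      simp [l, biprod.lift_eq]
    rw [h₃, ht, comp_zero, add_zero] at h₂
    exact h₂
  refine ⟨h.exact.desc _ h₁, ?_⟩
  rw [← cancel_epi (cokernel.π l), reassoc_of% hc]
  have h₂ : p ≫ h.exact.desc _ h₁ = _ := h.exact.g_desc _ _
  rw [h₂]
  refine biprod.hom_ext' _ _ ?_ ?_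
  · simp
  · simp [ht]

/-- The cone of `f : X ⟶ Y` is the pushout of `Y` along the embedding of `X` into a projective
object. -/
instance [E.IsClosedUnderExtensions] : HasCones (StableCat E) where
  exists_cone {X Y} f := by
    obtain ⟨X⟩ := X
    obtain ⟨Y⟩ := Y
    obtain ⟨f : X ⟶ Y, rfl⟩ := (toStable E).map_surjective f
    obtain ⟨Z, π, w, hS, hZ⟩ := exists_shortExact_of_embedding (suspSeq_spec E X).1 Y.property
      (suspSeq_spec E X).2.2.2 f.hom
    obtain ⟨-, hQ, hQ', -⟩ := suspSeq_spec E X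
    -- `f` is replaced by the monomorphism `(i, f) : X ⟶ Q ⊞ Y`, where `Q ⊞ Y` and `Y` are stably
    -- isomorphic
    let M : E.FullSubcategory := ⟨suspQ E X ⊞ Y.obj, hE.biprod _ _ hQ Y.property⟩
    let l : X ⟶ M := ObjectProperty.homMk (biprod.lift (suspI E X) f.hom)
    let Z' : E.FullSubcategory := ⟨Z, hZ⟩
    let π' : M ⟶ Z' := ObjectProperty.homMk π
    let j : Y ⟶ M := ObjectProperty.homMk biprod.inr
    let s : M ⟶ Y := ObjectProperty.homMk biprod.snd
    have hd : (biprod.lift (suspI E X) f.hom) ≫ biprod.fst ≫ suspP E X = 0 := by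
      rw [biprod.lift_fst_assoc, suspI_suspP]
    have hπ : Epi π := hS.epi_g
    let c : Z' ⟶ suspObj E X := ObjectProperty.homMk (hS.exact.desc (biprod.fst ≫ suspP E X) hd)
    have hc : π ≫ c.hom = biprod.fst ≫ suspP E X := hS.exact.g_desc _ _
    let β : (toStable E).obj Y ≅ (toStable E).obj M :=
      { hom := (toStable E).map j
        inv := (toStable E).map s
        hom_inv_id := by
          rw [← CategoryTheory.Functor.map_comp, ← CategoryTheory.Functor.map_id]
          congr 1
          ext
          exact biprod.inr_snd
        inv_hom_id := by
          rw [← CategoryTheory.Functor.map_comp, ← CategoryTheory.Functor.map_id]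
          refine (CategoryTheory.Quotient.sound _
            ⟨suspQ E X, hQ, hQ', biprod.fst, biprod.inl, ?_⟩).symm
          exact sub_eq_of_eq_add biprod.total.symm }
    refine ⟨(toStable E).obj Z', (toStable E).map (j ≫ π'), (toStable E).map c, X, M, Z', l, π', w,
      biprod.fst, c, Iso.refl _, β, Iso.refl _, hS, biprod.lift_fst _ _, hc, ?_, ?_, ?_⟩
    · refine Eq.trans ?_ (Category.id_comp _).symm
      refine (((toStable E).map_comp f j).symm).trans
        (CategoryTheory.Quotient.sound _ ⟨suspQ E X, hQ, hQ', suspI E X, biprod.inl, ?_⟩).symm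
      refine sub_eq_of_eq_add ?_
      change biprod.lift (suspI E X) f.hom = _ + f.hom ≫ biprod.inr
      ext <;> simp
    · exact (Category.comp_id _).trans ((toStable E).map_comp j π')
    · refine Eq.trans ?_ (Category.id_comp _).symm
      exact (congrArg _ ((stableSusp E).map_id _)).trans (Category.comp_id _)
  of_iso {X Y Z X' Y' Z' f g h f' g' h'} α β γ h₁ h₂ h₃ H := by
    obtain ⟨X'', Y'', Z'', k, l, w, b, c, α', β', γ', hS, hb, hc, h₁', h₂', h₃'⟩ := H
    refine ⟨X'', Y'', Z'', k, l, w, b, c, α.symm ≪≫ α', β.symm ≪≫ β', γ.symm ≪≫ γ', hS, hb, hc,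
      ?_, ?_, ?_⟩
    · rw [Iso.trans_hom, Iso.trans_hom, Iso.symm_hom, Iso.symm_hom, Category.assoc, ← h₁',
        Iso.eq_inv_comp, ← reassoc_of% h₁, Iso.hom_inv_id_assoc]
    · rw [Iso.trans_hom, Iso.trans_hom, Iso.symm_hom, Iso.symm_hom, Category.assoc, ← h₂',
        Iso.eq_inv_comp, ← reassoc_of% h₂, Iso.hom_inv_id_assoc]
    · exact comp_map_inv_comp (stableSusp E) h₃ h₃'

end ResolutionExact

/-! ### Closure properties of classes of modules -/

section Modules

/-- If `X` is a direct summand of `M`, then `X ⊕ M^(ℕ) ≅ M^(ℕ)`. -/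
lemma exists_swindle {C : Type u₁} [Category.{v₁} C] [Preadditive C] {X M : C} (i : X ⟶ M)
    (r : M ⟶ X) (hir : i ≫ r = 𝟙 X) (c : Cofan fun _ : ULift.{w} ℕ => M) (hc : IsColimit c) :
    ∃ (f : X ⟶ c.pt) (g : c.pt ⟶ c.pt) (h : f ≫ g = 0),
      Nonempty (ShortComplex.mk f g h).Splitting := by
  -- `g` shifts the summand `X` of each copy of `M` to the previous copy and is the identity on the
  -- complement; its kernel is the summand `X` of the first copy, and `s` shifts back
  have hri : r ≫ i ≫ r = r := by rw [hir, Category.comp_id]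
  let ρ : c.pt ⟶ X := Cofan.IsColimit.desc hc fun
    | ⟨0⟩ => r
    | ⟨_ + 1⟩ => 0
  let g : c.pt ⟶ c.pt := Cofan.IsColimit.desc hc fun
    | ⟨0⟩ => (𝟙 M - r ≫ i) ≫ c.inj ⟨0⟩
    | ⟨k + 1⟩ => (𝟙 M - r ≫ i) ≫ c.inj ⟨k + 1⟩ + (r ≫ i) ≫ c.inj ⟨k⟩
  let s : c.pt ⟶ c.pt := Cofan.IsColimit.desc hc fun k =>
    (𝟙 M - r ≫ i) ≫ c.inj k + (r ≫ i) ≫ c.inj ⟨k.down + 1⟩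
  have hρ₀ : c.inj ⟨0⟩ ≫ ρ = r := Cofan.IsColimit.fac hc _ _
  have hρ (k : ℕ) : c.inj ⟨k + 1⟩ ≫ ρ = 0 := Cofan.IsColimit.fac hc _ _
  have hg₀ : c.inj ⟨0⟩ ≫ g = (𝟙 M - r ≫ i) ≫ c.inj ⟨0⟩ := Cofan.IsColimit.fac hc _ _
  have hg (k : ℕ) : c.inj ⟨k + 1⟩ ≫ g = (𝟙 M - r ≫ i) ≫ c.inj ⟨k + 1⟩ + (r ≫ i) ≫ c.inj ⟨k⟩ :=
    Cofan.IsColimit.fac hc _ _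
  have hs (k : ℕ) : c.inj ⟨k⟩ ≫ s = (𝟙 M - r ≫ i) ≫ c.inj ⟨k⟩ + (r ≫ i) ≫ c.inj ⟨k + 1⟩ :=
    Cofan.IsColimit.fac hc _ _
  refine ⟨i ≫ c.inj ⟨0⟩, g, ?_, ⟨⟨ρ, s, ?_, ?_, ?_⟩⟩⟩
  · simp [hg₀, Preadditive.sub_comp, Preadditive.comp_sub, reassoc_of% hir]
  · simp [hρ₀, hir]
  · refine Cofan.IsColimit.hom_ext hc _ _ ?_
    rintro ⟨k⟩
    cases k <;>
    simp [reassoc_of% hs, hg, hg₀, Preadditive.sub_comp, Preadditive.comp_sub, reassoc_of% hir,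
      Preadditive.add_comp]
  · refine Cofan.IsColimit.hom_ext hc _ _ ?_
    rintro ⟨k⟩
    cases k with
    | zero =>
      simp [reassoc_of% hg₀, reassoc_of% hρ₀, hs, Preadditive.sub_comp, Preadditive.comp_sub,
        reassoc_of% hir]
    | succ k =>
      simp [reassoc_of% hg, reassoc_of% hρ, hs, Preadditive.sub_comp, Preadditive.comp_sub,
        Preadditive.add_comp, reassoc_of% hir]

/-- An extension closed class that is closed under isomorphisms and contains the zero objects
is additive. -/
lemma isAdditiveSubcategory_of_extensions {C : Type u₁} [Category.{v₁} C] [Abelian C]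
    (E : ObjectProperty C) [E.IsClosedUnderExtensions] (h₀ : ∀ X, IsZero X → E X)
    (h : ∀ {X Y : C}, (X ≅ Y) → E X → E Y) : IsAdditiveSubcategory E where
  of_isZero := h₀
  of_iso := h
  biprod X Y hX hY := E.prop_X₂_of_shortExact
    (S := ShortComplex.mk (biprod.inl : X ⟶ X ⊞ Y) biprod.snd (by simp))
    (ShortComplex.Splitting.mk biprod.fst biprod.inr (by simp) (by simp)
      (by simp)).shortExact hX hY

variable (R : Type u) (A : Type u) [CommRing R] [Ring A] [Algebra R A]

/-- The middle term of a short exact sequence of `A`-modules is an `R`-linear direct summand of the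
sum of the outer terms, if the last term is projective over `R`. -/
lemma exists_linear_retract (S : ShortComplex (ModuleCat.{u} A)) (hS : S.ShortExact)
    (h₃ : ModProj R A S.X₃) :
    ∃ (s : (ModuleCat.restrictScalars (algebraMap R A)).obj S.X₂ →ₗ[R]
        (ModuleCat.restrictScalars (algebraMap R A)).obj S.X₁ ×
        (ModuleCat.restrictScalars (algebraMap R A)).obj S.X₃)
      (t : _ →ₗ[R] _), t ∘ₗ s = LinearMap.id := by
  obtain ⟨⟨l, hl⟩, r, hr⟩ := exists_linear_splitting S hS h₃
  have hex : Function.Exact (restrictHom (R := R) S.f) (restrictHom (R := R) S.g) :=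
    (ShortComplex.ShortExact.moduleCat_exact_iff_function_exact S).1 hS.exact
  refine ⟨(r - r ∘ₗ l ∘ₗ restrictHom S.g).prod (restrictHom S.g),
    (restrictHom S.f).coprod l, ?_⟩
  ext x
  obtain ⟨y, hy⟩ := (hex (x - l (restrictHom S.g x))).1 (by
    rw [map_sub, sub_eq_zero]
    exact (LinearMap.congr_fun hl _).symm)
  have h₁ : r (restrictHom S.f y) = y := LinearMap.congr_fun hr y
  rw [hy, map_sub] at h₁
  change restrictHom S.f (r x - r (l (restrictHom S.g x))) + l (restrictHom S.g x) = x
  rw [h₁, hy, sub_add_cancel]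

instance : (ModProj R A).IsClosedUnderExtensions where
  prop_X₂_of_shortExact {S} hS h₁ h₃ := by
    obtain ⟨s, t, h⟩ := exists_linear_retract R A S hS h₃
    have : Module.Projective R ((ModuleCat.restrictScalars (algebraMap R A)).obj S.X₁) := h₁
    have : Module.Projective R ((ModuleCat.restrictScalars (algebraMap R A)).obj S.X₃) := h₃
    exact Module.Projective.of_split s t h

instance : (ModFinProj R A).IsClosedUnderExtensions where
  prop_X₂_of_shortExact {S} hS h₁ h₃ := by
    refine ⟨(ModProj R A).prop_X₂_of_shortExact hS h₁.1 h₃.1, ?_⟩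
    obtain ⟨s, t, h⟩ := exists_linear_retract R A S hS h₃.1
    have := h₁.2
    have := h₃.2
    exact Module.Finite.of_surjective t fun x => ⟨_, LinearMap.congr_fun h x⟩

instance : (ModLF R A).IsClosedUnderExtensions where
  prop_X₂_of_shortExact {S} hS h₁ h₃ := .two_of_three₂ S hS h₁
    ((ModProj R A).prop_X₂_of_shortExact hS (modLF_le_modProj _ h₁) (modLF_le_modProj _ h₃)) h₃

lemma restrictHom_comp_eq_id {X M : ModuleCat.{u} A} {i : X ⟶ M} {r : M ⟶ X} (h : i ≫ r = 𝟙 X) :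
    restrictHom (R := R) r ∘ₗ restrictHom i = LinearMap.id := by
  ext x
  exact congrArg (fun f : X ⟶ X => f.hom x) h

variable {R A}

lemma ModProj.of_retract {X M : ModuleCat.{u} A} (hM : ModProj R A M) (i : X ⟶ M) (r : M ⟶ X)
    (h : i ≫ r = 𝟙 X) : ModProj R A X :=
  have : Module.Projective R ((ModuleCat.restrictScalars (algebraMap R A)).obj M) := hM
  Module.Projective.of_split _ _ (restrictHom_comp_eq_id R A h)

lemma ModLF.of_retract {X M : ModuleCat.{u} A} (hM : ModLF R A M) (i : X ⟶ M) (r : M ⟶ X)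
    (h : i ≫ r = 𝟙 X) : ModLF R A X := by
  obtain ⟨f, g, w, ⟨s⟩⟩ := exists_swindle i r h (colimit.cocone (Discrete.functor
    fun _ : ULift.{u} ℕ => M)) (colimit.isColimit _)
  have hM' := ModLF.coprod _ _ _ (colimit.isColimit (Discrete.functor
    fun _ : ULift.{u} ℕ => M)) fun _ => hM
  exact .two_of_three₁ _ s.shortExact ((modLF_le_modProj _ hM).of_retract i r h) hM' hM'

variable (R A)

instance : IsAdditiveSubcategory (ModProj R A) :=
  isAdditiveSubcategory_of_extensions _
    (fun X h => (IsAdditiveSubcategory.of_isZero (E := ModFinProj R A) X h).1)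
    (fun e h => h.of_retract e.inv e.hom e.inv_hom_id)

instance : IsAdditiveSubcategory (ModLF R A) :=
  isAdditiveSubcategory_of_extensions _
    (fun X h => .of X (IsAdditiveSubcategory.of_isZero (E := ModFinProj R A) X h))
    (fun e h => h.of_retract e.inv e.hom e.inv_hom_id)

variable {R A} [IsFrobeniusAlgebra R A]

lemma ModLF.of_projective (P : ModuleCat.{u} A) (hP : Projective P) : ModLF R A P := by
  obtain ⟨q, hq⟩ := exists_surjection (A := A) P
  have : Epi (ModuleCat.ofHom q) := (ModuleCat.epi_iff_surjective _).2 hq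
  exact (modLF_finsupp (R := R) (A := A) P).of_retract (Projective.factorThru (𝟙 P)
    (ModuleCat.ofHom q))
    (ModuleCat.ofHom q) (Projective.factorThru_comp _ _)

lemma ModFinProj.of_isFGProj {P : ModuleCat.{u} A} (hP : IsFGProj A P) : ModFinProj R A P := by
  refine ⟨modLF_le_modProj _ (ModLF.of_projective P ((IsProjective.iff_projective P).1 hP.1)), ?_⟩
  let := restrictModule (R := R) P
  have := restrict_isScalarTower (R := R) P
  have : Module.Finite A P := hP.2
  exact Module.Finite.trans (R := R) A P

lemma ModFinProj.isFGProj {P : ModuleCat.{u} A} (hP : ModFinProj R A P) (h : Projective P) :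
    IsFGProj A P := by
  refine ⟨(IsProjective.iff_projective P).2 h, ?_⟩
  let := restrictModule (R := R) P
  have := restrict_isScalarTower (R := R) P
  have : Module.Finite R P := hP.2
  exact Module.Finite.of_restrictScalars_finite R A P

end Modules

/-! ### Coproducts in homotopy categories -/

section Coproducts

variable {C : Type u₁} [Category.{v₁} C] [Abelian C] {J : Type u} [HasCoproductsOfShape J C]

/-- The terms of a coproduct of complexes are coproducts. -/
def isColimitEval {K : J → CochainComplex C ℤ} {c : Cofan K} (hc : IsColimit c) (n : ℤ) :
    IsColimit (Cofan.mk (c.pt.X n) fun j => (c.inj j).f n) :=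
  isColimitCofanMkObjOfIsColimit (HomologicalComplex.eval C (ComplexShape.up ℤ) n) K c.inj
    (IsColimit.ofIsoColimit hc (Cofan.ext (Iso.refl _) (by simp)))

lemma nonempty_homotopy_of_cofan {K : J → CochainComplex C ℤ} {c : Cofan K} (hc : IsColimit c)
    {L : CochainComplex C ℤ} (f : c.pt ⟶ L) (h : ∀ j, Nonempty (Homotopy (c.inj j ≫ f) 0)) :
    Nonempty (Homotopy f 0) := by
  let σ : ∀ n m : ℤ, c.pt.X n ⟶ L.X m := fun n m =>
    Cofan.IsColimit.desc (isColimitEval hc n) fun j => (h j).some.hom n m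
  have hσ (n m : ℤ) (j : J) : (c.inj j).f n ≫ σ n m = (h j).some.hom n m :=
    Cofan.IsColimit.fac (isColimitEval hc n) _ j
  refine nonempty_homotopy_zero σ fun n k m hn hm => ?_
  refine Cofan.IsColimit.hom_ext (isColimitEval hc k) _ _ fun j => ?_
  have := (h j).some.comm k
  rw [dNext_eq _ (show (ComplexShape.up ℤ).Rel k m from hm),
    prevD_eq _ (show (ComplexShape.up ℤ).Rel n k from hn)] at this
  simp only [HomologicalComplex.comp_f, HomologicalComplex.zero_f, add_zero] at this
  change (c.inj j).f k ≫ f.f k = (c.inj j).f k ≫ (_ + _)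
  rw [Preadditive.comp_add, (c.inj j).comm_assoc, hσ, reassoc_of% hσ]
  exact this

lemma nonempty_isColimit_quotient {K : J → CochainComplex C ℤ} {c : Cofan K}
    (hc : IsColimit c) : Nonempty (IsColimit (Cofan.mk
      ((HomotopyCategory.quotient C (ComplexShape.up ℤ)).obj c.pt)
      fun j => (HomotopyCategory.quotient C (ComplexShape.up ℤ)).map (c.inj j))) := by
  let Q := HomotopyCategory.quotient C (ComplexShape.up ℤ)
  have hex (L : HomotopyCategory C (ComplexShape.up ℤ)) (s : ∀ j, Q.obj (K j) ⟶ L) :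
      ∃ f : Q.obj c.pt ⟶ L, ∀ j, Q.map (c.inj j) ≫ f = s j := by
    obtain ⟨L, rfl⟩ := L.quotient_obj_surjective
    choose g hg using fun j => Q.map_surjective (s j)
    refine ⟨Q.map (Cofan.IsColimit.desc hc g), fun j => ?_⟩
    rw [← CategoryTheory.Functor.map_comp, Cofan.IsColimit.fac]
    exact hg j
  have hext (L : HomotopyCategory C (ComplexShape.up ℤ)) (f : Q.obj c.pt ⟶ L)
      (h : ∀ j, Q.map (c.inj j) ≫ f = 0) : f = 0 := by
    obtain ⟨L, rfl⟩ := L.quotient_obj_surjective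
    obtain ⟨f, rfl⟩ := Q.map_surjective f
    obtain ⟨h⟩ := nonempty_homotopy_of_cofan hc f fun j =>
      ⟨HomotopyCategory.homotopyOfEq _ _ (by
        rw [CategoryTheory.Functor.map_comp, CategoryTheory.Functor.map_zero]; exact h j)⟩
    exact (HomotopyCategory.eq_of_homotopy _ _ h).trans (Q.map_zero _ _)
  refine ⟨Cofan.IsColimit.mk _ (fun s => (hex s.pt s.inj).choose)
    (fun s j => (hex s.pt s.inj).choose_spec j) fun s m hm => ?_⟩
  refine sub_eq_zero.1 (hext _ _ fun j => (Preadditive.comp_sub _ _ _).trans ?_)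
  exact sub_eq_zero.2 ((hm j).trans ((hex s.pt s.inj).choose_spec j).symm)

instance : HasColimitsOfShape (Discrete J) (HomotopyCategory C (ComplexShape.up ℤ)) where
  has_colimit F := ⟨_, (IsColimit.precomposeHomEquiv Discrete.natIsoFunctor _).symm
    (nonempty_isColimit_quotient (coproductIsCoproduct fun j => (F.obj ⟨j⟩).as)).some⟩

end Coproducts

section Coproducts

variable {T : Type u₁} [Category.{v₁} T] [Preadditive T]

/-- Compactness can be tested on one coproduct for each family of objects. -/
lemma IsCompactObject.of_exists {X : T} (h : ∀ (J : Type u) (Y : J → T), ∃ c : Cofan Y,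
    Nonempty (IsColimit c) ∧ ∀ f : X ⟶ c.pt, f ∈ finiteMaps c X) : IsCompactObject.{u} X := by
  intro J Y c hc f
  obtain ⟨c', ⟨hc'⟩, h⟩ := h J Y
  obtain ⟨s, g, hg⟩ := h (f ≫ (hc.coconePointUniqueUpToIso hc').hom)
  refine ⟨s, g, ?_⟩
  rw [← cancel_mono (hc.coconePointUniqueUpToIso hc').hom, hg, Preadditive.sum_comp]
  refine Finset.sum_congr rfl fun j _ => ?_
  rw [Category.assoc]
  exact congrArg (g j ≫ ·) (IsColimit.comp_coconePointUniqueUpToIso_hom hc hc' ⟨j⟩).symm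

lemma IsCompactObject.of_map {T' : Type u₂} [Category.{v₂} T'] [Preadditive T'] (F : T ⥤ T')
    [F.Full] [F.Faithful] [F.Additive] [∀ J : Type u, PreservesColimitsOfShape (Discrete J) F]
    {X : T} (h : IsCompactObject.{u} (F.obj X)) : IsCompactObject.{u} X := by
  intro J Y c hc f
  obtain ⟨s, g, hg⟩ := h J _ _ (isColimitCofanMkObjOfIsColimit F Y c.inj
    (IsColimit.ofIsoColimit hc (Cofan.ext (Iso.refl _) (by simp)))) (F.map f)
  refine ⟨s, fun j => F.preimage (g j), F.map_injective ?_⟩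
  rw [hg, CategoryTheory.Functor.map_sum]
  refine Finset.sum_congr rfl fun j _ => ?_
  rw [CategoryTheory.Functor.map_comp, F.map_preimage]
  rfl

end Coproducts

lemma opcyclesToCycles_isIso {C : Type u₁} [Category.{v₁} C] [Abelian C] (K : CochainComplex C ℤ)
    {n m : ℤ} (hnm : n + 1 = m) (hn : K.ExactAt n) (hm : K.ExactAt m) :
    IsIso (K.opcyclesToCycles n m) := by
  have h₁ : Mono (K.opcyclesToCycles n m) := by
    have := (shortExact_opcycles K hnm hn).mono_f
    dsimp at this
    rw [← K.opcyclesToCycles_iCycles n m] at this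
    exact mono_of_mono _ (K.iCycles m)
  have h₂ : Epi (K.toCycles n m) := by
    rw [Preadditive.epi_iff_cancel_zero]
    intro Z g hg
    have hk := K.homologyIsCokernel n m (by simp [← hnm])
    obtain ⟨l, hl⟩ := CokernelCofork.IsColimit.desc' hk g hg
    rw [← hl, show l = 0 from hm.isZero_homology.eq_of_src l 0]
    exact comp_zero
  have h₃ : Epi (K.opcyclesToCycles n m) := by
    rw [← K.pOpcycles_opcyclesToCycles n m] at h₂
    exact epi_of_epi (K.pOpcycles n) _
  exact isIso_of_mono_of_epi _

section Modules

variable {A : Type u} [Ring A]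

/-- A morphism from a finitely generated module to a coproduct factors through a finite
subcoproduct. -/
lemma exists_finset_of_finite {J : Type u} {Y : J → ModuleCat.{u} A} {c : Cofan Y}
    (hc : IsColimit c) {π : ∀ j, c.pt ⟶ Y j} (h₁ : ∀ j, c.inj j ≫ π j = 𝟙 _)
    (h₂ : ∀ i j, i ≠ j → c.inj i ≫ π j = 0) {M : ModuleCat.{u} A} [Module.Finite A M]
    (f : M ⟶ c.pt) :
    ∃ s : Finset J, ∀ s', s ⊆ s' → f = ∑ j ∈ s', f ≫ π j ≫ c.inj j := by
  classical
  let p (s : Finset J) : c.pt ⟶ c.pt := ∑ j ∈ s, π j ≫ c.inj j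
  -- `p s` is the projection onto the summands in `s`. The elements that are fixed by `p s` for all
  -- large `s` form a submodule `N`; it is everything, as the quotient map vanishes on each summand.
  let N : Submodule A c.pt :=
    { carrier := {y | ∃ s : Finset J, ∀ s', s ⊆ s' → (p s').hom y = y}
      zero_mem' := ⟨∅, fun _ _ => map_zero _⟩
      add_mem' := fun ⟨s, hs⟩ ⟨t, ht⟩ => ⟨s ∪ t, fun s' h => by
        rw [map_add, hs s' (Finset.union_subset_left h), ht s' (Finset.union_subset_right h)]⟩
      smul_mem' := fun a _ ⟨s, hs⟩ => ⟨s, fun s' h => by rw [map_smul, hs s' h]⟩ }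
  have hp (j : J) (s : Finset J) (hj : j ∈ s) : c.inj j ≫ p s = c.inj j := by
    rw [Preadditive.comp_sum, Finset.sum_eq_single j _ fun h => (h hj).elim]
    · rw [← Category.assoc, h₁, Category.id_comp]
    · intro i _ hi
      rw [← Category.assoc, h₂ j i hi.symm, zero_comp]
  have hN : ModuleCat.ofHom N.mkQ = 0 := by
    refine Cofan.IsColimit.hom_ext hc _ _ fun j => ?_
    rw [comp_zero]
    ext y
    refine (Submodule.Quotient.mk_eq_zero N).2 ⟨{j}, fun s' h => ?_⟩
    exact congrArg (fun k => k.hom y) (hp j s' (Finset.singleton_subset_iff.1 h))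
  have hN' (y : c.pt) : y ∈ N :=
    (Submodule.Quotient.mk_eq_zero N).1 (congrArg (fun k => k.hom y) hN)
  obtain ⟨G, hG⟩ := Module.Finite.fg_top (R := A) (M := M)
  choose s hs using fun x : M => hN' (f.hom x)
  refine ⟨G.biUnion s, fun s' h => ?_⟩
  have : f ≫ p s' = f := by
    refine ModuleCat.hom_ext (LinearMap.ext_on hG fun x hx => ?_)
    exact hs x s' ((Finset.subset_biUnion_of_mem s hx).trans h)
  rw [← Preadditive.comp_sum]
  exact this.symm

variable (A) in
lemma isProj_iff (M : ModuleCat.{u} A) : IsProj A M ↔ Projective M :=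
  IsProjective.iff_projective _

/-- The object of `K(Proj A)` that is given by a complex of projective modules. -/
abbrev KProj.mk (K : CochainComplex (ModuleCat.{u} A) ℤ) (hK : termwise (IsProj A) K) : KProj A :=
  ⟨(HomotopyCategory.quotient _ _).obj K, hK⟩

lemma KProj.exists_eq_mk (X : KProj A) : ∃ K hK, X = KProj.mk K hK := by
  obtain ⟨X, hX⟩ := X
  obtain ⟨K, rfl⟩ := X.quotient_obj_surjective
  exact ⟨K, hX, rfl⟩

lemma termwise_isProj_of_isColimit {J : Type u} {K : J → CochainComplex (ModuleCat.{u} A) ℤ}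
    (hK : ∀ j, termwise (IsProj A) (K j)) {c : Cofan K} (hc : IsColimit c) :
    termwise (IsProj A) c.pt := fun n => by
  have (j : J) : Projective ((K j).X n) := (isProj_iff A _).1 (hK j n)
  rw [isProj_iff]
  exact Projective.of_iso ((coproductIsCoproduct _).coconePointUniqueUpToIso
    (isColimitEval hc n)) (inferInstanceAs (Projective (∐ fun j => (K j).X n)))

/-- A coproduct of complexes of projective modules is a coproduct in `K(Proj A)`. -/
lemma KProj.nonempty_isColimit {J : Type u} {K : J → CochainComplex (ModuleCat.{u} A) ℤ}
    (hK : ∀ j, termwise (IsProj A) (K j)) {c : Cofan K} (hc : IsColimit c) :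
    Nonempty (IsColimit (Cofan.mk (KProj.mk c.pt (termwise_isProj_of_isColimit hK hc))
      fun j => (ObjectProperty.homMk ((HomotopyCategory.quotient _ _).map (c.inj j)) :
        KProj.mk (K j) (hK j) ⟶ _))) := by
  obtain ⟨h⟩ := nonempty_isColimit_quotient hc
  refine ⟨Cofan.IsColimit.mk _ (fun s => ObjectProperty.homMk
    (Cofan.IsColimit.desc h fun j => (s.inj j).hom)) (fun s j => ?_) fun s m hm => ?_⟩
  · ext
    exact Cofan.IsColimit.fac h _ j
  · ext
    refine Cofan.IsColimit.hom_ext h _ _ fun j => ?_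
    exact (congrArg (·.hom) (hm j)).trans
      (Cofan.IsColimit.fac h (fun j => (s.inj j).hom) j).symm

instance (J : Type u) : CreatesColimitsOfShape (Discrete J) (KTerm (IsProj A)).ι where
  CreatesColimit {F} := by
    have hK (j : J) : termwise (IsProj A) (F.obj ⟨j⟩).obj.as := (F.obj ⟨j⟩).property
    have hc := coproductIsCoproduct fun j => (F.obj ⟨j⟩).obj.as
    exact createsColimitFullSubcategoryInclusion' _
      ((IsColimit.precomposeHomEquiv Discrete.natIsoFunctor _).symm
        (nonempty_isColimit_quotient hc).some) (termwise_isProj_of_isColimit hK hc)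

instance : HasCoproducts.{u} (KProj A) := fun _ =>
  hasColimitsOfShape_of_hasColimitsOfShape_createsColimitsOfShape (KTerm (IsProj A)).ι

end Modules

lemma isZero_of_map {C : Type u₁} [Category.{v₁} C] [Preadditive C] {D : Type u₂}
    [Category.{v₂} D] [Preadditive D] (F : C ⥤ D) [F.Faithful] [F.PreservesZeroMorphisms] {X : C}
    (h : IsZero (F.obj X)) : IsZero X :=
  (IsZero.iff_id_eq_zero X).2 (F.map_injective (h.eq_of_src _ _))

section KPlusB

variable {R A : Type u} [CommRing R] [Ring A] [Algebra R A]

/-- A morphism from a bounded below complex of finitely generated modules to a coproduct factors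
through a finite subcoproduct in all degrees up to `b`, because only finitely many of these degrees
matter. -/
lemma exists_finset_eq_zero {J : Type u} {K : J → CochainComplex (ModuleCat.{u} A) ℤ} {c : Cofan K}
    (hc : IsColimit c) {X : CochainComplex (ModuleCat.{u} A) ℤ}
    (hX : ∀ n, Module.Finite A (X.X n)) {a : ℤ} (ha : X.IsStrictlyGE a) (b : ℤ) (f : X ⟶ c.pt) :
    ∃ (s : Finset J) (g : ∀ j, X ⟶ K j), ∀ n ≤ b, (f - ∑ j ∈ s, g j ≫ c.inj j).f n = 0 := by
  classical
  obtain ⟨π, h₁, h₂⟩ := exists_projections hc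
  have key (n : ℤ) : ∃ s : Finset J, ∀ s', s ⊆ s' →
      f.f n = ∑ j ∈ s', f.f n ≫ (π j).f n ≫ (c.inj j).f n :=
    exists_finset_of_finite (isColimitEval hc n) (π := fun j => (π j).f n)
      (fun j => congrArg (fun k => k.f n) (h₁ j))
      (fun i j h => congrArg (fun k => k.f n) (h₂ i j h)) (f.f n)
  choose s hs using key
  refine ⟨(Finset.Icc a b).biUnion s, fun j => f ≫ π j, fun n hn => ?_⟩
  by_cases h : a ≤ n
  · have := hs n ((Finset.Icc a b).biUnion s)
      (Finset.subset_biUnion_of_mem s (Finset.mem_Icc.2 ⟨h, hn⟩))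
    rw [HomologicalComplex.sub_f_apply, sub_eq_zero, this]
    refine Eq.trans ?_
      (map_sum (HomologicalComplex.Hom.fAddMonoidHom (C₁ := X) (C₂ := c.pt) n) _ _).symm
    exact Finset.sum_congr rfl fun j _ => (Category.assoc _ _ _).symm
  · exact (X.isZero_of_isStrictlyGE a n (by omega)).eq_of_src _ _

lemma mem_finiteMaps_quotient {J : Type u} {K : J → CochainComplex (ModuleCat.{u} A) ℤ}
    {c : Cofan K} (hc : IsColimit c) {X : CochainComplex (ModuleCat.{u} A) ℤ}
    (hX : ∀ n, Module.Finite A (X.X n)) {a : ℤ} (ha : X.IsStrictlyGE a) (b : ℤ)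
    (hb : ∀ φ : X ⟶ c.pt, (∀ n ≤ b, φ.f n = 0) → Nonempty (Homotopy φ 0))
    (f : (HomotopyCategory.quotient _ (ComplexShape.up ℤ)).obj X ⟶
      (HomotopyCategory.quotient _ _).obj c.pt) :
    f ∈ finiteMaps (Cofan.mk ((HomotopyCategory.quotient _ (ComplexShape.up ℤ)).obj c.pt)
      fun j => (HomotopyCategory.quotient _ _).map (c.inj j)) _ := by
  obtain ⟨f, rfl⟩ := (HomotopyCategory.quotient _ _).map_surjective f
  obtain ⟨s, g, hg⟩ := exists_finset_eq_zero hc hX ha b f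
  obtain ⟨h⟩ := hb _ hg
  have h' := HomotopyCategory.eq_of_homotopy _ _ h
  refine ⟨s, fun j => (HomotopyCategory.quotient _ _).map (g j), ?_⟩
  rw [CategoryTheory.Functor.map_sub, CategoryTheory.Functor.map_zero, sub_eq_zero,
    CategoryTheory.Functor.map_sum] at h'
  exact h'.trans (Finset.sum_congr rfl fun j _ => (HomotopyCategory.quotient _ _).map_comp _ _)

/-- The complexes in `K^{+,b}(proj A)`; instead of the cycles one can consider the quotients by
the boundaries. -/
structure IsPlusB (R : Type u) {A : Type u} [CommRing R] [Ring A] [Algebra R A]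
    (K : CochainComplex (ModuleCat.{u} A) ℤ) : Prop where
  isFGProj (n : ℤ) : IsFGProj A (K.X n)
  exists_ge : ∃ a, K.IsStrictlyGE a
  exists_exact : ∃ b : ℤ, ∀ n ≥ b, K.ExactAt n ∧ ModProj R A (K.opcycles n)

lemma kPlusB_iff (X : KProj A) : KPlusB R A X ↔ IsPlusB R X.obj.as := by
  constructor
  · rintro ⟨h₁, h₂, b, hb⟩
    refine ⟨h₁, h₂, b, fun n hn => ⟨(hb n hn).1, ?_⟩⟩
    have := opcyclesToCycles_isIso X.obj.as rfl (hb n hn).1 (hb (n + 1) (by omega)).1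
    exact IsAdditiveSubcategory.of_iso (E := ModProj R A)
      (asIso (X.obj.as.opcyclesToCycles n (n + 1))).symm (hb (n + 1) (by omega)).2
  · rintro ⟨h₁, h₂, b, hb⟩
    refine ⟨h₁, h₂, b + 1, fun n hn => ⟨(hb n (by omega)).1, ?_⟩⟩
    have := opcyclesToCycles_isIso X.obj.as (sub_add_cancel n 1) (hb (n - 1) (by omega)).1
      (hb n (by omega)).1
    exact IsAdditiveSubcategory.of_iso (E := ModProj R A)
      (asIso (X.obj.as.opcyclesToCycles (n - 1) n)) (hb (n - 1) (by omega)).2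

lemma IsPlusB.termwise {K : CochainComplex (ModuleCat.{u} A) ℤ} (hK : IsPlusB R K) :
    termwise (IsProj A) K := fun n => (hK.isFGProj n).1

lemma isPlusB_zero : IsPlusB R (0 : CochainComplex (ModuleCat.{u} A) ℤ) := by
  have h₀ : IsZero (0 : CochainComplex (ModuleCat.{u} A) ℤ) := isZero_zero _
  have hz (n : ℤ) : IsZero ((0 : CochainComplex (ModuleCat.{u} A) ℤ).X n) :=
    (HomologicalComplex.eval _ _ n).map_isZero h₀
  exact ⟨fun n => IsAdditiveSubcategory.of_isZero _ (hz n), ⟨0, inferInstance⟩,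
    0, fun n _ => ⟨.of_isZero (hz n), IsAdditiveSubcategory.of_isZero _
      ((HomologicalComplex.opcyclesFunctor _ _ n).map_isZero h₀)⟩⟩

lemma IsPlusB.shift {K : CochainComplex (ModuleCat.{u} A) ℤ} (hK : IsPlusB R K) (k : ℤ) :
    IsPlusB R (K⟦k⟧) := by
  obtain ⟨h, ⟨a, _⟩, b, hb⟩ := hK
  refine ⟨fun n => h (n + k), ⟨a - k, K.isStrictlyGE_shift a k (a - k) (by lia)⟩, b - k,
    fun n hn => ⟨?_, ?_⟩⟩
  · exact (HomologicalComplex.exactAt_iff_isZero_homology _ _).2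
      ((hb (n + k) (by omega)).1.isZero_homology.of_iso
        (((HomologicalComplex.homologyFunctor _ _ 0).shiftIso k n (n + k) (by omega)).app K))
  · exact IsAdditiveSubcategory.of_iso (E := ModProj R A) (shiftOpcyclesIso K k n (n + k) rfl).symm
      (hb (n + k) (by omega)).2

lemma exactAt_mappingCone {C : Type u₁} [Category.{v₁} C] [Abelian C] {K L : CochainComplex C ℤ}
    (φ : K ⟶ L) {n m : ℤ} (hnm : n + 1 = m) (hL : L.ExactAt n) (hK : K.ExactAt m) :
    (CochainComplex.mappingCone φ).ExactAt n := by
  have e (M : CochainComplex C ℤ) (i : ℤ) :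
      ((HomotopyCategory.homologyFunctor C (ComplexShape.up ℤ) 0).shift i).obj
        ((HomotopyCategory.quotient C (ComplexShape.up ℤ)).obj M) ≅ M.homology i :=
    (HomotopyCategory.homologyFunctorFactors C (ComplexShape.up ℤ) i).app M
  have hS := (HomotopyCategory.homologyFunctor C (ComplexShape.up ℤ) 0).homologySequence_exact₃ _
    (HomotopyCategory.mappingCone_triangleh_distinguished φ) n m hnm
  rw [HomologicalComplex.exactAt_iff_isZero_homology]
  refine IsZero.of_iso ?_ (e (CochainComplex.mappingCone φ) n).symm
  exact hS.isZero_X₂ ((hL.isZero_homology.of_iso (e L n)).eq_of_src _ _)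
    ((hK.isZero_homology.of_iso (e K m)).eq_of_tgt _ _)

lemma IsPlusB.mappingCone {K L : CochainComplex (ModuleCat.{u} A) ℤ} (hK : IsPlusB R K)
    (hL : IsPlusB R L) (φ : K ⟶ L) : IsPlusB R (CochainComplex.mappingCone φ) := by
  obtain ⟨h, ⟨a, _⟩, b, hb⟩ := hK
  obtain ⟨h', ⟨a', _⟩, b', hb'⟩ := hL
  refine ⟨termwise_cone _ φ h h', ⟨min a a' - 1, ?_⟩, max b b', fun n hn => ?_⟩
  · rw [CochainComplex.isStrictlyGE_iff]
    intro i hi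
    rw [CochainComplex.mappingCone.isZero_X_iff]
    exact ⟨K.isZero_of_isStrictlyGE a _ (by omega), L.isZero_of_isStrictlyGE a' _ (by omega)⟩
  · have hL := hb' n (by omega)
    have hK := hb (n + 1) (by omega)
    obtain ⟨p, w, -, hS⟩ := shortExact_opcycles_mappingCone φ rfl hL.1
    exact ⟨exactAt_mappingCone φ rfl hL.1 hK.1,
      ObjectProperty.prop_X₂_of_shortExact _ hS hL.2 hK.2⟩

instance : (homotopyProp (IsPlusB (A := A) R)).IsTriangulated :=
  homotopyProp_isTriangulated _ isPlusB_zero (fun _ hK k => hK.shift k)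
    (fun _ _ φ hK hL => hK.mappingCone hL φ)

lemma KProj.shift_obj (X : KProj A) (n : ℤ) : (X⟦n⟧).obj = X.obj⟦n⟧ := by
  with_unfolding_all rfl

/-- A triangulated subcategory of the homotopy category that is defined by a property of complexes
of projective modules gives a triangulated subcategory of `K(Proj A)`. -/
lemma isTriangulated_of_homotopyProp (Φ : ObjectProperty (CochainComplex (ModuleCat.{u} A) ℤ))
    [(homotopyProp Φ).IsTriangulated] (hΦ : Φ ≤ termwise (IsProj A)) (S : ObjectProperty (KProj A))
    (hS : ∀ X, S X ↔ Φ X.obj.as) : S.IsTriangulated :=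
  have h₁ : S.IsStableUnderShift ℤ :=
    { isStableUnderShiftBy n :=
        { le_shift X hX := by
            change S (X⟦n⟧)
            rw [hS, KProj.shift_obj]
            exact ((homotopyProp Φ).prop_shift_iff n X.obj).1
              (ObjectProperty.le_shift _ n _ ((hS _).1 hX)) } }
  have h₃ : S.IsTriangulatedClosed₃ :=
    { ext₃' T hT h h' := by
        obtain ⟨Z, hZ, ⟨e⟩⟩ := ObjectProperty.IsTriangulatedClosed₃.ext₃'
          (P := homotopyProp Φ) _ ((KTerm (IsProj A)).ι.map_distinguished T hT)
          ((hS _).1 h) ((hS _).1 h')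
        exact ⟨⟨Z, hΦ _ hZ⟩, (hS _).2 hZ, ⟨ObjectProperty.isoMk _ e⟩⟩ }
  { exists_zero := by
      obtain ⟨Z, hZ, hZ'⟩ := (homotopyProp Φ).exists_prop_of_containsZero
      exact ⟨⟨Z, hΦ _ hZ'⟩, isZero_of_map (KTerm (IsProj A)).ι hZ, (hS _).2 hZ'⟩
    toIsTriangulatedClosed₂ := .of_isTriangulatedClosed₃ }

instance : (KPlusB R A).IsTriangulated :=
  isTriangulated_of_homotopyProp (IsPlusB R) (fun _ h => h.termwise) _ kPlusB_iff

variable (A) in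
/-- The bounded complexes of finitely generated projective modules. -/
def KbProj : ObjectProperty (KProj A) := fun X => boundedTermwise (IsFGProj A) X.obj.as

instance : (KbProj A).IsTriangulated :=
  have : (homotopyProp (boundedTermwise (IsFGProj A))).IsTriangulated :=
    inferInstanceAs (KBounded (IsFGProj A)).IsTriangulated
  isTriangulated_of_homotopyProp (boundedTermwise (IsFGProj A)) (fun _ h n => (h.1 n).1) _
    fun _ => Iff.rfl

variable (R) in
lemma kbProj_le_kPlusB : KbProj A ≤ KPlusB R A := fun X ⟨h, h', b, hb⟩ => by
  refine (kPlusB_iff _).2 ⟨h, h', b + 1, fun n hn => ?_⟩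
  have hz := CochainComplex.isZero_of_isStrictlyLE X.obj.as b n (by omega)
  exact ⟨.of_isZero hz, IsAdditiveSubcategory.of_isZero _ (IsZero.of_epi (X.obj.as.pOpcycles n) hz)⟩

variable [IsFrobeniusAlgebra R A]

lemma IsPlusB.extendsAt {K : CochainComplex (ModuleCat.{u} A) ℤ} (hK : IsPlusB R K) :
    ∃ b : ℤ, ∀ n > b, ∀ Y : ModuleCat.{u} A, Projective Y → ExtendsAt K n Y := by
  obtain ⟨h, -, b, hb⟩ := hK
  refine ⟨b, fun n hn Y hY => ?_⟩
  exact extendsAt_of_exactAt (E := ModProj R A) K rfl (hb n hn.le).1 (hb n hn.le).2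
    (modLF_le_modProj _ (ModLF.of_projective _ ((isProj_iff A _).1 (h _).1)))
    (hb (n + 1) (by omega)).2 (modLF_le_modProj _ (ModLF.of_projective _ hY))

/-- The objects of `K^{+,b}(proj A)` are compact: a morphism to a coproduct differs from a
morphism to a finite subcoproduct by a morphism that vanishes in low degrees, and such a morphism is
null-homotopic. -/
lemma KPlusB.isCompactObject {X : KProj A} (hX : KPlusB R A X) : IsCompactObject.{u} X := by
  rw [kPlusB_iff] at hX
  obtain ⟨K, hK, rfl⟩ := X.exists_eq_mk
  change IsPlusB R K at hX
  obtain ⟨b, hb⟩ := hX.extendsAt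
  obtain ⟨a, ha⟩ := hX.exists_ge
  refine .of_exists fun J Y => ?_
  choose L hL hLY using fun j => (Y j).exists_eq_mk
  obtain rfl : Y = fun j => KProj.mk (L j) (hL j) := funext hLY
  have hc := coproductIsCoproduct L
  refine ⟨_, KProj.nonempty_isColimit hL hc, fun f => ?_⟩
  obtain ⟨f, rfl⟩ : ∃ f', f = ObjectProperty.homMk f' := ⟨f.hom, rfl⟩
  obtain ⟨s, g, rfl⟩ := mem_finiteMaps_quotient hc (fun n => (hX.isFGProj n).2) ha b (fun φ hφ =>
    homotopy_zero_of_extendsAt φ b hφ fun n hn => hb n hn _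
      ((isProj_iff A _).1 (termwise_isProj_of_isColimit hL hc n))) f
  refine ⟨s, fun j => ObjectProperty.homMk (g j), ?_⟩
  apply (KTerm (IsProj A)).ι.map_injective
  rw [CategoryTheory.Functor.map_sum]
  rfl

/-- The bounded complexes of finitely generated projective modules are compact even in the homotopy
category of all complexes of modules. -/
lemma KbProj.isCompactObject_obj {X : KProj A} (hX : KbProj A X) :
    IsCompactObject.{u} X.obj := by
  obtain ⟨K, hK, rfl⟩ := X.exists_eq_mk
  obtain ⟨h, ⟨a, ha⟩, b, hb⟩ : boundedTermwise (IsFGProj A) K := hX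
  refine .of_exists fun J Y => ?_
  choose L hL using fun j => (Y j).quotient_obj_surjective
  obtain rfl : (fun j => (HomotopyCategory.quotient _ _).obj (L j)) = Y := funext hL
  have hc := coproductIsCoproduct L
  refine ⟨_, nonempty_isColimit_quotient hc, fun f => ?_⟩
  refine mem_finiteMaps_quotient hc (fun n => (h n).2) ha b (fun φ hφ => ?_) f
  refine ⟨.ofEq (HomologicalComplex.hom_ext _ _ fun n => ?_)⟩
  by_cases hn : n ≤ b
  · exact hφ n hn
  · exact (K.isZero_of_isStrictlyLE b n (by omega)).eq_of_src _ _

end KPlusB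

/-! ### Skeletons -/

section Skeleton

variable {A : Type u} [Ring A]

/-- Up to isomorphism, there is only a set (in the universe `u`) of complexes of finitely generated
modules. -/
lemma exists_skeleton (S : ObjectProperty (KProj A))
    (hS : ∀ X, S X → ∀ n, IsFGProj A (X.obj.as.X n)) :
    ∃ (ι : Type u) (G : ι → KProj A), (∀ i, S (G i)) ∧ ∀ X, S X → ∃ i, Nonempty (G i ≅ X) := by
  -- Each finitely generated module is isomorphic to a quotient of some `A ^ k`.
  let M (p : Σ k : ℕ, Submodule A (Fin k → A)) : ModuleCat.{u} A :=
    ModuleCat.of A ((Fin p.1 → A) ⧸ p.2)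
  have hM (N : ModuleCat.{u} A) (hN : IsFGProj A N) : ∃ p, Nonempty (M p ≅ N) := by
    have := hN.2
    obtain ⟨k, f, hf⟩ := Module.Finite.exists_fin' A N
    exact ⟨⟨k, LinearMap.ker f⟩, ⟨(f.quotKerEquivOfSurjective hf).toModuleIso⟩⟩
  let ι₀ := Σ p : ℤ → Σ k : ℕ, Submodule A (Fin k → A),
    { d : ∀ n, M (p n) ⟶ M (p (n + 1)) // ∀ n, d n ≫ d (n + 1) = 0 }
  let G₀ (i : ι₀) : CochainComplex (ModuleCat.{u} A) ℤ :=
    CochainComplex.of (fun n => M (i.1 n)) i.2.1 i.2.2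
  have hG₀ (K : CochainComplex (ModuleCat.{u} A) ℤ) (hK : ∀ n, IsFGProj A (K.X n)) :
      ∃ i, Nonempty (G₀ i ≅ K) := by
    choose p e using fun n => hM _ (hK n)
    replace e n := (e n).some
    refine ⟨⟨p, fun n => (e n).hom ≫ K.d n (n + 1) ≫ (e (n + 1)).inv, fun n => by simp⟩,
      ⟨HomologicalComplex.Hom.isoOfComponents e ?_⟩⟩
    rintro n _ rfl
    dsimp [G₀]
    rw [CochainComplex.of_d]
    simp
  let ι := { i : ι₀ // ∃ X, S X ∧ Nonempty ((HomotopyCategory.quotient _ _).obj (G₀ i) ≅ X.obj) }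
  let G (i : ι) : KProj A := i.2.choose
  have hG (i : ι) : S (G i) := i.2.choose_spec.1
  have e (i : ι) : (HomotopyCategory.quotient _ _).obj (G₀ i.1) ≅ (G i).obj :=
    i.2.choose_spec.2.some
  refine ⟨ι, G, hG, fun X hX => ?_⟩
  obtain ⟨i, ⟨e'⟩⟩ := hG₀ X.obj.as (hS X hX)
  have e'' : (HomotopyCategory.quotient _ _).obj (G₀ i) ≅ X.obj :=
    (HomotopyCategory.quotient _ _).mapIso e'
  exact ⟨⟨i, X, hX, ⟨e''⟩⟩, ⟨ObjectProperty.isoMk _ ((e _).symm ≪≫ e'')⟩⟩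

end Skeleton

/-! ### Acyclic complexes of modules -/

section Acyclic

variable {A : Type u} [Ring A]

variable (A) in
/-- The complex that is given by the module `A` in degree `n`. -/
abbrev freeSingle (n : ℤ) : CochainComplex (ModuleCat.{u} A) ℤ :=
  (HomologicalComplex.single _ (ComplexShape.up ℤ) n).obj (ModuleCat.of A A)

variable (A) in
lemma boundedTermwise_freeSingle (n : ℤ) : boundedTermwise (IsFGProj A) (freeSingle A n) := by
  refine ⟨fun m => ?_, ⟨n, ?_⟩, ⟨n, ?_⟩⟩
  · by_cases h : m = n
    · exact IsAdditiveSubcategory.of_iso (E := IsFGProj A)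
        (HomologicalComplex.singleObjXIsoOfEq (ComplexShape.up ℤ) n (ModuleCat.of A A) m h).symm
        ⟨(inferInstance : Module.Projective A A), (inferInstance : Module.Finite A A)⟩
    · exact IsAdditiveSubcategory.of_isZero _ (HomologicalComplex.isZero_single_obj_X _ _ _ _ h)
  · rw [CochainComplex.isStrictlyGE_iff]
    exact fun i hi => HomologicalComplex.isZero_single_obj_X _ _ _ _ hi.ne
  · rw [CochainComplex.isStrictlyLE_iff]
    exact fun i hi => HomologicalComplex.isZero_single_obj_X _ _ _ _ hi.ne'

variable (A) in
/-- `A` in degree `n`, as an object of `K(Proj A)`. -/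
abbrev KProj.free (n : ℤ) : KProj A :=
  KProj.mk (freeSingle A n) fun m => ((boundedTermwise_freeSingle A n).1 m).1

lemma kbProj_free (n : ℤ) : KbProj A (KProj.free A n) := boundedTermwise_freeSingle A n

/-- A cycle of `K` is a morphism from a shift of `A`; a null-homotopy of this morphism gives a
preimage under the differential. -/
lemma acyclic_of_freeSingle (K : CochainComplex (ModuleCat.{u} A) ℤ)
    (h : ∀ (n : ℤ) (f : freeSingle A n ⟶ K), Nonempty (Homotopy f 0)) : K.Acyclic := by
  intro n
  rw [K.exactAt_iff' (n - 1) n (n + 1) (by simp) (by simp), ShortComplex.moduleCat_exact_iff]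
  intro x hx
  let φ : ModuleCat.of A A ⟶ K.X n := ModuleCat.ofHom (LinearMap.toSpanSingleton A _ x)
  have hφ : ∀ k, (ComplexShape.up ℤ).Rel n k → φ ≫ K.d n k = 0 := by
    rintro _ rfl
    refine ModuleCat.hom_ext (LinearMap.ext_ring ?_)
    change (K.d n (n + 1)).hom (LinearMap.toSpanSingleton A _ x 1) = 0
    rw [LinearMap.toSpanSingleton_apply, one_smul]
    exact hx
  obtain ⟨s⟩ := h n (HomologicalComplex.mkHomFromSingle φ hφ)
  have hs := s.comm n
  rw [dNext_eq _ (show (ComplexShape.up ℤ).Rel n (n + 1) from rfl),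
    prevD_eq _ (show (ComplexShape.up ℤ).Rel (n - 1) n from by simp),
    HomologicalComplex.mkHomFromSingle_f, HomologicalComplex.single_obj_d, zero_comp, zero_add,
    HomologicalComplex.zero_f, add_zero, ← Iso.eq_inv_comp] at hs
  refine ⟨((HomologicalComplex.singleObjXSelf (ComplexShape.up ℤ) n (ModuleCat.of A A)).inv ≫
    s.hom n (n - 1)).hom 1, ?_⟩
  have := congrArg (fun k => k.hom (1 : A)) hs
  refine this.symm.trans ?_
  change LinearMap.toSpanSingleton A _ x 1 = x
  rw [LinearMap.toSpanSingleton_apply, one_smul]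

/-- A complex of modules is acyclic if all morphisms from shifts of `A` are null-homotopic. -/
lemma mem_subcategoryAcyclic_of_free {X : HomotopyCategory (ModuleCat.{u} A) (ComplexShape.up ℤ)}
    (h : ∀ (n : ℤ) (f : (KProj.free A n).obj ⟶ X), f = 0) :
    HomotopyCategory.subcategoryAcyclic _ X := by
  obtain ⟨K, rfl⟩ := X.quotient_obj_surjective
  rw [HomotopyCategory.quotient_obj_mem_subcategoryAcyclic_iff_acyclic]
  refine acyclic_of_freeSingle K fun n f => ⟨HomotopyCategory.homotopyOfEq _ _ ?_⟩
  rw [CategoryTheory.Functor.map_zero]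
  exact h n _

lemma leftOrthogonal_of_kbProj {X : KProj A} (hX : KbProj A X) :
    (HomotopyCategory.subcategoryAcyclic (ModuleCat.{u} A)).leftOrthogonal X.obj := by
  obtain ⟨K, hK, rfl⟩ := X.exists_eq_mk
  have := isKProjective_of_perfect A K hX
  exact CochainComplex.IsKProjective.leftOrthogonal K

lemma leftOrthogonal_of_localising {X : KProj A} (hX : Localising.{u} (KbProj A) X) :
    (HomotopyCategory.subcategoryAcyclic (ModuleCat.{u} A)).leftOrthogonal X.obj := by
  intro Y f hY
  have h : ∀ W, KbProj A W → IsCouniversalFor (KTerm (IsProj A)).ι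
      (0 : (KTerm (IsProj A)).ι.obj 0 ⟶ Y) W := fun W hW =>
    ⟨fun a b _ => (isZero_zero (KProj A)).eq_of_tgt a b, fun g => ⟨0,
      comp_zero.trans (leftOrthogonal_of_kbProj hW g hY).symm⟩⟩
  obtain ⟨k, hk⟩ := (isCouniversalFor_of_localising (KTerm (IsProj A)).ι _ h hX).2 f
  rw [← hk]
  exact comp_zero

end Acyclic

/-! ### Resolutions by complexes of projective modules -/

section Resolution

lemma eq_zero_of_bijective {C : Type u₁} [Category.{v₁} C] [Preadditive C] [HasZeroObject C]
    [HasShift C ℤ] [∀ n : ℤ, (shiftFunctor C n).Additive] [Pretriangulated C] {X Y Z W : C}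
    {f : X ⟶ Y} {g : Y ⟶ Z} {h : Z ⟶ X⟦(1 : ℤ)⟧} (H : Triangle.mk f g h ∈ distTriang C)
    (h₁ : Function.Surjective fun k : W ⟶ X => k ≫ f)
    (h₂ : Function.Injective fun k : W⟦(-1 : ℤ)⟧ ⟶ X => k ≫ f) (k : W ⟶ Z) : k = 0 := by
  obtain ⟨e, l, hl⟩ := exists_eq_shift_map (k ≫ h)
  have hlf : l ≫ f = 0 := by
    apply (shiftFunctor C (1 : ℤ)).map_injective
    rw [CategoryTheory.Functor.map_comp, CategoryTheory.Functor.map_zero, ← cancel_epi e.hom,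
      ← Category.assoc, ← hl, Category.assoc, distTriang_comp₃₁ H, comp_zero, comp_zero]
  obtain rfl : l = 0 := h₂ (hlf.trans zero_comp.symm)
  obtain ⟨b, rfl⟩ := exists_lift₃ H k (by rw [hl, CategoryTheory.Functor.map_zero, comp_zero])
  obtain ⟨c, rfl⟩ := h₁ b
  dsimp
  rw [Category.assoc, distTriang_comp₁₂ H, comp_zero]

lemma Localising.map {T : Type u₁} [Category.{v₁} T] [Preadditive T] [HasZeroObject T]
    [HasShift T ℤ] [∀ n : ℤ, (shiftFunctor T n).Additive] [Pretriangulated T]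
    {T' : Type u₂} [Category.{v₂} T'] [Preadditive T'] [HasZeroObject T']
    [HasShift T' ℤ] [∀ n : ℤ, (shiftFunctor T' n).Additive] [Pretriangulated T']
    (F : T ⥤ T') [F.CommShift ℤ] [F.IsTriangulated]
    [∀ J : Type u, PreservesColimitsOfShape (Discrete J) F] {S : ObjectProperty T}
    {S' : ObjectProperty T'} (h : ∀ X, S X → Localising.{u} S' (F.obj X)) {X : T}
    (hX : Localising.{u} S X) : Localising.{u} S' (F.obj X) := by
  induction hX with
  | of X hX => exact h X hX
  | zero X hX => exact .zero _ (F.map_isZero hX)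
  | shift X n _ ih =>
    exact ObjectProperty.prop_of_iso _ ((F.commShiftIso n).app X).symm (.shift _ n ih)
  | ext₂ D hD _ _ h₁ h₃ => exact .ext₂ _ (F.map_distinguished D hD) h₁ h₃
  | coprod J Y c hc _ ih => exact .coprod J _ _ (isColimitCofanMkObjOfIsColimit F Y c.inj
      (IsColimit.ofIsoColimit hc (Cofan.ext (Iso.refl _) (by simp)))) ih

variable {A : Type u} [Ring A]

lemma mem_subcategoryAcyclic_of_bijective
    {X Y Z : HomotopyCategory (ModuleCat.{u} A) (ComplexShape.up ℤ)}
    {f : X ⟶ Y} {g : Y ⟶ Z} {h : Z ⟶ X⟦(1 : ℤ)⟧} (H : Triangle.mk f g h ∈ distTriang _)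
    (hf : ∀ W, KbProj A W → Function.Bijective fun k : W.obj ⟶ X => k ≫ f) :
    HomotopyCategory.subcategoryAcyclic _ Z := by
  refine mem_subcategoryAcyclic_of_free fun n => eq_zero_of_bijective H (hf _ (kbProj_free n)).2 ?_
  have := (hf _ ((KbProj A).le_shift (-1 : ℤ) _ (kbProj_free n))).1
  rwa [KProj.shift_obj] at this

/-- Every complex of modules admits a quasi-isomorphism from a complex in the localising subcategory
of `K(Proj A)` that is generated by the bounded complexes of finitely generated projective
modules. -/
lemma exists_resolution (Y : HomotopyCategory (ModuleCat.{u} A) (ComplexShape.up ℤ)) :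
    ∃ (X : KProj A) (_ : Localising.{u} (KbProj A) X) (ε : X.obj ⟶ Y)
      (Z : HomotopyCategory (ModuleCat.{u} A) (ComplexShape.up ℤ)) (g : Y ⟶ Z)
      (h : Z ⟶ X.obj⟦(1 : ℤ)⟧), Triangle.mk ε g h ∈ distTriang _ ∧
      HomotopyCategory.subcategoryAcyclic _ Z := by
  obtain ⟨ι, G, hG, hS⟩ := exists_skeleton (KbProj A) fun X hX => hX.1
  obtain ⟨X, hX, ε, hε⟩ := exists_couniversal (KTerm (IsProj A)).ι (KbProj A) G hG hS
    (fun X hX => (KbProj.isCompactObject_obj hX).of_map (KTerm (IsProj A)).ι) Y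
  obtain ⟨Z, g, h, H⟩ := distinguished_cocone_triangle ε
  refine ⟨X, hX, ε, Z, g, h, H, mem_subcategoryAcyclic_of_bijective H fun W hW => ?_⟩
  refine (Function.Bijective.of_comp_iff _ (ObjectProperty.fullyFaithfulι
    (KTerm (IsProj A))).homEquiv.bijective).1 (hε W (.of W hW))

variable [HasDerivedCategory.{w} (ModuleCat.{u} A)]

lemma isIso_Qh_map {X Y Z : HomotopyCategory (ModuleCat.{u} A) (ComplexShape.up ℤ)}
    {f : X ⟶ Y} {g : Y ⟶ Z} {h : Z ⟶ X⟦(1 : ℤ)⟧} (H : Triangle.mk f g h ∈ distTriang _)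
    (hZ : HomotopyCategory.subcategoryAcyclic _ Z) : IsIso (DerivedCategory.Qh.map f) :=
  Localization.inverts DerivedCategory.Qh (HomotopyCategory.subcategoryAcyclic _).trW _
    (.mk _ H hZ)

lemma isZero_Qh_iff (X : HomotopyCategory (ModuleCat.{u} A) (ComplexShape.up ℤ)) :
    IsZero (DerivedCategory.Qh.obj X) ↔ HomotopyCategory.subcategoryAcyclic _ X := by
  constructor
  · intro h
    rw [HomotopyCategory.mem_subcategoryAcyclic_iff]
    intro n
    exact (((DerivedCategory.homologyFunctor _ n).map_isZero h)).of_iso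
      ((DerivedCategory.homologyFunctorFactorsh _ n).app X).symm
  · intro h
    have := isIso_Qh_map (contractible_distinguished₁ X) h
    exact (DerivedCategory.Qh.map_isZero (isZero_zero _)).of_iso
      (asIso (DerivedCategory.Qh.map (0 : 0 ⟶ X))).symm

lemma bijective_Qh_map {X : KProj A} (hX : Localising.{u} (KbProj A) X)
    (Y : HomotopyCategory (ModuleCat.{u} A) (ComplexShape.up ℤ)) :
    Function.Bijective (DerivedCategory.Qh.map : (X.obj ⟶ Y) → _) :=
  (leftOrthogonal_of_localising hX).map_bijective_of_isTriangulated _ _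

/-- The localization functor `K(Mod A) ⥤ D(Mod A)` preserves coproducts. The coproduct `∐ P j` of
resolutions of the `X j` belongs to the localising subcategory generated by `K^b(proj A)`, so that
the claim holds for the `P j`, and the cone of `∐ P j ⟶ ∐ X j` is acyclic because the objects of
`K^b(proj A)` are compact in `K(Mod A)`. -/
lemma nonempty_isColimit_Qh {J : Type u}
    {X : J → HomotopyCategory (ModuleCat.{u} A) (ComplexShape.up ℤ)} {c : Cofan X}
    (hc : IsColimit c) : Nonempty (IsColimit (Cofan.mk (DerivedCategory.Qh.obj c.pt)
      fun j => DerivedCategory.Qh.map (c.inj j))) := by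
  choose P hP ε Z g h H hZ using fun j => exists_resolution (X j)
  have hι := isColimitCofanMkObjOfIsColimit (KTerm (IsProj A)).ι P _ (coproductIsCoproduct P)
  have hP' : Localising.{u} (KbProj A) (∐ P) := .coprod J P _ (coproductIsCoproduct P) hP
  let Q := DerivedCategory.Qh (C := ModuleCat.{u} A)
  let ι := (KTerm (IsProj A)).ι
  let i (j : J) : (P j).obj ⟶ (∐ P).obj := ι.map (Sigma.ι P j)
  let f : (∐ P).obj ⟶ c.pt := Cofan.IsColimit.desc hι fun j => ε j ≫ c.inj j
  have hf (j : J) : i j ≫ f = ε j ≫ c.inj j := Cofan.IsColimit.fac hι _ j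
  have hε (W : KProj A) (hW : KbProj A W) (j : J) :
      Function.Bijective fun k : W.obj ⟶ (P j).obj => k ≫ ε j := by
    have := isIso_Qh_map (H j) (hZ j)
    have hW' := fun Y => bijective_Qh_map (.of W hW) Y
    refine (Function.Bijective.of_comp_iff' (hW' _) _).1 ?_
    have : (Q.map ∘ fun k : W.obj ⟶ (P j).obj => k ≫ ε j) =
        (asIso (Q.map (ε j))).homToEquiv ∘ Q.map := by
      ext k
      exact Q.map_comp k (ε j)
    rw [this]
    exact (Equiv.bijective _).comp (hW' _)
  have hQf : IsIso (Q.map f) := by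
    obtain ⟨Z', g', h', H'⟩ := distinguished_cocone_triangle f
    refine isIso_Qh_map H' (mem_subcategoryAcyclic_of_bijective H' fun W hW => ?_)
    obtain ⟨π, h₁, h₂⟩ := exists_projections hι
    obtain ⟨π', h₁', h₂'⟩ := exists_projections hc
    have hπ (j : J) : f ≫ π' j = π j ≫ ε j := by
      refine Cofan.IsColimit.hom_ext hι _ _ fun l => ?_
      refine ((Category.assoc _ _ _).symm.trans (congrArg (· ≫ π' j) (hf l))).trans ?_
      rw [Category.assoc]
      by_cases hl : l = j
      · subst hl
        rw [h₁', Category.comp_id]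
        exact ((Category.assoc _ _ _).symm.trans ((congrArg (· ≫ ε l) (h₁ l)).trans
          (Category.id_comp _))).symm
      · rw [h₂' l j hl, comp_zero]
        exact ((Category.assoc _ _ _).symm.trans ((congrArg (· ≫ ε j) (h₂ l j hl)).trans
          zero_comp)).symm
    constructor
    · intro a b hab
      rw [← sub_eq_zero]
      have hab' : (a - b) ≫ f = 0 := by
        rw [Preadditive.sub_comp, sub_eq_zero]
        exact hab
      refine eq_zero_of_mem_finiteMaps (KbProj.isCompactObject_obj hW J _ _ hι _) h₁ h₂ fun j => ?_
      refine (hε W hW j).1 ?_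
      dsimp
      rw [Category.assoc, ← hπ, reassoc_of% hab', zero_comp, zero_comp]
    · intro k
      obtain ⟨s, l, rfl⟩ := KbProj.isCompactObject_obj hW J _ _ hc k
      choose m hm using fun j => (hε W hW j).2 (l j)
      refine ⟨∑ j ∈ s, m j ≫ i j, ?_⟩
      dsimp only
      rw [Preadditive.sum_comp]
      refine Finset.sum_congr rfl fun j _ => ?_
      rw [Category.assoc, hf, ← Category.assoc]
      exact congrArg (· ≫ c.inj j) (hm j)
  have hQε (j : J) : IsIso (Q.map (ε j)) := isIso_Qh_map (H j) (hZ j)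
  have hQf' (j : J) : Q.map (i j) ≫ Q.map f = Q.map (ε j) ≫ Q.map (c.inj j) := by
    rw [← Q.map_comp, hf, Q.map_comp]
  have hex (Y : DerivedCategory (ModuleCat.{u} A)) (t : ∀ j, Q.obj (X j) ⟶ Y) :
      ∃ k : Q.obj c.pt ⟶ Y, ∀ j, Q.map (c.inj j) ≫ k = t j := by
    let e := Q.objObjPreimageIso Y
    choose v hv using fun j => (bijective_Qh_map (hP j) _).2 (Q.map (ε j) ≫ t j ≫ e.inv)
    let v' := Cofan.IsColimit.desc hι v
    have hv' (j : J) : i j ≫ v' = v j := Cofan.IsColimit.fac hι _ j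
    refine ⟨inv (Q.map f) ≫ Q.map v' ≫ e.hom, fun j => ?_⟩
    rw [← cancel_epi (Q.map (ε j)), ← reassoc_of% hQf' j, IsIso.hom_inv_id_assoc,
      ← Q.map_comp_assoc, hv', hv]
    simp
  have hext (Y : DerivedCategory (ModuleCat.{u} A)) (k : Q.obj c.pt ⟶ Y)
      (hk : ∀ j, Q.map (c.inj j) ≫ k = 0) : k = 0 := by
    let e := Q.objObjPreimageIso Y
    obtain ⟨v, hv⟩ := (bijective_Qh_map hP' _).2 (Q.map f ≫ k ≫ e.inv)
    have : v = 0 := by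
      refine Cofan.IsColimit.hom_ext hι _ _ fun j => ?_
      refine (bijective_Qh_map (hP j) _).1 ?_
      change Q.map (i j ≫ v) = Q.map (i j ≫ 0)
      rw [Q.map_comp, hv, reassoc_of% hQf' j, reassoc_of% hk j, comp_zero, zero_comp, comp_zero,
        CategoryTheory.Functor.map_zero]
    rw [this, CategoryTheory.Functor.map_zero] at hv
    rw [← cancel_epi (Q.map f), ← cancel_mono e.inv, Category.assoc, ← hv, comp_zero, zero_comp]
  refine ⟨Cofan.IsColimit.mk _ (fun s => (hex s.pt s.inj).choose)
    (fun s j => (hex s.pt s.inj).choose_spec j) fun s m hm => ?_⟩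
  refine sub_eq_zero.1 (hext _ _ fun j => (Preadditive.comp_sub _ _ _).trans ?_)
  exact sub_eq_zero.2 ((hm j).trans ((hex s.pt s.inj).choose_spec j).symm)

instance (J : Type u) : PreservesColimitsOfShape (Discrete J)
    (DerivedCategory.Qh : _ ⥤ DerivedCategory (ModuleCat.{u} A)) :=
  have _ (X : J → HomotopyCategory (ModuleCat.{u} A) (ComplexShape.up ℤ)) :
      PreservesColimit (Discrete.functor X) (DerivedCategory.Qh : _ ⥤ DerivedCategory _) :=
    preservesColimit_of_preserves_colimit_cocone (coproductIsCoproduct X)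
      ((isColimitMapCoconeCofanMkEquiv _ _ _).symm
        (nonempty_isColimit_Qh (coproductIsCoproduct X)).some)
  preservesColimitsOfShape_of_discrete _

end Resolution

section Adjoints

variable {C : Type u₁} [Category.{v₁} C] [Preadditive C] [HasZeroObject C]
  [HasShift C ℤ] [∀ n : ℤ, (shiftFunctor C n).Additive] [Pretriangulated C]
  {D : Type u₂} [Category.{v₂} D] [Preadditive D] [HasZeroObject D]
  [HasShift D ℤ] [∀ n : ℤ, (shiftFunctor D n).Additive] [Pretriangulated D]

lemma isExactFunctor_leftAdjoint {F : C ⥤ D} {G : D ⥤ C} (adj : F ⊣ G) [G.CommShift ℤ]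
    [G.IsTriangulated] : IsExactFunctor F := by
  let := adj.leftAdjointCommShift ℤ
  have := adj.commShift_of_rightAdjoint ℤ
  have := adj.isTriangulated_leftAdjoint
  exact isExactFunctor_of_isTriangulated F

lemma isExactFunctor_rightAdjoint {F : C ⥤ D} {G : D ⥤ C} (adj : F ⊣ G) [F.CommShift ℤ]
    [F.IsTriangulated] : IsExactFunctor G := by
  let := adj.rightAdjointCommShift ℤ
  have := adj.commShift_of_leftAdjoint ℤ
  have := adj.isTriangulated_rightAdjoint
  exact isExactFunctor_of_isTriangulated G

/-- If `η : Y ⟶ G X` is an isomorphism with the universal property of the unit at `Y`, then the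
unit at `Y` is an isomorphism. -/
lemma isIso_unit_app_of_bijective {F : C ⥤ D} {G : D ⥤ C} (adj : F ⊣ G) {Y : C} {X : D}
    (η : Y ⟶ G.obj X) [IsIso η] (h : ∀ W : D, Function.Bijective fun k : X ⟶ W => η ≫ G.map k) :
    IsIso (adj.unit.app Y) := by
  obtain ⟨α, hα⟩ := (h (F.obj Y)).2 (adj.unit.app Y)
  have : adj.unit.app Y ≫ G.map ((adj.homEquiv _ _).symm η) = η :=
    (adj.homEquiv_unit _ _ _).symm.trans ((adj.homEquiv _ _).apply_symm_apply η)
  have hα' : α ≫ (adj.homEquiv _ _).symm η = 𝟙 _ := (h X).1 (by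
    dsimp at hα ⊢
    rw [CategoryTheory.Functor.map_comp, ← Category.assoc, hα, this]
    simp)
  have : (adj.homEquiv _ _).symm η ≫ α = 𝟙 _ := (adj.homEquiv _ _).injective (by
    rw [adj.homEquiv_unit, adj.homEquiv_unit, CategoryTheory.Functor.map_comp, ← Category.assoc,
      this]
    dsimp at hα
    rw [hα]
    simp)
  have : IsIso α := ⟨_, hα', this⟩
  dsimp at hα
  rw [← hα]
  infer_instance

end Adjoints

section Canonical

variable (R A : Type u) [CommRing R] [Ring A] [Algebra R A]
  [HasDerivedCategory.{w} (ModuleCat.{u} A)]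

instance : (canonicalFunctor.{w} R A).CommShift ℤ :=
  inferInstanceAs (((isKLF R A).ι ⋙ (KTerm (IsProj A)).ι ⋙ DerivedCategory.Qh).CommShift ℤ)

instance : (canonicalFunctor.{w} R A).IsTriangulated :=
  inferInstanceAs (((isKLF R A).ι ⋙ (KTerm (IsProj A)).ι ⋙ DerivedCategory.Qh).IsTriangulated)

variable {R A}

lemma isKLF_of_localising {X : KProj A} (hX : Localising.{u} (KbProj A) X) : isKLF R A X := by
  induction hX with
  | of X hX => exact .of X (kbProj_le_kPlusB R X hX)
  | zero X hX => exact .zero X hX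
  | shift X n _ ih => exact .shift X n ih
  | ext₂ D hD _ _ h₁ h₃ => exact .ext₂ D hD h₁ h₃
  | coprod J Y c hc _ ih => exact .coprod J Y c hc ih

/-- Every object of the derived category is isomorphic to the image of an object of the localising
subcategory that is generated by the bounded complexes of finitely generated projective modules. -/
lemma exists_localising_iso (Y : DerivedCategory (ModuleCat.{u} A)) :
    ∃ (X : KProj A) (_ : Localising.{u} (KbProj A) X),
      Nonempty (Y ≅ DerivedCategory.Qh.obj X.obj) := by
  obtain ⟨X, hX, ε, Z, g, h, H, hZ⟩ :=
    exists_resolution (DerivedCategory.Qh.objPreimage Y)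
  have := isIso_Qh_map H hZ
  exact ⟨X, hX, ⟨(DerivedCategory.Qh.objObjPreimageIso Y).symm ≪≫
    (asIso (DerivedCategory.Qh.map ε)).symm⟩⟩

lemma exists_universal_canonicalFunctor (Y : DerivedCategory (ModuleCat.{u} A)) :
    ∃ (X : KLF R A) (_ : Localising.{u} (KbProj A) X.obj)
      (η : Y ≅ (canonicalFunctor.{w} R A).obj X),
      ∀ W : KLF R A, Function.Bijective fun k : X ⟶ W =>
        η.hom ≫ (canonicalFunctor.{w} R A).map k := by
  obtain ⟨X, hX, ⟨η⟩⟩ := exists_localising_iso Y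
  refine ⟨⟨X, isKLF_of_localising hX⟩, hX, η, fun W => ?_⟩
  exact (Equiv.bijective η.symm.homFromEquiv).comp ((bijective_Qh_map hX W.obj.obj).comp
    ((ObjectProperty.fullyFaithfulι (KTerm (IsProj A))).homEquiv.bijective.comp
      (ObjectProperty.fullyFaithfulι (isKLF R A)).homEquiv.bijective))

/-- The left adjoint is the resolution by complexes that are built from `K^b(proj A)`. -/
instance : (canonicalFunctor.{w} R A).IsRightAdjoint :=
  isRightAdjoint_of_bijective _ fun Y => by
    obtain ⟨X, _, η, h⟩ := exists_universal_canonicalFunctor (R := R) Y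
    exact ⟨X, η.hom, h⟩

/-- The resolution functor is fully faithful. -/
lemma fullyFaithful_leftAdjoint : Nonempty
    ((canonicalFunctor.{w} R A).leftAdjoint.FullyFaithful) := by
  have (Y : DerivedCategory (ModuleCat.{u} A)) :
      IsIso ((Adjunction.ofIsRightAdjoint (canonicalFunctor.{w} R A)).unit.app Y) := by
    obtain ⟨X, _, η, h⟩ := exists_universal_canonicalFunctor (R := R) Y
    exact isIso_unit_app_of_bijective _ η.hom h
  have := NatIso.isIso_of_isIso_app (Adjunction.ofIsRightAdjoint (canonicalFunctor.{w} R A)).unit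
  exact ⟨(Adjunction.ofIsRightAdjoint (canonicalFunctor.{w} R A)).fullyFaithfulLOfIsIsoUnit⟩

instance small_hom (X Y : HomotopyCategory (ModuleCat.{u} A) (ComplexShape.up ℤ)) :
    Small.{u} (DerivedCategory.Qh.obj X ⟶ DerivedCategory.Qh.obj Y) := by
  obtain ⟨P, hP, ⟨e⟩⟩ := exists_localising_iso (DerivedCategory.Qh.obj X)
  exact (small_congr (e.homFromEquiv.trans
    (Equiv.ofBijective _ (bijective_Qh_map hP Y)).symm)).2 inferInstance

variable [IsFrobeniusAlgebra R A]

/-- The right adjoint exists by approximation of objects of the derived category by objects of the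
localising subcategory that is generated by the compact objects in `K^{+,b}(proj A)`. -/
instance : (canonicalFunctor.{w} R A).IsLeftAdjoint :=
  isLeftAdjoint_of_bijective _ fun Y => by
    obtain ⟨ι, G, hG, hS⟩ := exists_skeleton (KPlusB R A) fun X hX => hX.1
    let e := DerivedCategory.Qh.objObjPreimageIso Y
    have (i : ι) : Small.{u} (((KTerm (IsProj A)).ι ⋙ DerivedCategory.Qh).obj (G i) ⟶ Y) :=
      (small_congr e.symm.homToEquiv).2 (small_hom _ _)
    obtain ⟨X, hX, ε, h⟩ := exists_couniversal ((KTerm (IsProj A)).ι ⋙ DerivedCategory.Qh)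
      (KPlusB R A) G hG hS (fun _ hX => KPlusB.isCompactObject hX) Y
    exact ⟨⟨X, hX⟩, ε, fun W => (h W.obj W.property).comp
      (ObjectProperty.fullyFaithfulι (isKLF R A)).homEquiv.bijective⟩

/-- In an adjoint triple, the right adjoint is fully faithful if the left adjoint is. -/
lemma fullyFaithful_rightAdjoint : Nonempty
    ((canonicalFunctor.{w} R A).rightAdjoint.FullyFaithful) := by
  obtain ⟨h⟩ := fullyFaithful_leftAdjoint (R := R) (A := A)
  exact ⟨Adjunction.Triple.fullyFaithfulEquiv ⟨Adjunction.ofIsRightAdjoint _,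
    Adjunction.ofIsLeftAdjoint (canonicalFunctor.{w} R A)⟩ h⟩

end Canonical

/-! ### The kernel of the canonical functor -/

section Kernel

variable (R A : Type u) [CommRing R] [Ring A] [Algebra R A]

/-- The acyclic complexes in `K^lf(Proj A, R)`. -/
abbrev acyclicObjects : ObjectProperty (KLF R A) :=
  (HomotopyCategory.subcategoryAcyclic (ModuleCat.{u} A)).inverseImage
    ((isKLF R A).ι ⋙ (KTerm (IsProj A)).ι)

variable {R A}

/-- There are no nonzero morphisms from `X` to the acyclic complexes. -/
lemma eq_zero_of_localising {X W : KLF R A} (hX : Localising.{u} (KbProj A) X.obj)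
    (hW : acyclicObjects R A W) (f : X ⟶ W) : f = 0 := by
  apply (isKLF R A).ι.map_injective
  apply (KTerm (IsProj A)).ι.map_injective
  exact leftOrthogonal_of_localising hX _ hW

lemma Localising.klf_shift {X : KLF R A} (hX : Localising.{u} (KbProj A) X.obj) (n : ℤ) :
    Localising.{u} (KbProj A) (X⟦n⟧).obj :=
  ObjectProperty.prop_of_iso _ (((isKLF R A).ι.commShiftIso n).app X).symm (.shift _ n hX)

lemma isZero_canonicalFunctor_iff [HasDerivedCategory.{w} (ModuleCat.{u} A)] (X : KLF R A) :
    IsZero ((canonicalFunctor.{w} R A).obj X) ↔ acyclicObjects R A X :=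
  isZero_Qh_iff X.obj.obj

/-- Each object is an extension of an acyclic complex by a K-projective complex. -/
lemma exists_triangle_acyclic (Y : KLF R A) : ∃ (X V : KLF R A) (ε : X ⟶ Y) (g : Y ⟶ V)
    (h : V ⟶ X⟦(1 : ℤ)⟧), Triangle.mk ε g h ∈ distTriang (KLF R A) ∧
      Localising.{u} (KbProj A) X.obj ∧ acyclicObjects R A V := by
  let := HasDerivedCategory.standard (ModuleCat.{u} A)
  obtain ⟨X, hX, ε, Z, g, h, H, hZ⟩ := exists_resolution Y.obj.obj
  let ε' : (⟨X, isKLF_of_localising hX⟩ : KLF R A) ⟶ Y :=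
    ObjectProperty.homMk (ObjectProperty.homMk ε)
  have : IsIso ((canonicalFunctor R A).map ε') := isIso_Qh_map H hZ
  obtain ⟨V, g', h', H'⟩ := distinguished_cocone_triangle ε'
  refine ⟨_, V, ε', g', h', H', hX, ?_⟩
  rw [← isZero_canonicalFunctor_iff]
  exact (isIso₁_iff_isZero (map_distTriang (canonicalFunctor R A) H')).1 this

lemma bijective_comp_of_triangle {X Y V W : KLF R A} {ε : X ⟶ Y} {g : Y ⟶ V}
    {h : V ⟶ X⟦(1 : ℤ)⟧} (H : Triangle.mk ε g h ∈ distTriang (KLF R A))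
    (hX : Localising.{u} (KbProj A) X.obj) (hW : acyclicObjects R A W) :
    Function.Bijective fun k : V ⟶ W => g ≫ k := by
  constructor
  · intro a b hab
    rw [← sub_eq_zero]
    obtain ⟨c, hc⟩ := exists_desc₃ H (a - b) (by rw [Preadditive.comp_sub, sub_eq_zero]; exact hab)
    rw [hc, eq_zero_of_localising (hX.klf_shift 1) hW c, comp_zero]
  · intro m
    obtain ⟨k, rfl⟩ := exists_desc₂ H m (eq_zero_of_localising hX hW _)
    exact ⟨k, rfl⟩

/-- The left adjoint of the inclusion of the acyclic objects sends `Y` to the cone of its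
approximation by an object of the localising subcategory generated by `K^b(proj A)`. -/
instance : (acyclicObjects R A).ι.IsRightAdjoint :=
  isRightAdjoint_of_bijective _ fun Y => by
    obtain ⟨X, V, ε, g, h, H, hX, hV⟩ := exists_triangle_acyclic Y
    exact ⟨⟨V, hV⟩, g, fun W => (bijective_comp_of_triangle H hX W.property).comp
      (ObjectProperty.fullyFaithfulι _).homEquiv.bijective⟩

/-- The right adjoint of the inclusion of the acyclic objects sends `Y` to the fibre of the unit of
the adjunction between the canonical functor and its right adjoint. -/
instance [IsFrobeniusAlgebra R A] : (acyclicObjects R A).ι.IsLeftAdjoint :=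
  isLeftAdjoint_of_bijective _ fun Y => by
    let := HasDerivedCategory.standard (ModuleCat.{u} A)
    let q := canonicalFunctor R A
    obtain ⟨hff⟩ := fullyFaithful_rightAdjoint (R := R) (A := A)
    have := hff.full
    have := hff.faithful
    let adj := Adjunction.ofIsLeftAdjoint q
    have hz (W : KLF R A) (hW : acyclicObjects R A W) (Z : DerivedCategory (ModuleCat.{u} A))
        (f : W ⟶ q.rightAdjoint.obj Z) : f = 0 :=
      (adj.homEquiv _ _).symm.injective
        (((isZero_canonicalFunctor_iff W).2 hW).eq_of_src _ _)
    obtain ⟨X, f, h, H⟩ := distinguished_cocone_triangle₁ (adj.unit.app Y)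
    have hX : acyclicObjects R A X := by
      rw [← isZero_canonicalFunctor_iff]
      have : IsIso (q.map (adj.unit.app Y)) := inferInstance
      exact (Triangle.isZero₁_iff_isIso₂ _ (map_distTriang q H)).2 this
    refine ⟨⟨X, hX⟩, f, fun W => Function.Bijective.comp (g := fun k : W.obj ⟶ X => k ≫ f) ⟨?_, ?_⟩
      (ObjectProperty.fullyFaithfulι _).homEquiv.bijective⟩
    · intro a b hab
      rw [← sub_eq_zero]
      have hab' : (a - b) ≫ f = 0 := by
        rw [Preadditive.sub_comp, sub_eq_zero]
        exact hab
      generalize a - b = c at hab' ⊢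
      have hc : c⟦(1 : ℤ)⟧' ≫ f⟦(1 : ℤ)⟧' = 0 := by
        rw [← CategoryTheory.Functor.map_comp, hab', CategoryTheory.Functor.map_zero]
      obtain ⟨d, hd⟩ := exists_lift₁ H (c⟦(1 : ℤ)⟧') hc
      rw [hz _ ((acyclicObjects R A).le_shift (1 : ℤ) _ W.property) _ d, zero_comp] at hd
      exact (shiftFunctor (KLF R A) (1 : ℤ)).map_injective
        (hd.trans (CategoryTheory.Functor.map_zero _ _ _).symm)
    · intro m
      obtain ⟨k, hk⟩ := exists_lift₂ H m (hz _ W.property _ _)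
      exact ⟨k, hk.symm⟩

end Kernel

/-! ### Dévissage -/

section Image

variable {T : Type u₁} [Category.{v₁} T] [Preadditive T] [HasZeroObject T]
  [HasShift T ℤ] [∀ n : ℤ, (shiftFunctor T n).Additive] [Pretriangulated T]
  {D : Type u₂} [Category.{v₂} D] [Preadditive D] [HasZeroObject D]
  [HasShift D ℤ] [∀ n : ℤ, (shiftFunctor D n).Additive] [Pretriangulated D]
  (F : T ⥤ D) [F.CommShift ℤ] [F.IsTriangulated]

/-- The essential image of a class of objects. -/
def imageOf (S : ObjectProperty T) : ObjectProperty D := fun Y => ∃ X, S X ∧ Nonempty (F.obj X ≅ Y)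

instance (S : ObjectProperty T) : (imageOf F S).IsClosedUnderIsomorphisms where
  of_iso e := fun ⟨X, hX, ⟨e'⟩⟩ => ⟨X, hX, ⟨e' ≪≫ e⟩⟩

/-- The essential image of a triangulated subcategory is a triangulated subcategory if the functor
is full on it. -/
lemma isTriangulated_imageOf (S : ObjectProperty T) [S.IsTriangulated]
    (hS : ∀ X Y, S X → S Y → Function.Surjective (F.map : (X ⟶ Y) → _)) :
    (imageOf F S).IsTriangulated :=
  have h₁ : (imageOf F S).IsStableUnderShift ℤ :=
    { isStableUnderShiftBy n :=
        { le_shift := fun Y ⟨X, hX, ⟨e⟩⟩ => ⟨X⟦n⟧, S.le_shift n _ hX,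
            ⟨(F.commShiftIso n).app X ≪≫ (shiftFunctor D n).mapIso e⟩⟩ } }
  have h₃ : (imageOf F S).IsTriangulatedClosed₃ :=
    { ext₃' := fun Y hY ⟨X₁, hX₁, ⟨e₁⟩⟩ ⟨X₂, hX₂, ⟨e₂⟩⟩ => by
        obtain ⟨f, hf⟩ := hS X₁ X₂ hX₁ hX₂ (e₁.hom ≫ Y.mor₁ ≫ e₂.inv)
        obtain ⟨Z, g, h, H⟩ := distinguished_cocone_triangle f
        obtain ⟨Z', hZ', ⟨e'⟩⟩ := ObjectProperty.IsTriangulatedClosed₃.ext₃' (P := S) _ H hX₁ hX₂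
        have e := isoTriangleOfIso₁₂ _ Y (F.map_distinguished _ H) hY e₁ e₂ (by
          change F.map f ≫ e₂.hom = e₁.hom ≫ Y.mor₁
          rw [hf]
          simp)
        exact ⟨Y.obj₃, ⟨Z', hZ', ⟨(F.mapIso e').symm ≪≫ Triangle.π₃.mapIso e⟩⟩, ⟨Iso.refl _⟩⟩ }
  { exists_zero := by
      obtain ⟨Z, hZ, hZ'⟩ := S.exists_prop_of_containsZero
      exact ⟨F.obj Z, F.map_isZero hZ, Z, hZ', ⟨Iso.refl _⟩⟩
    toIsTriangulatedClosed₂ := .of_isTriangulatedClosed₃ }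

end Image

section Devissage

variable {C : Type u₁} [Category.{v₁} C] [Abelian C]

instance : IsAdditiveSubcategory (⊤ : ObjectProperty C) where
  of_isZero _ _ := trivial
  of_iso _ _ := trivial
  biprod _ _ _ _ := trivial

variable [HasDerivedCategory.{w} C]

lemma prop_single (P : ObjectProperty (DerivedCategory C)) [P.IsTriangulated]
    [P.IsClosedUnderIsomorphisms] {M : C} (h : P ((DerivedCategory.singleFunctor C 0).obj M))
    (n : ℤ) :
    P (DerivedCategory.Q.obj ((HomologicalComplex.single C (ComplexShape.up ℤ) n).obj M)) := by
  have e : ((DerivedCategory.singleFunctor C n).obj M)⟦n⟧ ≅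
      (DerivedCategory.singleFunctor C 0).obj M :=
    ((DerivedCategory.singleFunctors C).shiftIso n 0 n (add_zero n)).app M
  have : P ((DerivedCategory.singleFunctor C n).obj M) :=
    (P.prop_shift_iff_of_isStableUnderShift _ n).1 (P.prop_of_iso e.symm h)
  exact P.prop_of_iso ((DerivedCategory.singleFunctorIsoCompQ C n).app M) this

/-- A triangulated subcategory of the derived category contains all bounded complexes with terms
in `E` if it contains the objects of `E`. -/
theorem prop_of_boundedTermwise (E : ObjectProperty C) [hE : IsAdditiveSubcategory E]
    (P : ObjectProperty (DerivedCategory C)) [P.IsTriangulated]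
    [P.IsClosedUnderIsomorphisms] (h : ∀ M, E M → P ((DerivedCategory.singleFunctor C 0).obj M))
    {Y : CochainComplex C ℤ} (hY : boundedTermwise E Y) : P (DerivedCategory.Q.obj Y) := by
  obtain ⟨hY, ⟨a, ha⟩, ⟨b, hb⟩⟩ := hY
  -- Induction on the length of the complex, splitting off the term of highest degree.
  have key (k : ℕ) : ∀ (Y : CochainComplex C ℤ), termwise E Y → Y.IsStrictlyGE a →
      Y.IsStrictlyLE (a + k - 1) → P (DerivedCategory.Q.obj Y) := by
    induction k with
    | zero =>
      intro Y _ _ _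
      have : IsZero Y := by
        rw [IsZero.iff_id_eq_zero]
        ext n
        by_cases hn : n < a
        · exact (Y.isZero_of_isStrictlyGE a n hn).eq_of_src _ _
        · exact (Y.isZero_of_isStrictlyLE (a + (0 : ℕ) - 1) n (by push_cast; omega)).eq_of_src _ _
      exact P.prop_of_isZero (DerivedCategory.Q.map_isZero this)
    | succ k ih =>
      intro Y hY _ hk
      let f : (HomologicalComplex.single C (ComplexShape.up ℤ) (a + k)).obj (Y.X (a + k)) ⟶ Y :=
        HomologicalComplex.mkHomFromSingle (𝟙 _) fun n hn =>
          (Y.isZero_of_isStrictlyLE (a + (k + 1 : ℕ) - 1) n (by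
            have : a + k + 1 = n := hn
            push_cast; omega)).eq_of_tgt _ _
      have hf (n : ℤ) (hn : n ≠ a + k) : IsZero (((HomologicalComplex.single C (ComplexShape.up ℤ)
          (a + k)).obj (Y.X (a + k))).X n) := HomologicalComplex.isZero_single_obj_X _ _ _ _ hn
      have hf' : IsIso (f.f (a + k)) := by
        rw [HomologicalComplex.mkHomFromSingle_f]
        infer_instance
      have : Mono f := by
        refine @HomologicalComplex.mono_of_mono_f _ _ _ _ _ _ _ f fun n => ?_
        by_cases hn : n = a + k
        · subst hn; infer_instance
        · exact ⟨fun _ _ _ => (hf n hn).eq_of_tgt _ _⟩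
      let S : ShortComplex (CochainComplex C ℤ) :=
        ShortComplex.mk f (cokernel.π f) (cokernel.condition f)
      have hS : S.ShortExact :=
        .mk' (ShortComplex.exact_cokernel f) this (inferInstanceAs (Epi (cokernel.π f)))
      have hSn (n : ℤ) : (S.map (HomologicalComplex.eval C (ComplexShape.up ℤ) n)).ShortExact :=
        hS.map_of_exact _
      have h₀ : IsZero (S.X₃.X (a + k)) := by
        have := (hSn (a + k)).epi_g
        have h' : S.g.f (a + k) = 0 := by
          rw [← cancel_epi (f.f (a + k)), comp_zero]
          exact congrArg (fun k => HomologicalComplex.Hom.f k _) S.zero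
        exact IsZero.of_epi_eq_zero _ h'
      have h₁ (n : ℤ) (hn : n ≠ a + k) : Nonempty (Y.X n ≅ S.X₃.X n) := by
        have : IsIso (S.map (HomologicalComplex.eval C (ComplexShape.up ℤ) n)).g :=
          ((hSn n).isIso_g_iff).2 (hf n hn)
        exact ⟨@asIso _ _ _ _ _ this⟩
      refine P.ext_of_isTriangulatedClosed₂ _ (DerivedCategory.triangleOfSES_distinguished hS)
        (prop_single P (h _ (hY _)) _) (ih S.X₃ (fun n => ?_) ?_ ?_)
      · by_cases hn : n = a + k
        · subst hn
          exact hE.of_isZero _ h₀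
        · exact hE.of_iso (h₁ n hn).some (hY n)
      · rw [CochainComplex.isStrictlyGE_iff]
        intro n hn
        exact (Y.isZero_of_isStrictlyGE a n hn).of_iso (h₁ n (by omega)).some.symm
      · rw [CochainComplex.isStrictlyLE_iff]
        intro n hn
        by_cases hn' : n = a + k
        · subst hn'
          exact h₀
        · exact (Y.isZero_of_isStrictlyLE (a + (k + 1 : ℕ) - 1) n (by
            push_cast; omega)).of_iso (h₁ n hn').some.symm
  refine key (b + 1 - a).toNat Y hY ha ?_
  exact Y.isStrictlyLE_of_le b _ (by have := Int.self_le_toNat (b + 1 - a); omega)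

end Devissage

section BoundedAbove

variable {C : Type u₁} [Category.{v₁} C] [Abelian C]

/-- The complexes of projective objects that are bounded above. -/
def boundedAboveProjective : ObjectProperty (CochainComplex C ℤ) := fun K =>
  (∀ n, Projective (K.X n)) ∧ ∃ b, K.IsStrictlyLE b

instance : (homotopyProp (boundedAboveProjective (C := C))).IsTriangulated := by
  refine homotopyProp_isTriangulated _ ⟨fun n => ?_, 0, inferInstance⟩ ?_ ?_
  · exact IsZero.projective
      ((HomologicalComplex.eval C (ComplexShape.up ℤ) n).map_isZero (isZero_zero _))
  · rintro K ⟨hK, b, _⟩ n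
    exact ⟨fun i => hK (i + n), b - n, K.isStrictlyLE_shift b n (b - n) (by lia)⟩
  · rintro K L f ⟨hK, b, _⟩ ⟨hL, b', _⟩
    refine ⟨fun n => ?_, max b b' + 1, ?_⟩
    · have := hK (n + 1)
      have := hL n
      exact Projective.of_iso (HomologicalComplex.homotopyCofiber.XIsoBiprod f n (n + 1) rfl).symm
        inferInstance
    · rw [CochainComplex.isStrictlyLE_iff]
      intro i hi
      rw [CochainComplex.mappingCone.isZero_X_iff]
      exact ⟨K.isZero_of_isStrictlyLE b _ (by omega), L.isZero_of_isStrictlyLE b' _ (by omega)⟩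

lemma boundedAboveProjective.isKProjective {K : CochainComplex C ℤ}
    (hK : boundedAboveProjective K) : K.IsKProjective := by
  obtain ⟨h, b, _⟩ := hK
  exact CochainComplex.isKProjective_of_projective K b

/-- A bounded complex has a projective resolution that is bounded above. -/
lemma exists_boundedAboveProjective [HasDerivedCategory.{w} C] [EnoughProjectives C]
    {Y : CochainComplex C ℤ} (hY : boundedTermwise ⊤ Y) :
    ∃ P : CochainComplex C ℤ, boundedAboveProjective P ∧
      Nonempty (DerivedCategory.Q.obj P ≅ DerivedCategory.Q.obj Y) := by
  have := isTriangulated_imageOf (DerivedCategory.Qh (C := C))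
    (homotopyProp (boundedAboveProjective (C := C))) (by
      intro X Y hX _
      obtain ⟨K, rfl⟩ := X.quotient_obj_surjective
      have : CochainComplex.IsKProjective K := boundedAboveProjective.isKProjective hX
      exact (CochainComplex.IsKProjective.Qh_map_bijective K Y).2)
  obtain ⟨P, hP, ⟨e⟩⟩ := prop_of_boundedTermwise ⊤ (imageOf (DerivedCategory.Qh (C := C))
    (homotopyProp (boundedAboveProjective (C := C)))) (fun M _ => by
      obtain ⟨R⟩ : Nonempty (ProjectiveResolution M) := HasProjectiveResolution.out
      refine ⟨(HomotopyCategory.quotient _ _).obj R.cochainComplex,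
        ⟨fun n => inferInstanceAs (Projective (R.cochainComplex.X n)), 0,
          inferInstanceAs (R.cochainComplex.IsStrictlyLE 0)⟩, ⟨?_⟩⟩
      exact (DerivedCategory.quotientCompQhIso C).app _ ≪≫ asIso (DerivedCategory.Q.map R.π') ≪≫
        ((DerivedCategory.singleFunctorIsoCompQ C 0).app M).symm) hY
  obtain ⟨P, rfl⟩ := P.quotient_obj_surjective
  exact ⟨P, hP, ⟨((DerivedCategory.quotientCompQhIso C).app P).symm ≪≫ e⟩⟩

end BoundedAbove

/-! ### Complexes that are exact in high degrees -/

section ExactAbove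

variable {C : Type u₁} [Category.{v₁} C] [Abelian C] (E : ObjectProperty C)

/-- Complexes of projective objects of `E` that are exact with respect to the exact structure of `E`
in the degrees `n ≥ b`. -/
structure IsExactAbove (K : CochainComplex C ℤ) (b : ℤ) : Prop where
  projective (n : ℤ) : Projective (K.X n)
  mem (n : ℤ) : E (K.X n)
  exactAt (n : ℤ) : b ≤ n → K.ExactAt n
  opcycles (n : ℤ) : b ≤ n → E (K.opcycles n)

variable {E} {K L S : CochainComplex C ℤ} {b : ℤ}

lemma IsTotallyAcyclic.isExactAbove (hS : IsTotallyAcyclic E S) (b : ℤ) : IsExactAbove E S b :=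
  ⟨hS.projective, hS.mem, fun n _ => hS.acyclic n, fun n _ => hS.opcycles n⟩

lemma IsTotallyAcyclic.of_le {E' : ObjectProperty C} (h : E ≤ E') (hS : IsTotallyAcyclic E S) :
    IsTotallyAcyclic E' S :=
  ⟨hS.projective, fun n => h _ (hS.mem n), hS.acyclic, fun n => h _ (hS.opcycles n)⟩

/-- A termwise isomorphism above degree `b` induces isomorphisms on the cokernels of the
differentials. -/
lemma isIso_opcyclesMap (φ : K ⟶ L) {n m : ℤ} (hnm : n + 1 = m) [IsIso (φ.f n)] [IsIso (φ.f m)] :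
    IsIso (HomologicalComplex.opcyclesMap φ m) := by
  obtain ⟨e, he⟩ := exists_opcycles_iso hnm hnm (asIso (φ.f n)) (asIso (φ.f m))
    (.inl (φ.comm n m).symm)
  have : HomologicalComplex.opcyclesMap φ m = e.hom := by
    rw [← cancel_epi (K.pOpcycles m), he, HomologicalComplex.p_opcyclesMap, asIso_hom]
  rw [this]
  infer_instance

lemma exactAt_iff_of_isIso (φ : K ⟶ L) {i j k : ℤ} (hij : i + 1 = j) (hjk : j + 1 = k)
    [IsIso (φ.f i)] [IsIso (φ.f j)] [IsIso (φ.f k)] : K.ExactAt j ↔ L.ExactAt j := by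
  rw [K.exactAt_iff' i j k (by simp [← hij]) (by simp [← hjk]),
    L.exactAt_iff' i j k (by simp [← hij]) (by simp [← hjk])]
  let x : K.X i ≅ L.X i := asIso (φ.f i)
  let y : K.X j ≅ L.X j := asIso (φ.f j)
  let z : K.X k ≅ L.X k := asIso (φ.f k)
  exact ShortComplex.exact_iff_of_iso (ShortComplex.isoMk x y z (φ.comm i j) (φ.comm j k))

/-- The brutal truncation of a complex. -/
lemma exists_truncation (L : CochainComplex C ℤ) (a : ℤ) :
    ∃ (K : CochainComplex C ℤ) (φ : K ⟶ L), (∀ n < a, IsZero (K.X n)) ∧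
      ∀ n, a ≤ n → IsIso (φ.f n) := by
  have h (n : ℤ) : ∃ (X : C) (f : X ⟶ L.X n), (n < a → IsZero X) ∧ (a ≤ n → IsIso f) := by
    by_cases hn : n < a
    · exact ⟨0, 0, fun _ => isZero_zero _, fun h => by omega⟩
    · exact ⟨_, 𝟙 _, fun h => absurd h hn, fun _ => inferInstance⟩
  choose X f h₁ h₂ using h
  let g (n : ℤ) : L.X n ⟶ X n := if hn : a ≤ n then (have := h₂ n hn; inv (f n)) else 0
  have hg (n : ℤ) (hn : a ≤ n) : f n ≫ g n = 𝟙 _ ∧ g n ≫ f n = 𝟙 _ := by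
    have := h₂ n hn
    simp [g, hn]
  let K : CochainComplex C ℤ :=
    { X := X
      d := fun i j => f i ≫ L.d i j ≫ g j
      shape := fun i j hij => by rw [L.shape i j hij, zero_comp, comp_zero]
      d_comp_d' := by
        rintro i j k (hij : i + 1 = j) -
        by_cases hi : a ≤ i
        · simp only [Category.assoc, reassoc_of% (hg j (by omega)).2, L.d_comp_d_assoc, zero_comp,
            comp_zero]
        · exact (h₁ i (by omega)).eq_of_src _ _ }
  refine ⟨K, { f := f, comm' := ?_ }, h₁, h₂⟩
  rintro i j (hij : i + 1 = j)
  by_cases hi : a ≤ i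
  · change f i ≫ L.d i j = (f i ≫ L.d i j ≫ g j) ≫ f j
    rw [Category.assoc, Category.assoc, (hg j (by omega)).2, Category.comp_id]
  · exact (h₁ i (by omega)).eq_of_src _ _

variable [hF : IsFrobeniusSubcategory E]

lemma IsExactAbove.extendsAt (hK : IsExactAbove E K b) {n : ℤ} (hn : b ≤ n) {Y : C} (hY : E Y)
    [Projective Y] : ExtendsAt K n Y :=
  extendsAt_of_exactAt K rfl (hK.exactAt n hn) (hK.opcycles n hn) (hK.mem _)
    (hK.opcycles _ (by omega)) hY

lemma IsExactAbove.exists_opcyclesMap_eq (hK : IsExactAbove E K b) (hS : IsTotallyAcyclic E S)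
    (α : K.opcycles b ⟶ S.opcycles b) :
    ∃ φ : K ⟶ S, HomologicalComplex.opcyclesMap φ b = α :=
  have := hK.projective
  have := hS.projective
  exists_opcyclesMap_eq_of_extendsAt b (fun _ hm i => hK.extendsAt hm (hS.mem i))
    (fun _ _ => liftsAt_of_exactAt S (hS.acyclic _) _) α

variable [hE : IsAdditiveSubcategory E] [E.IsClosedUnderExtensions]

/-- If `φ : K ⟶ S` induces an isomorphism on the cokernels of the differentials in degree `b`, then
the mapping cone has a projective cokernel in degree `b`. So morphisms to an acyclic complex are
null-homotopic. -/
lemma IsExactAbove.nonempty_homotopy (hK : IsExactAbove E K b) (hS : IsTotallyAcyclic E S)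
    (φ : K ⟶ S) [IsIso (HomologicalComplex.opcyclesMap φ b)] {W : CochainComplex C ℤ}
    (hW : ∀ n, Projective (W.X n)) (hW' : ∀ n, E (W.X n)) (hW'' : W.Acyclic)
    (f : CochainComplex.mappingCone φ ⟶ W) : Nonempty (Homotopy f 0) := by
  have hcone : IsExactAbove E (CochainComplex.mappingCone φ) b := by
    refine ⟨fun n => ?_, fun n => ?_, fun n hn => ?_, fun n hn => ?_⟩
    · have := hK.projective (n + 1)
      have := hS.projective n
      exact Projective.of_iso (HomologicalComplex.homotopyCofiber.XIsoBiprod φ n (n + 1) rfl).symm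
        inferInstance
    · exact termwise_cone E φ hK.mem hS.mem n
    · exact exactAt_mappingCone φ rfl (hS.acyclic n) (hK.exactAt _ (by omega))
    · obtain ⟨p, w, -, h⟩ := shortExact_opcycles_mappingCone φ rfl (hS.acyclic n)
      exact ObjectProperty.prop_X₂_of_shortExact _ h (hS.opcycles n) (hK.opcycles _ (by omega))
  have hproj : Projective ((CochainComplex.mappingCone φ).opcycles b) := by
    have hse : (ShortComplex.mk (HomologicalComplex.opcyclesMap φ b) (0 : _ ⟶ (0 : C))
        comp_zero).ShortExact :=
      .mk' ((ShortComplex.exact_iff_epi _ rfl).2 inferInstance) inferInstance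
        ⟨fun _ _ _ => (isZero_zero C).eq_of_src _ _⟩
    obtain ⟨κ, w, -, h⟩ := shortExact_inl_mappingCone φ rfl (hK.exactAt b le_rfl)
      (hK.exactAt _ (by omega)) (hS.acyclic b) _ hse
    have hi : IsIso _ := (h.isIso_f_iff).2 (isZero_zero C)
    exact Projective.of_iso (@asIso _ _ _ _ _ hi) (hK.projective (b + 1))
  have := hcone.projective
  refine nonempty_homotopy_of_stablyEq b (fun n hn i => hcone.extendsAt hn (hW' i))
    (fun n i => liftsAt_of_exactAt W (hW'' n) _) ⟨_, hproj, 𝟙 _, _, (Category.id_comp _).symm⟩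

end ExactAbove

section Universal

lemma bijective_comp_of_eq_zero {T : Type u₁} [Category.{v₁} T] [Preadditive T] [HasZeroObject T]
    [HasShift T ℤ] [∀ n : ℤ, (shiftFunctor T n).Additive] [Pretriangulated T]
    {X Y V W : T} {ε : X ⟶ Y} {g : Y ⟶ V} {h : V ⟶ X⟦(1 : ℤ)⟧}
    (H : Triangle.mk ε g h ∈ distTriang T) (h₀ : ∀ k : X ⟶ W, k = 0)
    (h₁ : ∀ k : X⟦(1 : ℤ)⟧ ⟶ W, k = 0) : Function.Bijective fun k : V ⟶ W => g ≫ k := by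
  constructor
  · intro a b hab
    rw [← sub_eq_zero]
    obtain ⟨c, hc⟩ := exists_desc₃ H (a - b) (by rw [Preadditive.comp_sub, sub_eq_zero]; exact hab)
    rw [hc, h₁ c, comp_zero]
  · intro m
    obtain ⟨k, rfl⟩ := exists_desc₂ H m (h₀ _)
    exact ⟨k, rfl⟩

lemma bijective_comp_of_cone {T : Type u₁} [Category.{v₁} T] [Preadditive T] [HasZeroObject T]
    [HasShift T ℤ] [∀ n : ℤ, (shiftFunctor T n).Additive] [Pretriangulated T]
    {X Y V W : T} {f : X ⟶ Y} {g : Y ⟶ V} {h : V ⟶ X⟦(1 : ℤ)⟧}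
    (H : Triangle.mk f g h ∈ distTriang T) (h₀ : ∀ k : V ⟶ W, k = 0)
    (h₁ : ∀ k : V ⟶ W⟦(1 : ℤ)⟧, k = 0) : Function.Bijective fun k : Y ⟶ W => f ≫ k := by
  obtain ⟨k, l, H'⟩ := exists_inv_rot H
  refine bijective_comp_of_eq_zero H' (fun m => ?_) fun m => ?_
  · apply ((shiftAdjunction' T 1).homEquiv V W).injective
    rw [h₁ (((shiftAdjunction' T 1).homEquiv V W) m), h₁ (((shiftAdjunction' T 1).homEquiv V W) 0)]
  · refine (cancel_epi ((shiftEquiv T (1 : ℤ)).counitIso.inv.app V)).1 ?_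
    exact (h₀ _).trans comp_zero.symm

variable {R A : Type u} [CommRing R] [Ring A] [Algebra R A] [IsFrobeniusAlgebra R A]
  {K S : CochainComplex (ModuleCat.{u} A) ℤ} {b : ℤ}

lemma modProj_of_projective (P : ModuleCat.{u} A) (hP : Projective P) : ModProj R A P :=
  modLF_le_modProj _ (ModLF.of_projective _ hP)

lemma eq_zero_of_isExactAbove (hK : IsExactAbove (ModProj R A) K b)
    (hS : IsTotallyAcyclic (ModProj R A) S) (φ : K ⟶ S)
    [IsIso (HomologicalComplex.opcyclesMap φ b)]
    {W : HomotopyCategory (ModuleCat.{u} A) (ComplexShape.up ℤ)} (hW : KTerm (IsProj A) W)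
    (hW' : HomotopyCategory.subcategoryAcyclic _ W)
    (f : (HomotopyCategory.quotient _ _).obj (CochainComplex.mappingCone φ) ⟶ W) : f = 0 := by
  obtain ⟨W, rfl⟩ := W.quotient_obj_surjective
  obtain ⟨f, rfl⟩ := (HomotopyCategory.quotient _ _).map_surjective f
  rw [HomotopyCategory.quotient_obj_mem_subcategoryAcyclic_iff_acyclic] at hW'
  have hW (n : ℤ) : Projective (W.X n) := (isProj_iff A _).1 (hW n)
  obtain ⟨h⟩ := hK.nonempty_homotopy hS φ hW (fun n => modProj_of_projective _ (hW n)) hW' f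
  exact (HomotopyCategory.eq_of_homotopy _ _ h).trans (CategoryTheory.Functor.map_zero _ _ _)

/-- If `φ : K ⟶ S` induces an isomorphism on the cokernels of the differentials in a high degree,
then it is universal among the morphisms from `K` to acyclic complexes of projective modules. -/
lemma bijective_comp_of_isIso_opcyclesMap (hK : IsExactAbove (ModProj R A) K b)
    (hS : IsTotallyAcyclic (ModProj R A) S) (φ : K ⟶ S)
    [IsIso (HomologicalComplex.opcyclesMap φ b)]
    {W : HomotopyCategory (ModuleCat.{u} A) (ComplexShape.up ℤ)} (hW : KTerm (IsProj A) W)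
    (hW' : HomotopyCategory.subcategoryAcyclic _ W) :
    Function.Bijective fun k : (HomotopyCategory.quotient _ _).obj S ⟶ W =>
      (HomotopyCategory.quotient _ _).map φ ≫ k :=
  bijective_comp_of_cone (HomotopyCategory.mappingCone_triangleh_distinguished φ)
    (eq_zero_of_isExactAbove hK hS φ hW hW')
    (eq_zero_of_isExactAbove hK hS φ ((KTerm (IsProj A)).le_shift (1 : ℤ) _ hW)
      ((HomotopyCategory.subcategoryAcyclic _).le_shift (1 : ℤ) _ hW'))

lemma IsPlusB.exists_isExactAbove (hK : IsPlusB R K) : ∃ b, IsExactAbove (ModProj R A) K b ∧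
    ∀ n, b ≤ n → ModFinProj R A (K.opcycles n) := by
  obtain ⟨h, -, b, hb⟩ := hK
  have hP (n : ℤ) : Projective (K.X n) := (isProj_iff A _).1 (h n).1
  refine ⟨b, ⟨hP, fun n => modProj_of_projective _ (hP n), fun n hn => (hb n hn).1,
    fun n hn => (hb n hn).2⟩, fun n hn => ⟨(hb n hn).2, ?_⟩⟩
  have : Module.Finite R ((ModuleCat.restrictScalars (algebraMap R A)).obj (K.X n)) :=
    (ModFinProj.of_isFGProj (h n)).2
  have hs : Function.Surjective (K.pOpcycles n) := (ModuleCat.epi_iff_surjective _).1 inferInstance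
  exact Module.Finite.of_surjective
    ((ModuleCat.restrictScalars (algebraMap R A)).map (K.pOpcycles n)).hom hs

/-- A complex in `K^{+,b}(proj A)` admits a universal morphism to a totally acyclic complex. -/
lemma IsPlusB.exists_isTotallyAcyclic (hK : IsPlusB R K) :
    ∃ (b : ℤ) (S : CochainComplex (ModuleCat.{u} A) ℤ) (φ : K ⟶ S),
      IsExactAbove (ModProj R A) K b ∧ IsTotallyAcyclic (ModFinProj R A) S ∧
        IsIso (HomologicalComplex.opcyclesMap φ b) := by
  obtain ⟨b, hb, hb'⟩ := hK.exists_isExactAbove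
  obtain ⟨S, hS, ⟨e⟩⟩ := FrobRec.exists_isTotallyAcyclic (E := ModFinProj R A)
    (isClosedUnderIsomorphisms_of_isAdditiveSubcategory _) _ (hb' b le_rfl)
  have hS' := hS.shift (-b)
  let e' := shiftOpcyclesIso S (-b) b 0 (by omega) ≪≫ e
  obtain ⟨φ, hφ⟩ := hb.exists_opcyclesMap_eq
    (hS'.of_le fun M hM => modLF_le_modProj _ (modFinProj_le_modLF _ hM)) e'.inv
  exact ⟨b, _, φ, hb, hS', by rw [hφ]; infer_instance⟩

/-- A totally acyclic complex of finitely generated projective modules arises from its brutal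
truncations. -/
lemma IsTotallyAcyclic.exists_isPlusB {S : CochainComplex (ModuleCat.{u} A) ℤ}
    (hS : IsTotallyAcyclic (ModFinProj R A) S) (a : ℤ) :
    ∃ (K : CochainComplex (ModuleCat.{u} A) ℤ) (φ : K ⟶ S), (∀ n < a, IsZero (K.X n)) ∧
      (∀ n, a ≤ n → IsIso (φ.f n)) ∧ IsPlusB R K ∧ IsExactAbove (ModProj R A) K (a + 1) ∧
        IsIso (HomologicalComplex.opcyclesMap φ (a + 1)) := by
  obtain ⟨K, φ, h₁, h₂⟩ := exists_truncation S a
  have hiso (n : ℤ) (hn : a + 1 ≤ n) : IsIso (HomologicalComplex.opcyclesMap φ n) := by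
    have := h₂ (n - 1) (by omega)
    have := h₂ n (by omega)
    exact isIso_opcyclesMap φ (sub_add_cancel n 1)
  have hex (n : ℤ) (hn : a + 1 ≤ n) : K.ExactAt n := by
    have := h₂ (n - 1) (by omega)
    have := h₂ n (by omega)
    have := h₂ (n + 1) (by omega)
    exact (exactAt_iff_of_isIso φ (sub_add_cancel n 1) rfl).2 (hS.acyclic n)
  have hfg (n : ℤ) : IsFGProj A (K.X n) := by
    by_cases hn : n < a
    · exact IsAdditiveSubcategory.of_isZero _ (h₁ n hn)
    · have := h₂ n (by omega)
      exact IsAdditiveSubcategory.of_iso (asIso (φ.f n)).symm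
        (ModFinProj.isFGProj (hS.mem n) (hS.projective n))
  have hop (n : ℤ) (hn : a + 1 ≤ n) : ModProj R A (K.opcycles n) := by
    have := hiso n hn
    exact IsAdditiveSubcategory.of_iso (E := ModProj R A)
      (asIso (HomologicalComplex.opcyclesMap φ n)).symm (hS.opcycles n).1
  have hP (n : ℤ) : Projective (K.X n) := (isProj_iff A _).1 (hfg n).1
  exact ⟨K, φ, h₁, h₂, ⟨hfg, ⟨a, (K.isStrictlyGE_iff a).2 h₁⟩, a + 1,
    fun n hn => ⟨hex n hn, hop n hn⟩⟩, ⟨hP, fun n => modProj_of_projective _ (hP n), hex, hop⟩,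
    hiso _ le_rfl⟩

end Universal

/-! ### Coproducts in localising subcategories -/

section LocalisingCoproducts

variable {T : Type u₁} [Category.{v₁} T] [Preadditive T] [HasZeroObject T] [HasShift T ℤ]
  [∀ n : ℤ, (shiftFunctor T n).Additive] [Pretriangulated T] {S : ObjectProperty T}

/-- The induction principle for localising subcategories. -/
lemma Localising.le {P : ObjectProperty T} [P.IsTriangulated] [P.IsClosedUnderIsomorphisms]
    (hP : ∀ (J : Type u) (Y : J → T) (c : Cofan Y), IsColimit c → (∀ j, P (Y j)) → P c.pt)
    (h : S ≤ P) : Localising.{u} S ≤ P := by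
  intro X hX
  induction hX with
  | of X hX => exact h X hX
  | zero X hX => exact P.prop_of_isZero hX
  | shift X n _ ih => exact P.le_shift n _ ih
  | ext₂ D hD _ _ h₁ h₃ => exact P.ext_of_isTriangulatedClosed₂ D hD h₁ h₃
  | coprod J Y c hc _ ih => exact hP J Y c hc ih

lemma isClosedUnderColimitsOfShape_of_cofan {C : Type u₁} [Category.{v₁} C] {P : ObjectProperty C}
    {J : Type u} (hP : ∀ (Y : J → C) (c : Cofan Y), IsColimit c → (∀ j, P (Y j)) → P c.pt) :
    P.IsClosedUnderColimitsOfShape (Discrete J) where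
  colimitsOfShape_le := fun _ ⟨h⟩ => hP (fun j => h.diag.obj ⟨j⟩)
    (Cofan.mk _ fun j => h.ι.app ⟨j⟩)
    (IsColimit.ofIsoColimit ((IsColimit.precomposeHomEquiv Discrete.natIsoFunctor.symm _).symm
      h.isColimit) (Cocone.ext (Iso.refl _) fun ⟨j⟩ => by simp [Discrete.natIsoFunctor]))
    fun j => h.prop_diag_obj ⟨j⟩

instance (J : Type u) : (Localising.{u} S).IsClosedUnderColimitsOfShape (Discrete J) :=
  isClosedUnderColimitsOfShape_of_cofan fun Y c hc h => .coprod J Y c hc h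

lemma nonempty_isColimit_map {C : Type u₁} [Category.{v₁} C] {D : Type u₂} [Category.{v₂} D]
    (F : C ⥤ D) {J : Type u} [PreservesColimitsOfShape (Discrete J) F] {Y : J → C} {c : Cofan Y}
    (hc : IsColimit c) :
    Nonempty (IsColimit (Cofan.mk (F.obj c.pt) fun j => F.map (c.inj j))) :=
  ⟨isColimitCofanMkObjOfIsColimit F Y c.inj
    (IsColimit.ofIsoColimit hc (Cofan.ext (Iso.refl _) (by simp)))⟩

lemma nonempty_isColimit_of_map {C : Type u₁} [Category.{v₁} C] {D : Type u₂} [Category.{v₂} D]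
    (F : C ⥤ D) {J : Type u} [ReflectsColimitsOfShape (Discrete J) F] {Y : J → C} {X : C}
    {i : ∀ j, Y j ⟶ X} (hc : IsColimit (Cofan.mk (F.obj X) fun j => F.map (i j))) :
    Nonempty (IsColimit (Cofan.mk X i)) :=
  ⟨isColimitOfIsColimitCofanMkObj F Y i hc⟩

/-- Membership in the localising subcategory that is generated by `S` can be tested in every
localising subcategory `L` that contains `S`. -/
lemma Localising.inverseImage [HasCoproducts.{u} T] {L : ObjectProperty T} [L.IsTriangulated]
    [L.IsClosedUnderIsomorphisms] (h : S ≤ L)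
    (hL : ∀ (J : Type u) (Y : J → T) (c : Cofan Y), IsColimit c → (∀ j, L (Y j)) → L c.pt)
    (X : L.FullSubcategory) (hX : Localising.{u} S X.obj) :
    Localising.{u} (S.inverseImage L.ι) X := by
  have hS : Localising.{u} S ≤ L := Localising.le hL h
  have key (X : T) (hX : Localising.{u} S X) :
      Localising.{u} (S.inverseImage L.ι) ⟨X, hS _ hX⟩ := by
    induction hX with
    | of X hX => exact .of _ hX
    | zero X hX => exact .zero _ (isZero_of_map L.ι hX)
    | shift X n hX ih =>
      exact ObjectProperty.prop_of_iso _ (ObjectProperty.isoMk _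
        ((L.ι.commShiftIso n).app ⟨X, hS _ hX⟩)) (.shift _ n ih)
    | ext₂ D hD h₁ h₃ ih₁ ih₃ =>
      have h₂ : Localising.{u} S D.obj₂ := .ext₂ D hD h₁ h₃
      obtain ⟨Z, g, h, H⟩ := distinguished_cocone_triangle
        (ObjectProperty.homMk D.mor₁ : (⟨D.obj₁, hS _ h₁⟩ : L.FullSubcategory) ⟶
          ⟨D.obj₂, hS _ h₂⟩)
      obtain ⟨e, -⟩ := exists_iso_of_distTriang (map_distTriang L.ι H) (g' := D.mor₂)
        (h' := D.mor₃) hD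
      exact ObjectProperty.ext_of_isTriangulatedClosed₂ _ _ H ih₁
        (ObjectProperty.prop_of_iso _ (ObjectProperty.isoMk _ e.symm) ih₃)
    | coprod J Y c hc h ih =>
      obtain ⟨h'⟩ := nonempty_isColimit_of_map L.ι (Y := fun j => ⟨Y j, hS _ (h j)⟩)
        (X := ⟨c.pt, hS _ (.coprod J Y c hc h)⟩) (i := fun j => ObjectProperty.homMk (c.inj j))
        (IsColimit.ofIsoColimit hc (Cofan.ext (Iso.refl _) (by simp)))
      exact .coprod J _ _ h' ih
  exact key X.obj hX

end LocalisingCoproducts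

section Opcycles

variable {C : Type u₁} [Category.{v₁} C] [Abelian C] {J : Type u} [HasCoproductsOfShape J C]

/-- The cokernels of the differentials of a coproduct of complexes are coproducts. -/
lemma nonempty_isColimit_opcycles {K : J → CochainComplex C ℤ} {c : Cofan K} (hc : IsColimit c)
    (n : ℤ) : Nonempty (IsColimit (Cofan.mk (c.pt.opcycles n)
      fun j => HomologicalComplex.opcyclesMap (c.inj j) n)) := by
  have hex (W : C) (s : ∀ j, (K j).opcycles n ⟶ W) : ∃ f : c.pt.opcycles n ⟶ W,
      ∀ j, HomologicalComplex.opcyclesMap (c.inj j) n ≫ f = s j := by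
    obtain ⟨f, hf⟩ : ∃ f : c.pt.X n ⟶ W, ∀ j, (c.inj j).f n ≫ f = (K j).pOpcycles n ≫ s j :=
      ⟨_, Cofan.IsColimit.fac (isColimitEval hc n) fun j => (K j).pOpcycles n ≫ s j⟩
    refine ⟨c.pt.descOpcycles f (n - 1) (by simp) (Cofan.IsColimit.hom_ext (isColimitEval hc _) _ _
      fun j => ?_), fun j => ?_⟩
    · change (c.inj j).f (n - 1) ≫ _ = (c.inj j).f (n - 1) ≫ _
      rw [(c.inj j).comm_assoc, hf, HomologicalComplex.d_pOpcycles_assoc, zero_comp, comp_zero]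
    · rw [← cancel_epi ((K j).pOpcycles n), HomologicalComplex.p_opcyclesMap_assoc,
        HomologicalComplex.p_descOpcycles, hf]
  refine ⟨Cofan.IsColimit.mk _ (fun s => (hex s.pt s.inj).choose)
    (fun s j => (hex s.pt s.inj).choose_spec j) fun s m hm => ?_⟩
  rw [← cancel_epi (c.pt.pOpcycles n)]
  refine Cofan.IsColimit.hom_ext (isColimitEval hc n) _ _ fun j => ?_
  change (c.inj j).f n ≫ _ = (c.inj j).f n ≫ _
  rw [← HomologicalComplex.p_opcyclesMap_assoc, ← HomologicalComplex.p_opcyclesMap_assoc,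
    (hex s.pt s.inj).choose_spec j]
  exact congrArg _ (hm j)

end Opcycles

/-! ### The acyclic complexes in `K^lf(Proj A, R)` -/

section Resolutions

variable {R A : Type u} [CommRing R] [Ring A] [Algebra R A]

lemma isTotallyAcyclic_of_isColimit {J : Type u} {K : J → CochainComplex (ModuleCat.{u} A) ℤ}
    (hK : ∀ j, IsTotallyAcyclic (ModLF R A) (K j)) {c : Cofan K} (hc : IsColimit c) :
    IsTotallyAcyclic (ModLF R A) c.pt := by
  have hP (j : J) : termwise (IsProj A) (K j) := fun n =>
    (isProj_iff A _).2 ((hK j).projective n)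
  refine ⟨fun n => (isProj_iff A _).1 (termwise_isProj_of_isColimit hP hc n),
    fun n => .coprod J _ _ (isColimitEval hc n) fun j => (hK j).mem n, ?_,
    fun n => .coprod J _ _ (nonempty_isColimit_opcycles hc n).some fun j => (hK j).opcycles n⟩
  let := HasDerivedCategory.standard (ModuleCat.{u} A)
  obtain ⟨h⟩ := nonempty_isColimit_quotient hc
  obtain ⟨h⟩ := nonempty_isColimit_Qh h
  rw [← HomotopyCategory.quotient_obj_mem_subcategoryAcyclic_iff_acyclic, ← isZero_Qh_iff]
  rw [IsZero.iff_id_eq_zero]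
  refine Cofan.IsColimit.hom_ext h _ _ fun j => IsZero.eq_of_src ?_ _ _
  refine (isZero_Qh_iff _).2 ?_
  rw [HomotopyCategory.quotient_obj_mem_subcategoryAcyclic_iff_acyclic]
  exact (hK j).acyclic

variable (R A) in
/-- The complexes that are homotopy equivalent to a totally acyclic complex with cokernels in
`Mod^lf(A, R)`. -/
abbrev resolutions : ObjectProperty (HomotopyCategory (ModuleCat.{u} A) (ComplexShape.up ℤ)) :=
  (homotopyProp (IsTotallyAcyclic (ModLF R A))).isoClosure

lemma IsTotallyAcyclic.resolutions {K : CochainComplex (ModuleCat.{u} A) ℤ}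
    (hK : IsTotallyAcyclic (ModLF R A) K) :
    resolutions R A ((HomotopyCategory.quotient _ _).obj K) :=
  ObjectProperty.le_isoClosure _ _ hK

lemma resolutions_coprod (J : Type u)
    (Y : J → HomotopyCategory (ModuleCat.{u} A) (ComplexShape.up ℤ)) (c : Cofan Y)
    (hc : IsColimit c) (h : ∀ j, resolutions R A (Y j)) : resolutions R A c.pt := by
  choose X hX e using h
  choose K hK using fun j => (X j).quotient_obj_surjective
  obtain rfl : X = fun j => (HomotopyCategory.quotient _ _).obj (K j) :=
    funext fun j => (hK j).symm
  have h := coproductIsCoproduct K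
  obtain ⟨h'⟩ := nonempty_isColimit_quotient h
  refine ObjectProperty.prop_of_iso _ ?_ (isTotallyAcyclic_of_isColimit hX h).resolutions
  exact IsColimit.coconePointsIsoOfNatIso h' hc (Discrete.natIso fun j => (e j.as).some.symm)

end Resolutions

section AcyclicObjects

section Comp

variable {B : Type u₁} [Category.{v₁} B] [Preadditive B] [HasZeroObject B] [HasShift B ℤ]
  [∀ n : ℤ, (shiftFunctor B n).Additive] [Pretriangulated B]
  {C : Type u₂} [Category.{v₂} C] [Preadditive C] [HasZeroObject C] [HasShift C ℤ]
  [∀ n : ℤ, (shiftFunctor C n).Additive] [Pretriangulated C]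
  {D : Type u₃} [Category.{v₃} D] [Preadditive D] [HasZeroObject D] [HasShift D ℤ]
  [∀ n : ℤ, (shiftFunctor D n).Additive] [Pretriangulated D]

lemma isTriangulated_comp (F : B ⥤ C) (G : C ⥤ D) [F.CommShift ℤ] [G.CommShift ℤ]
    [F.IsTriangulated] [G.IsTriangulated] : (F ⋙ G).IsTriangulated :=
  inferInstance

end Comp

lemma exists_iso_of_bijective {C : Type u₁} [Category.{v₁} C] {P : ObjectProperty C} {Y V S : C}
    {g : Y ⟶ V} {g' : Y ⟶ S} (hV : P V) (hS : P S)
    (h : ∀ W, P W → Function.Bijective fun k : V ⟶ W => g ≫ k)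
    (h' : ∀ W, P W → Function.Bijective fun k : S ⟶ W => g' ≫ k) :
    ∃ e : V ≅ S, g ≫ e.hom = g' := by
  obtain ⟨a, ha⟩ := (h S hS).2 g'
  obtain ⟨b, hb⟩ := (h' V hV).2 g
  dsimp at ha hb
  exact ⟨⟨a, b, (h V hV).1 (by simp [reassoc_of% ha, hb]),
    (h' S hS).1 (by simp [reassoc_of% hb, ha])⟩, ha⟩

variable {R A : Type u} [CommRing R] [Ring A] [Algebra R A]

instance (J : Type u) : PreservesColimitsOfShape (Discrete J) (isKLF R A).ι := inferInstance

instance (J : Type u) : PreservesColimitsOfShape (Discrete J) (KTerm (IsProj A)).ι := inferInstance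

instance : HasCoproducts.{u} (KLF R A) := fun _ =>
  hasColimitsOfShape_of_hasColimitsOfShape_createsColimitsOfShape (isKLF R A).ι

variable (R A) in
/-- The inclusion of `K^lf(Proj A, R)` into the homotopy category of all complexes. -/
abbrev KLF.toHomotopy : KLF R A ⥤ HomotopyCategory (ModuleCat.{u} A) (ComplexShape.up ℤ) :=
  (isKLF R A).ι ⋙ (KTerm (IsProj A)).ι

instance (J : Type u) : (acyclicObjects R A).IsClosedUnderColimitsOfShape (Discrete J) :=
  isClosedUnderColimitsOfShape_of_cofan fun Y c hc h => by
    let := HasDerivedCategory.standard (ModuleCat.{u} A)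
    obtain ⟨h'⟩ := nonempty_isColimit_map (KLF.toHomotopy R A) hc
    obtain ⟨h'⟩ := nonempty_isColimit_Qh h'
    refine (isZero_canonicalFunctor_iff c.pt).1 ((IsZero.iff_id_eq_zero _).2 ?_)
    exact Cofan.IsColimit.hom_ext h' _ _ fun j =>
      ((isZero_canonicalFunctor_iff _).2 (h j)).eq_of_src _ _

instance (J : Type u) : PreservesColimitsOfShape (Discrete J) (acyclicObjects R A).ι :=
  inferInstance

/-- The triangle of `exists_triangle_acyclic` is universal also with respect to the acyclic
complexes of projective modules that do not belong to `K^lf(Proj A, R)`. -/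
lemma bijective_toHomotopy_map_comp {X Y V : KLF R A} {ε : X ⟶ Y} {g : Y ⟶ V}
    {h : V ⟶ X⟦(1 : ℤ)⟧} (H : Triangle.mk ε g h ∈ distTriang (KLF R A))
    (hX : Localising.{u} (KbProj A) X.obj)
    {W : HomotopyCategory (ModuleCat.{u} A) (ComplexShape.up ℤ)}
    (hW : HomotopyCategory.subcategoryAcyclic _ W) :
    Function.Bijective fun k : (KLF.toHomotopy R A).obj V ⟶ W =>
      (KLF.toHomotopy R A).map g ≫ k :=
  bijective_comp_of_eq_zero (map_distTriang (KLF.toHomotopy R A) H)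
    (fun k => leftOrthogonal_of_localising hX k hW)
    (fun k => (HomotopyCategory.subcategoryAcyclic _).leftOrthogonal.le_shift (1 : ℤ) _
      (leftOrthogonal_of_localising hX) k hW)

/-- A complex in `K^lf(Proj A, R)` belongs to a localising subcategory of `K(Proj A)` if and only if
it belongs to the corresponding localising subcategory of `K^lf(Proj A, R)`. -/
lemma localising_inverseImage {S : ObjectProperty (KProj A)} (hS : S ≤ isKLF R A) (X : KLF R A)
    (hX : Localising.{u} S X.obj) : Localising.{u} (S.inverseImage (isKLF R A).ι) X :=
  Localising.inverseImage hS .coprod X hX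

lemma localising_kPlusB (X : KLF R A) :
    Localising.{u} ((KPlusB R A).inverseImage (isKLF R A).ι) X :=
  localising_inverseImage .of X X.property

variable [IsFrobeniusAlgebra R A]

lemma exists_iso_of_isExactAbove {K S : CochainComplex (ModuleCat.{u} A) ℤ} {b : ℤ}
    (hK : IsExactAbove (ModProj R A) K b) (hS : IsTotallyAcyclic (ModProj R A) S) (φ : K ⟶ S)
    [IsIso (HomologicalComplex.opcyclesMap φ b)] {X V Y : KLF R A} {ε : X ⟶ Y} {g : Y ⟶ V}
    {h : V ⟶ X⟦(1 : ℤ)⟧} (H : Triangle.mk ε g h ∈ distTriang (KLF R A))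
    (hX : Localising.{u} (KbProj A) X.obj) (hV : acyclicObjects R A V)
    (hY : Y.obj.obj = (HomotopyCategory.quotient _ _).obj K) :
    Nonempty ((KLF.toHomotopy R A).obj V ≅ (HomotopyCategory.quotient _ _).obj S) := by
  obtain ⟨⟨Y, hY'⟩, hY''⟩ := Y
  obtain rfl : Y = _ := hY
  refine (exists_iso_of_bijective
    (P := KTerm (IsProj A) ⊓ HomotopyCategory.subcategoryAcyclic _)
    (g := (KLF.toHomotopy R A).map g)
    (g' := (HomotopyCategory.quotient _ _).map φ) ⟨V.obj.property, hV⟩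
    ⟨fun n => (isProj_iff A _).2 (hS.projective n), ?_⟩
    (fun W hW => bijective_toHomotopy_map_comp H hX hW.2)
    fun W hW => bijective_comp_of_isIso_opcyclesMap hK hS φ hW.1 hW.2).nonempty
  rw [HomotopyCategory.quotient_obj_mem_subcategoryAcyclic_iff_acyclic]
  exact hS.acyclic

lemma IsTotallyAcyclic.modProj {S : CochainComplex (ModuleCat.{u} A) ℤ}
    (hS : IsTotallyAcyclic (ModFinProj R A) S) : IsTotallyAcyclic (ModProj R A) S :=
  hS.of_le fun _ hM => hM.1

lemma IsPlusB.isKLF {K : CochainComplex (ModuleCat.{u} A) ℤ} (hK : IsPlusB R K) :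
    isKLF R A (KProj.mk K hK.termwise) := .of _ ((kPlusB_iff _).2 hK)

/-- A totally acyclic complex of finitely generated projective modules belongs to
`K^lf(Proj A, R)`: it is the acyclic part of its brutal truncation. -/
lemma IsTotallyAcyclic.exists_klf {S : CochainComplex (ModuleCat.{u} A) ℤ}
    (hS : IsTotallyAcyclic (ModFinProj R A) S) : ∃ (X V Y : KLF R A) (ε : X ⟶ Y) (g : Y ⟶ V)
      (h : V ⟶ X⟦(1 : ℤ)⟧), Triangle.mk ε g h ∈ distTriang (KLF R A) ∧
      Localising.{u} (KbProj A) X.obj ∧ acyclicObjects R A V ∧ KPlusB R A Y.obj ∧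
      Nonempty ((KLF.toHomotopy R A).obj V ≅ (HomotopyCategory.quotient _ _).obj S) := by
  obtain ⟨K, φ, -, -, hK, hK', _⟩ := hS.exists_isPlusB 0
  obtain ⟨X, V, ε, g, h, H, hX, hV⟩ := exists_triangle_acyclic ⟨_, hK.isKLF⟩
  exact ⟨X, V, _, ε, g, h, H, hX, hV, (kPlusB_iff _).2 hK,
    exists_iso_of_isExactAbove hK' hS.modProj φ H hX hV rfl⟩

/-- The acyclic part of a complex in `K^{+,b}(proj A)` is a totally acyclic complex of finitely
generated projective modules. -/
lemma exists_isTotallyAcyclic_iso {X V Y : KLF R A} {ε : X ⟶ Y} {g : Y ⟶ V}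
    {h : V ⟶ X⟦(1 : ℤ)⟧} (H : Triangle.mk ε g h ∈ distTriang (KLF R A))
    (hX : Localising.{u} (KbProj A) X.obj) (hV : acyclicObjects R A V) (hY : KPlusB R A Y.obj) :
    ∃ S, IsTotallyAcyclic (ModFinProj R A) S ∧
      Nonempty ((KLF.toHomotopy R A).obj V ≅ (HomotopyCategory.quotient _ _).obj S) := by
  obtain ⟨⟨Y, hY'⟩, hY''⟩ := Y
  obtain ⟨K, rfl⟩ := Y.quotient_obj_surjective
  obtain ⟨b, S, φ, hK, hS, _⟩ := ((kPlusB_iff _).1 hY).exists_isTotallyAcyclic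
  exact ⟨S, hS, exists_iso_of_isExactAbove hK hS.modProj φ H hX hV rfl⟩

variable (R A) in
/-- The complexes in `K^lf(Proj A, R)`, as objects of the homotopy category of all complexes. -/
abbrev klfImage : ObjectProperty (HomotopyCategory (ModuleCat.{u} A) (ComplexShape.up ℤ)) :=
  imageOf (KTerm (IsProj A)).ι (isKLF R A)

instance : (klfImage R A).IsTriangulated :=
  isTriangulated_imageOf _ _ fun _ _ _ _ => (KTerm (IsProj A)).ι.map_surjective

lemma klfImage_iff (X : KProj A) : klfImage R A X.obj ↔ isKLF R A X :=
  ⟨fun ⟨_, hY, ⟨e⟩⟩ => ObjectProperty.prop_of_iso _ (ObjectProperty.isoMk _ e) hY,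
    fun h => ⟨X, h, ⟨Iso.refl _⟩⟩⟩

lemma klfImage_of_isTotallyAcyclic {S : CochainComplex (ModuleCat.{u} A) ℤ}
    (hS : IsTotallyAcyclic (ModFinProj R A) S) :
    klfImage R A ((HomotopyCategory.quotient _ _).obj S) := by
  obtain ⟨_, V, _, _, _, _, -, -, -, -, ⟨e⟩⟩ := hS.exists_klf
  exact ⟨V.obj, V.property, ⟨e⟩⟩

lemma klfImage_of_isColimit {J : Type u} {K : J → CochainComplex (ModuleCat.{u} A) ℤ}
    (hK : ∀ j, klfImage R A ((HomotopyCategory.quotient _ _).obj (K j)))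
    (hK' : ∀ j, termwise (IsProj A) (K j)) {c : Cofan K} (hc : IsColimit c) :
    klfImage R A ((HomotopyCategory.quotient _ _).obj c.pt) := by
  obtain ⟨h⟩ := KProj.nonempty_isColimit hK' hc
  exact ⟨_, .coprod J _ _ h fun j => (klfImage_iff (KProj.mk (K j) (hK' j))).1 (hK j),
    ⟨Iso.refl _⟩⟩

lemma exists_distTriang_resolutionFunctor {C : Type u₁} [Category.{v₁} C] [Abelian C]
    {E : ObjectProperty C} [hF : IsFrobeniusSubcategory E] [IsAdditiveSubcategory E]
    [E.IsClosedUnderExtensions] {S : ShortComplex C} (hS : S.ShortExact) (h₁ : E S.X₁)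
    (h₂ : E S.X₂) (h₃ : E S.X₃) : ∃ f g h, Triangle.mk
      (f : (resolutionFunctor E).obj ((toStable E).obj ⟨S.X₁, h₁⟩) ⟶
        (resolutionFunctor E).obj ((toStable E).obj ⟨S.X₂, h₂⟩))
      (g : _ ⟶ (resolutionFunctor E).obj ((toStable E).obj ⟨S.X₃, h₃⟩)) h ∈ distTriang _ := by
  let X : E.FullSubcategory := ⟨S.X₁, h₁⟩
  obtain ⟨hs, hq, hp, hn⟩ := suspSeq_spec E X
  obtain ⟨b, hb⟩ := hF.extend S hS h₁ h₂ h₃ (suspQ E X) hq hp (suspI E X)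
  have := hS.epi_g
  have w : S.f ≫ b ≫ suspP E X = 0 := by rw [reassoc_of% hb, suspI_suspP]
  have hc := hS.exact.g_desc (b ≫ suspP E X) w
  exact ⟨_, _, _, resolutionFunctor_distinguished (X := X) (Y := ⟨S.X₂, h₂⟩) (Z := ⟨S.X₃, h₃⟩)
    (ObjectProperty.homMk S.f) (ObjectProperty.homMk S.g) S.zero hS b
    (ObjectProperty.homMk (hS.exact.desc (b ≫ suspP E X) w)) hb hc⟩

/-- The complete resolutions of the objects of `Mod^lf(A, R)` belong to `K^lf(Proj A, R)`. -/
lemma klfImage_resolutionFunctor (X : StModLF R A) :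
    klfImage R A ((resolutionFunctor (ModLF R A)).obj X) := by
  -- Complete resolutions preserve coproducts and turn short exact sequences into exact triangles,
  -- so that it suffices to consider the finitely generated modules.
  have key (M : ModuleCat.{u} A) (hM : ModLF R A M) :
      klfImage R A ((resolutionFunctor (ModLF R A)).obj ((toStable _).obj ⟨M, hM⟩)) := by
    induction hM with
    | of M hM =>
      obtain ⟨S, hS, ⟨e⟩⟩ := FrobRec.exists_isTotallyAcyclic (E := ModFinProj R A)
        (isClosedUnderIsomorphisms_of_isAdditiveSubcategory _) M hM
      obtain ⟨e'⟩ := nonempty_quotient_obj_iso (hS.of_le modFinProj_le_modLF)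
        (isTotallyAcyclic_completeResolution (ModLF R A) ⟨M, .of M hM⟩)
        (e ≪≫ (completeResolutionIso (ModLF R A) ⟨M, .of M hM⟩).symm)
      exact ObjectProperty.prop_of_iso _ e' (klfImage_of_isTotallyAcyclic hS)
    | coprod J M c hc h ih =>
      have hK (j : J) := isTotallyAcyclic_completeResolution (ModLF R A) ⟨M j, h j⟩
      let d := coproductIsCoproduct fun j : J => completeResolution (ModLF R A) ⟨M j, h j⟩
      obtain ⟨d'⟩ := nonempty_isColimit_opcycles d 0
      have e : (∐ fun j : J => completeResolution (ModLF R A) ⟨M j, h j⟩).opcycles 0 ≅ c.pt :=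
        IsColimit.coconePointsIsoOfNatIso d' hc (Discrete.natIso fun j =>
          completeResolutionIso (ModLF R A) ⟨M j.as, h j.as⟩)
      have hM : ModLF R A c.pt := .coprod J M c hc h
      obtain ⟨e'⟩ := nonempty_quotient_obj_iso (isTotallyAcyclic_of_isColimit hK d)
        (isTotallyAcyclic_completeResolution (ModLF R A) ⟨c.pt, hM⟩)
        (e ≪≫ (completeResolutionIso (ModLF R A) ⟨c.pt, hM⟩).symm)
      exact ObjectProperty.prop_of_iso _ e' (klfImage_of_isColimit ih
        (fun j n => (isProj_iff A _).2 ((hK j).projective n)) d)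
    | two_of_three₁ S hS h₁ h₂ h₃ ih₂ ih₃ =>
      obtain ⟨f, g, h, H⟩ := exists_distTriang_resolutionFunctor hS (.two_of_three₁ S hS h₁ h₂ h₃)
        h₂ h₃
      exact ObjectProperty.ext_of_isTriangulatedClosed₁ _ _ H ih₂ ih₃
    | two_of_three₂ S hS h₁ h₂ h₃ ih₁ ih₃ =>
      obtain ⟨f, g, h, H⟩ := exists_distTriang_resolutionFunctor hS h₁
        (.two_of_three₂ S hS h₁ h₂ h₃) h₃
      exact ObjectProperty.ext_of_isTriangulatedClosed₂ _ _ H ih₁ ih₃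
    | two_of_three₃ S hS h₁ h₂ h₃ ih₁ ih₂ =>
      obtain ⟨f, g, h, H⟩ := exists_distTriang_resolutionFunctor hS h₁ h₂
        (.two_of_three₃ S hS h₁ h₂ h₃)
      exact ObjectProperty.ext_of_isTriangulatedClosed₃ _ _ H ih₁ ih₂
  obtain ⟨⟨M, hM⟩, rfl⟩ : ∃ M, X = (toStable _).obj M := ⟨X.as, rfl⟩
  exact key M hM

variable (R A) in
/-- The left adjoint of the inclusion of the acyclic complexes, as a functor
`K^lf(Proj A, R) ⥤ K^lf(Proj A, R)`. -/
def acyclicPart : KLF R A ⥤ (acyclicObjects R A).FullSubcategory :=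
  (acyclicObjects R A).ι.leftAdjoint

variable (R A) in
/-- The adjunction that defines the acyclic part. -/
def acyclicPartAdj : acyclicPart R A ⊣ (acyclicObjects R A).ι := Adjunction.ofIsRightAdjoint _

instance : (acyclicPart R A).CommShift ℤ := (acyclicPartAdj R A).leftAdjointCommShift ℤ

instance : (acyclicPart R A).IsTriangulated :=
  have := (acyclicPartAdj R A).commShift_of_rightAdjoint ℤ
  (acyclicPartAdj R A).isTriangulated_leftAdjoint

instance (J : Type u) : PreservesColimitsOfShape (Discrete J) (acyclicPart R A) :=
  (acyclicPartAdj R A).leftAdjoint_preservesColimits.preservesColimitsOfShape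

lemma exists_acyclicPart_iso {X V Y : KLF R A} {ε : X ⟶ Y} {g : Y ⟶ V}
    {h : V ⟶ X⟦(1 : ℤ)⟧} (H : Triangle.mk ε g h ∈ distTriang (KLF R A))
    (hX : Localising.{u} (KbProj A) X.obj) (hV : acyclicObjects R A V) :
    ∃ e : V ≅ ((acyclicPart R A).obj Y).obj, g ≫ e.hom = (acyclicPartAdj R A).unit.app Y := by
  refine exists_iso_of_bijective (P := acyclicObjects R A) (g := g)
    (g' := (acyclicPartAdj R A).unit.app Y) hV ((acyclicPart R A).obj Y).property
    (fun W hW => bijective_comp_of_triangle H hX hW) fun W hW => ?_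
  convert ((acyclicPartAdj R A).homEquiv Y ⟨W, hW⟩).bijective.comp
    (ObjectProperty.fullyFaithfulι _).homEquiv.symm.bijective using 1
  funext k
  exact ((acyclicPartAdj R A).homEquiv_unit Y ⟨W, hW⟩ (ObjectProperty.homMk k)).symm

/-- The acyclic part of each complex in `K^lf(Proj A, R)` is homotopy equivalent to a totally
acyclic complex: this holds for the generators of `K^lf(Proj A, R)`, and the acyclic part is exact
and preserves coproducts. -/
lemma resolutions_acyclicPart (Y : KLF R A) :
    resolutions R A ((KLF.toHomotopy R A).obj ((acyclicPart R A).obj Y).obj) := by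
  have := isTriangulated_comp (acyclicPart R A) ((acyclicObjects R A).ι ⋙ KLF.toHomotopy R A)
  refine Localising.le (P := resolutions R A) resolutions_coprod le_rfl _ (Localising.map
    (acyclicPart R A ⋙ (acyclicObjects R A).ι ⋙ KLF.toHomotopy R A) (fun Y hY => .of _ ?_)
      (localising_kPlusB Y))
  obtain ⟨X, V, ε, g, h, H, hX, hV⟩ := exists_triangle_acyclic Y
  obtain ⟨S, hS, ⟨e⟩⟩ := exists_isTotallyAcyclic_iso H hX hV hY
  obtain ⟨e', -⟩ := exists_acyclicPart_iso H hX hV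
  exact ObjectProperty.prop_of_iso _ (e.symm ≪≫ (KLF.toHomotopy R A).mapIso e')
    (hS.of_le modFinProj_le_modLF).resolutions

lemma resolutions_of_acyclicObjects {W : KLF R A} (hW : acyclicObjects R A W) :
    resolutions R A ((KLF.toHomotopy R A).obj W) :=
  ObjectProperty.prop_of_iso _ ((KLF.toHomotopy R A).mapIso ((acyclicObjects R A).ι.mapIso
    (asIso ((acyclicPartAdj R A).counit.app ⟨W, hW⟩)))) (resolutions_acyclicPart W)

lemma essImage_of_acyclicObjects {W : KLF R A} (hW : acyclicObjects R A W) :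
    (resolutionFunctor (ModLF R A)).essImage ((KLF.toHomotopy R A).obj W) := by
  obtain ⟨K, hK, ⟨e⟩⟩ := resolutions_of_acyclicObjects hW
  obtain ⟨K, rfl⟩ := K.quotient_obj_surjective
  exact (resolutionFunctor (ModLF R A)).essImage.prop_of_iso e.symm (essImage_resolutionFunctor hK)

end AcyclicObjects

/-! ### The recollement -/

section Recollement

variable {R A : Type u} [CommRing R] [Ring A] [Algebra R A] [IsFrobeniusAlgebra R A]

lemma resolutionFunctor_obj_mem_kTerm (X : StModLF R A) :
    KTerm (IsProj A) ((resolutionFunctor (ModLF R A)).obj X) :=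
  fun n => (isProj_iff A _).2 ((resolutionFunctor_obj_mem X).projective n)

variable (R A) in
/-- The functor that sends an object of `StMod^lf(A, R)` to its complete resolution,
as an acyclic complex in `K^lf(Proj A, R)`. -/
def resolutionKLF : StModLF R A ⥤ (acyclicObjects R A).FullSubcategory :=
  ObjectProperty.lift _ (ObjectProperty.lift _ (ObjectProperty.lift _
    (resolutionFunctor (ModLF R A)) resolutionFunctor_obj_mem_kTerm)
      fun X => (klfImage_iff ⟨_, resolutionFunctor_obj_mem_kTerm X⟩).1
        (klfImage_resolutionFunctor X)) fun X =>
    (HomotopyCategory.quotient_obj_mem_subcategoryAcyclic_iff_acyclic _).2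
      (resolutionFunctor_obj_mem X).acyclic

instance : (resolutionKLF R A).Full :=
  have : (resolutionKLF R A ⋙ (acyclicObjects R A).ι ⋙ KLF.toHomotopy R A).Full :=
    inferInstanceAs (resolutionFunctor (ModLF R A)).Full
  .of_comp_faithful _ ((acyclicObjects R A).ι ⋙ KLF.toHomotopy R A)

instance : (resolutionKLF R A).Faithful :=
  have : (resolutionKLF R A ⋙ (acyclicObjects R A).ι ⋙ KLF.toHomotopy R A).Faithful :=
    inferInstanceAs (resolutionFunctor (ModLF R A)).Faithful
  .of_comp _ ((acyclicObjects R A).ι ⋙ KLF.toHomotopy R A)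

instance : (resolutionKLF R A).EssSurj where
  mem_essImage W := by
    obtain ⟨X, ⟨e⟩⟩ := essImage_of_acyclicObjects W.property
    exact ⟨X, ⟨ObjectProperty.isoMk _ (ObjectProperty.isoMk _ (ObjectProperty.isoMk _ e))⟩⟩

instance : (resolutionKLF R A).IsEquivalence where

variable (R A) in
/-- The stable category `StMod^lf(A, R)` is equivalent to the category of acyclic complexes in
`K^lf(Proj A, R)`. -/
def acyclicEquivalence : StModLF R A ≌ (acyclicObjects R A).FullSubcategory :=
  (resolutionKLF R A).asEquivalence

variable (R A) in
/-- The inclusion of the acyclic complexes, as a functor on the stable category. -/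
def recollementInclusion : StModLF R A ⥤ KLF R A :=
  (acyclicEquivalence R A).functor ⋙ (acyclicObjects R A).ι

instance : (recollementInclusion R A).Full :=
  inferInstanceAs ((acyclicEquivalence R A).functor ⋙ (acyclicObjects R A).ι).Full

instance : (recollementInclusion R A).Faithful :=
  inferInstanceAs ((acyclicEquivalence R A).functor ⋙ (acyclicObjects R A).ι).Faithful

set_option synthInstance.maxSize 1000 in
instance : TriangleStructure (acyclicObjects R A).FullSubcategory :=
  TriangleStructure.ofPretriangulated _

lemma isExactFunctor_recollementInclusion : IsExactFunctor (recollementInclusion R A) :=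
  IsExactFunctor.of_comp (F := KLF.toHomotopy R A) (isExactFunctor_of_isTriangulated _)
    (isExactFunctor_resolutionFunctor (ModLF R A))

/-- The composite with the equivalence between the acyclic complexes and the stable category
is exact. -/
lemma isExactFunctor_comp_inverse {B : Type u₁} [Category.{v₁} B] [TriangleStructure B]
    {F : B ⥤ (acyclicObjects R A).FullSubcategory} (hF : IsExactFunctor F) :
    IsExactFunctor (F ⋙ (acyclicEquivalence R A).inverse) := by
  refine IsExactFunctor.of_comp isExactFunctor_recollementInclusion ?_
  have h : IsExactFunctor (F ⋙ (acyclicObjects R A).ι) :=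
    hF.comp (isExactFunctor_of_isTriangulated _)
  exact h.of_iso (Functor.isoWhiskerRight (F.rightUnitor.symm ≪≫
    Functor.isoWhiskerLeft F (acyclicEquivalence R A).counitIso.symm) (acyclicObjects R A).ι)

variable (R A) in
/-- The left adjoint of the inclusion. -/
def recollementCokernel : KLF R A ⥤ StModLF R A :=
  acyclicPart R A ⋙ (acyclicEquivalence R A).inverse

variable (R A) in
/-- The adjunction between `recollementCokernel` and `recollementInclusion`. -/
def recollementAdj : recollementCokernel R A ⊣ recollementInclusion R A :=
  (acyclicPartAdj R A).comp (acyclicEquivalence R A).symm.toAdjunction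

lemma essImage_recollementInclusion_iff [HasDerivedCategory.{w} (ModuleCat.{u} A)] (X : KLF R A) :
    (recollementInclusion R A).essImage X ↔ IsZero ((canonicalFunctor.{w} R A).obj X) := by
  rw [isZero_canonicalFunctor_iff]
  constructor
  · rintro ⟨Y, ⟨e⟩⟩
    exact ObjectProperty.prop_of_iso _ e ((acyclicEquivalence R A).functor.obj Y).property
  · intro h
    exact ⟨(acyclicEquivalence R A).inverse.obj ⟨X, h⟩, ⟨(acyclicObjects R A).ι.mapIso
      ((acyclicEquivalence R A).counitIso.app ⟨X, h⟩)⟩⟩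

variable (R A) in
/-- The recollement of `K^lf(Proj A, R)`. -/
def recollement [HasDerivedCategory.{w} (ModuleCat.{u} A)] :
    Recollement (StModLF R A) (canonicalFunctor.{w} R A) where
  iLowerStar := recollementInclusion R A
  iUpperStar := recollementCokernel R A
  iUpperShriek := (acyclicObjects R A).ι.rightAdjoint ⋙ (acyclicEquivalence R A).inverse
  jLowerShriek := (canonicalFunctor.{w} R A).leftAdjoint
  jLowerStar := (canonicalFunctor.{w} R A).rightAdjoint
  exact_j := isExactFunctor_of_isTriangulated _
  exact_iLowerStar := isExactFunctor_recollementInclusion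
  exact_iUpperStar := isExactFunctor_comp_inverse (isExactFunctor_leftAdjoint (acyclicPartAdj R A))
  exact_iUpperShriek := isExactFunctor_comp_inverse
    (isExactFunctor_rightAdjoint (Adjunction.ofIsLeftAdjoint (acyclicObjects R A).ι))
  exact_jLowerShriek := isExactFunctor_leftAdjoint
    (Adjunction.ofIsRightAdjoint (canonicalFunctor.{w} R A))
  exact_jLowerStar := isExactFunctor_rightAdjoint
    (Adjunction.ofIsLeftAdjoint (canonicalFunctor.{w} R A))
  adj_iUpperStar := recollementAdj R A
  adj_iUpperShriek := (acyclicEquivalence R A).toAdjunction.comp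
    (Adjunction.ofIsLeftAdjoint (acyclicObjects R A).ι)
  adj_jLowerShriek := Adjunction.ofIsRightAdjoint _
  adj_jLowerStar := Adjunction.ofIsLeftAdjoint _
  ff_iLowerStar := .ofFullyFaithful _
  ff_jLowerShriek := fullyFaithful_leftAdjoint.some
  ff_jLowerStar := fullyFaithful_rightAdjoint.some
  essImage_iff := essImage_recollementInclusion_iff

end Recollement

/-! ### The cokernel functor -/

section Cokernel

section

variable {A : Type u} [Ring A]

lemma toStable_opcyclesMap_eq {K L : CochainComplex (ModuleCat.{u} A) ℤ}
    (hL : termwise (IsProj A) L) {f g : K ⟶ L} (h : (HomotopyCategory.quotient _ _).map f =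
      (HomotopyCategory.quotient _ _).map g) (n : ℤ) :
    (toStable (⊤ : ObjectProperty (ModuleCat.{u} A))).map
      (ObjectProperty.homMk (X := ⟨K.opcycles n, trivial⟩) (Y := ⟨L.opcycles n, trivial⟩)
        (HomologicalComplex.opcyclesMap f n)) =
    (toStable (⊤ : ObjectProperty (ModuleCat.{u} A))).map
      (ObjectProperty.homMk (HomologicalComplex.opcyclesMap g n)) :=
  (toStable_map_eq_iff _ exists_cover_top _ _).2 (stablyEq_opcyclesMap
    (fun i => (isProj_iff A _).1 (hL i)) (HomotopyCategory.homotopyOfEq _ _ h) n)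

variable (A) in
/-- The functor that sends a complex `X` of projective modules to `Coker (X^{-1} ⟶ X^0)`. -/
def kProjCokernel : KProj A ⥤ StableCat (⊤ : ObjectProperty (ModuleCat.{u} A)) where
  obj X := (toStable _).obj ⟨X.obj.as.opcycles 0, trivial⟩
  map {X Y} f := (toStable _).map (ObjectProperty.homMk (HomologicalComplex.opcyclesMap
    (((HomotopyCategory.quotient _ _).map_surjective f.hom).choose : X.obj.as ⟶ Y.obj.as) 0))
  map_id X := by
    refine (toStable_opcyclesMap_eq (g := 𝟙 X.obj.as) X.property ?_ 0).trans ?_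
    · exact ((HomotopyCategory.quotient _ _).map_surjective (𝟙 X : X ⟶ X).hom).choose_spec.trans
        (CategoryTheory.Functor.map_id (HomotopyCategory.quotient _ _) X.obj.as).symm
    · rw [← CategoryTheory.Functor.map_id]
      congr 1
      ext1
      exact HomologicalComplex.opcyclesMap_id _ _
  map_comp {X Y Z} f g := by
    have hf := ((HomotopyCategory.quotient _ _).map_surjective f.hom).choose_spec
    have hg := ((HomotopyCategory.quotient _ _).map_surjective g.hom).choose_spec
    have hfg := ((HomotopyCategory.quotient _ _).map_surjective (f ≫ g).hom).choose_spec
    refine (toStable_opcyclesMap_eq Z.property (hfg.trans ((congrArg₂ (· ≫ ·) hf hg).symm.trans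
      (CategoryTheory.Functor.map_comp _ _ _).symm)) 0).trans ?_
    rw [← CategoryTheory.Functor.map_comp]
    congr 1
    ext1
    exact HomologicalComplex.opcyclesMap_comp _ _ _

lemma kProjCokernel_map {K L : CochainComplex (ModuleCat.{u} A) ℤ} (hK : termwise (IsProj A) K)
    (hL : termwise (IsProj A) L) (f : K ⟶ L) :
    (kProjCokernel A).map (ObjectProperty.homMk ((HomotopyCategory.quotient _ _).map f) :
      KProj.mk K hK ⟶ KProj.mk L hL) = (toStable _).map
      (ObjectProperty.homMk (HomologicalComplex.opcyclesMap f 0)) :=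
  toStable_opcyclesMap_eq hL
    ((HomotopyCategory.quotient _ _).map_surjective _).choose_spec 0

end

variable (R A : Type u) [CommRing R] [Ring A] [Algebra R A]

/-- The cokernel functor on the acyclic complexes factors through the homotopy category. -/
def acyclicToKLFCokernelIso :
    acyclicToKLF R A ⋙ (isKLF R A).ι ⋙ kProjCokernel A ≅ cokernelFunctor R A :=
  NatIso.ofComponents (fun _ => Iso.refl _) fun {K L} f => by
    refine (Category.comp_id _).trans (Eq.trans ?_ (Category.id_comp _).symm)
    exact kProjCokernel_map K.property.2.choose L.property.2.choose f.hom

variable [IsFrobeniusAlgebra R A]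

/-- An object of the stable category is recovered from its complete resolution as a cokernel. -/
def recollementInclusionCokernelIso :
    recollementInclusion R A ⋙ (isKLF R A).ι ⋙ kProjCokernel A ≅ stableInclusion le_top :=
  NatIso.ofComponents (fun X => (toStable _).mapIso (ObjectProperty.isoMk _
    (completeResolutionIso (ModLF R A) X.as))) fun {X Y} f => by
    obtain ⟨f, rfl⟩ := (toStable (ModLF R A)).map_surjective f
    refine (congrArg (· ≫ _) (kProjCokernel_map (resolutionFunctor_obj_mem_kTerm X)
      (resolutionFunctor_obj_mem_kTerm Y) (resolutionMap f))).trans ?_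
    refine ((toStable _).map_comp _ _).symm.trans (Eq.trans ?_ ((toStable _).map_comp _ _))
    congr 1
    ext1
    exact resolutionMap_spec f

instance (K : (acyclicKLF R A).FullSubcategory) :
    IsIso ((recollementAdj R A).unit.app ((acyclicToKLF R A).obj K)) := by
  let := HasDerivedCategory.standard (ModuleCat.{u} A)
  have h : (recollementInclusion R A).essImage ((acyclicToKLF R A).obj K) := by
    rw [essImage_recollementInclusion_iff, isZero_canonicalFunctor_iff]
    exact (HomotopyCategory.quotient_obj_mem_subcategoryAcyclic_iff_acyclic _).2 K.property.1
  exact (recollementAdj R A).isIso_unit_app_of_iso h.getIso.symm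

/-- On acyclic complexes the left adjoint of the inclusion is the cokernel of the differential. -/
theorem nonempty_cokernel_iso : Nonempty (acyclicToKLF R A ⋙ recollementCokernel R A ⋙
    stableInclusion le_top ≅ cokernelFunctor R A) := by
  let α : acyclicToKLF R A ⟶ (acyclicToKLF R A ⋙ recollementCokernel R A) ⋙
      recollementInclusion R A := Functor.whiskerLeft (acyclicToKLF R A) (recollementAdj R A).unit
  have (K : (acyclicKLF R A).FullSubcategory) : IsIso (α.app K) :=
    inferInstanceAs (IsIso ((recollementAdj R A).unit.app ((acyclicToKLF R A).obj K)))
  have : IsIso α := NatIso.isIso_of_isIso_app α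
  exact ⟨Functor.isoWhiskerLeft (acyclicToKLF R A ⋙ recollementCokernel R A)
    (recollementInclusionCokernelIso R A).symm ≪≫ Functor.isoWhiskerRight (asIso α).symm
      ((isKLF R A).ι ⋙ kProjCokernel A) ≪≫ acyclicToKLFCokernelIso R A⟩

end Cokernel

/-! ### Resolutions of modules by complexes in `K^{+,b}(proj A)` -/

section SingleResolution

variable {C : Type u₁} [Category.{v₁} C] [Abelian C]

/-- An embedding of `M` as the kernel of the first differential of a complex that is exact
elsewhere is a quasi-isomorphism. -/
lemma quasiIso_mkHomFromSingle {K : CochainComplex C ℤ} {n m : ℤ} (hnm : n + 1 = m)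
    (hK : ∀ i < n, IsZero (K.X i)) (hK' : ∀ i > n, K.ExactAt i) {M : C} (φ : M ⟶ K.X n) [Mono φ]
    (w : φ ≫ K.d n m = 0) (hφ : (ShortComplex.mk φ (K.d n m) w).Exact)
    (h : ∀ k, (ComplexShape.up ℤ).Rel n k → φ ≫ K.d n k = 0) :
    QuasiIso (HomologicalComplex.mkHomFromSingle φ h) := by
  have hs (i : ℤ) (hi : i ≠ n) : IsZero (((HomologicalComplex.single C (ComplexShape.up ℤ) n).obj
      M).X i) := HomologicalComplex.isZero_single_obj_X _ _ _ _ hi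
  refine ⟨fun i => ?_⟩
  by_cases hi : i = n
  · subst hi
    have h' := HomologicalComplex.mkHomFromSingle_f φ h
    rw [quasiIsoAt_iff' _ (i - 1) i m (by simp) (by simp [hnm]),
      ShortComplex.quasiIso_iff_of_zeros _ ((hs _ (by omega)).eq_of_src _ _)
        ((hs _ (by omega)).eq_of_tgt _ _) ((hK _ (by omega)).eq_of_src _ _)]
    refine ⟨ShortComplex.exact_of_iso (ShortComplex.isoMk
      (HomologicalComplex.singleObjXSelf (ComplexShape.up ℤ) i M).symm (Iso.refl (K.X i))
      (Iso.refl (K.X m)) ?_ ?_) hφ, ?_⟩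
    · refine Eq.trans ?_ (Category.comp_id φ).symm
      exact (congrArg (_ ≫ ·) h').trans (Iso.inv_hom_id_assoc _ _)
    · exact (Category.id_comp _).trans (Category.comp_id _).symm
    · have : Mono ((HomologicalComplex.mkHomFromSingle φ h).f i) := by
        rw [h']
        infer_instance
      exact this
  · rw [quasiIsoAt_iff_exactAt _ _ (.of_isZero (hs i hi))]
    rcases lt_or_gt_of_ne hi with hi | hi
    · exact .of_isZero (hK i hi)
    · exact hK' i hi

variable {R A : Type u} [CommRing R] [Ring A] [Algebra R A] [IsFrobeniusAlgebra R A]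

/-- A module in `mod(A, R)` has a coresolution in `K^{+,b}(proj A)`: the brutal truncation of a
complete resolution. -/
lemma exists_isPlusB_single [HasDerivedCategory.{w} (ModuleCat.{u} A)] {M : ModuleCat.{u} A}
    (hM : ModFinProj R A M) : ∃ K, IsPlusB R K ∧
      Nonempty (DerivedCategory.Q.obj K ≅ (DerivedCategory.singleFunctor _ 0).obj M) := by
  -- After a shift, `M` is the kernel of the differential of `S` in degree `0`, and the truncation
  -- of `S` to nonnegative degrees is a coresolution of `M`.
  obtain ⟨S, hS, ⟨e⟩⟩ := FrobRec.exists_isTotallyAcyclic (E := ModFinProj R A)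
    (isClosedUnderIsomorphisms_of_isAdditiveSubcategory _) M hM
  have hS := hS.shift 1
  have e := shiftOpcyclesIso S 1 (-1) 0 (by omega) ≪≫ e
  generalize S⟦(1 : ℤ)⟧ = S at hS e
  obtain ⟨K, φ, h₁, h₂, hK, hK', -⟩ := hS.exists_isPlusB 0
  have h₃ := h₂ 0 le_rfl
  have h₄ := h₂ 1 (by omega)
  let x : S.X 0 ≅ K.X 0 := (asIso (φ.f 0)).symm
  let y : S.X 1 ≅ K.X 1 := (asIso (φ.f 1)).symm
  have hxy : x.hom ≫ K.d 0 1 = S.d 0 1 ≫ y.hom := by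
    have h : φ.f 0 ≫ S.d 0 1 = K.d 0 1 ≫ φ.f 1 := φ.comm 0 1
    have hx : x.hom ≫ φ.f 0 = 𝟙 _ := x.hom_inv_id
    have hy : φ.f 1 ≫ y.hom = 𝟙 _ := y.inv_hom_id
    calc x.hom ≫ K.d 0 1 = x.hom ≫ (K.d 0 1 ≫ φ.f 1) ≫ y.hom := by
          rw [Category.assoc, hy, Category.comp_id]
      _ = S.d 0 1 ≫ y.hom := by rw [← h, Category.assoc, reassoc_of% hx]
  have hS₁ := shortExact_opcycles S (show (-1 : ℤ) + 1 = 0 by omega) (hS.acyclic (-1))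
  have hS₂ := shortExact_opcycles S (show (0 : ℤ) + 1 = 1 by omega) (hS.acyclic 0)
  have := hS₁.mono_f
  have := hS₂.mono_f
  have hw : S.fromOpcycles (-1) 0 ≫ S.d 0 1 = 0 := by
    rw [← cancel_epi (S.pOpcycles (-1))]
    simp
  have hex : (ShortComplex.mk _ _ hw).Exact :=
    (ShortComplex.exact_iff_of_epi_of_isIso_of_mono
      { τ₁ := 𝟙 _, τ₂ := 𝟙 _, τ₃ := S.fromOpcycles 0 1 : ShortComplex.mk (S.fromOpcycles (-1) 0)
          (S.pOpcycles 0) _ ⟶ ShortComplex.mk _ _ hw }).1 hS₁.exact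
  have hw' : (e.inv ≫ S.fromOpcycles (-1) 0 ≫ x.hom) ≫ K.d 0 1 = 0 := by
    rw [Category.assoc, Category.assoc, hxy, reassoc_of% hw, zero_comp, comp_zero]
  have : Mono (e.inv ≫ S.fromOpcycles (-1) 0 ≫ x.hom) := by
    have : Mono (S.fromOpcycles (-1) 0) := hS₁.mono_f
    infer_instance
  have hq := quasiIso_mkHomFromSingle (K := K) (show (0 : ℤ) + 1 = 1 by omega) h₁
    (fun i hi => hK'.exactAt i (by omega)) (e.inv ≫ S.fromOpcycles (-1) 0 ≫ x.hom) hw'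
    ((ShortComplex.exact_iff_of_iso (ShortComplex.isoMk e x y (by simp) hxy)).1 hex)
    (by
      rintro _ rfl
      exact hw')
  have := (DerivedCategory.isIso_Q_map_iff_quasiIso _ _).2 hq
  exact ⟨K, hK, ⟨((DerivedCategory.singleFunctorIsoCompQ _ 0).app M ≪≫
    @asIso _ _ _ _ _ this).symm⟩⟩

end SingleResolution

/-! ### Full faithfulness of the canonical functor on `K^{+,b}(proj A)` -/

section Canonical

variable {R A : Type u} [CommRing R] [Ring A] [Algebra R A] [IsFrobeniusAlgebra R A]

variable (R A) in
/-- The objects of `K^{+,b}(proj A)`, up to isomorphism, considered as objects of the localising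
subcategory that they generate. -/
abbrev klfPlusB : ObjectProperty (KLF R A) :=
  (KPlusB R A).isoClosure.inverseImage (isKLF R A).ι

instance : (klfPlusB R A).IsTriangulated := inferInstance

lemma klfPlusB_of_kPlusB {X : KLF R A} (hX : KPlusB R A X.obj) : klfPlusB R A X :=
  ObjectProperty.le_isoClosure _ _ hX

lemma klfPlusB.exists_iso {X : KLF R A} (hX : klfPlusB R A X) : ∃ (K : CochainComplex _ ℤ)
    (_ : IsPlusB R K), Nonempty ((KLF.toHomotopy R A).obj X ≅
      (HomotopyCategory.quotient _ _).obj K) := by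
  obtain ⟨Y, hY, ⟨e⟩⟩ := hX
  obtain ⟨K, hK, rfl⟩ := Y.exists_eq_mk
  exact ⟨K, (kPlusB_iff _).1 hY, ⟨(KTerm (IsProj A)).ι.mapIso e⟩⟩

/-- There are no nonzero morphisms from an acyclic object to a complex in `K^{+,b}(proj A)`. -/
lemma klfPlusB_le_rightOrthogonal : klfPlusB R A ≤ (acyclicObjects R A).rightOrthogonal := by
  intro Y hY V f hV
  -- The source is homotopy equivalent to a totally acyclic complex, and maps from the latter into
  -- projective modules extend along its differentials. The target is bounded below, so a
  -- null-homotopy can be constructed by induction on the degree.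
  obtain ⟨S, hS, ⟨e⟩⟩ := resolutions_of_acyclicObjects hV
  obtain ⟨S, rfl⟩ := S.quotient_obj_surjective
  obtain ⟨K, hK, ⟨e'⟩⟩ := hY.exists_iso
  refine (KLF.toHomotopy R A).map_injective ?_
  rw [CategoryTheory.Functor.map_zero, ← cancel_mono e'.hom, ← cancel_epi e.inv, zero_comp,
    comp_zero]
  obtain ⟨g, hg⟩ := (HomotopyCategory.quotient _ _).map_surjective
    (e.inv ≫ (KLF.toHomotopy R A).map f ≫ e'.hom)
  rw [← hg, ← CategoryTheory.Functor.map_zero]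
  obtain ⟨a, ha⟩ := hK.exists_ge
  have hP (n : ℤ) : Projective (K.X n) := (isProj_iff A _).1 (hK.isFGProj n).1
  refine HomotopyCategory.eq_of_homotopy _ _ (homotopy_zero_of_extendsAt g (a - 1) ?_ ?_).some
  · exact fun n hn => (K.isZero_of_isStrictlyGE a n (by omega)).eq_of_tgt _ _
  · intro n _
    exact (hS.isExactAbove n).extendsAt le_rfl
      (ModLF.of_projective _ (hP n))

variable [HasDerivedCategory.{w} (ModuleCat.{u} A)]

/-- The functor to the derived category is fully faithful on morphisms into an object that is
right orthogonal to the acyclic objects. -/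
lemma bijective_canonicalFunctor_map (X : KLF R A) {Y : KLF R A}
    (hY : (acyclicObjects R A).rightOrthogonal Y) :
    Function.Bijective ((canonicalFunctor.{w} R A).map : (X ⟶ Y) → _) := by
  obtain ⟨P, V, ε, g, h, H, hP, hV⟩ := exists_triangle_acyclic X
  have := (isZero_canonicalFunctor_iff.{w} V).2 hV
  have hε : IsIso ((canonicalFunctor.{w} R A).map ε) :=
    (isIso₁_iff_isZero (map_distTriang (canonicalFunctor.{w} R A) H)).2 this
  have h₁ : Function.Bijective fun k : X ⟶ Y => ε ≫ k :=
    bijective_comp_of_cone H (fun k => hY k hV)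
      fun k => (acyclicObjects R A).rightOrthogonal.le_shift (1 : ℤ) _ hY k hV
  have h₂ : Function.Bijective ((canonicalFunctor.{w} R A).map : (P ⟶ Y) → _) :=
    (bijective_Qh_map hP _).comp
      (Functor.FullyFaithful.ofFullyFaithful (KLF.toHomotopy R A)).homEquiv.bijective
  have h₃ : Function.Bijective fun k : (canonicalFunctor.{w} R A).obj X ⟶
      (canonicalFunctor.{w} R A).obj Y => (canonicalFunctor.{w} R A).map ε ≫ k :=
    (asIso ((canonicalFunctor.{w} R A).map ε)).symm.homFromEquiv.bijective
  refine (Function.Bijective.of_comp_iff' h₃ _).1 ?_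
  convert h₂.comp h₁ using 1
  ext k
  exact ((canonicalFunctor.{w} R A).map_comp ε k).symm

variable (R A) in
/-- The canonical functor on the objects that are right orthogonal to the acyclic objects. -/
def orthogonalToDerived :
    (acyclicObjects R A).rightOrthogonal.FullSubcategory ⥤ DerivedCategory (ModuleCat.{u} A) :=
  (acyclicObjects R A).rightOrthogonal.ι ⋙ canonicalFunctor.{w} R A

instance : (orthogonalToDerived.{w} R A).CommShift ℤ :=
  inferInstanceAs
    (((acyclicObjects R A).rightOrthogonal.ι ⋙ canonicalFunctor.{w} R A).CommShift ℤ)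

instance : (orthogonalToDerived.{w} R A).IsTriangulated :=
  isTriangulated_comp (acyclicObjects R A).rightOrthogonal.ι (canonicalFunctor.{w} R A)

lemma bijective_orthogonalToDerived_map
    (X Y : (acyclicObjects R A).rightOrthogonal.FullSubcategory) :
    Function.Bijective ((orthogonalToDerived.{w} R A).map : (X ⟶ Y) → _) :=
  (bijective_canonicalFunctor_map X.obj Y.property).comp
    (ObjectProperty.fullyFaithfulι _).homEquiv.bijective

instance : (orthogonalToDerived.{w} R A).Full :=
  ⟨fun {X Y} => (bijective_orthogonalToDerived_map X Y).2⟩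

instance : (orthogonalToDerived.{w} R A).Faithful :=
  ⟨fun {X Y} => @(bijective_orthogonalToDerived_map X Y).1⟩

/-- Every bounded complex in `mod(A, R)` is quasi-isomorphic to a complex in
`K^{+,b}(proj A)`. -/
lemma exists_isPlusB {Y : CochainComplex (ModuleCat.{u} A) ℤ}
    (hY : boundedTermwise (ModFinProj R A) Y) :
    ∃ K, IsPlusB R K ∧ Nonempty (DerivedCategory.Q.obj K ≅ DerivedCategory.Q.obj Y) := by
  have := isTriangulated_imageOf (canonicalFunctor.{w} R A) (klfPlusB R A)
    fun X Y _ hY => (bijective_canonicalFunctor_map X (klfPlusB_le_rightOrthogonal _ hY)).2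
  have h : imageOf (canonicalFunctor.{w} R A) (klfPlusB R A) (DerivedCategory.Q.obj Y) := by
    refine prop_of_boundedTermwise (ModFinProj R A) _ (fun M hM => ?_) hY
    obtain ⟨K, hK, ⟨e⟩⟩ := exists_isPlusB_single.{w} hM
    exact ⟨⟨KProj.mk K hK.termwise, hK.isKLF⟩, klfPlusB_of_kPlusB ((kPlusB_iff _).2 hK),
      ⟨(DerivedCategory.quotientCompQhIso _).app K ≪≫ e⟩⟩
  obtain ⟨X, hX, ⟨e⟩⟩ := h
  obtain ⟨K, hK, ⟨e'⟩⟩ := hX.exists_iso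
  exact ⟨K, hK, ⟨((DerivedCategory.quotientCompQhIso _).app K).symm ≪≫
    DerivedCategory.Qh.mapIso e'.symm ≪≫ e⟩⟩

end Canonical

/-! ### Morphisms in `D^b(mod(A, R))` -/

section Truncation

variable {C : Type u₁} [Category.{v₁} C] [Abelian C] {E : ObjectProperty C}

lemma boundedTermwise_truncLE [IsAdditiveSubcategory E] {K : CochainComplex C ℤ}
    (hK : ∀ n, E (K.X n)) {a : ℤ} (ha : K.IsStrictlyGE a) {n m : ℤ} (hnm : n + 1 = m)
    (hn : K.ExactAt n) (hm : K.ExactAt m) (h : E (K.opcycles n)) :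
    boundedTermwise E (K.truncLE m) := by
  have hE := ‹IsAdditiveSubcategory E›
  refine ⟨fun i => ?_, ⟨a, inferInstance⟩, ⟨m, inferInstance⟩⟩
  have := opcyclesToCycles_isIso K hnm hn hm
  rcases lt_trichotomy i m with hi | rfl | hi
  · exact hE.of_iso (K.truncLEXIso m i hi).symm (hK i)
  · exact hE.of_iso (asIso (K.opcyclesToCycles n i) ≪≫ (K.truncLEXIsoCycles i).symm) h
  · exact hE.of_isZero _ ((K.truncLE m).isZero_of_isStrictlyLE m i hi)

lemma quasiIso_ιTruncLE {K : CochainComplex C ℤ} {m : ℤ} (hK : ∀ n > m, K.ExactAt n) :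
    QuasiIso (K.ιTruncLE m) := by
  have : K.IsLE m := (K.isLE_iff m).2 fun i hi => hK i hi
  infer_instance

/-- A morphism from a complex that vanishes above the degree `m` factors through the truncation
in degree `m`. -/
lemma exists_eq_comp_ιTruncLE {K L : CochainComplex C ℤ} {m : ℤ} (hK : K.IsStrictlyLE m)
    (φ : K ⟶ L) : ∃ ψ : K ⟶ L.truncLE m, φ = ψ ≫ L.ιTruncLE m :=
  ⟨inv (K.ιTruncLE m) ≫ CochainComplex.truncLEMap φ m, by
    rw [Category.assoc, CochainComplex.ιTruncLE_naturality, IsIso.inv_hom_id_assoc]⟩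

end Truncation

section Derived

variable {R A : Type u} [CommRing R] [Ring A] [Algebra R A] [IsFrobeniusAlgebra R A]

lemma IsPlusB.exists_truncLE {I : CochainComplex (ModuleCat.{u} A) ℤ} (hI : IsPlusB R I) :
    ∃ m : ℤ, ∀ n ≥ m, boundedTermwise (ModFinProj R A) (I.truncLE n) ∧
      QuasiIso (I.ιTruncLE n) := by
  obtain ⟨b, hb, hb'⟩ := hI.exists_isExactAbove
  obtain ⟨a, ha⟩ := hI.exists_ge
  refine ⟨b + 1, fun n hn => ⟨?_, quasiIso_ιTruncLE fun i hi => hb.exactAt i (by omega)⟩⟩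
  exact boundedTermwise_truncLE (fun i => .of_isFGProj (hI.isFGProj i)) ha
    (show n - 1 + 1 = n by omega) (hb.exactAt _ (by omega)) (hb.exactAt _ (by omega))
    (hb' _ (by omega))

/-- The cokernels of the differentials of a bounded above acyclic complex are projective over `R`
if the terms of the complex are projective over `R`. -/
lemma modProj_opcycles {Z : CochainComplex (ModuleCat.{u} A) ℤ} (hZ : Z.Acyclic)
    (hZ' : ∀ n, ModProj R A (Z.X n)) {b : ℤ} (hb : Z.IsStrictlyLE b) (n : ℤ) :
    ModProj R A (Z.opcycles n) := by
  obtain hn | hn := lt_or_ge b n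
  · have h : IsZero (Z.opcycles n) := (Z.isZero_of_isStrictlyLE b n hn).of_epi (Z.pOpcycles n)
    exact IsAdditiveSubcategory.of_isZero _ h
  · obtain ⟨k, hk⟩ := Int.le.dest hn
    induction k generalizing n with
    | zero =>
      obtain rfl : n = b := by simpa using hk
      have h : IsZero (Z.opcycles (n + 1)) :=
        (Z.isZero_of_isStrictlyLE n (n + 1) (by omega)).of_epi (Z.pOpcycles _)
      exact modProj_of_shortExact _ (shortExact_opcycles Z rfl (hZ n)) (hZ' _)
        (IsAdditiveSubcategory.of_isZero _ h)
    | succ k ih =>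
      exact modProj_of_shortExact _ (shortExact_opcycles Z rfl (hZ n)) (hZ' _)
        (ih (n + 1) (by omega) (by push_cast at hk; omega))

/-- The cycles of a bounded above acyclic complex `Z` with terms projective over `R` are projective
over `R`. Over a Frobenius algebra, projective modules are injective relative to the exact
sequences of such modules, so that morphisms to bounded below complexes of projective modules are
null-homotopic. -/
lemma eq_zero_of_acyclic_of_isPlusB {Z : CochainComplex (ModuleCat.{u} A) ℤ} (hZ : Z.Acyclic)
    (hZ' : ∀ n, ModProj R A (Z.X n)) {b : ℤ} (hb : Z.IsStrictlyLE b)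
    {I : HomotopyCategory (ModuleCat.{u} A) (ComplexShape.up ℤ)}
    (hI : homotopyProp (IsPlusB R) I) (f : (HomotopyCategory.quotient _ _).obj Z ⟶ I) : f = 0 := by
  obtain ⟨I : CochainComplex _ ℤ, rfl⟩ := I.quotient_obj_surjective
  change IsPlusB R I at hI
  obtain ⟨f, rfl⟩ := (HomotopyCategory.quotient _ _).map_surjective f
  obtain ⟨a, ha⟩ := hI.exists_ge
  have hP (n : ℤ) : Projective (I.X n) := (isProj_iff A _).1 (hI.isFGProj n).1
  obtain ⟨h⟩ := homotopy_zero_of_extendsAt f (a - 1)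
    (fun n hn => (I.isZero_of_isStrictlyGE a n (by omega)).eq_of_tgt _ _) fun n _ =>
      extendsAt_of_exactAt (E := ModProj R A) Z rfl (hZ n) (modProj_opcycles hZ hZ' hb n)
        (hZ' (n + 1)) (modProj_opcycles hZ hZ' hb (n + 1)) (modProj_of_projective _ (hP n))
  exact (HomotopyCategory.eq_of_homotopy _ _ h).trans (CategoryTheory.Functor.map_zero _ _ _)

variable [HasDerivedCategory.{w} (ModuleCat.{u} A)]

/-- Complexes in `K^{+,b}(proj A)` are relatively injective with respect to bounded complexes
in `mod(A, R)`. -/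
lemma surjective_Qh_map_of_isPlusB {X I : CochainComplex (ModuleCat.{u} A) ℤ}
    (hX : boundedTermwise (ModFinProj R A) X) (hI : IsPlusB R I) :
    Function.Surjective (DerivedCategory.Qh.map :
      ((HomotopyCategory.quotient _ (ComplexShape.up ℤ)).obj X ⟶
        (HomotopyCategory.quotient _ _).obj I) → _) := by
  intro f
  -- Let `s : P ⟶ X` be a projective resolution. A morphism in the derived category is a morphism
  -- `P ⟶ I` up to homotopy. It extends along `s`, because the cone of `s` is a bounded above
  -- acyclic complex with terms projective over `R` and thus has no nonzero morphisms to `I`.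
  obtain ⟨P, hP, ⟨e⟩⟩ := exists_boundedAboveProjective.{w} (Y := X)
    ⟨fun _ => trivial, hX.2⟩
  have := hP.isKProjective
  let e' := (DerivedCategory.quotientCompQhIso _).app P ≪≫ e ≪≫
    ((DerivedCategory.quotientCompQhIso _).app X).symm
  have hbij (K) := CochainComplex.IsKProjective.Qh_map_bijective P K
  obtain ⟨s, hs⟩ := (hbij _).2 e'.hom
  obtain ⟨s, rfl⟩ := (HomotopyCategory.quotient _ _).map_surjective s
  have hs' : IsIso (DerivedCategory.Qh.map ((HomotopyCategory.quotient _ _).map s)) := by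
    rw [hs]
    infer_instance
  have H := HomotopyCategory.mappingCone_triangleh_distinguished s
  have hZ : (CochainComplex.mappingCone s).Acyclic := by
    have := (isIso₁_iff_isZero (map_distTriang DerivedCategory.Qh H)).1 hs'
    rw [isZero_Qh_iff] at this
    exact (HomotopyCategory.quotient_obj_mem_subcategoryAcyclic_iff_acyclic _).1 this
  have hZ' : ∀ n, ModProj R A ((CochainComplex.mappingCone s).X n) :=
    termwise_cone (ModProj R A) s (fun n => modProj_of_projective _ (hP.1 n)) fun n => (hX.1 n).1
  have hb : ∃ b, (CochainComplex.mappingCone s).IsStrictlyLE b := by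
    obtain ⟨-, b, _⟩ := hP
    obtain ⟨-, -, b', _⟩ := hX
    refine ⟨max b b' + 1, ?_⟩
    rw [CochainComplex.isStrictlyLE_iff]
    intro i hi
    rw [CochainComplex.mappingCone.isZero_X_iff]
    exact ⟨P.isZero_of_isStrictlyLE b _ (by omega), X.isZero_of_isStrictlyLE b' _ (by omega)⟩
  obtain ⟨b, hb⟩ := hb
  obtain ⟨g, hg⟩ := (hbij _).2 (DerivedCategory.Qh.map ((HomotopyCategory.quotient _ _).map s) ≫ f)
  obtain ⟨k, hk⟩ := (bijective_comp_of_cone H (eq_zero_of_acyclic_of_isPlusB hZ hZ' hb hI)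
    (eq_zero_of_acyclic_of_isPlusB hZ hZ' hb
      ((homotopyProp (IsPlusB R)).le_shift (1 : ℤ) _ hI))).2 g
  refine ⟨k, ?_⟩
  rw [← cancel_epi (DerivedCategory.Qh.map ((HomotopyCategory.quotient _ _).map s)), ← hg, ← hk]
  exact (CategoryTheory.Functor.map_comp _ _ _).symm

/-- A morphism in the derived category between bounded complexes in `mod(A, R)` is represented by
a fraction of morphisms of such complexes. -/
lemma exists_fraction {X Y : CochainComplex (ModuleCat.{u} A) ℤ}
    (hX : boundedTermwise (ModFinProj R A) X) (hY : boundedTermwise (ModFinProj R A) Y)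
    (f : DerivedCategory.Qh.obj ((HomotopyCategory.quotient _ _).obj X) ⟶
      DerivedCategory.Qh.obj ((HomotopyCategory.quotient _ _).obj Y)) :
    ∃ (T : CochainComplex (ModuleCat.{u} A) ℤ) (_ : boundedTermwise (ModFinProj R A) T)
      (a : X ⟶ T) (s : Y ⟶ T),
      IsIso (DerivedCategory.Qh.map ((HomotopyCategory.quotient _ _).map s)) ∧
        f ≫ DerivedCategory.Qh.map ((HomotopyCategory.quotient _ _).map s) =
          DerivedCategory.Qh.map ((HomotopyCategory.quotient _ _).map a) := by
  -- Both `X` and `Y` map to a resolution `I` of `Y`, and these maps factor through a truncation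
  -- of `I`, as `X` and `Y` are bounded.
  obtain ⟨I, hI, ⟨e⟩⟩ := exists_isPlusB.{w} hY
  let e' := (DerivedCategory.quotientCompQhIso _).app Y ≪≫ e.symm ≪≫
    ((DerivedCategory.quotientCompQhIso _).app I).symm
  obtain ⟨s, hs⟩ := surjective_Qh_map_of_isPlusB hY hI e'.hom
  obtain ⟨a, ha⟩ := surjective_Qh_map_of_isPlusB hX hI (f ≫ e'.hom)
  obtain ⟨s, rfl⟩ := (HomotopyCategory.quotient _ _).map_surjective s
  obtain ⟨a, rfl⟩ := (HomotopyCategory.quotient _ _).map_surjective a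
  obtain ⟨m, hm⟩ := hI.exists_truncLE
  obtain ⟨-, -, b, hb⟩ := hX
  obtain ⟨-, -, b', hb'⟩ := hY
  obtain ⟨hT, hT'⟩ := hm (max m (max b b')) (by omega)
  obtain ⟨s, rfl⟩ := exists_eq_comp_ιTruncLE (Y.isStrictlyLE_of_le b' (max m (max b b'))
    (by omega)) s
  obtain ⟨a, rfl⟩ := exists_eq_comp_ιTruncLE (X.isStrictlyLE_of_le b (max m (max b b'))
    (by omega)) a
  have hι : IsIso (DerivedCategory.Qh.map ((HomotopyCategory.quotient _ _).map
      (I.ιTruncLE (max m (max b b'))))) :=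
    (DerivedCategory.isIso_Q_map_iff_quasiIso _ _).2 hT'
  rw [CategoryTheory.Functor.map_comp, CategoryTheory.Functor.map_comp] at hs ha
  refine ⟨_, hT, a, s, ?_, ?_⟩
  · refine @IsIso.of_isIso_comp_right _ _ _ _ _ _ _ hι ?_
    rw [hs]
    infer_instance
  · rw [← cancel_mono (DerivedCategory.Qh.map ((HomotopyCategory.quotient _ _).map
      (I.ιTruncLE (max m (max b b'))))), ha, Category.assoc, hs]

/-- Fullness can be tested on the objects in the image of an essentially surjective functor. -/
lemma full_of_essSurj {C : Type u₁} [Category.{v₁} C] {D : Type u₂} [Category.{v₂} D]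
    {D' : Type u₃} [Category D'] {L : C ⥤ D} {F : D ⥤ D'} {G : C ⥤ D'} [L.EssSurj]
    (e : L ⋙ F ≅ G) (h : ∀ (X Y : C) (f : G.obj X ⟶ G.obj Y), ∃ g : L.obj X ⟶ L.obj Y,
      F.map g = e.hom.app X ≫ f ≫ e.inv.app Y) : F.Full where
  map_surjective {X Y} f := by
    obtain ⟨g, hg⟩ := h _ _ (e.inv.app (L.objPreimage X) ≫ F.map (L.objObjPreimageIso X).hom ≫ f ≫
      F.map (L.objObjPreimageIso Y).inv ≫ e.hom.app (L.objPreimage Y))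
    refine ⟨(L.objObjPreimageIso X).inv ≫ g ≫ (L.objObjPreimageIso Y).hom, ?_⟩
    simp only [Functor.map_comp, hg, Category.assoc, Iso.hom_inv_id_app_assoc,
      Iso.hom_inv_id_app]
    simp [← Functor.map_comp]

instance : (acyclicBounded (ModFinProj R A)).trW.Q.EssSurj :=
  Localization.essSurj _ (acyclicBounded (ModFinProj R A)).trW

instance : (Dbmod.toDerived.{w} R A).Full := by
  let e := Localization.Lifting.iso (acyclicBounded (ModFinProj R A)).trW.Q
    (acyclicBounded (ModFinProj R A)).trW ((KBounded (ModFinProj R A)).ι ⋙ DerivedCategory.Qh)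
    (DBounded.toDerived.{w} (ModFinProj R A))
  refine full_of_essSurj e fun X Y f => ?_
  obtain ⟨X, hX⟩ := X
  obtain ⟨Y, hY⟩ := Y
  obtain ⟨X, rfl⟩ := X.quotient_obj_surjective
  obtain ⟨Y, rfl⟩ := Y.quotient_obj_surjective
  obtain ⟨T, hT, a, s, hs, h⟩ := exists_fraction hX hY f
  let a' : (⟨_, hX⟩ : (KBounded (ModFinProj R A)).FullSubcategory) ⟶ ⟨_, hT⟩ :=
    ObjectProperty.homMk ((HomotopyCategory.quotient _ _).map a)
  let s' : (⟨_, hY⟩ : (KBounded (ModFinProj R A)).FullSubcategory) ⟶ ⟨_, hT⟩ :=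
    ObjectProperty.homMk ((HomotopyCategory.quotient _ _).map s)
  have hs' : (acyclicBounded (ModFinProj R A)).trW s' := by
    obtain ⟨Z, g, k, H⟩ := distinguished_cocone_triangle s'
    exact .mk _ H ((isZero_Qh_iff _).1 ((isIso₁_iff_isZero
      (map_distTriang ((KBounded (ModFinProj R A)).ι ⋙ DerivedCategory.Qh) H)).1 hs))
  have := Localization.inverts (acyclicBounded (ModFinProj R A)).trW.Q _ _ hs'
  refine ⟨(acyclicBounded (ModFinProj R A)).trW.Q.map a' ≫
    inv ((acyclicBounded (ModFinProj R A)).trW.Q.map s'), ?_⟩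
  rw [CategoryTheory.Functor.map_comp, CategoryTheory.Functor.map_inv, IsIso.comp_inv_eq,
    Category.assoc, Category.assoc]
  refine Eq.trans ?_ (congrArg (fun k => e.hom.app _ ≫ f ≫ k) (e.inv.naturality s'))
  refine ((Iso.eq_comp_inv (e.app _)).2 (e.hom.naturality a')).trans ?_
  rw [Category.assoc]
  refine congrArg (e.hom.app _ ≫ ·) ?_
  exact (congrArg (· ≫ e.inv.app _) h).symm.trans (Category.assoc _ _ _)

/-- An exact functor that inverts the morphisms with cone in `P` sends the objects of `P` to
zero. -/
lemma isZero_obj_of_prop {T : Type u₁} [Category.{v₁} T] [Preadditive T] [HasZeroObject T]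
    [HasShift T ℤ] [∀ n : ℤ, (shiftFunctor T n).Additive] [Pretriangulated T]
    {D : Type u₂} [Category.{v₂} D] [Preadditive D] [HasZeroObject D] [HasShift D ℤ]
    [∀ n : ℤ, (shiftFunctor D n).Additive] [Pretriangulated D] (P : ObjectProperty T)
    (F : T ⥤ D) [F.CommShift ℤ] [F.IsTriangulated] (hF : P.trW.IsInvertedBy F) {X : T} (hX : P X) :
    IsZero (F.obj X) :=
  (isIso₁_iff_isZero (map_distTriang F (contractible_distinguished₁ X))).1
    (hF _ (.mk _ (contractible_distinguished₁ X) hX))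

instance : (Dbmod.toDerived.{w} R A).Faithful :=
  faithful_of_isZero _ fun X hX => by
    let e := Localization.Lifting.iso (acyclicBounded (ModFinProj R A)).trW.Q
      (acyclicBounded (ModFinProj R A)).trW ((KBounded (ModFinProj R A)).ι ⋙ DerivedCategory.Qh)
      (DBounded.toDerived.{w} (ModFinProj R A))
    let x := (acyclicBounded (ModFinProj R A)).trW.Q.objObjPreimageIso X
    have h := (hX.of_iso ((Dbmod.toDerived.{w} R A).mapIso x)).of_iso (e.app _).symm
    exact (isZero_obj_of_prop (acyclicBounded (ModFinProj R A)) _ (Localization.inverts _ _)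
      ((isZero_Qh_iff _).1 h)).of_iso x.symm

end Derived

/-! ### The embedding of `D^b(mod(A, R))` -/

section Embedding

/-- The lift of a functor `G` through a fully faithful functor `F` whose essential image contains
the values of `G`. -/
def liftThrough {C : Type u₁} [Category.{v₁} C] {D : Type u₂} [Category.{v₂} D]
    {D' : Type u₃} [Category D'] (F : C ⥤ D) [F.Full] [F.Faithful] (G : D' ⥤ D)
    (h : ∀ X, F.essImage (G.obj X)) : D' ⥤ C :=
  F.essImage.lift G h ⋙ F.toEssImage.inv

/-- The defining property of the lift of a functor through a fully faithful functor. -/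
def liftThroughIso {C : Type u₁} [Category.{v₁} C] {D : Type u₂} [Category.{v₂} D]
    {D' : Type u₃} [Category D'] (F : C ⥤ D) [F.Full] [F.Faithful] (G : D' ⥤ D)
    (h : ∀ X, F.essImage (G.obj X)) : liftThrough F G h ⋙ F ≅ G :=
  Functor.isoWhiskerLeft (F.essImage.lift G h ⋙ F.toEssImage.inv) F.toEssImageCompι.symm ≪≫
    Functor.isoWhiskerLeft (F.essImage.lift G h)
      (Functor.isoWhiskerRight F.toEssImage.asEquivalence.counitIso F.essImage.ι)

variable {R A : Type u} [CommRing R] [Ring A] [Algebra R A] [IsFrobeniusAlgebra R A]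
  [HasDerivedCategory.{w} (ModuleCat.{u} A)]

variable (R A) in
/-- The projection from `K^b(mod(A, R))` to `D^b(mod(A, R))`, followed by the functor to the
derived category. -/
def toDerivedIso : (acyclicBounded (ModFinProj R A)).trW.Q ⋙ Dbmod.toDerived.{w} R A ≅
    (KBounded (ModFinProj R A)).ι ⋙ DerivedCategory.Qh :=
  Localization.Lifting.iso (acyclicBounded (ModFinProj R A)).trW.Q
    (acyclicBounded (ModFinProj R A)).trW ((KBounded (ModFinProj R A)).ι ⋙ DerivedCategory.Qh)
    (DBounded.toDerived.{w} (ModFinProj R A))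

lemma essImage_toDerived_iff (Y : DerivedCategory (ModuleCat.{u} A)) :
    (Dbmod.toDerived.{w} R A).essImage Y ↔ ∃ K, boundedTermwise (ModFinProj R A) K ∧
      Nonempty (DerivedCategory.Q.obj K ≅ Y) := by
  constructor
  · rintro ⟨X, ⟨e⟩⟩
    let x := (acyclicBounded (ModFinProj R A)).trW.Q.objObjPreimageIso X
    have e' := (toDerivedIso.{w} R A).symm.app _ ≪≫ (Dbmod.toDerived.{w} R A).mapIso x ≪≫ e
    generalize (acyclicBounded (ModFinProj R A)).trW.Q.objPreimage X = K at e'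
    obtain ⟨K, hK⟩ := K
    obtain ⟨K, rfl⟩ := K.quotient_obj_surjective
    exact ⟨K, hK, ⟨((DerivedCategory.quotientCompQhIso _).app K).symm ≪≫ e'⟩⟩
  · rintro ⟨K, hK, ⟨e⟩⟩
    let K' : (KBounded (ModFinProj R A)).FullSubcategory :=
      ⟨(HomotopyCategory.quotient _ _).obj K, hK⟩
    exact ⟨_, ⟨(toDerivedIso.{w} R A).app K' ≪≫ (DerivedCategory.quotientCompQhIso _).app K ≪≫ e⟩⟩

lemma exists_klfPlusB {Y : DerivedCategory (ModuleCat.{u} A)}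
    (hY : (Dbmod.toDerived.{w} R A).essImage Y) :
    ∃ X : KLF R A, klfPlusB R A X ∧ Nonempty ((canonicalFunctor.{w} R A).obj X ≅ Y) := by
  obtain ⟨K, hK, ⟨e⟩⟩ := (essImage_toDerived_iff Y).1 hY
  obtain ⟨I, hI, ⟨e'⟩⟩ := exists_isPlusB.{w} hK
  exact ⟨⟨KProj.mk I hI.termwise, hI.isKLF⟩, klfPlusB_of_kPlusB ((kPlusB_iff _).2 hI),
    ⟨(DerivedCategory.quotientCompQhIso _).app I ≪≫ e' ≪≫ e⟩⟩

lemma essImage_orthogonalToDerived (X : Dbmod R A) :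
    (orthogonalToDerived.{w} R A).essImage ((Dbmod.toDerived.{w} R A).obj X) := by
  obtain ⟨Y, hY, ⟨e⟩⟩ := exists_klfPlusB (Functor.obj_mem_essImage (Dbmod.toDerived.{w} R A) X)
  exact ⟨⟨Y, klfPlusB_le_rightOrthogonal _ hY⟩, ⟨e⟩⟩

variable (R A) in
/-- The lift of the canonical functor from `D^b(mod(A, R))` to the derived category to the objects
that are right orthogonal to the acyclic objects. -/
def dbmodToOrthogonal : Dbmod R A ⥤ (acyclicObjects R A).rightOrthogonal.FullSubcategory :=
  liftThrough (orthogonalToDerived.{w} R A) (Dbmod.toDerived.{w} R A) essImage_orthogonalToDerived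

variable (R A) in
/-- The lift followed by the functor to the derived category. -/
def dbmodToOrthogonalIso : dbmodToOrthogonal.{w} R A ⋙ orthogonalToDerived.{w} R A ≅
    Dbmod.toDerived.{w} R A :=
  liftThroughIso _ _ _

instance : (dbmodToOrthogonal.{w} R A).Full :=
  Functor.Full.of_comp_faithful_iso (dbmodToOrthogonalIso.{w} R A)

instance : (dbmodToOrthogonal.{w} R A).Faithful :=
  Functor.Faithful.of_comp_iso (dbmodToOrthogonalIso.{w} R A)

instance : (dbmodToOrthogonal.{w} R A).CommShift ℤ :=
  Functor.CommShift.ofComp (dbmodToOrthogonalIso.{w} R A) ℤ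

instance : NatTrans.CommShift (dbmodToOrthogonalIso.{w} R A).hom ℤ :=
  Functor.CommShift.ofComp_compatibility _ _

instance : (dbmodToOrthogonal.{w} R A).IsTriangulated :=
  (Functor.isTriangulated_iff_comp_right (dbmodToOrthogonalIso.{w} R A)).2 inferInstance

variable (R A) in
/-- The fully faithful functor from `D^b(mod(A, R))` to `K^lf(Proj A, R)` that identifies
`D^b(mod(A, R))` with the compact objects. -/
def dbmodToKLF : Dbmod R A ⥤ KLF R A :=
  dbmodToOrthogonal.{w} R A ⋙ (acyclicObjects R A).rightOrthogonal.ι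

instance : (dbmodToKLF.{w} R A).CommShift ℤ :=
  inferInstanceAs ((dbmodToOrthogonal.{w} R A ⋙
    (acyclicObjects R A).rightOrthogonal.ι).CommShift ℤ)

instance : (dbmodToKLF.{w} R A).IsTriangulated :=
  isTriangulated_comp (dbmodToOrthogonal.{w} R A) (acyclicObjects R A).rightOrthogonal.ι

instance : (dbmodToKLF.{w} R A).Full := Functor.Full.comp _ _

instance : (dbmodToKLF.{w} R A).Faithful := Functor.Faithful.comp _ _

variable (R A) in
/-- The functor `dbmodToKLF` followed by the functor to the derived category. -/
def dbmodToKLFIso : dbmodToKLF.{w} R A ⋙ canonicalFunctor.{w} R A ≅ Dbmod.toDerived.{w} R A :=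
  dbmodToOrthogonalIso R A

lemma isExactFunctor_dbmodToKLF : IsExactFunctor (dbmodToKLF.{w} R A) :=
  isExactFunctor_of_isTriangulated _

lemma essImage_dbmodToKLF_iff (X : KLF R A) : (dbmodToKLF.{w} R A).essImage X ↔
    (acyclicObjects R A).rightOrthogonal X ∧
      (Dbmod.toDerived.{w} R A).essImage ((canonicalFunctor.{w} R A).obj X) := by
  constructor
  · rintro ⟨Z, ⟨e⟩⟩
    exact ⟨ObjectProperty.prop_of_iso _ e ((dbmodToOrthogonal.{w} R A).obj Z).property,
      ⟨Z, ⟨((dbmodToKLFIso.{w} R A).app Z).symm ≪≫ (canonicalFunctor.{w} R A).mapIso e⟩⟩⟩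
  · rintro ⟨hX, Z, ⟨e⟩⟩
    let X' : (acyclicObjects R A).rightOrthogonal.FullSubcategory := ⟨X, hX⟩
    let e' : (orthogonalToDerived.{w} R A).obj ((dbmodToOrthogonal.{w} R A).obj Z) ≅
      (orthogonalToDerived.{w} R A).obj X' := (dbmodToOrthogonalIso.{w} R A).app Z ≪≫ e
    exact ⟨Z, ⟨(acyclicObjects R A).rightOrthogonal.ι.mapIso
      ((orthogonalToDerived.{w} R A).preimageIso e')⟩⟩

lemma klfPlusB_dbmodToKLF (Z : Dbmod R A) : klfPlusB R A ((dbmodToKLF.{w} R A).obj Z) := by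
  obtain ⟨Y, hY, ⟨e⟩⟩ := exists_klfPlusB (Functor.obj_mem_essImage (Dbmod.toDerived.{w} R A) Z)
  let Y' : (acyclicObjects R A).rightOrthogonal.FullSubcategory :=
    ⟨Y, klfPlusB_le_rightOrthogonal _ hY⟩
  let e' : (orthogonalToDerived.{w} R A).obj Y' ≅
    (orthogonalToDerived.{w} R A).obj ((dbmodToOrthogonal.{w} R A).obj Z) :=
      e ≪≫ ((dbmodToOrthogonalIso.{w} R A).app Z).symm
  exact ObjectProperty.prop_of_iso _ ((acyclicObjects R A).rightOrthogonal.ι.mapIso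
      ((orthogonalToDerived.{w} R A).preimageIso e')) hY

end Embedding

/-! ### Direct summands of complexes that become resolutions after adding a shift -/

section Summand

variable {C : Type u₁} [Category.{v₁} C] [Abelian C]

/-- If the identity of `K` is, up to homotopy, the sum of a morphism that factors through `L` and
one that factors through `L'`, where `L'` has no contribution in the degree `m`, then the cokernel
of the differential of `K` in this degree is a direct summand of that of `L`, up to a projective
object. -/
lemma exists_retract_opcycles {K L L' : CochainComplex C ℤ} (hK : ∀ n, Projective (K.X n))
    {a : K ⟶ L} {b : L ⟶ K} {a' : K ⟶ L'} {b' : L' ⟶ K} (h : Homotopy (a ≫ b + a' ≫ b') (𝟙 K))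
    {m : ℤ} (hL' : IsZero (L'.X m)) : ∃ (P : C) (_ : Projective P)
      (s : K.opcycles m ⟶ L.opcycles m ⊞ P) (t : L.opcycles m ⊞ P ⟶ K.opcycles m), s ≫ t = 𝟙 _ := by
  obtain ⟨P, hP, x, y, hxy⟩ := stablyEq_opcyclesMap hK h m
  have hz : IsZero (L'.opcycles m) := hL'.of_epi (L'.pOpcycles m)
  have h' : HomologicalComplex.opcyclesMap (a ≫ b + a' ≫ b') m =
      HomologicalComplex.opcyclesMap a m ≫ HomologicalComplex.opcyclesMap b m := by
    rw [← cancel_epi (K.pOpcycles m)]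
    have := hL'.eq_of_tgt (a'.f m) 0
    simp [this]
  refine ⟨P, hP, biprod.lift (HomologicalComplex.opcyclesMap a m) (-x),
    biprod.desc (HomologicalComplex.opcyclesMap b m) y, ?_⟩
  rw [biprod.lift_desc, Preadditive.neg_comp, ← hxy, h', HomologicalComplex.opcyclesMap_id]
  abel

variable [HasDerivedCategory.{w} C]

/-- If `K` is quasi-isomorphic to the sum of `Y` and a shift of `Y` that is concentrated in much
higher degrees, then `Y` is quasi-isomorphic to a truncation of `K`. -/
lemma exists_boundedTermwise_of_biprod_shift {E : ObjectProperty C} [IsAdditiveSubcategory E]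
    {K : CochainComplex C ℤ} (hK : ∀ n, E (K.X n)) {a : ℤ} (ha : K.IsStrictlyGE a)
    {Y : DerivedCategory C} {N m c : ℤ} (e : DerivedCategory.Q.obj K ≅ Y ⊞ Y⟦N⟧)
    (h₁ : ∀ i < c, IsZero ((DerivedCategory.homologyFunctor C i).obj Y))
    (h₂ : ∀ i ≥ m, IsZero ((DerivedCategory.homologyFunctor C i).obj Y)) (h : m + 1 + N < c)
    (hm : E (K.opcycles m)) :
    ∃ T, boundedTermwise E T ∧ Nonempty (DerivedCategory.Q.obj T ≅ Y) := by
  have h₃ (i : ℤ) (hi : i ≤ m + 1) :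
      IsZero ((DerivedCategory.homologyFunctor C i).obj (Y⟦N⟧)) :=
    (h₁ (N + i) (by omega)).of_iso
      (((DerivedCategory.homologyFunctor C 0).shiftIso N i (N + i) rfl).app Y)
  have h₄ (i : ℤ) (hi : i ≤ m + 1) : IsIso ((DerivedCategory.homologyFunctor C i).map
      (biprod.fst : Y ⊞ Y⟦N⟧ ⟶ Y)) := by
    refine ⟨(DerivedCategory.homologyFunctor C i).map biprod.inl, ?_, ?_⟩
    · rw [← CategoryTheory.Functor.map_comp, ← CategoryTheory.Functor.map_id, ← biprod.total,
        CategoryTheory.Functor.map_add, CategoryTheory.Functor.map_comp _ biprod.snd,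
        (h₃ i hi).eq_of_tgt ((DerivedCategory.homologyFunctor C i).map biprod.snd) 0, zero_comp,
        add_zero]
    · rw [← CategoryTheory.Functor.map_comp, biprod.inl_fst, CategoryTheory.Functor.map_id]
  have h₅ (i : ℤ) (hi : i = m ∨ i = m + 1) : K.ExactAt i := by
    have := h₄ i (by omega)
    rw [HomologicalComplex.exactAt_iff_isZero_homology]
    exact (h₂ i (by omega)).of_iso (((DerivedCategory.homologyFunctorFactors C i).app K).symm ≪≫
      (DerivedCategory.homologyFunctor C i).mapIso e ≪≫
        asIso ((DerivedCategory.homologyFunctor C i).map biprod.fst))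
  refine ⟨_, boundedTermwise_truncLE hK ha rfl (h₅ m (by omega)) (h₅ (m + 1) (by omega)) hm, ?_⟩
  let φ : DerivedCategory.Q.obj (K.truncLE (m + 1)) ⟶ Y :=
    DerivedCategory.Q.map (K.ιTruncLE (m + 1)) ≫ e.hom ≫ biprod.fst
  have : IsIso φ := by
    rw [DerivedCategory.isIso_iff]
    intro i
    rcases le_or_gt i (m + 1) with hi | hi
    · have := h₄ i hi
      have : IsIso ((DerivedCategory.homologyFunctor C i).map
          (DerivedCategory.Q.map (K.ιTruncLE (m + 1)))) := by
        have := K.quasiIsoAt_ιTruncLE (m + 1) i hi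
        rw [quasiIsoAt_iff_isIso_homologyMap] at this
        exact (NatIso.isIso_map_iff (DerivedCategory.homologyFunctorFactors C i) _).2 this
      simp only [φ, CategoryTheory.Functor.map_comp]
      infer_instance
    · refine ((DerivedCategory.isLE_iff _ (m + 1)).1 ?_ i hi).isIso (h₂ i (by omega)) _
      infer_instance
  exact ⟨asIso φ⟩

end Summand

/-! ### The compact objects of `K^lf(Proj A, R)` and of the derived category -/

section Compact

variable {R A : Type u} [CommRing R] [Ring A] [Algebra R A] [IsFrobeniusAlgebra R A]

/-- Let `K` be a complex of projective modules that represents `X ⊞ X⟦N⟧`, where `X` is a direct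
summand of `L`. In degrees where the shift of `L` vanishes, the cokernel of the differential of `K`
is a direct summand of that of `L`, up to a projective module. -/
lemma exists_retract_opcycles_of_biprod_shift {X : KLF R A}
    {K L : CochainComplex (ModuleCat.{u} A) ℤ} (hK : ∀ n, Projective (K.X n)) {N m c : ℤ}
    (e : (KLF.toHomotopy R A).obj (X ⊞ X⟦N⟧) ≅ (HomotopyCategory.quotient _ _).obj K)
    (a : (KLF.toHomotopy R A).obj X ⟶ (HomotopyCategory.quotient _ _).obj L)
    (b : (HomotopyCategory.quotient _ _).obj L ⟶ (KLF.toHomotopy R A).obj X) (hab : a ≫ b = 𝟙 _)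
    (hL : L.IsStrictlyGE c) (h : m + N < c) : ∃ (P : ModuleCat.{u} A) (_ : Projective P)
      (s : K.opcycles m ⟶ L.opcycles m ⊞ P) (t : L.opcycles m ⊞ P ⟶ K.opcycles m), s ≫ t = 𝟙 _ := by
  let x := ((KLF.toHomotopy R A).commShiftIso N).app X
  let y := ((HomotopyCategory.quotient (ModuleCat.{u} A) (ComplexShape.up ℤ)).commShiftIso N).app L
  obtain ⟨a₁, ha₁⟩ := (HomotopyCategory.quotient _ _).map_surjective
    (e.inv ≫ (KLF.toHomotopy R A).map biprod.fst ≫ a)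
  obtain ⟨b₁, hb₁⟩ := (HomotopyCategory.quotient _ _).map_surjective
    (b ≫ (KLF.toHomotopy R A).map biprod.inl ≫ e.hom)
  obtain ⟨a₂, ha₂⟩ := (HomotopyCategory.quotient _ _).map_surjective
    (e.inv ≫ (KLF.toHomotopy R A).map biprod.snd ≫ x.hom ≫ a⟦N⟧' ≫ y.inv)
  obtain ⟨b₂, hb₂⟩ := (HomotopyCategory.quotient _ _).map_surjective
    (y.hom ≫ b⟦N⟧' ≫ x.inv ≫ (KLF.toHomotopy R A).map biprod.inr ≫ e.hom)
  refine exists_retract_opcycles (L := L) (L' := L⟦N⟧) (a := a₁) (b := b₁) (a' := a₂) (b' := b₂) hK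
    (HomotopyCategory.homotopyOfEq _ _ ?_) (L.isZero_of_isStrictlyGE c (m + N) h)
  have hab' : (a⟦N⟧' : _) ≫ (b⟦N⟧' : _) = 𝟙 _ := by
    rw [← CategoryTheory.Functor.map_comp, hab, CategoryTheory.Functor.map_id]
  have h₁ : (KLF.toHomotopy R A).map (biprod.fst : X ⊞ X⟦N⟧ ⟶ X) ≫
      (KLF.toHomotopy R A).map biprod.inl +
      (KLF.toHomotopy R A).map (biprod.snd : X ⊞ X⟦N⟧ ⟶ _) ≫
      (KLF.toHomotopy R A).map biprod.inr = 𝟙 _ := by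
    rw [← CategoryTheory.Functor.map_comp, ← CategoryTheory.Functor.map_comp,
      ← CategoryTheory.Functor.map_add, biprod.total, CategoryTheory.Functor.map_id]
  rw [CategoryTheory.Functor.map_add, CategoryTheory.Functor.map_comp,
    CategoryTheory.Functor.map_comp, ha₁, hb₁, ha₂, hb₂, CategoryTheory.Functor.map_id]
  simp only [Category.assoc, Iso.inv_hom_id_assoc]
  rw [reassoc_of% hab, reassoc_of% hab', Iso.hom_inv_id_assoc, ← Preadditive.comp_add,
    ← Category.assoc, ← Category.assoc (_ : _ ⟶ _), ← Preadditive.add_comp, h₁, Category.id_comp,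
    Iso.inv_hom_id]

variable [HasDerivedCategory.{w} (ModuleCat.{u} A)]

variable (R A) in
/-- The objects of `K^lf(Proj A, R)` that are homotopy equivalent to bounded complexes of finitely
generated projective modules. -/
abbrev klfPerf : ObjectProperty (KLF R A) := (KbProj A).isoClosure.inverseImage (isKLF R A).ι

lemma klfPerf_le_klfPlusB : klfPerf R A ≤ klfPlusB R A := fun _ ⟨Y, hY, e⟩ =>
  ⟨Y, kbProj_le_kPlusB R Y hY, e⟩

lemma klfPlusB.isCompactObject {X : KLF R A} (hX : klfPlusB R A X) : IsCompactObject.{u} X := by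
  obtain ⟨Y, hY, ⟨e⟩⟩ := hX
  exact (hY.isCompactObject.of_iso e.symm).of_map (isKLF R A).ι

/-- An object that has the universal property of the image under the left adjoint is this image. -/
lemma isIso_counit_app {C : Type u₁} [Category.{v₁} C] {D : Type u₂} [Category.{v₂} D] {F : C ⥤ D}
    {G : D ⥤ C} (adj : F ⊣ G) {X : D}
    (hX : ∀ W, Function.Bijective (G.map : (X ⟶ W) → _)) : IsIso (adj.counit.app X) := by
  have h (W : D) : Function.Bijective fun k : X ⟶ W => adj.counit.app X ≫ k := by
    refine (Function.Bijective.of_comp_iff' (adj.homEquiv _ _).bijective _).1 ?_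
    convert hX W using 1
    ext k
    simp [Adjunction.homEquiv_unit]
  obtain ⟨k, hk⟩ := (h _).2 (𝟙 _)
  refine ⟨k, hk, (h _).1 ?_⟩
  dsimp at hk ⊢
  rw [reassoc_of% hk, Category.comp_id]

lemma bijective_canonicalFunctor_map_of_localising {X : KLF R A}
    (hX : Localising.{u} (KbProj A) X.obj) (W : KLF R A) :
    Function.Bijective ((canonicalFunctor.{w} R A).map : (X ⟶ W) → _) :=
  (bijective_Qh_map hX _).comp
    (Functor.FullyFaithful.ofFullyFaithful (KLF.toHomotopy R A)).homEquiv.bijective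

variable (R) in
lemma isPerfect_iff (Y : DerivedCategory (ModuleCat.{u} A)) : IsPerfect A Y ↔
    ∃ X : KLF R A, KbProj A X.obj ∧ Nonempty ((canonicalFunctor.{w} R A).obj X ≅ Y) := by
  constructor
  · rintro ⟨K, hK, ⟨e⟩⟩
    have hK' : KbProj A (KProj.mk K fun n => (hK.1 n).1) := hK
    exact ⟨⟨KProj.mk K fun n => (hK.1 n).1, .of _ (kbProj_le_kPlusB R _ hK')⟩, hK',
      ⟨(DerivedCategory.quotientCompQhIso _).app K ≪≫ e.symm⟩⟩
  · rintro ⟨⟨X, hX'⟩, hX, ⟨e⟩⟩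
    obtain ⟨K, hK, rfl⟩ := X.exists_eq_mk
    exact ⟨K, hX, ⟨e.symm ≪≫ (DerivedCategory.quotientCompQhIso _).app K⟩⟩

/-- The left adjoint `p` preserves compact objects, since its right adjoint preserves coproducts. -/
lemma isCompactObject_map {p : DerivedCategory (ModuleCat.{u} A) ⥤ KLF R A}
    (adj : p ⊣ canonicalFunctor.{w} R A) {Y : DerivedCategory (ModuleCat.{u} A)}
    (hY : IsCompactObject.{u} Y) :
    IsCompactObject.{u} (p.obj Y) :=
  have : p.Additive := adj.left_adjoint_additive
  hY.map_of_adjunction adj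

/-- The properties of a module that make it a member of `E` if it is an image of a finitely
generated projective module and a direct summand of the sum of an object of `E` and of a projective
module. -/
structure IsSummandClosed (E : ObjectProperty (ModuleCat.{u} A)) : Prop where
  of_isFGProj : IsFGProj A ≤ E
  of_retract {L M N P : ModuleCat.{u} A} (π : L ⟶ M) (s : M ⟶ N ⊞ P) (t : N ⊞ P ⟶ M) :
    Epi π → IsFGProj A L → E N → Projective P → s ≫ t = 𝟙 M → E M

lemma isSummandClosed_isFGProj : IsSummandClosed (IsFGProj A) where
  of_isFGProj _ h := h
  of_retract π s t hπ hL hN hP hst := by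
    have : Projective _ := (isProj_iff A _).1 hN.1
    have h := hL.2
    refine ⟨(isProj_iff A _).2 ({ i := s, r := t, retract := hst } : Retract _ _).projective, ?_⟩
    exact Module.Finite.of_surjective π.hom ((ModuleCat.epi_iff_surjective π).1 hπ)

lemma isSummandClosed_modFinProj : IsSummandClosed (ModFinProj R A) where
  of_isFGProj _ h := .of_isFGProj h
  of_retract π s t hπ hL hN hP hst := by
    refine ⟨ModProj.of_retract ?_ s t hst, ?_⟩
    · exact IsAdditiveSubcategory.biprod (E := ModProj R A) _ _ hN.1 (modProj_of_projective _ hP)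
    · have := (ModFinProj.of_isFGProj (R := R) hL).2
      exact Module.Finite.of_surjective (restrictHom (R := R) π)
        ((ModuleCat.epi_iff_surjective π).1 hπ)

/-- A compact object in the localising subcategory generated by a triangulated subcategory of
complexes in `K^{+,b}(proj A)` with syzygies in `E` is a direct summand of such a complex, and it is
quasi-isomorphic to a bounded complex in `E`. -/
lemma exists_boundedTermwise_of_isCompactObject {E : ObjectProperty (ModuleCat.{u} A)}
    [IsAdditiveSubcategory E] (hE : IsSummandClosed E) (S : ObjectProperty (KLF R A))
    [S.IsTriangulated] [S.IsClosedUnderIsomorphisms] (hS : S ≤ klfPlusB R A)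
    (hS' : ∀ X, S X → ∃ K, IsPlusB R K ∧ (∃ b : ℤ, ∀ n ≥ b, E (K.opcycles n)) ∧
      Nonempty ((KLF.toHomotopy R A).obj X ≅ (HomotopyCategory.quotient _ _).obj K))
    {X : KLF R A} (hX : Localising.{u} S X) (hX' : IsCompactObject.{u} X) :
    (acyclicObjects R A).rightOrthogonal X ∧ ∃ T, boundedTermwise E T ∧
      Nonempty (DerivedCategory.Q.obj T ≅ (canonicalFunctor.{w} R A).obj X) := by
  obtain ⟨C, hC, a, b, hab⟩ := exists_factor_of_isCompactObject S
    (fun X hX => klfPlusB.isCompactObject (hS X hX)) hX hX' (𝟙 X)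
  constructor
  · intro V f hV
    rw [← Category.comp_id f, hab, ← Category.assoc,
      klfPlusB_le_rightOrthogonal _ (hS C hC) (f ≫ a) hV, zero_comp]
  -- `X` is a direct summand of `C`, hence `X ⊞ X⟦N⟧` belongs to `S` for `N` arbitrarily far in the
  -- negative direction. Then `X` and `X⟦N⟧` have their cohomology in disjoint ranges, and
  -- truncating a complex `K` that represents the sum at a degree between these ranges yields `X`.
  obtain ⟨L, hL, ⟨m, hm⟩, ⟨e⟩⟩ := hS' C hC
  obtain ⟨c, hc⟩ := hL.exists_ge
  obtain ⟨m', hm'⟩ := hL.exists_exact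
  obtain ⟨N, hN, hN'⟩ := exists_biprod_shift_mem S hC a b hab.symm (max m m' - c + 2).toNat
  obtain ⟨K, hK, -, ⟨e'⟩⟩ := hS' _ hN'
  have hN'' : max m m' + 1 + N < c := by omega
  have hP (n : ℤ) : Projective (K.X n) := (isProj_iff A _).1 (hK.isFGProj n).1
  obtain ⟨P, hP', s, t, hst⟩ := exists_retract_opcycles_of_biprod_shift hP e'
    ((KLF.toHomotopy R A).map a ≫ e.hom) (e.inv ≫ (KLF.toHomotopy R A).map b)
    (by
      rw [Category.assoc, e.hom_inv_id_assoc, ← CategoryTheory.Functor.map_comp, ← hab,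
        CategoryTheory.Functor.map_id]) hc (show max m m' + N < c by omega)
  have hEm : E (K.opcycles (max m m')) :=
    hE.of_retract (K.pOpcycles _) s t inferInstance (hK.isFGProj _) (hm _ (by omega)) hP' hst
  obtain ⟨d, hd⟩ := hK.exists_ge
  have hr (i : ℤ) (h : L.ExactAt i) : IsZero ((DerivedCategory.homologyFunctor _ i).obj
      ((canonicalFunctor.{w} R A).obj X)) := by
    have h' : IsZero ((DerivedCategory.homologyFunctor _ i).obj
        ((canonicalFunctor.{w} R A).obj C)) :=
      h.isZero_homology.of_iso ((DerivedCategory.homologyFunctor _ i).mapIso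
        (DerivedCategory.Qh.mapIso e ≪≫ (DerivedCategory.quotientCompQhIso _).app L) ≪≫
          (DerivedCategory.homologyFunctorFactors _ i).app L)
    rw [IsZero.iff_id_eq_zero] at h' ⊢
    rw [← CategoryTheory.Functor.map_id, ← CategoryTheory.Functor.map_id, hab,
      CategoryTheory.Functor.map_comp, CategoryTheory.Functor.map_comp, ← Category.id_comp
        ((DerivedCategory.homologyFunctor _ i).map ((canonicalFunctor.{w} R A).map b)), h',
      zero_comp, comp_zero]
  have := preservesBinaryBiproducts_of_preservesBiproducts (canonicalFunctor.{w} R A)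
  exact exists_boundedTermwise_of_biprod_shift (fun n => hE.of_isFGProj _ (hK.isFGProj n)) hd
    (((DerivedCategory.quotientCompQhIso _).app K).symm ≪≫ DerivedCategory.Qh.mapIso e'.symm ≪≫
      (canonicalFunctor.{w} R A).mapBiprod X (X⟦N⟧) ≪≫
        biprod.mapIso (Iso.refl _) (((canonicalFunctor.{w} R A).commShiftIso N).app X))
    (fun i hi => hr i (.of_isZero (L.isZero_of_isStrictlyGE c i hi)))
    (fun i hi => hr i (hm' i (by omega)).1) hN'' hEm

lemma Localising.mono {T : Type u₁} [Category.{v₁} T] [Preadditive T] [HasZeroObject T]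
    [HasShift T ℤ] [∀ n : ℤ, (shiftFunctor T n).Additive] [Pretriangulated T]
    {S S' : ObjectProperty T} (h : S ≤ S') : Localising.{u} S ≤ Localising.{u} S' := by
  intro X hX
  induction hX with
  | of X hX => exact .of X (h X hX)
  | zero X hX => exact .zero X hX
  | shift X n _ ih => exact .shift X n ih
  | ext₂ D hD _ _ h₁ h₃ => exact .ext₂ D hD h₁ h₃
  | coprod J Y c hc _ ih => exact .coprod J Y c hc ih

/-- A compact object in the localising subcategory generated by the bounded complexes of finitely
generated projective modules is sent to a perfect complex. -/
lemma isPerfect_of_isCompactObject {X : KLF R A} (hX : Localising.{u} (KbProj A) X.obj)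
    (hX' : IsCompactObject.{u} X) : IsPerfect A ((canonicalFunctor.{w} R A).obj X) := by
  have h : Localising.{u} (klfPerf R A) X :=
    Localising.mono (fun Y h => ObjectProperty.le_isoClosure (KbProj A) Y.obj h) _
      (localising_inverseImage (fun Y hY => .of Y (kbProj_le_kPlusB R Y hY)) X hX)
  obtain ⟨-, T, hT, ⟨e⟩⟩ := exists_boundedTermwise_of_isCompactObject.{w} (E := IsFGProj A)
    isSummandClosed_isFGProj (klfPerf R A) klfPerf_le_klfPlusB (fun Y hY => by
      obtain ⟨Z, hZ, ⟨e⟩⟩ := hY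
      obtain ⟨K, hK, rfl⟩ := Z.exists_eq_mk
      refine ⟨K, (kPlusB_iff _).1 (kbProj_le_kPlusB R _ hZ), ?_, ⟨(KTerm (IsProj A)).ι.mapIso e⟩⟩
      obtain ⟨-, -, b, hb⟩ := hZ
      have hb : K.IsStrictlyLE b := hb
      refine ⟨b + 1, fun n hn => IsAdditiveSubcategory.of_isZero _ ?_⟩
      exact (K.isZero_of_isStrictlyLE b n (by omega)).of_epi (K.pOpcycles n)) h hX'
  exact ⟨T, hT, ⟨e.symm⟩⟩

/-- The compact objects of the derived category are the perfect complexes. -/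
lemma isCompactObject_iff_isPerfect (R : Type u) [CommRing R] [Algebra R A]
    [IsFrobeniusAlgebra R A] (Y : DerivedCategory (ModuleCat.{u} A)) :
    IsCompactObject.{u} Y ↔ IsPerfect A Y := by
  let adj := Adjunction.ofIsRightAdjoint (canonicalFunctor.{w} R A)
  have : (canonicalFunctor.{w} R A).leftAdjoint.Additive := adj.left_adjoint_additive
  have hc {X : KLF R A} (hX : Localising.{u} (KbProj A) X.obj) :
      IsIso (adj.counit.app X) :=
    isIso_counit_app adj (bijective_canonicalFunctor_map_of_localising hX)
  constructor
  · intro hY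
    obtain ⟨X, hX, ⟨e⟩⟩ := exists_localising_iso.{w} Y
    let X' : KLF R A := ⟨X, isKLF_of_localising hX⟩
    have hX' : IsIso (adj.counit.app X') := hc hX
    exact (IsPerfect A).prop_of_iso e.symm (isPerfect_of_isCompactObject (X := X') hX
      (((hY.of_iso e).map_of_adjunction adj).of_iso (@asIso _ _ _ _ _ hX')))
  · intro hY
    obtain ⟨X, hX, ⟨e⟩⟩ := (isPerfect_iff R Y).1 hY
    have := hc (.of _ hX)
    obtain ⟨h⟩ := fullyFaithful_leftAdjoint.{w} (R := R) (A := A)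
    have := h.full
    have := h.faithful
    refine IsCompactObject.of_iso (.of_map (canonicalFunctor.{w} R A).leftAdjoint ?_) e
    exact (klfPlusB_of_kPlusB (kbProj_le_kPlusB R _ hX)).isCompactObject.of_iso
      (asIso (adj.counit.app X)).symm

/-- The compact objects of `K^lf(Proj A, R)` are the images of the bounded complexes in
`mod(A, R)`. -/
lemma isCompactObject_iff_essImage (X : KLF R A) :
    IsCompactObject.{u} X ↔ (dbmodToKLF.{w} R A).essImage X := by
  constructor
  · intro hX
    have h : Localising.{u} (klfPlusB R A) X :=
      Localising.mono (fun _ h => klfPlusB_of_kPlusB h) _ (localising_kPlusB X)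
    rw [essImage_dbmodToKLF_iff, essImage_toDerived_iff]
    refine exists_boundedTermwise_of_isCompactObject isSummandClosed_modFinProj (klfPlusB R A)
      le_rfl (fun Y hY => ?_) h hX
    obtain ⟨K, hK, e⟩ := hY.exists_iso
    obtain ⟨b, -, hb⟩ := hK.exists_isExactAbove
    exact ⟨K, hK, ⟨b, hb⟩, e⟩
  · rintro ⟨Z, ⟨e⟩⟩
    exact (klfPlusB.isCompactObject (klfPlusB_dbmodToKLF Z)).of_iso e

end Compact

/-! ### The stable category of finitely generated modules -/

section StableInclusion

section

variable {C : Type u₁} [Category.{v₁} C] [Abelian C] {E E' : ObjectProperty C}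
  [IsAdditiveSubcategory E] [IsAdditiveSubcategory E'] [IsFrobeniusSubcategory E]
  [IsFrobeniusSubcategory E']

lemma exists_resolutionComparison (h : E ≤ E') (X : E.FullSubcategory) :
    ∃ φ : completeResolution E' ⟨X.obj, h _ X.property⟩ ⟶ completeResolution E X,
      HomologicalComplex.opcyclesMap φ 0 ≫ (completeResolutionIso E X).hom =
        (completeResolutionIso E' ⟨X.obj, h _ X.property⟩).hom := by
  obtain ⟨φ, hφ⟩ := exists_resolutionMap
    (isTotallyAcyclic_completeResolution E' ⟨X.obj, h _ X.property⟩)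
    ((isTotallyAcyclic_completeResolution E X).of_le h)
    (completeResolutionIso E' ⟨X.obj, h _ X.property⟩).hom (completeResolutionIso E X) (𝟙 X.obj)
  exact ⟨φ, hφ.trans (Category.comp_id _)⟩

/-- A chain map between the complete resolutions of an object with respect to two Frobenius
subcategories. -/
def resolutionComparison (h : E ≤ E') (X : E.FullSubcategory) :
    completeResolution E' ⟨X.obj, h _ X.property⟩ ⟶ completeResolution E X :=
  (exists_resolutionComparison h X).choose

lemma resolutionComparison_spec (h : E ≤ E') (X : E.FullSubcategory) :
    HomologicalComplex.opcyclesMap (resolutionComparison h X) 0 ≫ (completeResolutionIso E X).hom =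
      (completeResolutionIso E' ⟨X.obj, h _ X.property⟩).hom :=
  (exists_resolutionComparison h X).choose_spec

lemma isIso_quotient_map_resolutionComparison (h : E ≤ E') (X : E.FullSubcategory) :
    IsIso ((HomotopyCategory.quotient C (ComplexShape.up ℤ)).map (resolutionComparison h X)) := by
  let e := completeResolutionIso E' ⟨X.obj, h _ X.property⟩ ≪≫ (completeResolutionIso E X).symm
  have he : HomologicalComplex.opcyclesMap (resolutionComparison h X) 0 = e.hom :=
    (Iso.eq_comp_inv _).2 (resolutionComparison_spec h X)
  exact isIso_quotient_map (isTotallyAcyclic_completeResolution E' _)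
    ((isTotallyAcyclic_completeResolution E X).of_le h) _ 0 e.inv (he ▸ .of_iso e)

lemma resolutionComparison_naturality (h : E ≤ E') {X Y : E.FullSubcategory} (f : X ⟶ Y) :
    (HomotopyCategory.quotient C (ComplexShape.up ℤ)).map
      (resolutionMap ((ObjectProperty.ιOfLE h).map f)) ≫
        (HomotopyCategory.quotient C (ComplexShape.up ℤ)).map (resolutionComparison h Y) =
    (HomotopyCategory.quotient C (ComplexShape.up ℤ)).map (resolutionComparison h X) ≫
      (HomotopyCategory.quotient C (ComplexShape.up ℤ)).map (resolutionMap f) := by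
  rw [← CategoryTheory.Functor.map_comp, ← CategoryTheory.Functor.map_comp]
  refine quotient_map_eq_of_iso (isTotallyAcyclic_completeResolution E' _)
    ((isTotallyAcyclic_completeResolution E Y).of_le h) (completeResolutionIso E Y) (.of_eq ?_)
  rw [HomologicalComplex.opcyclesMap_comp, HomologicalComplex.opcyclesMap_comp, Category.assoc,
    Category.assoc, resolutionMap_spec, reassoc_of% (resolutionComparison_spec h X)]
  exact (congrArg (_ ≫ ·) (resolutionComparison_spec h Y)).trans
    (resolutionMap_spec ((ObjectProperty.ιOfLE h).map f))

/-- A complete resolution in `E` is also a complete resolution in each larger Frobenius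
subcategory. -/
def stableInclusionCompResolutionFunctorIso (h : E ≤ E') :
    stableInclusion h ⋙ resolutionFunctor E' ≅ resolutionFunctor E :=
  NatIso.ofComponents (fun X => @asIso _ _ _ _
    ((HomotopyCategory.quotient C (ComplexShape.up ℤ)).map (resolutionComparison h X.as))
      (isIso_quotient_map_resolutionComparison h X.as)) fun {X Y} f => by
        obtain ⟨f, rfl⟩ := (toStable E).map_surjective f
        exact resolutionComparison_naturality h f

instance (h : E ≤ E') : (stableInclusion h).Full :=
  have : (stableInclusion h ⋙ resolutionFunctor E').Full :=
    .of_iso (stableInclusionCompResolutionFunctorIso h).symm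
  .of_comp_faithful _ (resolutionFunctor E')

instance (h : E ≤ E') : (stableInclusion h).Faithful :=
  .of_comp_iso (stableInclusionCompResolutionFunctorIso h)

lemma isExactFunctor_stableInclusion_comp [E.IsClosedUnderExtensions]
    [E'.IsClosedUnderExtensions] (h : E ≤ E') :
    IsExactFunctor (stableInclusion h ⋙ resolutionFunctor E') :=
  (isExactFunctor_resolutionFunctor E).of_iso (stableInclusionCompResolutionFunctorIso h).symm

end

variable (R A : Type u) [CommRing R] [Ring A] [Algebra R A] [IsFrobeniusAlgebra R A]

/-- The functor that sends an object of `stmod(A, R)` to its complete resolution,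
as an acyclic complex in `K^lf(Proj A, R)`. -/
def stmodResolution : Stmod R A ⥤ (acyclicObjects R A).FullSubcategory :=
  stableInclusion modFinProj_le_modLF ⋙ resolutionKLF R A

instance : (stmodResolution R A).Full := Functor.Full.comp _ _

instance : (stmodResolution R A).Faithful := Functor.Faithful.comp _ _

lemma isExactFunctor_stmodResolution_comp :
    IsExactFunctor (stmodResolution R A ⋙ (acyclicObjects R A).ι) :=
  IsExactFunctor.of_comp (F := KLF.toHomotopy R A) (isExactFunctor_of_isTriangulated _)
    (isExactFunctor_stableInclusion_comp (E := ModFinProj R A) modFinProj_le_modLF)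

variable {R A}

lemma essImage_stmodResolution_iff (W : (acyclicObjects R A).FullSubcategory) :
    (stmodResolution R A).essImage W ↔ ∃ S, IsTotallyAcyclic (ModFinProj R A) S ∧
      Nonempty ((KLF.toHomotopy R A).obj W.obj ≅ (HomotopyCategory.quotient _ _).obj S) := by
  constructor
  · rintro ⟨X, ⟨e⟩⟩
    exact ⟨_, isTotallyAcyclic_completeResolution _ X.as, ⟨(KLF.toHomotopy R A).mapIso
      ((acyclicObjects R A).ι.mapIso e.symm) ≪≫
        (stableInclusionCompResolutionFunctorIso modFinProj_le_modLF).app X⟩⟩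
  · rintro ⟨S, hS, ⟨e⟩⟩
    obtain ⟨X, ⟨e'⟩⟩ := essImage_resolutionFunctor hS
    have e₀ : (KLF.toHomotopy R A).obj ((stmodResolution R A).obj X).obj ≅
        (KLF.toHomotopy R A).obj W.obj :=
      (stableInclusionCompResolutionFunctorIso modFinProj_le_modLF).app X ≪≫ e' ≪≫ e.symm
    exact ⟨X, ⟨ObjectProperty.isoMk _ ((KLF.toHomotopy R A).preimageIso e₀)⟩⟩

end StableInclusion

/-! ### The Verdier quotient by the perfect complexes -/

section Quotient

variable {R A : Type u} [CommRing R] [Ring A] [Algebra R A] [IsFrobeniusAlgebra R A]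
  [HasDerivedCategory.{w} (ModuleCat.{u} A)]

lemma nonempty_iso_of_rightOrthogonal {X Y : KLF R A} (hX : (acyclicObjects R A).rightOrthogonal X)
    (hY : (acyclicObjects R A).rightOrthogonal Y)
    (e : (canonicalFunctor.{w} R A).obj X ≅ (canonicalFunctor.{w} R A).obj Y) :
    Nonempty (X ≅ Y) := by
  let X' : (acyclicObjects R A).rightOrthogonal.FullSubcategory := ⟨X, hX⟩
  let Y' : (acyclicObjects R A).rightOrthogonal.FullSubcategory := ⟨Y, hY⟩
  let e' : (orthogonalToDerived.{w} R A).obj X' ≅ (orthogonalToDerived.{w} R A).obj Y' := e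
  exact ⟨(acyclicObjects R A).rightOrthogonal.ι.mapIso
    ((orthogonalToDerived.{w} R A).preimageIso e')⟩

lemma perfDbmod_iff (Z : Dbmod R A) :
    perfDbmod.{w} R A Z ↔ klfPerf R A ((dbmodToKLF.{w} R A).obj Z) := by
  let e := (dbmodToKLFIso.{w} R A).app Z
  constructor
  · intro hZ
    obtain ⟨X, hX, ⟨e'⟩⟩ := (isPerfect_iff.{w} R _).1 hZ
    obtain ⟨e''⟩ := nonempty_iso_of_rightOrthogonal.{w} (klfPlusB_le_rightOrthogonal _
      (klfPlusB_of_kPlusB (kbProj_le_kPlusB R _ hX)))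
        (klfPlusB_le_rightOrthogonal _ (klfPlusB_dbmodToKLF Z)) (e' ≪≫ e.symm)
    exact (klfPerf R A).prop_of_iso e'' (ObjectProperty.le_isoClosure _ _ hX)
  · rintro ⟨X, hX, ⟨e'⟩⟩
    let X' : KLF R A := ⟨X, .of _ (kbProj_le_kPlusB R _ hX)⟩
    let i : (dbmodToKLF.{w} R A).obj Z ≅ X' := ObjectProperty.isoMk _ e'
    exact (isPerfect_iff.{w} R _).2 ⟨X', hX, ⟨(canonicalFunctor.{w} R A).mapIso i.symm ≪≫ e⟩⟩

lemma localising_of_klfPerf {X : KLF R A} (hX : klfPerf R A X) :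
    Localising.{u} (KbProj A) X.obj := by
  obtain ⟨Y, hY, ⟨e⟩⟩ := hX
  exact ObjectProperty.prop_of_iso _ e.symm (.of _ hY)

/-- On the perfect complexes, the embedding of `D^b(mod(A, R))` agrees with every left adjoint of
the functor to the derived category. -/
def perfDbmodIso {p : DerivedCategory (ModuleCat.{u} A) ⥤ KLF R A}
    (adj : p ⊣ canonicalFunctor.{w} R A) :
    (perfDbmod.{w} R A).ι ⋙ dbmodToKLF.{w} R A ≅
      (perfDbmod.{w} R A).ι ⋙ Dbmod.toDerived.{w} R A ⋙ p :=
  let α : ((perfDbmod.{w} R A).ι ⋙ dbmodToKLF.{w} R A) ⋙ canonicalFunctor.{w} R A ⋙ p ⟶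
      (perfDbmod.{w} R A).ι ⋙ dbmodToKLF.{w} R A :=
    Functor.whiskerLeft ((perfDbmod.{w} R A).ι ⋙ dbmodToKLF.{w} R A) adj.counit
  have : IsIso α := by
    have h (Z) : IsIso (α.app Z) :=
      isIso_counit_app adj (bijective_canonicalFunctor_map_of_localising
        (localising_of_klfPerf ((perfDbmod_iff.{w} _).1 Z.property)))
    exact NatIso.isIso_of_isIso_app α
  (asIso α).symm ≪≫
    Functor.isoWhiskerLeft (perfDbmod.{w} R A).ι (Functor.isoWhiskerRight (dbmodToKLFIso.{w} R A) p)

lemma isZero_acyclicPart {X : KLF R A} (hX : Localising.{u} (KbProj A) X.obj) :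
    IsZero ((acyclicPart R A).obj X) := by
  rw [IsZero.iff_id_eq_zero]
  refine ((acyclicPartAdj R A).homEquiv X _).injective ?_
  exact (eq_zero_of_localising hX ((acyclicPart R A).obj X).property _).trans
    (eq_zero_of_localising hX ((acyclicPart R A).obj X).property _).symm

lemma isZero_acyclicPart_iff (X : KLF R A) :
    IsZero ((acyclicPart R A).obj X) ↔ Localising.{u} (KbProj A) X.obj := by
  refine ⟨fun h => ?_, isZero_acyclicPart⟩
  obtain ⟨P, V, ε, g, k, H, hP, hV⟩ := exists_triangle_acyclic X
  obtain ⟨e, -⟩ := exists_acyclicPart_iso H hP hV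
  have : IsIso ε := (isIso₁_iff_isZero H).2
    (((acyclicObjects R A).ι.map_isZero h).of_iso e)
  exact ObjectProperty.prop_of_iso _ ((isKLF R A).ι.mapIso (asIso ε)) hP

variable (R A) in
/-- The embedding of `D^b(mod(A, R))` followed by the acyclic part. -/
def dbmodToAcyclic : Dbmod R A ⥤ (acyclicObjects R A).FullSubcategory :=
  dbmodToKLF.{w} R A ⋙ acyclicPart R A

instance : (dbmodToAcyclic.{w} R A).CommShift ℤ :=
  inferInstanceAs ((dbmodToKLF.{w} R A ⋙ acyclicPart R A).CommShift ℤ)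

instance : (dbmodToAcyclic.{w} R A).IsTriangulated :=
  isTriangulated_comp (dbmodToKLF.{w} R A) (acyclicPart R A)

lemma isZero_dbmodToAcyclic_iff (X : Dbmod R A) :
    IsZero ((dbmodToAcyclic.{w} R A).obj X) ↔ perfDbmod.{w} R A X := by
  refine (isZero_acyclicPart_iff _).trans ⟨fun h => ?_, fun h =>
    localising_of_klfPerf ((perfDbmod_iff X).1 h)⟩
  exact (IsPerfect A).prop_of_iso ((dbmodToKLFIso.{w} R A).app X)
    (isPerfect_of_isCompactObject h ((isCompactObject_iff_essImage _).2
      (Functor.obj_mem_essImage _ X)))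

lemma isInvertedBy_dbmodToAcyclic :
    (perfDbmod.{w} R A).trW.IsInvertedBy (dbmodToAcyclic.{w} R A) := by
  rintro X Y f ⟨Z, g, h, H, hZ⟩
  exact (isIso₁_iff_isZero (map_distTriang (dbmodToAcyclic.{w} R A) H)).2
    ((isZero_dbmodToAcyclic_iff Z).2 hZ)

variable (R A) in
/-- The functor from the Verdier quotient to the acyclic complexes that is induced by the acyclic
part. -/
def quotientToAcyclic : DbmodModPerf.{w} R A ⥤ (acyclicObjects R A).FullSubcategory :=
  Localization.lift (dbmodToAcyclic.{w} R A) isInvertedBy_dbmodToAcyclic (perfDbmod.{w} R A).trW.Q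

instance : Localization.Lifting (perfDbmod.{w} R A).trW.Q (perfDbmod.{w} R A).trW
    (dbmodToAcyclic.{w} R A) (quotientToAcyclic.{w} R A) :=
  inferInstanceAs (Localization.Lifting _ _ _ (Localization.lift _ isInvertedBy_dbmodToAcyclic _))

instance : (quotientToAcyclic.{w} R A).CommShift ℤ :=
  Functor.commShiftOfLocalization (perfDbmod.{w} R A).trW.Q (perfDbmod.{w} R A).trW ℤ
    (dbmodToAcyclic.{w} R A) _

variable (R A) in
/-- The defining property of the functor on the Verdier quotient. -/
def quotientToAcyclicIso :
    (perfDbmod.{w} R A).trW.Q ⋙ quotientToAcyclic.{w} R A ≅ dbmodToAcyclic.{w} R A :=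
  Localization.Lifting.iso (perfDbmod.{w} R A).trW.Q (perfDbmod.{w} R A).trW
    (dbmodToAcyclic.{w} R A) (quotientToAcyclic.{w} R A)

instance : NatTrans.CommShift (quotientToAcyclicIso.{w} R A).hom ℤ :=
  NatTrans.commShift_iso_hom_of_localization ..

set_option synthInstance.maxSize 1000 in
instance : (quotientToAcyclic.{w} R A).IsTriangulated :=
  have : (perfDbmod.{w} R A).trW.Q.mapArrow.EssSurj :=
    Localization.essSurj_mapArrow _ (perfDbmod.{w} R A).trW
  Functor.isTriangulated_of_precomp_iso (quotientToAcyclicIso.{w} R A)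

end Quotient

/-! ### The equivalence with `stmod(A, R)` -/

section Equivalence

variable {R A : Type u} [CommRing R] [Ring A] [Algebra R A] [IsFrobeniusAlgebra R A]
  [HasDerivedCategory.{w} (ModuleCat.{u} A)]

/-- A morphism from a compact object to an object of the localising subcategory generated by
`K^b(proj A)` factors through an object of `K^b(proj A)`. -/
lemma exists_perfDbmod_factor {X : Dbmod R A} {Y : KLF R A} (hY : Localising.{u} (KbProj A) Y.obj)
    (f : (dbmodToKLF.{w} R A).obj X ⟶ Y) : ∃ (Z : Dbmod R A) (_ : perfDbmod.{w} R A Z) (a : X ⟶ Z)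
      (b : (dbmodToKLF.{w} R A).obj Z ⟶ Y), f = (dbmodToKLF.{w} R A).map a ≫ b := by
  have h : Localising.{u} (klfPerf R A) Y :=
    Localising.mono (fun Y h => ObjectProperty.le_isoClosure (KbProj A) Y.obj h) _
      (localising_inverseImage (fun Y hY => .of Y (kbProj_le_kPlusB R Y hY)) Y hY)
  obtain ⟨C, hC, a, b, rfl⟩ := exists_factor_of_isCompactObject (klfPerf R A)
    (fun Z hZ => (klfPerf_le_klfPlusB Z hZ).isCompactObject) h
    ((isCompactObject_iff_essImage _).2 (Functor.obj_mem_essImage _ X)) f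
  obtain ⟨Z, ⟨e⟩⟩ := (isCompactObject_iff_essImage.{w} C).1
    (klfPerf_le_klfPlusB C hC).isCompactObject
  obtain ⟨a', ha'⟩ := (dbmodToKLF.{w} R A).map_surjective (a ≫ e.inv)
  exact ⟨Z, (perfDbmod_iff Z).2 ((klfPerf R A).prop_of_iso e.symm hC), a', e.hom ≫ b, by simp [ha']⟩

lemma acyclicPart_hom_ext {X : KLF R A} {W : (acyclicObjects R A).FullSubcategory}
    {a b : (acyclicPart R A).obj X ⟶ W}
    (h : (acyclicPartAdj R A).unit.app X ≫ (acyclicObjects R A).ι.map a =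
      (acyclicPartAdj R A).unit.app X ≫ (acyclicObjects R A).ι.map b) : a = b :=
  ((acyclicPartAdj R A).homEquiv _ _).injective (by
    rwa [Adjunction.homEquiv_unit, Adjunction.homEquiv_unit])

/-- A morphism between acyclic parts becomes the acyclic part of a morphism after composition with
a morphism whose cone is perfect. -/
lemma exists_dbmodToAcyclic_fraction {X Y : Dbmod R A}
    (f : (dbmodToAcyclic.{w} R A).obj X ⟶ (dbmodToAcyclic.{w} R A).obj Y) :
    ∃ (T : Dbmod R A) (s : T ⟶ X) (_ : (perfDbmod.{w} R A).trW s) (g : T ⟶ Y),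
      (dbmodToAcyclic.{w} R A).map s ≫ f = (dbmodToAcyclic.{w} R A).map g := by
  -- In the triangle `P ⟶ κ Y ⟶ V ⟶ P⟦1⟧`, the object `V` is the acyclic part of `κ Y`, and `f`
  -- corresponds to a morphism `κ X ⟶ V`. Its composite with `V ⟶ P⟦1⟧` factors through a perfect
  -- complex `Z`, as `κ X` is compact. On the fibre `T` of `X ⟶ Z`, it lifts to a morphism to `κ Y`.
  obtain ⟨P, V, ε, g, h, H, hP, hV⟩ := exists_triangle_acyclic ((dbmodToKLF.{w} R A).obj Y)
  obtain ⟨e, he⟩ := exists_acyclicPart_iso H hP hV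
  let η := (acyclicPartAdj R A).unit
  let f' : (dbmodToKLF.{w} R A).obj X ⟶ V :=
    (η.app _ ≫ (acyclicObjects R A).ι.map f) ≫ e.inv
  obtain ⟨Z, hZ, a, b, hab⟩ := exists_perfDbmod_factor (hP.klf_shift 1) (f' ≫ h)
  obtain ⟨T, s, k, hT⟩ := distinguished_cocone_triangle₁ a
  obtain ⟨c, hc⟩ := exists_lift₃ H ((dbmodToKLF.{w} R A).map s ≫ f') (by
    rw [Category.assoc, hab, ← Category.assoc, ← CategoryTheory.Functor.map_comp,
      distTriang_comp₁₂ hT, CategoryTheory.Functor.map_zero, zero_comp])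
  obtain ⟨c, rfl⟩ := (dbmodToKLF.{w} R A).map_surjective c
  refine ⟨T, s, .mk _ hT hZ, c, acyclicPart_hom_ext (X := (dbmodToKLF.{w} R A).obj T) ?_⟩
  have h₁ : η.app _ ≫ (acyclicObjects R A).ι.map ((dbmodToAcyclic.{w} R A).map s) =
    (dbmodToKLF.{w} R A).map s ≫ η.app _ := (η.naturality ((dbmodToKLF.{w} R A).map s)).symm
  have h₂ : η.app _ ≫ (acyclicObjects R A).ι.map ((dbmodToAcyclic.{w} R A).map c) =
    (dbmodToKLF.{w} R A).map c ≫ η.app _ := (η.naturality ((dbmodToKLF.{w} R A).map c)).symm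
  refine Eq.trans ?_ h₂.symm
  refine (congrArg (_ ≫ ·) ((acyclicObjects R A).ι.map_comp _ _)).trans ?_
  refine (Category.assoc _ _ _).symm.trans ((congrArg (· ≫ _) h₁).trans ?_)
  have h₃ : η.app _ ≫ (acyclicObjects R A).ι.map f = f' ≫ e.hom :=
    ((Iso.eq_comp_inv e).1 (Eq.refl f')).symm
  refine (Category.assoc _ _ _).trans ((congrArg (_ ≫ ·) h₃).trans ?_)
  refine (Category.assoc _ _ _).symm.trans ((congrArg (· ≫ _) hc).trans ?_)
  exact (Category.assoc _ _ _).trans (congrArg (_ ≫ ·) he)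

instance : (perfDbmod.{w} R A).trW.Q.EssSurj :=
  Localization.essSurj _ (perfDbmod.{w} R A).trW

instance : (quotientToAcyclic.{w} R A).Full :=
  full_of_essSurj (quotientToAcyclicIso.{w} R A) fun X Y f => by
    obtain ⟨T, s, hs, g, h⟩ := exists_dbmodToAcyclic_fraction f
    let e := quotientToAcyclicIso.{w} R A
    have := Localization.inverts (perfDbmod.{w} R A).trW.Q _ _ hs
    refine ⟨inv ((perfDbmod.{w} R A).trW.Q.map s) ≫ (perfDbmod.{w} R A).trW.Q.map g, ?_⟩
    rw [CategoryTheory.Functor.map_comp, CategoryTheory.Functor.map_inv, IsIso.inv_comp_eq]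
    refine ((Iso.eq_comp_inv (e.app Y)).2 (e.hom.naturality g)).trans ?_
    have h' : (quotientToAcyclic.{w} R A).map ((perfDbmod.{w} R A).trW.Q.map s) ≫ e.hom.app X =
      e.hom.app T ≫ (dbmodToAcyclic.{w} R A).map s := e.hom.naturality s
    refine Eq.trans ?_ (Category.assoc _ _ _)
    rw [h', ← h]
    simp only [Category.assoc]
    rfl

set_option synthInstance.maxSize 1000 in
instance : (quotientToAcyclic.{w} R A).Faithful :=
  faithful_of_isZero _ fun X hX => by
    let x := (perfDbmod.{w} R A).trW.Q.objObjPreimageIso X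
    have h : perfDbmod.{w} R A ((perfDbmod.{w} R A).trW.Q.objPreimage X) :=
      (isZero_dbmodToAcyclic_iff _).1 (hX.of_iso (((quotientToAcyclicIso.{w} R A).app _).symm ≪≫
        (quotientToAcyclic.{w} R A).mapIso x))
    exact (isZero_obj_of_prop (perfDbmod.{w} R A) _ (Localization.inverts _ _) h).of_iso x.symm

lemma essImage_stmodResolution_dbmodToAcyclic (X : Dbmod R A) :
    (stmodResolution R A).essImage ((dbmodToAcyclic.{w} R A).obj X) := by
  rw [essImage_stmodResolution_iff]
  obtain ⟨Y, hY, ⟨i⟩⟩ := klfPlusB_dbmodToKLF.{w} X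
  let Y' : KLF R A := ⟨Y, .of _ hY⟩
  let i' : (dbmodToKLF.{w} R A).obj X ≅ Y' := ObjectProperty.isoMk _ i
  obtain ⟨P, V, ε, g, h, H, hP, hV⟩ := exists_triangle_acyclic Y'
  obtain ⟨S, hS, ⟨e⟩⟩ := exists_isTotallyAcyclic_iso H hP hV hY
  obtain ⟨e', -⟩ := exists_acyclicPart_iso H hP hV
  exact ⟨S, hS, ⟨(KLF.toHomotopy R A).mapIso ((acyclicObjects R A).ι.mapIso
    ((acyclicPart R A).mapIso i') ≪≫ e'.symm) ≪≫ e⟩⟩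

lemma essImage_stmodResolution (X : DbmodModPerf.{w} R A) :
    (stmodResolution R A).essImage ((quotientToAcyclic.{w} R A).obj X) :=
  ObjectProperty.prop_of_iso _ (((quotientToAcyclicIso.{w} R A).app _).symm ≪≫
    (quotientToAcyclic.{w} R A).mapIso ((perfDbmod.{w} R A).trW.Q.objObjPreimageIso X))
      (essImage_stmodResolution_dbmodToAcyclic _)

lemma essImage_quotientToAcyclic (X : Stmod R A) :
    (quotientToAcyclic.{w} R A).essImage ((stmodResolution R A).obj X) := by
  obtain ⟨S, hS, ⟨e⟩⟩ := (essImage_stmodResolution_iff _).1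
    (Functor.obj_mem_essImage (stmodResolution R A) X)
  obtain ⟨P, V, Y, ε, g, h, H, hP, hV, hY, ⟨e'⟩⟩ := hS.exists_klf
  obtain ⟨i, -⟩ := exists_acyclicPart_iso H hP hV
  obtain ⟨Z, ⟨z⟩⟩ := (isCompactObject_iff_essImage.{w} Y).1 (klfPlusB_of_kPlusB hY).isCompactObject
  let j : (quotientToAcyclic.{w} R A).obj ((perfDbmod.{w} R A).trW.Q.obj Z) ≅
    (acyclicPart R A).obj Y := (quotientToAcyclicIso.{w} R A).app Z ≪≫ (acyclicPart R A).mapIso z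
  exact ⟨_, ⟨j ≪≫ ObjectProperty.isoMk _ (i.symm ≪≫ (KLF.toHomotopy R A).preimageIso
    (e' ≪≫ e.symm))⟩⟩

variable (R A) in
/-- The equivalence between the Verdier quotient of `D^b(mod(A, R))` by the perfect complexes and
`stmod(A, R)`. -/
def quotientToStmod : DbmodModPerf.{w} R A ⥤ Stmod R A :=
  liftThrough (stmodResolution R A) (quotientToAcyclic.{w} R A) essImage_stmodResolution

variable (R A) in
/-- The defining property of the equivalence. -/
def quotientToStmodIso :
    quotientToStmod.{w} R A ⋙ stmodResolution R A ≅ quotientToAcyclic.{w} R A :=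
  liftThroughIso _ _ _

instance : (quotientToStmod.{w} R A).Full :=
  Functor.Full.of_comp_faithful_iso (quotientToStmodIso.{w} R A)

instance : (quotientToStmod.{w} R A).Faithful :=
  Functor.Faithful.of_comp_iso (quotientToStmodIso.{w} R A)

instance : (quotientToStmod.{w} R A).EssSurj where
  mem_essImage X := by
    obtain ⟨Y, ⟨e⟩⟩ := essImage_quotientToAcyclic.{w} X
    exact ⟨Y, ⟨(stmodResolution R A).preimageIso ((quotientToStmodIso.{w} R A).app Y ≪≫ e)⟩⟩

instance : (quotientToStmod.{w} R A).IsEquivalence where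

set_option synthInstance.maxSize 1000 in
lemma isExactFunctor_quotientToStmod : IsExactFunctor (quotientToStmod.{w} R A) :=
  IsExactFunctor.of_comp (isExactFunctor_stmodResolution_comp R A)
    (((isExactFunctor_of_isTriangulated (quotientToAcyclic.{w} R A)).comp
      (isExactFunctor_of_isTriangulated (acyclicObjects R A).ι)).of_iso
        (Functor.isoWhiskerRight (quotientToStmodIso.{w} R A).symm (acyclicObjects R A).ι))

variable (R A) in
/-- The equivalence is induced by the left adjoint of the inclusion of the stable category. -/
def dbmodToKLFCompCokernelIso : dbmodToKLF.{w} R A ⋙ recollementCokernel R A ≅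
    (perfDbmod.{w} R A).trW.Q ⋙ quotientToStmod.{w} R A ⋙ stableInclusion modFinProj_le_modLF :=
  Functor.isoWhiskerRight ((quotientToAcyclicIso.{w} R A).symm ≪≫
    Functor.isoWhiskerLeft _ (quotientToStmodIso.{w} R A).symm) (acyclicEquivalence R A).inverse ≪≫
  Functor.isoWhiskerLeft ((perfDbmod.{w} R A).trW.Q ⋙ quotientToStmod.{w} R A ⋙
    stableInclusion modFinProj_le_modLF) (acyclicEquivalence R A).unitIso.symm ≪≫
  Functor.rightUnitor _

end Equivalence

end FrobRec

end

theorem corollary2p11 (R A : Type u) [CommRing R] [Ring A] [Algebra R A]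
    [FrobRec.IsFrobeniusAlgebra R A] [HasDerivedCategory.{w} (ModuleCat.{u} A)] :
    -- the recollement with `q = canonicalFunctor`, `t = iUpperStar` and `p = jLowerShriek`
    ∃ r : FrobRec.Recollement (FrobRec.StModLF R A) (FrobRec.canonicalFunctor.{w} R A),
      -- on acyclic complexes `t` is the cokernel of the differential in degree `-1`
      Nonempty (FrobRec.acyclicToKLF R A ⋙ r.iUpperStar ⋙ FrobRec.stableInclusion le_top ≅
        FrobRec.cokernelFunctor R A) ∧
      -- the compact objects on the right, and `p` preserves compactness
      (∀ X : DerivedCategory (ModuleCat.{u} A),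
        FrobRec.IsCompactObject.{u} X ↔ FrobRec.IsPerfect A X) ∧
      (∀ X : DerivedCategory (ModuleCat.{u} A), FrobRec.IsCompactObject.{u} X →
        FrobRec.IsCompactObject.{u} (r.jLowerShriek.obj X)) ∧
      ∃ (κ : FrobRec.Dbmod R A ⥤ FrobRec.KLF R A)
        (G : FrobRec.DbmodModPerf.{w} R A ⥤ FrobRec.Stmod R A),
        -- `κ` identifies `D^b(mod(A, R))` with the compact objects in the middle,
        -- as a quasi-inverse of the canonical functor `q`
        κ.Full ∧ κ.Faithful ∧ FrobRec.IsExactFunctor κ ∧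
        (∀ X : FrobRec.KLF R A, FrobRec.IsCompactObject.{u} X ↔ κ.essImage X) ∧
        Nonempty (κ ⋙ FrobRec.canonicalFunctor.{w} R A ≅ FrobRec.Dbmod.toDerived.{w} R A) ∧
        -- `p` restricted to the perfect complexes is the inclusion into `D^b(mod(A, R))`
        Nonempty ((FrobRec.perfDbmod.{w} R A).ι ⋙ κ ≅
          (FrobRec.perfDbmod.{w} R A).ι ⋙ FrobRec.Dbmod.toDerived.{w} R A ⋙ r.jLowerShriek) ∧
        -- `G` is a triangle equivalence that is induced by `t`
        G.IsEquivalence ∧ FrobRec.IsExactFunctor G ∧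
        Nonempty (κ ⋙ r.iUpperStar ≅ (FrobRec.perfDbmod.{w} R A).trW.Q ⋙ G ⋙
          FrobRec.stableInclusion FrobRec.modFinProj_le_modLF) := by
  exact ⟨FrobRec.recollement R A, FrobRec.nonempty_cokernel_iso R A,
    FrobRec.isCompactObject_iff_isPerfect R,
    fun _ hX => FrobRec.isCompactObject_map (Adjunction.ofIsRightAdjoint _) hX,
    FrobRec.dbmodToKLF R A, FrobRec.quotientToStmod R A, inferInstance, inferInstance,
    FrobRec.isExactFunctor_dbmodToKLF, FrobRec.isCompactObject_iff_essImage,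
    ⟨FrobRec.dbmodToKLFIso R A⟩,
    ⟨FrobRec.perfDbmodIso (Adjunction.ofIsRightAdjoint (FrobRec.canonicalFunctor R A))⟩,
    inferInstance, FrobRec.isExactFunctor_quotientToStmod,
    ⟨FrobRec.dbmodToKLFCompCokernelIso R A⟩⟩
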